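/- Write points of the half-plane $\mathbb R\times\mathbb R_+$, $\mathbb{R}_+=(0,\infty)$, as $(\theta,\mu)$, let $H_0:=-\partial_\mu^2-(\partial_\theta+i\mu)^2$, and let $\sigma_{\mathrm{Landau}}:=\{2j+1: j=0,1,2,\dots\}$. For $m\in\mathbb N=\{0,1,2,\dots\}$, $M\ge 1$ and $u:\mathbb R\times\mathbb R_+\to\mathbb C$ put $$|||u|||_{m,M}:=\sup_{\Theta\in\mathbb R}\Bigl(1+\Bigl|\frac{\Theta}{M}\Bigr|\Bigr)^{-m}\Bigl(\frac1{2M}\int_{|\theta-\Theta|<M}\int_0^\infty|u(\theta,\mu)|^2\,d\mu\,d\theta\Bigr)^{1/2}\in[0,\infty].$$ For every integer $N\ge 1$, every $\delta>0$ and all $m,n\in\mathbb N$ there is a constant $C<\infty$, depending only on $N,\delta,m,n$, such that the following holds. Let $\lambda\in(2N-1,2N+1)$ satisfy $\operatorname{dist}(\lambda,\sigma_{\mathrm{Landau}})\ge\delta$ and let $M\ge1$. Let $\{\Psi_\varepsilon\}_{\varepsilon>0},\{g_\varepsilon\}_{\varepsilon>0}\subset H^2(\mathbb R\times\mathbb R_+;\mathbb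 C)$ be families of functions such that, for every $\varepsilon>0$, $\Psi_\varepsilon$ and $g_\varepsilon$ are compactly supported in the variable $\theta$ (they vanish almost everywhere outside a strip $\{|\theta|\le R_\varepsilon\}$) and $$(H_0-\lambda)\Psi_\varepsilon=g_\varepsilon\ \text{ in }\mathbb R\times\mathbb R_+,\qquad \Psi_\varepsilon=0\ \text{ on }\mathbb R\times\{\mu=0\}$$ (the boundary condition in the sense $\Psi_\varepsilon\in H^1_0(\mathbb R\times\mathbb R_+)$). If $$\limsup_{\varepsilon\downarrow0}|||(1+\mu)^{-n}g_\varepsilon|||_{m,M}\le1,$$ then $$\limsup_{\varepsilon\downarrow0}|||(1+\mu)^{-n}\Psi_\varepsilon|||_{m+1,M}\le C\Bigl(M+\limsup_{\varepsilon\downarrow0}\frac1{4M}\int_{|\theta|<2M}\int_0^\infty(1+\mu)^{-2n}|\Psi_\varepsilon(\theta,\mu)|^2\,d\mu\,d\theta\Bigr).$$ -/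

import Mathlib

open MeasureTheory Filter Topology Set
open scoped ENNReal NNReal ContDiff

noncomputable section

namespace HalfPlane

/-- The open half-plane `ℝ × ℝ₊`; a point is written `p = (θ, μ)`. -/
def halfPlane : Set (ℝ × ℝ) := {p | 0 < p.2}

/-- Lebesgue measure on the half-plane. -/
def vol : Measure (ℝ × ℝ) := volume.restrict halfPlane

/-- `φ ∈ C_c^∞(ℝ × ℝ₊; ℂ)`. -/
structure IsTest (φ : ℝ × ℝ → ℂ) : Prop where
  smooth : ContDiff ℝ ∞ φ
  compact : HasCompactSupport φ
  supp : tsupport φ ⊆ halfPlane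

/-- `w` is the weak derivative of `u` on the half-plane in the direction `v`. -/
structure HasWeakDeriv (v : ℝ × ℝ) (u w : ℝ × ℝ → ℂ) : Prop where
  locInt : LocallyIntegrableOn u halfPlane
  locInt_deriv : LocallyIntegrableOn w halfPlane
  byParts : ∀ φ : ℝ × ℝ → ℂ, IsTest φ →
    ∫ p, u p * fderiv ℝ φ p v ∂vol = - ∫ p, w p * φ p ∂vol

/-- `w = ∂_θ u` weakly. -/
abbrev HasWeakDTheta (u w : ℝ × ℝ → ℂ) : Prop := HasWeakDeriv (1, 0) u w

/-- `w = ∂_μ u` weakly. -/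
abbrev HasWeakDMu (u w : ℝ × ℝ → ℂ) : Prop := HasWeakDeriv (0, 1) u w

/-- `u ∈ H¹(ℝ × ℝ₊)`. -/
def MemH1 (u : ℝ × ℝ → ℂ) : Prop :=
  MemLp u 2 vol ∧ ∃ uθ uμ : ℝ × ℝ → ℂ,
    HasWeakDTheta u uθ ∧ HasWeakDMu u uμ ∧ MemLp uθ 2 vol ∧ MemLp uμ 2 vol

/-- `u ∈ H²(ℝ × ℝ₊)`. -/
def MemH2 (u : ℝ × ℝ → ℂ) : Prop :=
  MemLp u 2 vol ∧ ∃ uθ uμ : ℝ × ℝ → ℂ,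
    HasWeakDTheta u uθ ∧ HasWeakDMu u uμ ∧ MemH1 uθ ∧ MemH1 uμ

/-- `u ∈ H¹₀(ℝ × ℝ₊)`, the closure of `C_c^∞(ℝ × ℝ₊)` in the norm of `H¹`. For `u ∈ H¹` this says
that the trace of `u` on `ℝ × {μ = 0}` vanishes. -/
def MemH10 (u : ℝ × ℝ → ℂ) : Prop :=
  MemLp u 2 vol ∧ ∃ uθ uμ : ℝ × ℝ → ℂ,
    HasWeakDTheta u uθ ∧ HasWeakDMu u uμ ∧ MemLp uθ 2 vol ∧ MemLp uμ 2 vol ∧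
    ∃ φ : ℕ → ℝ × ℝ → ℂ, (∀ j, IsTest (φ j)) ∧
      Tendsto (fun j => eLpNorm (fun p => u p - φ j p) 2 vol) atTop (𝓝 0) ∧
      Tendsto (fun j => eLpNorm (fun p => uθ p - fderiv ℝ (φ j) p (1, 0)) 2 vol) atTop (𝓝 0) ∧
      Tendsto (fun j => eLpNorm (fun p => uμ p - fderiv ℝ (φ j) p (0, 1)) 2 vol) atTop (𝓝 0)

/-- `u` vanishes almost everywhere outside some strip `{|θ| ≤ R}` of the half-plane. -/
def CompactlySupportedInTheta (u : ℝ × ℝ → ℂ) : Prop :=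
  ∃ R : ℝ, ∀ᵐ p ∂vol, R < |p.1| → u p = 0

/-- `w = (∂_θ + iμ) u` weakly. -/
def HasWeakCovDTheta (u w : ℝ × ℝ → ℂ) : Prop :=
  ∃ uθ : ℝ × ℝ → ℂ, HasWeakDTheta u uθ ∧
    ∀ p : ℝ × ℝ, w p = uθ p + Complex.I * (p.2 : ℂ) * u p

/-- `(H₀ - λ) Ψ = g` in the half-plane, where `H₀ = -∂_μ² - (∂_θ + iμ)²`. -/
def SolvesH0 (lam : ℝ) (Ψ g : ℝ × ℝ → ℂ) : Prop :=
  ∃ Ψμ Ψμμ D DD : ℝ × ℝ → ℂ,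
    HasWeakDMu Ψ Ψμ ∧ HasWeakDMu Ψμ Ψμμ ∧
    HasWeakCovDTheta Ψ D ∧ HasWeakCovDTheta D DD ∧
    ∀ᵐ p ∂vol, (- Ψμμ p - DD p) - (lam : ℂ) * Ψ p = g p

/-- The Landau levels `2j + 1`, `j = 0, 1, 2, …`, of the unit magnetic field. -/
def landauLevels : Set ℝ := {x | ∃ j : ℕ, x = 2 * (j : ℝ) + 1}

/-- The function `(1 + μ)^{-n} u`. -/
def weighted (n : ℕ) (u : ℝ × ℝ → ℂ) : ℝ × ℝ → ℂ :=
  fun p => (((1 + p.2) ^ n)⁻¹ : ℝ) • u p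

/-- `⨍_{|θ - Θ| < r} ∫_{ℝ₊} |u(θ, μ)|² dμ dθ`, with values in `[0, ∞]`. -/
def avgSq (Θ r : ℝ) (u : ℝ × ℝ → ℂ) : ℝ≥0∞ :=
  ⨍⁻ θ in {θ : ℝ | |θ - Θ| < r}, (∫⁻ μ in Ioi (0 : ℝ), ‖u (θ, μ)‖ₑ ^ 2) ∂volume

/-- The norm `|||u|||_{m,M}`, the supremum over `Θ ∈ ℝ` of
`(1 + |Θ/M|)^{-m} (⨍_{|θ - Θ| < M} ∫_{ℝ₊} |u|²)^{1/2}`, with values in `[0, ∞]`. -/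
def tripleNorm (m : ℕ) (M : ℝ) (u : ℝ × ℝ → ℂ) : ℝ≥0∞ :=
  ⨆ Θ : ℝ, ENNReal.ofReal (((1 + |Θ / M|) ^ m)⁻¹) * (avgSq Θ M u) ^ (1 / 2 : ℝ)

end HalfPlane

end

open scoped ComplexConjugate

noncomputable section

namespace HalfPlane

/-! ### Differential operators -/

/-! Write `D = ∂_θ + iμ` and let `g` be the source. Inside a spectral gap of the Landau operator on
the whole plane, a solution on the half-plane lives near the boundary, up to its source, and
everything near the boundary moves in one direction. Its size is therefore measured by a conserved
current, and a conserved current that is bounded near `θ = 0` is bounded everywhere, up to what the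
source injects.

Three facts carry this for smooth Dirichlet functions. (i) The plane resolvent at `λ` has an
explicit kernel dominated by a Gaussian. Green's `representation` writes `Ψ` as a volume potential
of `g` minus a boundary potential of `∂_μΨ`, and Schur's test gives `bulk_le`: the mass in `{μ ≥ R}`
is at most the source plus `e^{-R}` times the squared normal derivative on the boundary. The kernel
is an integral of the Mehler kernel over complex times. The divergent time integral to infinity is
replaced by a vertical segment of length `π`, along which the kernel is antiperiodic; this produces
the factor `1 + e^{iπλ}`, which is bounded below by the distance to the Landau levels. (ii) Because
`[∂_μ, D] = i`, the `momentum_identity` expresses `½∫|∂_μΨ(θ,0)|²` through the current `∫ Im(Ψ̄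
DΨ)`. With slowly varying weights the error is absorbed by (i), and `traceMass_le_current` bounds
the boundary trace, hence the whole energy, by current and source. (iii) By `flux_sub_flux` the
current changes only by `∫ Im(Ψ̄ g)`. Averaging it near `θ = 0` gives `flux_le`: the current at `x`
is bounded by the mass in `|θ| < 2M` plus `∫|Ψ||g|` over a strip of half-width `|x| + 2M`.

The last integral grows by one power of `1 + |x/M|` faster than the masses of `g` allow; this is the
passage from `m` to `m + 1`. It contains `Ψ` itself, but with a coefficient that can be made small.
So the supremum `S` of the normalised energies satisfies `S ≤ S/2 + C(a + M²K)`, where `a` and `K`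
measure the mass near `0` and the source, and `S` is finite because `Ψ` has compact support
(`energy_bootstrap`, `energy_estimate`).

The weight `(1+μ)^{-n}` is treated by subtracting, away from the boundary, the volume potential of
`g`, which is bounded on weighted spaces. The remainder `innerPart` has its source in a bounded
range of `μ`, where the weight is harmless (`weighted_estimate`). Finally
`exists_isDirichlet_approx` passes from smooth functions to `H² ∩ H¹₀` by odd reflection and
mollification, and `tripleNorm_le` takes a square root: `x + M² ≤ (M + x)²`. -/

/-- The classical derivative `∂_θ f`. -/
def dTheta (f : ℝ × ℝ → ℂ) : ℝ × ℝ → ℂ := fun p => fderiv ℝ f p (1, 0)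

/-- The classical derivative `∂_μ f`. -/
def dMu (f : ℝ × ℝ → ℂ) : ℝ × ℝ → ℂ := fun p => fderiv ℝ f p (0, 1)

/-- The covariant derivative `(∂_θ + iμ) f`. -/
def covD (f : ℝ × ℝ → ℂ) : ℝ × ℝ → ℂ := fun p => dTheta f p + Complex.I * (p.2 : ℂ) * f p

/-- The magnetic Laplacian `-∂_μ² - (∂_θ + iμ)²`. -/
def landau (f : ℝ × ℝ → ℂ) : ℝ × ℝ → ℂ := fun p => - dMu (dMu f) p - covD (covD f) p

/-- `(H₀ - λ) f`. -/
def resid (lam : ℝ) (f : ℝ × ℝ → ℂ) : ℝ × ℝ → ℂ := fun p => landau f p - (lam : ℂ) * f p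

/-- Smooth functions with compact support in the plane that vanish on `{μ = 0}`. -/
structure IsDirichlet (f : ℝ × ℝ → ℂ) : Prop where
  smooth : ContDiff ℝ ∞ f
  compact : HasCompactSupport f
  zero : ∀ θ, f (θ, 0) = 0

lemma IsDirichlet.eq_zero {f : ℝ × ℝ → ℂ} (_ : IsDirichlet f) : ∀ p ∉ tsupport f, f p = 0 :=
  fun _ => image_eq_zero_of_notMem_tsupport

lemma contDiff_dTheta {f : ℝ × ℝ → ℂ} (hf : ContDiff ℝ ∞ f) : ContDiff ℝ ∞ (dTheta f) :=
  (hf.fderiv_right (m := ∞) (by simp)).clm_apply contDiff_const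

lemma contDiff_dMu {f : ℝ × ℝ → ℂ} (hf : ContDiff ℝ ∞ f) : ContDiff ℝ ∞ (dMu f) :=
  (hf.fderiv_right (m := ∞) (by simp)).clm_apply contDiff_const

lemma contDiff_snd_complex : ContDiff ℝ ∞ (fun p : ℝ × ℝ => (p.2 : ℂ)) :=
  Complex.ofRealCLM.contDiff.comp contDiff_snd

lemma contDiff_covD {f : ℝ × ℝ → ℂ} (hf : ContDiff ℝ ∞ f) : ContDiff ℝ ∞ (covD f) :=
  (contDiff_dTheta hf).add ((contDiff_const.mul contDiff_snd_complex).mul hf)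

lemma contDiff_landau {f : ℝ × ℝ → ℂ} (hf : ContDiff ℝ ∞ f) : ContDiff ℝ ∞ (landau f) :=
  (contDiff_dMu (contDiff_dMu hf)).neg.sub (contDiff_covD (contDiff_covD hf))

lemma contDiff_resid {f : ℝ × ℝ → ℂ} (lam : ℝ) (hf : ContDiff ℝ ∞ f) :
    ContDiff ℝ ∞ (resid lam f) :=
  (contDiff_landau hf).sub (contDiff_const.mul hf)

lemma tsupport_dTheta (f : ℝ × ℝ → ℂ) : tsupport (dTheta f) ⊆ tsupport f :=
  (closure_mono (fun p hp => by
    simp only [dTheta, Function.mem_support] at hp ⊢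
    exact fun h => hp (by rw [h]; rfl))).trans (tsupport_fderiv_subset ℝ (f := f))

lemma tsupport_dMu (f : ℝ × ℝ → ℂ) : tsupport (dMu f) ⊆ tsupport f :=
  (closure_mono (fun p hp => by
    simp only [dMu, Function.mem_support] at hp ⊢
    exact fun h => hp (by rw [h]; rfl))).trans (tsupport_fderiv_subset ℝ (f := f))

lemma dTheta_eq_zero {f : ℝ × ℝ → ℂ} {p : ℝ × ℝ} (hp : p ∉ tsupport f) : dTheta f p = 0 :=
  image_eq_zero_of_notMem_tsupport fun h => hp (tsupport_dTheta f h)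

lemma dMu_eq_zero {f : ℝ × ℝ → ℂ} {p : ℝ × ℝ} (hp : p ∉ tsupport f) : dMu f p = 0 :=
  image_eq_zero_of_notMem_tsupport fun h => hp (tsupport_dMu f h)

lemma covD_eq_zero {f : ℝ × ℝ → ℂ} {p : ℝ × ℝ} (hp : p ∉ tsupport f) : covD f p = 0 := by
  simp [covD, dTheta_eq_zero hp, image_eq_zero_of_notMem_tsupport hp]

lemma tsupport_covD (f : ℝ × ℝ → ℂ) : tsupport (covD f) ⊆ tsupport f :=
  closure_minimal (fun p hp => by
    by_contra h
    exact hp (covD_eq_zero h)) (isClosed_tsupport f)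

lemma landau_eq_zero {f : ℝ × ℝ → ℂ} {p : ℝ × ℝ} (hp : p ∉ tsupport f) : landau f p = 0 := by
  have h1 : dMu (dMu f) p = 0 := dMu_eq_zero fun h => hp (tsupport_dMu f h)
  have h2 : covD (covD f) p = 0 := covD_eq_zero fun h => hp (tsupport_covD f h)
  simp [landau, h1, h2]

lemma resid_eq_zero {lam : ℝ} {f : ℝ × ℝ → ℂ} {p : ℝ × ℝ} (hp : p ∉ tsupport f) :
    resid lam f p = 0 := by
  simp [resid, landau_eq_zero hp, image_eq_zero_of_notMem_tsupport hp]

lemma hasCompactSupport_of_tsupport {α : Type*} [Zero α] {f : ℝ × ℝ → ℂ} {F : ℝ × ℝ → α}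
    (hf : HasCompactSupport f) (h : ∀ p ∉ tsupport f, F p = 0) : HasCompactSupport F :=
  HasCompactSupport.intro hf (fun p hp => h p hp)

lemma dTheta_mul {f g : ℝ × ℝ → ℂ} {p : ℝ × ℝ} (hf : DifferentiableAt ℝ f p)
    (hg : DifferentiableAt ℝ g p) :
    dTheta (fun q => f q * g q) p = dTheta f p * g p + f p * dTheta g p := by
  simp only [dTheta]
  rw [fderiv_fun_mul hf hg]
  simp only [add_apply, smul_apply, smul_eq_mul]
  ring

lemma dMu_mul {f g : ℝ × ℝ → ℂ} {p : ℝ × ℝ} (hf : DifferentiableAt ℝ f p)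
    (hg : DifferentiableAt ℝ g p) :
    dMu (fun q => f q * g q) p = dMu f p * g p + f p * dMu g p := by
  simp only [dMu]
  rw [fderiv_fun_mul hf hg]
  simp only [add_apply, smul_apply, smul_eq_mul]
  ring

lemma dTheta_conj {f : ℝ × ℝ → ℂ} {p : ℝ × ℝ} (hf : DifferentiableAt ℝ f p) :
    dTheta (fun q => conj (f q)) p = conj (dTheta f p) := by
  have := (Complex.conjCLE.toContinuousLinearMap.hasFDerivAt.comp p hf.hasFDerivAt).fderiv
  simp only [dTheta]
  change fderiv ℝ (Complex.conjCLE.toContinuousLinearMap ∘ f) p (1, 0) = _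
  rw [this]; rfl

lemma dMu_conj {f : ℝ × ℝ → ℂ} {p : ℝ × ℝ} (hf : DifferentiableAt ℝ f p) :
    dMu (fun q => conj (f q)) p = conj (dMu f p) := by
  have := (Complex.conjCLE.toContinuousLinearMap.hasFDerivAt.comp p hf.hasFDerivAt).fderiv
  simp only [dMu]
  change fderiv ℝ (Complex.conjCLE.toContinuousLinearMap ∘ f) p (0, 1) = _
  rw [this]; rfl

lemma contDiff_conj {f : ℝ × ℝ → ℂ} (hf : ContDiff ℝ ∞ f) :
    ContDiff ℝ ∞ (fun p => conj (f p)) :=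
  Complex.conjCLE.toContinuousLinearMap.contDiff.comp hf

lemma differentiable_of_smooth {f : ℝ × ℝ → ℂ} (hf : ContDiff ℝ ∞ f) : Differentiable ℝ f :=
  hf.differentiable (by simp)

lemma hasDerivAt_fst {f : ℝ × ℝ → ℂ} {p : ℝ × ℝ} (hf : DifferentiableAt ℝ f p) :
    HasDerivAt (fun θ => f (θ, p.2)) (dTheta f p) p.1 := by
  have h : HasDerivAt (fun θ : ℝ => (θ, p.2)) ((1 : ℝ), (0 : ℝ)) p.1 :=
    (hasDerivAt_id p.1).prodMk (hasDerivAt_const p.1 p.2)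
  exact hf.hasFDerivAt.comp_hasDerivAt p.1 h

lemma hasDerivAt_snd {f : ℝ × ℝ → ℂ} {p : ℝ × ℝ} (hf : DifferentiableAt ℝ f p) :
    HasDerivAt (fun μ => f (p.1, μ)) (dMu f p) p.2 := by
  have h : HasDerivAt (fun μ : ℝ => (p.1, μ)) ((0 : ℝ), (1 : ℝ)) p.2 :=
    (hasDerivAt_const p.2 p.1).prodMk (hasDerivAt_id p.2)
  exact hf.hasFDerivAt.comp_hasDerivAt p.2 h

/-- `[∂_μ, ∂_θ + iμ] = i`. -/
lemma dMu_covD {f : ℝ × ℝ → ℂ} (hf : ContDiff ℝ ∞ f) (p : ℝ × ℝ) :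
    dMu (covD f) p = covD (dMu f) p + Complex.I * f p := by
  have hd := differentiable_of_smooth hf
  have hsymm : dMu (dTheta f) p = dTheta (dMu f) p := by
    have h2 : DifferentiableAt ℝ (fderiv ℝ f) p :=
      ((hf.fderiv_right (m := ∞) (by simp)).differentiable (by simp)) p
    change fderiv ℝ (fun q => fderiv ℝ f q (1, 0)) p (0, 1)
      = fderiv ℝ (fun q => fderiv ℝ f q (0, 1)) p (1, 0)
    rw [fderiv_clm_apply h2 (differentiableAt_const _),
      fderiv_clm_apply h2 (differentiableAt_const _)]
    simp only [fderiv_fun_const, Pi.zero_apply, ContinuousLinearMap.comp_zero, zero_add,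
      ContinuousLinearMap.flip_apply]
    exact (hf.contDiffAt.isSymmSndFDerivAt (by simp only [minSmoothness_of_isRCLikeNormedField]; exact WithTop.coe_le_coe.2 le_top)) _ _
  have hmu : dMu (fun q : ℝ × ℝ => Complex.I * (q.2 : ℂ)) p = Complex.I := by
    have : HasDerivAt (fun μ : ℝ => Complex.I * (μ : ℂ)) (Complex.I * 1) p.2 :=
      (Complex.ofRealCLM.hasDerivAt (x := p.2)).const_mul Complex.I
    have h2 := hasDerivAt_snd (f := fun q : ℝ × ℝ => Complex.I * (q.2 : ℂ)) (p := p)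
      ((differentiable_of_smooth (contDiff_const.mul contDiff_snd_complex)) p)
    simpa using h2.unique this
  have hsum : dMu (covD f) p = dMu (dTheta f) p
      + dMu (fun q => Complex.I * (q.2 : ℂ) * f q) p := by
    simp only [dMu]
    rw [show covD f = fun q => dTheta f q + Complex.I * (q.2 : ℂ) * f q from rfl,
      fderiv_fun_add (differentiable_of_smooth (contDiff_dTheta hf) p)
      ((differentiable_of_smooth ((contDiff_const.mul contDiff_snd_complex).mul hf)) p)]
    rfl
  rw [hsum, hsymm, dMu_mul (f := fun q : ℝ × ℝ => Complex.I * (q.2 : ℂ))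
    ((differentiable_of_smooth (contDiff_const.mul contDiff_snd_complex)) p) (hd p), hmu]
  simp only [covD]
  ring

/-! ### Integration over the half-plane -/

lemma vol_eq_prod : vol = (volume : Measure ℝ).prod (volume.restrict (Ioi (0 : ℝ))) := by
  have h : halfPlane = (univ : Set ℝ) ×ˢ Ioi (0 : ℝ) := by
    ext p; simp [halfPlane]
  rw [vol, h, Measure.volume_eq_prod, ← Measure.prod_restrict, Measure.restrict_univ]

instance : SFinite vol := by rw [vol]; infer_instance

lemma isOpen_halfPlane : IsOpen halfPlane := isOpen_lt continuous_const continuous_snd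

lemma measurableSet_halfPlane : MeasurableSet halfPlane := isOpen_halfPlane.measurableSet

lemma ae_vol_pos : ∀ᵐ p ∂vol, 0 < p.2 := self_mem_ae_restrict measurableSet_halfPlane

lemma integrable_vol {E : Type*} [NormedAddCommGroup E] {F : ℝ × ℝ → E} (hF : Continuous F)
    (hc : HasCompactSupport F) : Integrable F vol :=
  (hF.integrable_of_hasCompactSupport hc).integrableOn

lemma integrable_of_tsupport {E : Type*} [NormedAddCommGroup E] {f : ℝ × ℝ → ℂ} {F : ℝ × ℝ → E}
    (hf : HasCompactSupport f) (hF : Continuous F) (h : ∀ p ∉ tsupport f, F p = 0) :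
    Integrable F vol :=
  integrable_vol hF (hasCompactSupport_of_tsupport hf h)

lemma hasCompactSupport_slice_fst {α : Type*} [Zero α] {F : ℝ × ℝ → α}
    (hc : HasCompactSupport F) (μ : ℝ) : HasCompactSupport (fun θ => F (θ, μ)) :=
  HasCompactSupport.intro (hc.isCompact.image continuous_fst) fun θ hθ =>
    image_eq_zero_of_notMem_tsupport fun h => hθ ⟨(θ, μ), h, rfl⟩

lemma hasCompactSupport_slice_snd {α : Type*} [Zero α] {F : ℝ × ℝ → α}
    (hc : HasCompactSupport F) (θ : ℝ) : HasCompactSupport (fun μ => F (θ, μ)) :=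
  HasCompactSupport.intro (hc.isCompact.image continuous_snd) fun μ hμ =>
    image_eq_zero_of_notMem_tsupport fun h => hμ ⟨(θ, μ), h, rfl⟩

lemma integral_dTheta {F : ℝ × ℝ → ℂ} (hF : ContDiff ℝ ∞ F) (hc : HasCompactSupport F) :
    ∫ p, dTheta F p ∂vol = 0 := by
  have hint : Integrable (dTheta F) vol :=
    integrable_of_tsupport hc (contDiff_dTheta hF).continuous fun p hp => dTheta_eq_zero hp
  rw [vol_eq_prod] at hint ⊢
  rw [integral_prod_symm _ hint]
  refine integral_eq_zero_of_ae (Eventually.of_forall fun μ => ?_)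
  have hs : HasCompactSupport (fun θ => F (θ, μ)) := hasCompactSupport_slice_fst hc μ
  have hcs : Continuous (fun θ => F (θ, μ)) := hF.continuous.comp (by fun_prop)
  have hs' : HasCompactSupport (fun θ => dTheta F (θ, μ)) :=
    hasCompactSupport_slice_fst (hasCompactSupport_of_tsupport hc fun p hp => dTheta_eq_zero hp) μ
  have hcs' : Continuous (fun θ => dTheta F (θ, μ)) :=
    (contDiff_dTheta hF).continuous.comp (by fun_prop)
  exact integral_eq_zero_of_hasDerivAt_of_integrable
    (fun θ => hasDerivAt_fst (p := (θ, μ)) (differentiable_of_smooth hF _))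
    (hcs'.integrable_of_hasCompactSupport hs') (hcs.integrable_of_hasCompactSupport hs)

lemma integral_slice_dMu {F : ℝ × ℝ → ℂ} (hF : ContDiff ℝ ∞ F) (hc : HasCompactSupport F)
    (θ : ℝ) : ∫ μ in Ioi (0 : ℝ), dMu F (θ, μ) = - F (θ, 0) := by
  have hs : HasCompactSupport (fun μ => F (θ, μ)) := hasCompactSupport_slice_snd hc θ
  have hcd : ContDiff ℝ 1 (fun μ => F (θ, μ)) :=
    (hF.of_le (by simp)).comp (contDiff_const.prodMk contDiff_id)
  rw [← hs.integral_Ioi_deriv_eq hcd 0]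
  congr 1 with μ
  exact ((hasDerivAt_snd (p := (θ, μ)) (differentiable_of_smooth hF _)).deriv).symm

lemma integral_dMu {F : ℝ × ℝ → ℂ} (hF : ContDiff ℝ ∞ F) (hc : HasCompactSupport F) :
    ∫ p, dMu F p ∂vol = - ∫ θ, F (θ, 0) := by
  have hint : Integrable (dMu F) vol :=
    integrable_of_tsupport hc (contDiff_dMu hF).continuous fun p hp => dMu_eq_zero hp
  rw [vol_eq_prod] at hint ⊢
  rw [integral_prod _ hint, ← integral_neg]
  exact integral_congr_ae (Eventually.of_forall fun θ => integral_slice_dMu hF hc θ)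

lemma mul_eq_zero_off {f g F G : ℝ × ℝ → ℂ} (h : HasCompactSupport f ∨ HasCompactSupport g)
    (hF : ∀ p ∉ tsupport f, F p = 0) (hG : ∀ p ∉ tsupport g, G p = 0) :
    HasCompactSupport (fun p => F p * G p) := by
  rcases h with h | h
  · exact hasCompactSupport_of_tsupport h fun p hp => by simp [hF p hp]
  · exact hasCompactSupport_of_tsupport h fun p hp => by simp [hG p hp]

/-- Integration by parts for the covariant derivative. -/
lemma integral_conj_mul_covD {u v : ℝ × ℝ → ℂ} (hu : ContDiff ℝ ∞ u) (hv : ContDiff ℝ ∞ v)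
    (h : HasCompactSupport u ∨ HasCompactSupport v) :
    ∫ p, conj (u p) * covD v p ∂vol = - ∫ p, conj (covD u p) * v p ∂vol := by
  have hz : ∀ {w : ℝ × ℝ → ℂ}, ∀ p ∉ tsupport w, w p = 0 :=
    fun p hp => image_eq_zero_of_notMem_tsupport hp
  have key := integral_dTheta ((contDiff_conj hu).mul hv)
    (mul_eq_zero_off (F := fun p => conj (u p)) (G := v) h
      (fun p hp => by simp [hz p hp]) hz)
  have hsum : ∀ p, dTheta (fun q => conj (u q) * v q) p
      = conj (u p) * covD v p + conj (covD u p) * v p := by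
    intro p
    rw [dTheta_mul (differentiable_of_smooth (contDiff_conj hu) p) (differentiable_of_smooth hv p),
      dTheta_conj (differentiable_of_smooth hu p)]
    -- Multiplication by `iμ` is skew-adjoint, so the two magnetic terms cancel and `D` integrates
    -- by parts like `∂_θ`.
    simp only [covD, map_add, map_mul, Complex.conj_I, Complex.conj_ofReal]
    ring
  have i1 : Integrable (fun p => conj (u p) * covD v p) vol :=
    integrable_vol ((contDiff_conj hu).continuous.mul (contDiff_covD hv).continuous)
      (mul_eq_zero_off (F := fun p => conj (u p)) (G := covD v) h
        (fun p hp => by simp [hz p hp]) fun p hp => covD_eq_zero hp)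
  have i2 : Integrable (fun p => conj (covD u p) * v p) vol :=
    integrable_vol ((contDiff_conj (contDiff_covD hu)).continuous.mul hv.continuous)
      (mul_eq_zero_off (F := fun p => conj (covD u p)) (G := v) h
        (fun p hp => by simp [covD_eq_zero hp]) hz)
  simp_rw [hsum] at key
  rw [integral_add i1 i2] at key
  exact eq_neg_of_add_eq_zero_left key

/-- Integration by parts for the normal derivative. -/
lemma integral_conj_mul_dMu {u v : ℝ × ℝ → ℂ} (hu : ContDiff ℝ ∞ u) (hv : ContDiff ℝ ∞ v)
    (h : HasCompactSupport u ∨ HasCompactSupport v) :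
    ∫ p, conj (u p) * dMu v p ∂vol
      = - (∫ p, conj (dMu u p) * v p ∂vol) - ∫ θ, conj (u (θ, 0)) * v (θ, 0) := by
  have hz : ∀ {w : ℝ × ℝ → ℂ}, ∀ p ∉ tsupport w, w p = 0 :=
    fun p hp => image_eq_zero_of_notMem_tsupport hp
  have key := integral_dMu ((contDiff_conj hu).mul hv)
    (mul_eq_zero_off (F := fun p => conj (u p)) (G := v) h
      (fun p hp => by simp [hz p hp]) hz)
  have hsum : ∀ p, dMu (fun q => conj (u q) * v q) p
      = conj (u p) * dMu v p + conj (dMu u p) * v p := by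
    intro p
    rw [dMu_mul (differentiable_of_smooth (contDiff_conj hu) p) (differentiable_of_smooth hv p),
      dMu_conj (differentiable_of_smooth hu p)]
    ring
  have i1 : Integrable (fun p => conj (u p) * dMu v p) vol :=
    integrable_vol ((contDiff_conj hu).continuous.mul (contDiff_dMu hv).continuous)
      (mul_eq_zero_off (F := fun p => conj (u p)) (G := dMu v) h
        (fun p hp => by simp [hz p hp]) fun p hp => dMu_eq_zero hp)
  have i2 : Integrable (fun p => conj (dMu u p) * v p) vol :=
    integrable_vol ((contDiff_conj (contDiff_dMu hu)).continuous.mul hv.continuous)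
      (mul_eq_zero_off (F := fun p => conj (dMu u p)) (G := v) h
        (fun p hp => by simp [dMu_eq_zero hp]) hz)
  simp_rw [hsum] at key
  rw [integral_add i1 i2] at key
  linear_combination key

/-! ### Energy, flux and momentum identities -/

lemma re_integral {α : Type*} [MeasurableSpace α] {ν : Measure α} {f : α → ℂ}
    (hf : Integrable f ν) : (∫ a, f a ∂ν).re = ∫ a, (f a).re ∂ν :=
  (Complex.reCLM.integral_comp_comm hf).symm

lemma im_integral {α : Type*} [MeasurableSpace α] {ν : Measure α} {f : α → ℂ}
    (hf : Integrable f ν) : (∫ a, f a ∂ν).im = ∫ a, (f a).im ∂ν :=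
  (Complex.imCLM.integral_comp_comm hf).symm

lemma contDiff_ofReal_comp {χ : ℝ × ℝ → ℝ} (hχ : ContDiff ℝ ∞ χ) :
    ContDiff ℝ ∞ (fun p => (χ p : ℂ)) :=
  Complex.ofRealCLM.contDiff.comp hχ

lemma dTheta_ofReal {χ : ℝ × ℝ → ℝ} {p : ℝ × ℝ} (hχ : DifferentiableAt ℝ χ p) :
    dTheta (fun q => (χ q : ℂ)) p = (fderiv ℝ χ p (1, 0) : ℝ) := by
  have := (Complex.ofRealCLM.hasFDerivAt.comp p hχ.hasFDerivAt).fderiv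
  change fderiv ℝ (Complex.ofRealCLM ∘ χ) p (1, 0) = _
  rw [this]; rfl

lemma dMu_ofReal {χ : ℝ × ℝ → ℝ} {p : ℝ × ℝ} (hχ : DifferentiableAt ℝ χ p) :
    dMu (fun q => (χ q : ℂ)) p = (fderiv ℝ χ p (0, 1) : ℝ) := by
  have := (Complex.ofRealCLM.hasFDerivAt.comp p hχ.hasFDerivAt).fderiv
  change fderiv ℝ (Complex.ofRealCLM ∘ χ) p (0, 1) = _
  rw [this]; rfl

lemma covD_mul {f g : ℝ × ℝ → ℂ} {p : ℝ × ℝ} (hf : DifferentiableAt ℝ f p)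
    (hg : DifferentiableAt ℝ g p) :
    covD (fun q => f q * g q) p = dTheta f p * g p + f p * covD g p := by
  simp only [covD, dTheta_mul hf hg]
  ring

/-- Young's inequality for the cross term. It is used with `x = χ`, `y` a derivative of `χ`, `w = v`
and `a` a derivative of `v`, so that the conjugated factor is the derivative of `χ²v`. -/
lemma re_conj_mul_ge (x y : ℝ) (a w : ℂ) :
    x ^ 2 * ‖a‖ ^ 2 / 2 - 2 * (y ^ 2 * ‖w‖ ^ 2)
      ≤ (conj ((2 * x * y : ℝ) * w + (x ^ 2 : ℝ) * a) * a).re := by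
  rw [Complex.sq_norm, Complex.sq_norm, Complex.normSq_apply, Complex.normSq_apply]
  simp only [map_add, map_mul, Complex.conj_ofReal, Complex.mul_re, Complex.add_re,
    Complex.add_im, Complex.mul_im, Complex.ofReal_re, Complex.ofReal_im, Complex.conj_re,
    Complex.conj_im]
  nlinarith [sq_nonneg (x * a.re + 2 * y * w.re), sq_nonneg (x * a.im + 2 * y * w.im)]

/-- The local energy estimate. -/
theorem energy_le {χ : ℝ × ℝ → ℝ} {v : ℝ × ℝ → ℂ} (hχ : ContDiff ℝ ∞ χ) (hv : ContDiff ℝ ∞ v)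
    (hc : HasCompactSupport χ ∨ HasCompactSupport v) (h0 : ∀ θ, χ (θ, 0) = 0 ∨ v (θ, 0) = 0) :
    ∫ p, χ p ^ 2 * (‖covD v p‖ ^ 2 + ‖dMu v p‖ ^ 2) ∂vol
      ≤ 2 * (∫ p, χ p ^ 2 * (‖v p‖ * ‖landau v p‖) ∂vol)
        + 4 * ∫ p, (fderiv ℝ χ p (1, 0) ^ 2 + fderiv ℝ χ p (0, 1) ^ 2) * ‖v p‖ ^ 2 ∂vol := by
  set c : ℝ × ℝ → ℂ := fun p => ((χ p ^ 2 : ℝ) : ℂ) with hcdef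
  set u : ℝ × ℝ → ℂ := fun p => c p * v p with hu
  have hχ2 : ContDiff ℝ ∞ (fun p => χ p ^ 2) := hχ.pow 2
  have hcs : ContDiff ℝ ∞ c := contDiff_ofReal_comp hχ2
  have hus : ContDiff ℝ ∞ u := hcs.mul hv
  have hχd : Differentiable ℝ χ := hχ.differentiable (by simp)
  -- Either the cutoff or the function may be the compactly supported one; `f` is whichever it is,
  -- so that all integrands below vanish off one compact set.
  obtain ⟨f, hf, hfχ⟩ : ∃ f : ℝ × ℝ → ℂ, HasCompactSupport f ∧
      ∀ p ∉ tsupport f, (χ p = 0 ∧ fderiv ℝ χ p = 0) ∨ p ∉ tsupport v := by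
    rcases hc with h | h
    · refine ⟨fun p => (χ p : ℂ), h.comp_left (g := fun x : ℝ => (x : ℂ)) rfl, fun p hp => ?_⟩
      have hs : p ∉ tsupport χ := by
        rwa [show tsupport (fun p => (χ p : ℂ)) = tsupport χ by
          simp [tsupport, Function.support]] at hp
      exact Or.inl ⟨image_eq_zero_of_notMem_tsupport hs,
        image_eq_zero_of_notMem_tsupport fun h' => hs (tsupport_fderiv_subset ℝ h')⟩
    · exact ⟨v, h, fun p hp => Or.inr hp⟩
  have huc : HasCompactSupport u := by
    refine hasCompactSupport_of_tsupport hf fun p hp => ?_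
    rcases hfχ p hp with ⟨h, -⟩ | h
    · simp [hu, hcdef, h]
    · simp [hu, image_eq_zero_of_notMem_tsupport h]
  have hDu : ∀ p, covD u p = ((2 * χ p * fderiv ℝ χ p (1, 0) : ℝ) : ℂ) * v p
      + ((χ p ^ 2 : ℝ) : ℂ) * covD v p := by
    intro p
    rw [hu, covD_mul (differentiable_of_smooth hcs p) (differentiable_of_smooth hv p), hcdef,
      dTheta_ofReal ((hχ2.differentiable (by simp)) p), fderiv_fun_pow 2 (hχd p)]
    simp
  have hPu : ∀ p, dMu u p = ((2 * χ p * fderiv ℝ χ p (0, 1) : ℝ) : ℂ) * v p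
      + ((χ p ^ 2 : ℝ) : ℂ) * dMu v p := by
    intro p
    rw [hu, dMu_mul (differentiable_of_smooth hcs p) (differentiable_of_smooth hv p), hcdef,
      dMu_ofReal ((hχ2.differentiable (by simp)) p), fderiv_fun_pow 2 (hχd p)]
    simp
  have e1 := integral_conj_mul_covD hus (contDiff_covD hv) (Or.inl huc)
  have e2 := integral_conj_mul_dMu hus (contDiff_dMu hv) (Or.inl huc)
  -- `χ²v` vanishes on the boundary line because one of its factors does; no boundary term survives.
  have hb : ∫ θ, conj (u (θ, 0)) * dMu v (θ, 0) = 0 := by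
    refine integral_eq_zero_of_ae (Eventually.of_forall fun θ => ?_)
    rcases h0 θ with h | h <;> simp [hu, hcdef, h]
  rw [hb, sub_zero] at e2
  have hcD := (contDiff_covD hv).continuous
  have hcP := (contDiff_dMu hv).continuous
  have hcH := (contDiff_landau hv).continuous
  have hcχ := hχ.continuous
  have hcv := hv.continuous
  have hχ' : Continuous (fun p => fderiv ℝ χ p) := hχ.continuous_fderiv (by simp)
  have i1 : Integrable (fun p => conj (u p) * covD (covD v) p) vol :=
    integrable_of_tsupport huc ((contDiff_conj hus).continuous.mul
      (contDiff_covD (contDiff_covD hv)).continuous) fun p hp => by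
        simp [image_eq_zero_of_notMem_tsupport hp]
  have i2 : Integrable (fun p => conj (u p) * dMu (dMu v) p) vol :=
    integrable_of_tsupport huc ((contDiff_conj hus).continuous.mul
      (contDiff_dMu (contDiff_dMu hv)).continuous) fun p hp => by
        simp [image_eq_zero_of_notMem_tsupport hp]
  have i3 : Integrable (fun p => conj (covD u p) * covD v p) vol :=
    integrable_of_tsupport huc ((contDiff_conj (contDiff_covD hus)).continuous.mul hcD)
      fun p hp => by simp [covD_eq_zero hp]
  have i4 : Integrable (fun p => conj (dMu u p) * dMu v p) vol :=
    integrable_of_tsupport huc ((contDiff_conj (contDiff_dMu hus)).continuous.mul hcP)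
      fun p hp => by simp [dMu_eq_zero hp]
  -- The operator applied to `v` is tested against `χ²v` and integrated by parts.
  have key : ∫ p, (conj (u p) * landau v p).re ∂vol
      = ∫ p, (conj (covD u p) * covD v p + conj (dMu u p) * dMu v p).re ∂vol := by
    have i34 : Integrable (fun p => conj (covD u p) * covD v p + conj (dMu u p) * dMu v p) vol :=
      i3.add i4
    rw [← re_integral i34, integral_add i3 i4, ← re_integral]
    · congr 1
      have : ∀ p, conj (u p) * landau v p
          = -(conj (u p) * dMu (dMu v) p) - conj (u p) * covD (covD v) p := fun p => by
        simp only [landau]; ring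
      simp_rw [this]
      rw [integral_sub i2.fun_neg i1, integral_neg, e1, e2]
      ring
    · refine (i2.neg.sub i1).congr (Eventually.of_forall fun p => ?_)
      simp only [landau, Pi.sub_apply, Pi.neg_apply]; ring
  have j1 : Integrable (fun p => χ p ^ 2 * (‖v p‖ * ‖landau v p‖)) vol := by
    refine integrable_of_tsupport hf (by fun_prop) fun p hp => ?_
    rcases hfχ p hp with ⟨h, -⟩ | h
    · simp [h]
    · simp [image_eq_zero_of_notMem_tsupport h]
  have j2 : Integrable (fun p => (fderiv ℝ χ p (1, 0) ^ 2 + fderiv ℝ χ p (0, 1) ^ 2)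
      * ‖v p‖ ^ 2) vol := by
    refine integrable_of_tsupport hf (by fun_prop) fun p hp => ?_
    rcases hfχ p hp with ⟨-, h⟩ | h
    · simp [h]
    · simp [image_eq_zero_of_notMem_tsupport h]
  have j3 : Integrable (fun p => χ p ^ 2 * (‖covD v p‖ ^ 2 + ‖dMu v p‖ ^ 2)) vol := by
    refine integrable_of_tsupport hf (by fun_prop) fun p hp => ?_
    rcases hfχ p hp with ⟨h, -⟩ | h
    · simp [h]
    · simp [covD_eq_zero h, dMu_eq_zero h]
  have up : ∫ p, (conj (u p) * landau v p).re ∂vol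
      ≤ ∫ p, χ p ^ 2 * (‖v p‖ * ‖landau v p‖) ∂vol := by
    refine integral_mono ?_ j1 fun p => ?_
    · refine (((i2.neg.sub i1).congr (Eventually.of_forall fun p => ?_)) :
        Integrable (fun p => conj (u p) * landau v p) vol).re
      simp only [landau, Pi.sub_apply, Pi.neg_apply]; ring
    · refine (Complex.re_le_norm _).trans (le_of_eq ?_)
      simp [hu, hcdef, mul_assoc]
  have lo : ∫ p, (χ p ^ 2 * (‖covD v p‖ ^ 2 + ‖dMu v p‖ ^ 2) / 2
        - 2 * ((fderiv ℝ χ p (1, 0) ^ 2 + fderiv ℝ χ p (0, 1) ^ 2) * ‖v p‖ ^ 2)) ∂vol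
      ≤ ∫ p, (conj (covD u p) * covD v p + conj (dMu u p) * dMu v p).re ∂vol := by
    refine integral_mono ((j3.div_const 2).sub (j2.const_mul 2)) (i3.add i4).re fun p => ?_
    have h1 := re_conj_mul_ge (χ p) (fderiv ℝ χ p (1, 0)) (covD v p) (v p)
    have h2 := re_conj_mul_ge (χ p) (fderiv ℝ χ p (0, 1)) (dMu v p) (v p)
    simp only [hDu, hPu, Complex.add_re]
    linarith
  rw [integral_sub (j3.div_const 2) (j2.const_mul 2), integral_div, integral_const_mul] at lo
  linarith

lemma IsDirichlet.covD_zero {Ψ : ℝ × ℝ → ℂ} (h : IsDirichlet Ψ) (θ : ℝ) : covD Ψ (θ, 0) = 0 := by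
  have h1 := hasDerivAt_fst (p := (θ, 0)) (differentiable_of_smooth h.smooth (θ, 0))
  simp only [h.zero] at h1
  have h2 : dTheta Ψ (θ, 0) = 0 := h1.unique (hasDerivAt_const _ _)
  simp [covD, h2]

/-- Lets the equation eliminate second tangential derivatives in the momentum and current balances.
-/
lemma covD_covD_eq (lam : ℝ) (Ψ : ℝ × ℝ → ℂ) (p : ℝ × ℝ) :
    covD (covD Ψ) p = - dMu (dMu Ψ) p - lam * Ψ p - resid lam Ψ p := by
  simp only [resid, landau]; ring

/-- The momentum balance in the direction normal to the boundary. -/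
theorem momentum_identity {Ψ : ℝ × ℝ → ℂ} (h : IsDirichlet Ψ) (lam : ℝ) {W : ℝ → ℝ}
    (hW : ContDiff ℝ ∞ W) :
    (1 / 2) * ∫ θ, W θ * ‖dMu Ψ (θ, 0)‖ ^ 2
      = (∫ p, W p.1 * (conj (Ψ p) * covD Ψ p).im ∂vol)
        - (∫ p, deriv W p.1 * (conj (dMu Ψ p) * covD Ψ p).re ∂vol)
        + ∫ p, W p.1 * (conj (dMu Ψ p) * resid lam Ψ p).re ∂vol := by
  have hs := h.smooth
  set w : ℝ × ℝ → ℂ := fun p => ((W p.1 : ℝ) : ℂ) with hw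
  have hW1 : ContDiff ℝ ∞ (fun p : ℝ × ℝ => W p.1) := hW.comp contDiff_fst
  have hws : ContDiff ℝ ∞ w := contDiff_ofReal_comp hW1
  have hWd : Differentiable ℝ W := hW.differentiable (by simp)
  have hfd : ∀ p : ℝ × ℝ, HasFDerivAt (fun p : ℝ × ℝ => W p.1)
      ((ContinuousLinearMap.fst ℝ ℝ ℝ).smulRight (deriv W p.1)) p := fun p => by
    have := (hWd p.1).hasDerivAt.hasFDerivAt.comp p (hasFDerivAt_fst (𝕜 := ℝ) (p := p))
    refine this.congr_fderiv ?_
    ext <;> simp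
  have hwθ : ∀ p, dTheta w p = (deriv W p.1 : ℝ) := fun p => by
    rw [hw, dTheta_ofReal (hfd p).differentiableAt, (hfd p).fderiv]; simp
  have hwμ : ∀ p, dMu w p = 0 := fun p => by
    rw [hw, dMu_ofReal (hfd p).differentiableAt, (hfd p).fderiv]; simp
  have sP := contDiff_dMu hs
  have sD := contDiff_covD hs
  -- The identity is a divergence theorem for the stress field with tangential component `F` and
  -- normal component `-½W(|DΨ|² - |∂_μΨ|² - λ|Ψ|²)`.
  set F : ℝ × ℝ → ℂ := fun p => w p * (conj (dMu Ψ p) * covD Ψ p) with hF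
  set Q : (ℝ × ℝ → ℂ) → ℝ × ℝ → ℂ := fun v p => w p * (conj (v p) * v p) with hQ
  have sQ : ∀ {v : ℝ × ℝ → ℂ}, ContDiff ℝ ∞ v → ContDiff ℝ ∞ (Q v) := fun hv =>
    hws.mul ((contDiff_conj hv).mul hv)
  have cQ : ∀ {v : ℝ × ℝ → ℂ}, HasCompactSupport v → HasCompactSupport (Q v) := fun hv =>
    hasCompactSupport_of_tsupport hv fun p hp => by
      simp [hQ, image_eq_zero_of_notMem_tsupport hp]
  have cP : HasCompactSupport (dMu Ψ) := hasCompactSupport_of_tsupport h.compact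
    fun p hp => dMu_eq_zero hp
  have cD : HasCompactSupport (covD Ψ) := hasCompactSupport_of_tsupport h.compact
    fun p hp => covD_eq_zero hp
  have iQ : ∀ {v : ℝ × ℝ → ℂ}, ContDiff ℝ ∞ v → HasCompactSupport v →
      Integrable (dMu (Q v)) vol := fun hv hvc =>
    integrable_of_tsupport (cQ hvc) (contDiff_dMu (sQ hv)).continuous fun p hp => dMu_eq_zero hp
  have dQ : ∀ {v : ℝ × ℝ → ℂ}, ContDiff ℝ ∞ v → ∀ p, dMu (Q v) p
      = w p * (conj (dMu v p) * v p + conj (v p) * dMu v p) := fun hv p => by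
    rw [hQ, dMu_mul (differentiable_of_smooth hws p)
      (differentiable_of_smooth ((contDiff_conj hv).mul hv) p), hwμ,
      dMu_mul (differentiable_of_smooth (contDiff_conj hv) p) (differentiable_of_smooth hv p),
      dMu_conj (differentiable_of_smooth hv p)]
    ring
  have sF : ContDiff ℝ ∞ F := hws.mul ((contDiff_conj sP).mul sD)
  have cF : HasCompactSupport F := hasCompactSupport_of_tsupport cD fun p hp => by
    simp [hF, image_eq_zero_of_notMem_tsupport hp]
  have iF : Integrable (dTheta F) vol :=
    integrable_of_tsupport cF (contDiff_dTheta sF).continuous fun p hp => dTheta_eq_zero hp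
  have dF : ∀ p, dTheta F p = (deriv W p.1 : ℝ) * (conj (dMu Ψ p) * covD Ψ p)
      + w p * (conj (covD (dMu Ψ) p) * covD Ψ p + conj (dMu Ψ p) * covD (covD Ψ) p) := fun p => by
    rw [hF, dTheta_mul (differentiable_of_smooth hws p)
      (differentiable_of_smooth ((contDiff_conj sP).mul sD) p), hwθ,
      dTheta_mul (differentiable_of_smooth (contDiff_conj sP) p) (differentiable_of_smooth sD p),
      dTheta_conj (differentiable_of_smooth sP p)]
    simp only [covD, map_add, map_mul, Complex.conj_I, Complex.conj_ofReal]
    ring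
  have e0 := integral_dTheta sF cF
  have e1 := integral_dMu (sQ sD) (cQ cD)
  have e2 := integral_dMu (sQ sP) (cQ cP)
  have e3 := integral_dMu (sQ hs) (cQ h.compact)
  have z1 : ∫ θ, Q (covD Ψ) (θ, 0) = 0 := by simp [hQ, h.covD_zero]
  have z3 : ∫ θ, Q Ψ (θ, 0) = 0 := by simp [hQ, h.zero]
  have z2 : ∫ θ, Q (dMu Ψ) (θ, 0) = ((∫ θ, W θ * ‖dMu Ψ (θ, 0)‖ ^ 2 : ℝ) : ℂ) := by
    rw [← integral_complex_ofReal]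
    congr 1 with θ
    simp only [hQ, hw, Complex.conj_mul']
    push_cast; rfl
  rw [z1, neg_zero] at e1
  rw [z3, neg_zero] at e3
  rw [z2] at e2
  have iD : Integrable (fun p => dMu (Q (covD Ψ)) p - dMu (Q (dMu Ψ)) p) vol :=
    (iQ sD cD).sub (iQ sP cP)
  have iL : Integrable (fun p => lam * dMu (Q Ψ) p) vol := (iQ hs h.compact).const_mul _
  have iDL : Integrable (fun p => dMu (Q (covD Ψ)) p - dMu (Q (dMu Ψ)) p
      - lam * dMu (Q Ψ) p) vol := iD.sub iL
  have iA : Integrable (fun p => dTheta F p - (1 / 2 : ℂ) * (dMu (Q (covD Ψ)) p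
      - dMu (Q (dMu Ψ)) p - lam * dMu (Q Ψ) p)) vol := iF.sub (iDL.const_mul _)
  -- On the boundary `Ψ` and `DΨ` vanish, so only the term with `|∂_μΨ|²` leaves a trace.
  have total : ∫ p, (dTheta F p - (1 / 2 : ℂ) * (dMu (Q (covD Ψ)) p - dMu (Q (dMu Ψ)) p
      - lam * dMu (Q Ψ) p)) ∂vol
      = -(1 / 2 : ℂ) * ((∫ θ, W θ * ‖dMu Ψ (θ, 0)‖ ^ 2 : ℝ) : ℂ) := by
    rw [integral_sub iF (iDL.const_mul _), integral_const_mul, integral_sub iD iL,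
      integral_sub (iQ sD cD) (iQ sP cP), integral_const_mul, e0, e1, e2, e3]
    ring
  have hre := congrArg Complex.re total
  rw [re_integral iA] at hre
  -- All second derivatives cancel or are replaced by the source; the commutator `[∂_μ, D] = i` is
  -- what leaves the current density `Im(Ψ̄ DΨ)`.
  have hpt : ∀ p, (dTheta F p - (1 / 2 : ℂ) * (dMu (Q (covD Ψ)) p - dMu (Q (dMu Ψ)) p
      - lam * dMu (Q Ψ) p)).re = deriv W p.1 * (conj (dMu Ψ p) * covD Ψ p).re
        - W p.1 * (conj (Ψ p) * covD Ψ p).im - W p.1 * (conj (dMu Ψ p) * resid lam Ψ p).re := by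
    intro p
    rw [dF, dQ sD, dQ sP, dQ hs, dMu_covD hs, covD_covD_eq lam]
    simp only [hw, map_add, map_mul, Complex.conj_I, Complex.conj_re, Complex.conj_im,
      Complex.add_re, Complex.sub_re, Complex.mul_re, Complex.add_im, Complex.sub_im,
      Complex.mul_im, Complex.neg_re, Complex.neg_im, Complex.ofReal_re, Complex.ofReal_im,
      Complex.I_re, Complex.I_im, Complex.div_re, Complex.div_im, Complex.one_re, Complex.one_im,
      Complex.re_ofNat, Complex.im_ofNat, Complex.normSq_ofNat]
    ring
  simp_rw [hpt] at hre
  have hWc : Continuous fun p : ℝ × ℝ => W p.1 := hW1.continuous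
  have hWc' : Continuous fun p : ℝ × ℝ => deriv W p.1 :=
    (hW.continuous_deriv (by simp)).comp continuous_fst
  have cc1 := (contDiff_conj hs).continuous
  have cc2 := (contDiff_conj sP).continuous
  have c3 := sD.continuous
  have c4 := (contDiff_resid lam hs).continuous
  have k1 : Integrable (fun p => deriv W p.1 * (conj (dMu Ψ p) * covD Ψ p).re) vol :=
    integrable_of_tsupport cD (hWc'.mul (Complex.continuous_re.comp (cc2.mul c3))) fun p hp => by
      simp [image_eq_zero_of_notMem_tsupport hp]
  have k2 : Integrable (fun p => W p.1 * (conj (Ψ p) * covD Ψ p).im) vol :=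
    integrable_of_tsupport cD (hWc.mul (Complex.continuous_im.comp (cc1.mul c3))) fun p hp => by
      simp [image_eq_zero_of_notMem_tsupport hp]
  have k3 : Integrable (fun p => W p.1 * (conj (dMu Ψ p) * resid lam Ψ p).re) vol :=
    integrable_of_tsupport cP (hWc.mul (Complex.continuous_re.comp (cc2.mul c4))) fun p hp => by
      simp [image_eq_zero_of_notMem_tsupport hp]
  have k12 : Integrable (fun p => deriv W p.1 * (conj (dMu Ψ p) * covD Ψ p).re
      - W p.1 * (conj (Ψ p) * covD Ψ p).im) vol := k1.sub k2
  rw [integral_sub k12 k3, integral_sub k1 k2] at hre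
  have : (-(1 / 2 : ℂ) * ((∫ θ, W θ * ‖dMu Ψ (θ, 0)‖ ^ 2 : ℝ) : ℂ)).re
      = -(1 / 2) * ∫ θ, W θ * ‖dMu Ψ (θ, 0)‖ ^ 2 := by
    rw [show (-(1 / 2 : ℂ)) = ((-(1 / 2) : ℝ) : ℂ) by push_cast; rfl, ← Complex.ofReal_mul,
      Complex.ofReal_re]
  rw [this] at hre
  linarith

/-- The edge current `Im ∫ conj Ψ (∂_θ + iμ)Ψ dμ` through the half-line at `θ`. -/
def flux (Ψ : ℝ × ℝ → ℂ) (θ : ℝ) : ℝ := ∫ μ in Ioi (0 : ℝ), (conj (Ψ (θ, μ)) * covD Ψ (θ, μ)).im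

lemma integrable_slice_snd {E : Type*} [NormedAddCommGroup E] {F : ℝ × ℝ → E} (hF : Continuous F)
    (hc : HasCompactSupport F) (θ : ℝ) :
    Integrable (fun μ => F (θ, μ)) (volume.restrict (Ioi (0 : ℝ))) :=
  ((hF.comp (by fun_prop : Continuous fun μ : ℝ => (θ, μ))).integrable_of_hasCompactSupport
    (hasCompactSupport_slice_snd hc θ)).integrableOn

/-- The current is conserved up to the source term. -/
theorem flux_sub_flux {Ψ : ℝ × ℝ → ℂ} (h : IsDirichlet Ψ) (lam : ℝ) (x y : ℝ) :
    flux Ψ x - flux Ψ y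
      = - ∫ θ in y..x, ∫ μ in Ioi (0 : ℝ), (conj (Ψ (θ, μ)) * resid lam Ψ (θ, μ)).im := by
  have hs := h.smooth
  have sP := contDiff_dMu hs
  have sD := contDiff_covD hs
  have sR := contDiff_resid lam hs
  have hz := h.eq_zero
  set F : ℝ × ℝ → ℂ := fun p => conj (Ψ p) * covD Ψ p with hF
  set G : ℝ × ℝ → ℂ := fun p => conj (Ψ p) * dMu Ψ p with hG
  have sF : ContDiff ℝ ∞ F := (contDiff_conj hs).mul sD
  have sG : ContDiff ℝ ∞ G := (contDiff_conj hs).mul sP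
  have cF : HasCompactSupport F := hasCompactSupport_of_tsupport h.compact fun p hp => by
    simp [hF, hz p hp]
  have cG : HasCompactSupport G := hasCompactSupport_of_tsupport h.compact fun p hp => by
    simp [hG, hz p hp]
  have cF' : HasCompactSupport (dTheta F) := hasCompactSupport_of_tsupport cF fun p hp =>
    dTheta_eq_zero hp
  have cG' : HasCompactSupport (dMu G) := hasCompactSupport_of_tsupport cG fun p hp =>
    dMu_eq_zero hp
  have kF' := (contDiff_dTheta sF).continuous
  have kG' := (contDiff_dMu sG).continuous
  -- The local continuity equation: `|DΨ|²`, `|∂_μΨ|²` and `λ|Ψ|²` are real and drop out of the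
  -- imaginary part.
  have dF : ∀ p, (dTheta F p).im = -(dMu G p).im - (conj (Ψ p) * resid lam Ψ p).im := by
    intro p
    rw [hF, hG, dTheta_mul (differentiable_of_smooth (contDiff_conj hs) p)
      (differentiable_of_smooth sD p), dTheta_conj (differentiable_of_smooth hs p),
      dMu_mul (differentiable_of_smooth (contDiff_conj hs) p) (differentiable_of_smooth sP p),
      dMu_conj (differentiable_of_smooth hs p)]
    have e1 : dTheta (covD Ψ) p = covD (covD Ψ) p - Complex.I * p.2 * covD Ψ p := by
      simp only [covD]; ring
    have e2 : dTheta Ψ p = covD Ψ p - Complex.I * p.2 * Ψ p := by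
      simp only [covD]; ring
    rw [e1, e2, covD_covD_eq lam]
    simp only [map_sub, map_mul, Complex.conj_I, Complex.conj_ofReal, Complex.conj_re,
      Complex.conj_im, Complex.sub_re, Complex.mul_re, Complex.add_im,
      Complex.sub_im, Complex.mul_im, Complex.neg_re, Complex.neg_im, Complex.ofReal_re,
      Complex.ofReal_im, Complex.I_re, Complex.I_im]
    ring
  -- No current leaves through the boundary, where `Ψ` vanishes, nor at infinity, by compact
  -- support.
  have slice : ∀ θ, (∫ μ in Ioi (0 : ℝ), dTheta F (θ, μ)).im
      = - ∫ μ in Ioi (0 : ℝ), (conj (Ψ (θ, μ)) * resid lam Ψ (θ, μ)).im := by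
    intro θ
    have i1 := integrable_slice_snd kG' cG' θ
    have i2 : Integrable (fun μ => conj (Ψ (θ, μ)) * resid lam Ψ (θ, μ))
        (volume.restrict (Ioi (0 : ℝ))) :=
      integrable_slice_snd (F := fun p => conj (Ψ p) * resid lam Ψ p)
        ((contDiff_conj hs).mul sR).continuous
        (hasCompactSupport_of_tsupport h.compact fun p hp => by simp [hz p hp]) θ
    rw [im_integral (integrable_slice_snd kF' cF' θ)]
    simp_rw [dF]
    have i1' : Integrable (fun μ => -(dMu G (θ, μ)).im) (volume.restrict (Ioi (0 : ℝ))) := i1.im.neg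
    have i2' : Integrable (fun μ => (conj (Ψ (θ, μ)) * resid lam Ψ (θ, μ)).im)
        (volume.restrict (Ioi (0 : ℝ))) := i2.im
    rw [integral_sub i1' i2', integral_neg, ← im_integral i1, integral_slice_dMu sG cG]
    simp [hG, h.zero]
  have hdiff : ∀ μ, ∫ θ in y..x, dTheta F (θ, μ) = F (x, μ) - F (y, μ) := fun μ =>
    intervalIntegral.integral_eq_sub_of_hasDerivAt (f := fun θ => F (θ, μ))
      (f' := fun θ => dTheta F (θ, μ)) (fun θ _ => hasDerivAt_fst (p := (θ, μ)) (differentiable_of_smooth sF _))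
      ((kF'.comp (by fun_prop : Continuous fun θ : ℝ => (θ, μ))).intervalIntegrable _ _)
  have hflux : ∀ θ, flux Ψ θ = (∫ μ in Ioi (0 : ℝ), F (θ, μ)).im := fun θ => by
    rw [im_integral (integrable_slice_snd sF.continuous cF θ)]; rfl
  have iprod : Integrable (dTheta F) ((volume : Measure ℝ).prod (volume.restrict (Ioi 0))) := by
    rw [← vol_eq_prod]; exact integrable_vol kF' cF'
  have swap : ∫ μ in Ioi (0 : ℝ), ∫ θ in y..x, dTheta F (θ, μ)
      = ∫ θ in y..x, ∫ μ in Ioi (0 : ℝ), dTheta F (θ, μ) := by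
    simp only [intervalIntegral]
    have hr : ∀ s : Set ℝ, Integrable (Function.uncurry fun θ μ => dTheta F (θ, μ))
        ((volume.restrict s).prod (volume.restrict (Ioi (0 : ℝ)))) := fun s =>
      iprod.mono_measure (Measure.prod_mono Measure.restrict_le_self le_rfl)
    have hr' : ∀ s : Set ℝ, Integrable (fun μ => ∫ θ in s, dTheta F (θ, μ))
        (volume.restrict (Ioi (0 : ℝ))) := fun s => (hr s).integral_prod_right
    rw [integral_sub (hr' (Ioc y x)) (hr' (Ioc x y)),
      integral_integral_swap (hr (Ioc y x)), integral_integral_swap (hr (Ioc x y))]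
  rw [hflux, hflux, ← Complex.sub_im, ← integral_sub (integrable_slice_snd sF.continuous cF x)
    (integrable_slice_snd sF.continuous cF y)]
  simp_rw [← hdiff]
  rw [swap]
  have hi : Integrable (fun θ => ∫ μ in Ioi (0 : ℝ), dTheta F (θ, μ)) := iprod.integral_prod_left
  have : (∫ θ in y..x, ∫ μ in Ioi (0 : ℝ), dTheta F (θ, μ)).im
      = ∫ θ in y..x, (∫ μ in Ioi (0 : ℝ), dTheta F (θ, μ)).im :=
    (Complex.imCLM.intervalIntegral_comp_comm hi.intervalIntegrable).symm
  rw [this]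
  simp_rw [slice]
  rw [intervalIntegral.integral_neg]

/-! ### The Mehler kernel of the magnetic Laplacian on the plane -/

/-- Squared Euclidean distance. -/
def distSq (x y : ℝ × ℝ) : ℝ := (x.1 - y.1) ^ 2 + (x.2 - y.2) ^ 2

/-- The gauge factor of the integral kernels of functions of the magnetic Laplacian. -/
def gauge (x y : ℝ × ℝ) : ℂ :=
  Complex.exp (-(Complex.I * ((x.1 - y.1) * (x.2 + y.2) / 2 : ℝ)))

/-- The radial part of the kernel of `exp (-zH)`. -/
def mehler (z : ℂ) (ρ : ℝ) : ℂ :=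
  (4 * Real.pi * Complex.sinh z)⁻¹ * Complex.exp (-(Complex.cosh z / Complex.sinh z) * ρ / 4)

/-- The kernel of `exp (-zH)`. -/
def heatKernel (z : ℂ) (x y : ℝ × ℝ) : ℂ := mehler z (distSq x y) * gauge x y

/-- A Gaussian centred at `x`, in the gauge adapted to the magnetic field. -/
def magGauss (k c : ℂ) (x y : ℝ × ℝ) : ℂ :=
  k * Complex.exp (-c * ((x.1 - y.1) ^ 2 + (x.2 - y.2) ^ 2) / 4
    + Complex.I * ((x.1 - y.1) * (x.2 + y.2) / 2))

lemma contDiff_magGauss (k c : ℂ) (x : ℝ × ℝ) : ContDiff ℝ ∞ (magGauss k c x) := by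
  have h1 : ContDiff ℝ ∞ (fun p : ℝ × ℝ => (p.1 : ℂ)) :=
    Complex.ofRealCLM.contDiff.comp contDiff_fst
  have h2 := contDiff_snd_complex
  have e : ContDiff ℝ ∞ Complex.exp := Complex.contDiff_exp
  unfold magGauss
  fun_prop

lemma dTheta_of_hasDerivAt {f : ℝ × ℝ → ℂ} {p : ℝ × ℝ} {d : ℂ} (hf : DifferentiableAt ℝ f p)
    (h : HasDerivAt (fun θ : ℝ => f (θ, p.2)) d p.1) : dTheta f p = d :=
  (hasDerivAt_fst hf).unique h

lemma dMu_of_hasDerivAt {f : ℝ × ℝ → ℂ} {p : ℝ × ℝ} {d : ℂ} (hf : DifferentiableAt ℝ f p)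
    (h : HasDerivAt (fun μ : ℝ => f (p.1, μ)) d p.2) : dMu f p = d :=
  (hasDerivAt_snd hf).unique h

/-- The phase is chosen so that its derivative `-i(x₂+y₂)/2` combines with the potential `iy₂` to a
function of `x - y` alone: the gauge restores translation invariance. -/
lemma covD_magGauss (k c : ℂ) (x y : ℝ × ℝ) :
    covD (magGauss k c x) y
      = (c * (x.1 - y.1) / 2 - Complex.I * (x.2 - y.2) / 2) * magGauss k c x y := by
  have hd : HasDerivAt (fun w : ℂ => k * Complex.exp (-c * ((x.1 - w) ^ 2 + (x.2 - y.2) ^ 2) / 4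
      + Complex.I * ((x.1 - w) * (x.2 + y.2) / 2)))
      ((c * (x.1 - y.1) / 2 - Complex.I * (x.2 + y.2) / 2) * magGauss k c x y) (y.1 : ℂ) := by
    have h0 : HasDerivAt (fun w : ℂ => (x.1 : ℂ) - w) (-1) (y.1 : ℂ) :=
      (hasDerivAt_id (y.1 : ℂ)).const_sub _
    have h1 := ((((h0.pow 2).add_const (((x.2 : ℂ) - y.2) ^ 2)).const_mul (-c)).div_const 4).add
      (((h0.mul_const ((x.2 : ℂ) + y.2)).div_const 2).const_mul Complex.I)
    refine (h1.cexp.const_mul k).congr_deriv ?_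
    simp only [magGauss, Pi.add_apply, Pi.pow_apply]
    ring
  have := dTheta_of_hasDerivAt (f := magGauss k c x) (p := y)
    (differentiable_of_smooth (contDiff_magGauss k c x) y) hd.comp_ofReal
  rw [covD, this]
  ring

lemma dMu_magGauss (k c : ℂ) (x y : ℝ × ℝ) :
    dMu (magGauss k c x) y
      = (c * (x.2 - y.2) / 2 + Complex.I * (x.1 - y.1) / 2) * magGauss k c x y := by
  have hd : HasDerivAt (fun w : ℂ => k * Complex.exp (-c * ((x.1 - y.1) ^ 2 + (x.2 - w) ^ 2) / 4
      + Complex.I * ((x.1 - y.1) * (x.2 + w) / 2)))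
      ((c * (x.2 - y.2) / 2 + Complex.I * (x.1 - y.1) / 2) * magGauss k c x y) (y.2 : ℂ) := by
    have h0 : HasDerivAt (fun w : ℂ => (x.2 : ℂ) - w) (-1) (y.2 : ℂ) :=
      (hasDerivAt_id (y.2 : ℂ)).const_sub _
    have h0' : HasDerivAt (fun w : ℂ => (x.2 : ℂ) + w) 1 (y.2 : ℂ) :=
      (hasDerivAt_id (y.2 : ℂ)).const_add _
    have h1 := ((((h0.pow 2).const_add (((x.1 : ℂ) - y.1) ^ 2)).const_mul (-c)).div_const 4).add
      (((h0'.const_mul ((x.1 : ℂ) - y.1)).div_const 2).const_mul Complex.I)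
    refine (h1.cexp.const_mul k).congr_deriv ?_
    simp only [magGauss, Pi.add_apply, Pi.pow_apply]
    ring
  exact dMu_of_hasDerivAt (f := magGauss k c x) (p := y)
    (differentiable_of_smooth (contDiff_magGauss k c x) y) hd.comp_ofReal

/-- Both first order operators multiply the Gaussian by linear functions of `x - y`; in the sum of
squares the mixed terms cancel and a radial factor remains. For `c = 1` the factor is the constant
`1`, the lowest Landau level. -/
lemma landau_magGauss (k c : ℂ) (x y : ℝ × ℝ) :
    landau (magGauss k c x) y = (c - (c ^ 2 - 1) * distSq x y / 4) * magGauss k c x y := by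
  have h1 : ContDiff ℝ ∞ (fun p : ℝ × ℝ => (p.1 : ℂ)) :=
    Complex.ofRealCLM.contDiff.comp contDiff_fst
  have h2 := contDiff_snd_complex
  have sL : ContDiff ℝ ∞ (fun y : ℝ × ℝ => c * (x.1 - y.1) / 2 - Complex.I * (x.2 - y.2) / 2) := by
    fun_prop
  have sM : ContDiff ℝ ∞ (fun y : ℝ × ℝ => c * (x.2 - y.2) / 2 + Complex.I * (x.1 - y.1) / 2) := by
    fun_prop
  have dL : dTheta (fun y : ℝ × ℝ => c * (x.1 - y.1) / 2 - Complex.I * (x.2 - y.2) / 2) y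
      = -c / 2 := by
    refine dTheta_of_hasDerivAt (differentiable_of_smooth sL y) (HasDerivAt.comp_ofReal
      (e := fun w : ℂ => c * (x.1 - w) / 2 - Complex.I * (x.2 - y.2) / 2) ?_)
    refine (((((hasDerivAt_id (y.1 : ℂ)).const_sub _).const_mul c).div_const 2).sub_const
      _).congr_deriv (by ring)
  have dM : dMu (fun y : ℝ × ℝ => c * (x.2 - y.2) / 2 + Complex.I * (x.1 - y.1) / 2) y
      = -c / 2 := by
    refine dMu_of_hasDerivAt (differentiable_of_smooth sM y) (HasDerivAt.comp_ofReal
      (e := fun w : ℂ => c * (x.2 - w) / 2 + Complex.I * (x.1 - y.1) / 2) ?_)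
    refine (((((hasDerivAt_id (y.2 : ℂ)).const_sub _).const_mul c).div_const 2).add_const
      _).congr_deriv (by ring)
  have e1 : covD (magGauss k c x) = fun y : ℝ × ℝ =>
      (c * (x.1 - y.1) / 2 - Complex.I * (x.2 - y.2) / 2) * magGauss k c x y :=
    funext (covD_magGauss k c x)
  have e2 : dMu (magGauss k c x) = fun y : ℝ × ℝ =>
      (c * (x.2 - y.2) / 2 + Complex.I * (x.1 - y.1) / 2) * magGauss k c x y :=
    funext (dMu_magGauss k c x)
  have hg := differentiable_of_smooth (contDiff_magGauss k c x) y
  rw [landau, e1, e2, covD_mul (differentiable_of_smooth sL y) hg,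
    dMu_mul (differentiable_of_smooth sM y) hg, dL, dM, covD_magGauss, dMu_magGauss, distSq]
  push_cast
  linear_combination (-(x.1 - y.1 : ℂ) ^ 2 / 4 - (x.2 - y.2 : ℂ) ^ 2 / 4)
    * magGauss k c x y * Complex.I_sq

/-- Green's identity on the half-plane. -/
lemma green_identity {u Ψ : ℝ × ℝ → ℂ} (hu : ContDiff ℝ ∞ u) (h : IsDirichlet Ψ) :
    ∫ p, conj (u p) * landau Ψ p ∂vol = (∫ p, conj (landau u p) * Ψ p ∂vol)
      + ∫ θ, conj (u (θ, 0)) * dMu Ψ (θ, 0) := by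
  have hs := h.smooth
  have cP : HasCompactSupport (dMu Ψ) := hasCompactSupport_of_tsupport h.compact
    fun p hp => dMu_eq_zero hp
  have cD : HasCompactSupport (covD Ψ) := hasCompactSupport_of_tsupport h.compact
    fun p hp => covD_eq_zero hp
  have e1 := integral_conj_mul_covD hu (contDiff_covD hs) (Or.inr cD)
  have e2 := integral_conj_mul_covD (contDiff_covD hu) hs (Or.inr h.compact)
  have e3 := integral_conj_mul_dMu hu (contDiff_dMu hs) (Or.inr cP)
  have e4 := integral_conj_mul_dMu (contDiff_dMu hu) hs (Or.inr h.compact)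
  simp only [h.zero, mul_zero, integral_zero, sub_zero] at e4
  have ii : ∀ {f g : ℝ × ℝ → ℂ}, ContDiff ℝ ∞ f → ContDiff ℝ ∞ g → HasCompactSupport g →
      Integrable (fun p => conj (f p) * g p) vol := fun hf hg hc =>
    integrable_of_tsupport hc ((contDiff_conj hf).continuous.mul hg.continuous)
      fun p hp => by simp [image_eq_zero_of_notMem_tsupport hp]
  have i1 := ii hu (contDiff_covD (contDiff_covD hs))
    (hasCompactSupport_of_tsupport cD fun p hp => covD_eq_zero hp)
  have i2 := ii hu (contDiff_dMu (contDiff_dMu hs))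
    (hasCompactSupport_of_tsupport cP fun p hp => dMu_eq_zero hp)
  have i3 := ii (contDiff_covD (contDiff_covD hu)) hs h.compact
  have i4 := ii (contDiff_dMu (contDiff_dMu hu)) hs h.compact
  have f1 : ∀ p, conj (u p) * landau Ψ p
      = -(conj (u p) * dMu (dMu Ψ) p) - conj (u p) * covD (covD Ψ) p := fun p => by
    simp only [landau]; ring
  have f2 : ∀ p, conj (landau u p) * Ψ p
      = -(conj (dMu (dMu u) p) * Ψ p) - conj (covD (covD u) p) * Ψ p := fun p => by
    simp only [landau, map_sub, map_neg]; ring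
  simp_rw [f1, f2]
  rw [integral_sub i2.fun_neg i1, integral_sub i4.fun_neg i3, integral_neg, integral_neg, e1, e2,
    e3, e4]
  ring

/-- Brings the kernel, as a function of its second variable, to the form in which `green_identity`
moves the operator onto it. -/
lemma heatKernel_eq_conj (z : ℂ) (x y : ℝ × ℝ) :
    heatKernel z x y = conj (magGauss (conj ((4 * Real.pi * Complex.sinh z)⁻¹))
      (conj (Complex.cosh z / Complex.sinh z)) x y) := by
  simp only [heatKernel, magGauss, mehler, gauge, distSq, map_mul, Complex.conj_conj,
    ← Complex.exp_conj, map_add, map_neg, map_div₀, map_pow, map_sub, Complex.conj_ofReal,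
    Complex.conj_I, map_ofNat]
  rw [mul_assoc, ← Complex.exp_add]
  push_cast
  ring_nf

lemma continuous_heatKernel (z : ℂ) (x : ℝ × ℝ) : Continuous (heatKernel z x) := by
  rw [funext (heatKernel_eq_conj z x)]
  exact (contDiff_conj (contDiff_magGauss _ _ _)).continuous

/-- The pairing of the heat kernel with the source and the boundary data of `Ψ`. -/
def heatSource (lam : ℝ) (Ψ : ℝ × ℝ → ℂ) (x : ℝ × ℝ) (z : ℂ) : ℂ :=
  (∫ y, heatKernel z x y * resid lam Ψ y ∂vol) - ∫ s, heatKernel z x (s, 0) * dMu Ψ (s, 0)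

/-- The time derivative of the radial part, up to the factor `mehler z ρ`. -/
def mehlerLog (z : ℂ) (ρ : ℝ) : ℂ :=
  Complex.cosh z / Complex.sinh z - ((Complex.cosh z / Complex.sinh z) ^ 2 - 1) * ρ / 4

/-- Green's identity with a Gaussian of complex width `coth z`: the operator acts on the kernel as
multiplication by `mehlerLog`, and the boundary contributes the normal derivative of `Ψ` only. -/
lemma integral_heatKernel_generator {Ψ : ℝ × ℝ → ℂ} (h : IsDirichlet Ψ) (lam : ℝ) (x : ℝ × ℝ)
    (z : ℂ) :
    ∫ y, (lam - mehlerLog z (distSq x y)) * heatKernel z x y * Ψ y ∂vol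
      = - heatSource lam Ψ x z := by
  have hg := green_identity (contDiff_magGauss (conj ((4 * Real.pi * Complex.sinh z)⁻¹))
      (conj (Complex.cosh z / Complex.sinh z)) x) h
  simp_rw [landau_magGauss, map_mul, ← heatKernel_eq_conj] at hg
  have e : ∀ p, conj (conj (Complex.cosh z / Complex.sinh z)
      - (conj (Complex.cosh z / Complex.sinh z) ^ 2 - 1) * (distSq x p : ℂ) / 4)
      = mehlerLog z (distSq x p) := fun p => by
    simp only [mehlerLog, map_sub, map_div₀, map_mul, map_pow, Complex.conj_conj, map_one,
      Complex.conj_ofReal, map_ofNat]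
  simp_rw [e] at hg
  have hK := continuous_heatKernel z x
  have hml : Continuous fun y => mehlerLog z (distSq x y) := by
    unfold mehlerLog distSq; fun_prop
  have i1 : Integrable (fun y => heatKernel z x y * Ψ y) vol :=
    integrable_of_tsupport h.compact (hK.mul h.smooth.continuous)
      fun p hp => by simp [image_eq_zero_of_notMem_tsupport hp]
  have i2 : Integrable (fun y => mehlerLog z (distSq x y) * heatKernel z x y * Ψ y) vol :=
    integrable_of_tsupport h.compact ((hml.mul hK).mul h.smooth.continuous)
      fun p hp => by simp [image_eq_zero_of_notMem_tsupport hp]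
  have i3 : Integrable (fun y => heatKernel z x y * landau Ψ y) vol :=
    integrable_of_tsupport h.compact (hK.mul (contDiff_landau h.smooth).continuous)
      fun p hp => by simp [landau_eq_zero hp]
  have f1 : ∀ y, (lam - mehlerLog z (distSq x y)) * heatKernel z x y * Ψ y
      = lam * (heatKernel z x y * Ψ y) - mehlerLog z (distSq x y) * heatKernel z x y * Ψ y :=
    fun y => by ring
  have f2 : ∀ y, heatKernel z x y * resid lam Ψ y
      = heatKernel z x y * landau Ψ y - lam * (heatKernel z x y * Ψ y) := fun y => by
    simp only [resid]; ring
  simp only [heatSource]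
  simp_rw [f1, f2]
  rw [integral_sub (i1.const_mul _) i2, integral_sub i3 (i1.const_mul _), integral_const_mul, hg]
  ring

/-- With `integral_heatKernel_generator` this is the heat equation in complex time: `-∂_z` and the
operator act on the kernel by the same factor, wherever `sinh z ≠ 0`. -/
lemma hasDerivAt_mehler {z : ℂ} (hz : Complex.sinh z ≠ 0) (ρ : ℝ) :
    HasDerivAt (fun w => mehler w ρ) (-mehlerLog z ρ * mehler z ρ) z := by
  have h1 : HasDerivAt (fun w => Complex.cosh w / Complex.sinh w)
      ((Complex.sinh z * Complex.sinh z - Complex.cosh z * Complex.cosh z) / Complex.sinh z ^ 2)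
      z := (Complex.hasDerivAt_cosh z).div (Complex.hasDerivAt_sinh z) hz
  have hpi : (4 * Real.pi * Complex.sinh z : ℂ) ≠ 0 :=
    mul_ne_zero (mul_ne_zero (by norm_num) (Complex.ofReal_ne_zero.2 Real.pi_ne_zero)) hz
  have h2 : HasDerivAt (fun w => (4 * Real.pi * Complex.sinh w : ℂ)⁻¹)
      (-(4 * Real.pi * Complex.cosh z) / (4 * Real.pi * Complex.sinh z) ^ 2) z :=
    ((Complex.hasDerivAt_sinh z).const_mul _).inv hpi
  have h3 := h2.mul ((((h1.neg).mul_const (ρ : ℂ)).div_const 4).cexp)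
  refine h3.congr_deriv ?_
  have hpi' : (Real.pi : ℂ) ≠ 0 := Complex.ofReal_ne_zero.2 Real.pi_ne_zero
  simp only [mehler, mehlerLog, Pi.neg_apply]
  set E := Complex.exp (-(Complex.cosh z / Complex.sinh z) * ρ / 4)
  field_simp
  ring

lemma continuousOn_heat_path (lam : ℝ) (x : ℝ × ℝ) {Ψ : ℝ × ℝ → ℂ} (hΨ : Continuous Ψ)
    {z₀ d : ℂ} {a b : ℝ} (hz : ∀ t ∈ uIcc a b, Complex.sinh (z₀ + d * t) ≠ 0) :
    ContinuousOn (fun q : (ℝ × ℝ) × ℝ => Complex.exp (lam * (z₀ + d * q.2))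
      * ((lam - mehlerLog (z₀ + d * q.2) (distSq x q.1)) * heatKernel (z₀ + d * q.2) x q.1
        * Ψ q.1)) (univ ×ˢ uIcc a b) := by
  have hs : ∀ q ∈ (univ : Set (ℝ × ℝ)) ×ˢ uIcc a b, Complex.sinh (z₀ + d * q.2) ≠ 0 :=
    fun q hq => hz q.2 hq.2
  have hpi : ∀ q ∈ (univ : Set (ℝ × ℝ)) ×ˢ uIcc a b,
      (4 * Real.pi * Complex.sinh (z₀ + d * q.2) : ℂ) ≠ 0 := fun q hq =>
    mul_ne_zero (mul_ne_zero (by norm_num) (Complex.ofReal_ne_zero.2 Real.pi_ne_zero)) (hs q hq)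
  have c1 : ContinuousOn (fun q : (ℝ × ℝ) × ℝ => Complex.cosh (z₀ + d * q.2)
      / Complex.sinh (z₀ + d * q.2)) (univ ×ˢ uIcc a b) :=
    ContinuousOn.div (by fun_prop) (by fun_prop) hs
  have c2 : ContinuousOn (fun q : (ℝ × ℝ) × ℝ => (4 * Real.pi * Complex.sinh (z₀ + d * q.2) : ℂ)⁻¹)
      (univ ×ˢ uIcc a b) := ContinuousOn.inv₀ (by fun_prop) hpi
  unfold mehlerLog heatKernel mehler gauge distSq
  fun_prop

/-- Duhamel's formula along a straight path of complex times. -/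
lemma heat_path {Ψ : ℝ × ℝ → ℂ} (h : IsDirichlet Ψ) (lam : ℝ) (x : ℝ × ℝ) {z₀ d : ℂ} {a b : ℝ}
    (hab : a ≤ b) (hz : ∀ t ∈ uIcc a b, Complex.sinh (z₀ + d * t) ≠ 0) :
    (Complex.exp (lam * (z₀ + d * b)) * ∫ y, heatKernel (z₀ + d * b) x y * Ψ y ∂vol)
      - Complex.exp (lam * (z₀ + d * a)) * ∫ y, heatKernel (z₀ + d * a) x y * Ψ y ∂vol
      = - d * ∫ t in a..b, Complex.exp (lam * (z₀ + d * t)) * heatSource lam Ψ x (z₀ + d * t) := by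
  set f : ℝ × ℝ → ℝ → ℂ := fun y t => Complex.exp (lam * (z₀ + d * t))
      * ((lam - mehlerLog (z₀ + d * t) (distSq x y)) * heatKernel (z₀ + d * t) x y * Ψ y) with hf
  have hcont := continuousOn_heat_path lam x h.smooth.continuous hz
  -- For fixed `y` the integrand is the exact `t`-derivative of `e^{λz}` times the kernel along the
  -- path.
  have hFTC : ∀ y, ∫ t in a..b, d * f y t
      = Complex.exp (lam * (z₀ + d * b)) * (heatKernel (z₀ + d * b) x y * Ψ y)
        - Complex.exp (lam * (z₀ + d * a)) * (heatKernel (z₀ + d * a) x y * Ψ y) := by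
    intro y
    refine intervalIntegral.integral_eq_sub_of_hasDerivAt (f := fun t : ℝ =>
      Complex.exp (lam * (z₀ + d * t)) * (heatKernel (z₀ + d * t) x y * Ψ y)) (fun t ht => ?_) ?_
    · have hzt : HasDerivAt (fun w : ℂ => z₀ + d * w) d (t : ℂ) := by
        simpa using ((hasDerivAt_id (t : ℂ)).const_mul d).const_add z₀
      have h1 : HasDerivAt (fun w : ℂ => mehler (z₀ + d * w) (distSq x y))
          (-mehlerLog (z₀ + d * t) (distSq x y) * mehler (z₀ + d * t) (distSq x y) * d) (t : ℂ) :=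
        HasDerivAt.comp (h₂ := fun w => mehler w (distSq x y)) (t : ℂ)
          (hasDerivAt_mehler (hz t ht) (distSq x y)) hzt
      have h2 := ((hzt.const_mul (lam : ℂ)).cexp).mul
        ((h1.mul_const (gauge x y)).mul_const (Ψ y))
      refine h2.comp_ofReal.congr_deriv ?_
      simp only [hf, heatKernel]
      ring
    · refine ContinuousOn.intervalIntegrable ?_
      refine continuousOn_const.mul (hcont.comp (f := fun t : ℝ => (y, t)) (by fun_prop) ?_)
      exact fun t ht => ⟨mem_univ _, ht⟩
  -- Continuity on the compact set `supp Ψ × [a, b]` justifies exchanging the two integrals.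
  have hint : Integrable (Function.uncurry f) (vol.prod (volume.restrict (Ioc a b))) := by
    have hK : IsCompact (tsupport Ψ ×ˢ Icc a b) := h.compact.isCompact.prod isCompact_Icc
    have h1 : IntegrableOn (Function.uncurry f) (tsupport Ψ ×ˢ Icc a b)
        ((volume : Measure (ℝ × ℝ)).prod volume) := by
      refine ContinuousOn.integrableOn_compact hK (hcont.mono ?_)
      rw [uIcc_of_le hab]
      exact prod_mono (subset_univ _) le_rfl
    have h2 : IntegrableOn (Function.uncurry f) (univ ×ˢ Icc a b)
        ((volume : Measure (ℝ × ℝ)).prod volume) := by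
      refine h1.of_forall_sdiff_eq_zero (MeasurableSet.univ.prod measurableSet_Icc) ?_
      rintro ⟨y, t⟩ ⟨⟨-, ht⟩, hn⟩
      have : y ∉ tsupport Ψ := fun hy => hn ⟨hy, ht⟩
      simp [Function.uncurry, hf, image_eq_zero_of_notMem_tsupport this]
    have h3 : Integrable (Function.uncurry f)
        ((volume : Measure (ℝ × ℝ)).prod (volume.restrict (Icc a b))) := by
      rwa [IntegrableOn, ← Measure.prod_restrict, Measure.restrict_univ] at h2
    exact h3.mono_measure (Measure.prod_mono Measure.restrict_le_self
      (Measure.restrict_mono Ioc_subset_Icc_self le_rfl))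
  have hi : ∀ z : ℂ, Integrable (fun y => heatKernel z x y * Ψ y) vol := fun z =>
    integrable_of_tsupport h.compact ((continuous_heatKernel z x).mul h.smooth.continuous)
      fun p hp => by simp [image_eq_zero_of_notMem_tsupport hp]
  rw [← integral_const_mul, ← integral_const_mul, ← integral_sub ((hi _).const_mul _)
    ((hi _).const_mul _)]
  simp_rw [← hFTC, intervalIntegral.integral_const_mul]
  rw [integral_const_mul]
  simp_rw [intervalIntegral.integral_of_le hab]
  rw [integral_integral_swap hint, neg_mul, ← mul_neg, ← integral_neg]
  congr 2 with t
  simp only [hf]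
  rw [integral_const_mul, integral_heatKernel_generator h]
  ring

/-! ### Bounds for the Mehler kernel -/

/-- The Gaussian majorant of the resolvent kernel, with an integrable singularity in the first
variable. -/
def majorant (a b : ℝ) : ℝ := |a| ^ (-(1 / 2) : ℝ) * Real.exp (-a ^ 2 / 16) * Real.exp (-b ^ 2 / 16)

lemma majorant_nonneg (a b : ℝ) : 0 ≤ majorant a b := by unfold majorant; positivity

lemma sinh_le_mul_cosh {t : ℝ} (ht : 0 ≤ t) : Real.sinh t ≤ t * Real.cosh t := by
  have hd : ∀ x : ℝ, HasDerivAt (fun s => s * Real.cosh s - Real.sinh s) (x * Real.sinh x) x :=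
    fun x => (((hasDerivAt_id x).mul (Real.hasDerivAt_cosh x)).sub
      (Real.hasDerivAt_sinh x)).congr_deriv (by simp)
  have hm : MonotoneOn (fun s => s * Real.cosh s - Real.sinh s) (Ici 0) := by
    refine monotoneOn_of_deriv_nonneg (convex_Ici 0)
      (fun x _ => (hd x).continuousAt.continuousWithinAt)
      (fun x _ => (hd x).differentiableAt.differentiableWithinAt) fun x hx => ?_
    rw [interior_Ici] at hx
    rw [(hd x).deriv]
    exact mul_nonneg (le_of_lt hx) (Real.sinh_nonneg_iff.2 (le_of_lt hx))
  have := hm (mem_Ici.2 le_rfl) (mem_Ici.2 ht) ht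
  simp at this
  linarith

lemma mehler_ofReal (t ρ : ℝ) : mehler t ρ
    = (((4 * Real.pi * Real.sinh t)⁻¹ * Real.exp (-(Real.cosh t / Real.sinh t) * ρ / 4) : ℝ) : ℂ) := by
  simp only [mehler]
  push_cast
  rfl

/-- Since `sinh t ≥ t` and `coth t ≥ 1/t`, the magnetic kernel at real times is dominated by the
ordinary heat kernel. -/
lemma norm_mehler_ofReal {t ρ : ℝ} (ht : 0 < t) (hρ : 0 ≤ ρ) :
    ‖mehler t ρ‖ ≤ (4 * Real.pi * t)⁻¹ * Real.exp (-ρ / (4 * t)) := by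
  have hs : 0 < Real.sinh t := Real.sinh_pos_iff.2 ht
  have hts : t ≤ Real.sinh t := Real.self_le_sinh_iff.2 ht.le
  have hc : 1 / t ≤ Real.cosh t / Real.sinh t := by
    rw [div_le_div_iff₀ ht hs]
    have := sinh_le_mul_cosh ht.le
    linarith
  rw [mehler_ofReal, Complex.norm_real, Real.norm_of_nonneg (by positivity)]
  have hpi := Real.pi_pos
  have : 1 / t * ρ ≤ Real.cosh t / Real.sinh t * ρ := by gcongr
  have e : -ρ / (4 * t) = -(1 / t * ρ) / 4 := by field_simp
  refine mul_le_mul (inv_anti₀ (by positivity) (by gcongr)) (Real.exp_le_exp.2 ?_)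
    (Real.exp_nonneg _) (by positivity)
  rw [e]
  linarith

/-- The exponent `1/4` shares the singularity `1/t` of the heat kernel: `t^{-3/4}` stays integrable
in time, and the price `|a|^{-1/2}` is integrable on a line, as the boundary potential requires. -/
lemma exp_neg_le_rpow {x : ℝ} (hx : 0 < x) : Real.exp (-x) ≤ x ^ (-(1 / 4) : ℝ) := by
  rw [Real.rpow_neg hx.le, Real.exp_neg]
  refine inv_anti₀ (by positivity) ?_
  calc x ^ (1 / 4 : ℝ) ≤ (Real.exp x) ^ (1 / 4 : ℝ) := by
        gcongr
        linarith [Real.add_one_le_exp x]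
    _ = Real.exp (x * (1 / 4)) := by rw [← Real.exp_mul]
    _ ≤ Real.exp x := Real.exp_le_exp.2 (by linarith)

lemma sq_rpow_neg_quarter {a : ℝ} : (a ^ 2) ^ (-(1 / 4) : ℝ) = |a| ^ (-(1 / 2) : ℝ) := by
  rw [← sq_abs, ← Real.rpow_natCast, ← Real.rpow_mul (abs_nonneg a)]
  norm_num

lemma exp_neg_sq_le {a s : ℝ} (ha : a ≠ 0) (hs : 0 < s) :
    Real.exp (-a ^ 2 / (16 * s)) ≤ 2 * (s ^ (1 / 4 : ℝ) * |a| ^ (-(1 / 2) : ℝ)) := by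
  have h := exp_neg_le_rpow (x := a ^ 2 / (16 * s)) (by positivity)
  rw [show -(a ^ 2 / (16 * s)) = -a ^ 2 / (16 * s) by ring, Real.div_rpow (by positivity)
    (by positivity), sq_rpow_neg_quarter, Real.mul_rpow (by norm_num) hs.le, Real.rpow_neg hs.le,
    show (16 : ℝ) ^ (-(1 / 4) : ℝ) = 1 / 2 by
      rw [show (16 : ℝ) = 2 ^ (4 : ℝ) by norm_num, ← Real.rpow_mul (by norm_num)]
      norm_num [Real.rpow_neg]] at h
  refine h.trans (le_of_eq ?_)
  have : 0 < s ^ (1 / 4 : ℝ) := by positivity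
  field_simp

lemma norm_mehler_le_majorant {t a b : ℝ} (ht : 0 < t) (ht1 : t ≤ 1) (ha : a ≠ 0) :
    ‖mehler t (a ^ 2 + b ^ 2)‖ ≤ t ^ (-(3 / 4) : ℝ) * majorant a b := by
  refine (norm_mehler_ofReal ht (by positivity)).trans ?_
  have hpi := Real.pi_gt_three
  -- Of the exponent `a²/(4t)` a quarter pays for the singularity; as `t ≤ 1`, the rest still gives
  -- a Gaussian that does not depend on `t`.
  have h1 : Real.exp (-(a ^ 2 + b ^ 2) / (4 * t)) ≤ Real.exp (-a ^ 2 / (16 * t))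
      * (Real.exp (-a ^ 2 / 16) * Real.exp (-b ^ 2 / 16)) := by
    rw [← Real.exp_add, ← Real.exp_add]
    refine Real.exp_le_exp.2 ?_
    have hq : 1 ≤ 1 / t := by rw [le_div_iff₀ ht]; linarith
    have e1 : -(a ^ 2 + b ^ 2) / (4 * t) = -(a ^ 2 + b ^ 2) / 4 * (1 / t) := by field_simp
    have e2 : -a ^ 2 / (16 * t) = -a ^ 2 / 16 * (1 / t) := by field_simp
    rw [e1, e2]
    nlinarith [sq_nonneg a, sq_nonneg b, mul_nonneg (sq_nonneg a) (sub_nonneg.2 hq),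
      mul_nonneg (sq_nonneg b) (sub_nonneg.2 hq)]
  have h2 := exp_neg_sq_le (s := t) ha ht
  have h3 : t⁻¹ * t ^ (1 / 4 : ℝ) = t ^ (-(3 / 4) : ℝ) := by
    rw [← Real.rpow_neg_one, ← Real.rpow_add ht]; norm_num
  calc (4 * Real.pi * t)⁻¹ * Real.exp (-(a ^ 2 + b ^ 2) / (4 * t))
      ≤ (2 * t)⁻¹ * ((2 * (t ^ (1 / 4 : ℝ) * |a| ^ (-(1 / 2) : ℝ)))
        * (Real.exp (-a ^ 2 / 16) * Real.exp (-b ^ 2 / 16))) := by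
        gcongr
        · linarith
        · exact h1.trans (by gcongr)
    _ = (t⁻¹ * t ^ (1 / 4 : ℝ)) * majorant a b := by
        unfold majorant; field_simp
    _ = _ := by rw [h3]

lemma sinh_one_add (s : ℝ) : Complex.sinh (1 + Complex.I * s)
    = (Real.sinh 1 * Real.cos s : ℝ) + (Real.cosh 1 * Real.sin s : ℝ) * Complex.I := by
  rw [mul_comm, Complex.sinh_add, Complex.sinh_mul_I, Complex.cosh_mul_I]
  push_cast; ring

lemma cosh_one_add (s : ℝ) : Complex.cosh (1 + Complex.I * s)
    = (Real.cosh 1 * Real.cos s : ℝ) + (Real.sinh 1 * Real.sin s : ℝ) * Complex.I := by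
  rw [mul_comm, Complex.cosh_add, Complex.sinh_mul_I, Complex.cosh_mul_I]
  push_cast; ring

lemma normSq_sinh_one_add (s : ℝ) : Complex.normSq (Complex.sinh (1 + Complex.I * s))
    = Real.sinh 1 ^ 2 + Real.sin s ^ 2 := by
  rw [sinh_one_add, Complex.normSq_add_mul_I]
  nlinarith [Real.sin_sq_add_cos_sq s, Real.cosh_sq 1]

lemma one_le_sinh_one : 1 ≤ Real.sinh 1 := Real.self_le_sinh_iff.2 zero_le_one

lemma one_le_norm_sinh_one_add (s : ℝ) : 1 ≤ ‖Complex.sinh (1 + Complex.I * s)‖ := by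
  have h := normSq_sinh_one_add s
  rw [Complex.normSq_eq_norm_sq] at h
  have := one_le_sinh_one
  nlinarith [sq_nonneg (Real.sin s), norm_nonneg (Complex.sinh (1 + Complex.I * s))]

lemma sinh_one_add_ne_zero (s : ℝ) : Complex.sinh (1 + Complex.I * s) ≠ 0 := by
  intro h
  have := one_le_norm_sinh_one_add s
  rw [h, norm_zero] at this
  linarith

/-- The real part equals `cosh 1 · sinh 1 / (sinh² 1 + sin² s)`, and both terms of the denominator
are at most `cosh 1 · sinh 1` because `sinh 1 ≥ 1`. It gives Gaussian decay uniformly along the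
vertical segment. -/
lemma half_le_re_coth (s : ℝ) :
    1 / 2 ≤ (Complex.cosh (1 + Complex.I * s) / Complex.sinh (1 + Complex.I * s)).re := by
  rw [Complex.div_re, ← add_div, normSq_sinh_one_add, sinh_one_add, cosh_one_add]
  simp only [Complex.add_re, Complex.ofReal_re, Complex.mul_re, Complex.I_re, mul_zero,
    Complex.ofReal_im, Complex.I_im, mul_one, sub_self, add_zero, Complex.add_im, Complex.mul_im,
    zero_add]
  have h1 := one_le_sinh_one
  have h2 := Real.sin_sq_add_cos_sq s
  have h3 := Real.cosh_sq 1
  have h4 : Real.sinh 1 < Real.cosh 1 := Real.sinh_lt_cosh 1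
  rw [div_le_div_iff₀ (by norm_num) (by positivity)]
  have e : (Real.cosh 1 * Real.cos s * (Real.sinh 1 * Real.cos s)
      + Real.sinh 1 * Real.sin s * (Real.cosh 1 * Real.sin s)) = Real.cosh 1 * Real.sinh 1 := by
    linear_combination (Real.cosh 1 * Real.sinh 1) * h2
  rw [e]
  nlinarith [sq_nonneg (Real.cos s)]

lemma norm_mehler_vertical_le {a b : ℝ} (ha : a ≠ 0) (s : ℝ) :
    ‖mehler (1 + Complex.I * s) (a ^ 2 + b ^ 2)‖ ≤ 2 * majorant a b := by
  have h1 := one_le_norm_sinh_one_add s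
  have h2 := half_le_re_coth s
  have hpi := Real.pi_gt_three
  have e1 : ‖(4 * Real.pi * Complex.sinh (1 + Complex.I * s) : ℂ)⁻¹‖ ≤ 1 := by
    rw [norm_inv]
    refine inv_le_one_of_one_le₀ ?_
    rw [norm_mul, norm_mul, Complex.norm_real, Real.norm_of_nonneg Real.pi_pos.le]
    · simp only [Complex.norm_ofNat]
      nlinarith
  have e2 : ‖Complex.exp (-(Complex.cosh (1 + Complex.I * s) / Complex.sinh (1 + Complex.I * s))
      * ((a ^ 2 + b ^ 2 : ℝ) : ℂ) / 4)‖ ≤ Real.exp (-a ^ 2 / (16 * 1))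
        * (Real.exp (-a ^ 2 / 16) * Real.exp (-b ^ 2 / 16)) := by
    rw [Complex.norm_exp, ← Real.exp_add, ← Real.exp_add]
    refine Real.exp_le_exp.2 ?_
    have : ∀ w : ℂ, (-w * ((a ^ 2 + b ^ 2 : ℝ) : ℂ) / 4).re = -w.re * (a ^ 2 + b ^ 2) / 4 := by
      intro w
      rw [show (4 : ℂ) = ((4 : ℝ) : ℂ) by norm_num, Complex.div_ofReal_re, Complex.re_mul_ofReal,
        Complex.neg_re]
    rw [this]
    nlinarith [mul_le_mul_of_nonneg_right h2 (by positivity : 0 ≤ a ^ 2 + b ^ 2), sq_nonneg b]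
  have e3 := exp_neg_sq_le (s := 1) ha one_pos
  rw [Real.one_rpow, one_mul] at e3
  rw [mehler, norm_mul]
  calc _ ≤ 1 * ((2 * |a| ^ (-(1 / 2) : ℝ)) * (Real.exp (-a ^ 2 / 16) * Real.exp (-b ^ 2 / 16))) := by
        gcongr
        exact e2.trans (by gcongr)
    _ = 2 * majorant a b := by unfold majorant; ring

lemma norm_gauge (x y : ℝ × ℝ) : ‖gauge x y‖ = 1 := by
  rw [gauge, Complex.norm_exp]
  simp

lemma continuous_gauge (x : ℝ × ℝ) : Continuous (gauge x) := by unfold gauge; fun_prop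

/-! ### Short-time limit -/

lemma integral_gaussian_plane :
    ∫ v : ℝ × ℝ, ((4 * Real.pi)⁻¹ : ℝ) * Real.exp (-(v.1 ^ 2 + v.2 ^ 2) / 4) = 1 := by
  have e : ∀ v : ℝ × ℝ, Real.exp (-(v.1 ^ 2 + v.2 ^ 2) / 4)
      = Real.exp (-(1 / 4) * v.1 ^ 2) * Real.exp (-(1 / 4) * v.2 ^ 2) := fun v => by
    rw [← Real.exp_add]; ring_nf
  simp_rw [e]
  rw [integral_const_mul, Measure.volume_eq_prod, integral_prod_mul (fun a : ℝ =>
    Real.exp (-(1 / 4) * a ^ 2)) (fun a : ℝ => Real.exp (-(1 / 4) * a ^ 2)), integral_gaussian,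
    Real.mul_self_sqrt (by positivity)]
  field_simp

lemma tendsto_div_sinh : Tendsto (fun t : ℝ => t / Real.sinh t) (𝓝[>] 0) (𝓝 1) := by
  have h := (hasDerivAt_iff_tendsto_slope_zero.1 (Real.hasDerivAt_sinh 0))
  simp only [zero_add, Real.sinh_zero, sub_zero, smul_eq_mul, Real.cosh_zero] at h
  have h2 := (h.mono_left (nhdsWithin_mono 0 (fun t (ht : 0 < t) => ne_of_gt ht))).inv₀ one_ne_zero
  rw [inv_one] at h2
  refine h2.congr fun t => ?_
  rw [mul_inv, inv_inv, div_eq_mul_inv]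

/-- After the substitution `y = x + √t v` the kernel becomes a Gaussian of total mass one, and
dominated convergence applies. The point must be interior, so that the extension of `Ψ` by zero is
continuous there. -/
lemma tendsto_heatKernel {Ψ : ℝ × ℝ → ℂ} (h : IsDirichlet Ψ) {x : ℝ × ℝ} (hx : 0 < x.2) :
    Tendsto (fun t : ℝ => ∫ y, heatKernel t x y * Ψ y ∂vol) (𝓝[>] 0) (𝓝 (Ψ x)) := by
  set Φ : ℝ × ℝ → ℂ := halfPlane.indicator Ψ with hΦ
  obtain ⟨B, hB⟩ := h.compact.exists_bound_of_continuous h.smooth.continuous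
  have hΦB : ∀ y, ‖Φ y‖ ≤ B := fun y => (norm_indicator_le_norm_self _ _).trans (hB y)
  have hB0 : 0 ≤ B := (norm_nonneg _).trans (hB x)
  have hΦm : Measurable Φ := h.smooth.continuous.measurable.indicator measurableSet_halfPlane
  have hΦx : Tendsto Φ (𝓝 x) (𝓝 (Ψ x)) := by
    refine (h.smooth.continuous.tendsto x).congr' ?_
    filter_upwards [isOpen_halfPlane.mem_nhds hx] with y hy
    rw [hΦ, indicator_of_mem hy]
  have step : ∀ t : ℝ, 0 < t → ∫ y, heatKernel t x y * Ψ y ∂vol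
      = ∫ v : ℝ × ℝ, (t : ℂ) * (heatKernel t x (x + √t • v) * Φ (x + √t • v)) := by
    intro t ht
    have e1 : ∫ y, heatKernel t x y * Ψ y ∂vol = ∫ y, heatKernel t x y * Φ y := by
      rw [vol, ← integral_indicator measurableSet_halfPlane]
      congr 1 with y
      by_cases hy : y ∈ halfPlane <;> simp [hΦ, hy]
    rw [e1, ← integral_add_left_eq_self _ x]
    have e2 := Measure.integral_comp_smul (volume : Measure (ℝ × ℝ))
      (fun w => heatKernel t x (x + w) * Φ (x + w)) (√t)
    rw [integral_const_mul, e2]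
    -- The Jacobian of the dilation by `√t` in two dimensions.
    have e3 : (√t) ^ Module.finrank ℝ (ℝ × ℝ) = t := by
      rw [Module.finrank_prod, Module.finrank_self]
      exact Real.sq_sqrt ht.le
    rw [e3, abs_of_pos (inv_pos.2 ht), Complex.real_smul, ← mul_assoc]
    push_cast
    rw [mul_inv_cancel₀ (Complex.ofReal_ne_zero.2 ht.ne'), one_mul]
  have hdist : ∀ (t : ℝ) (v : ℝ × ℝ), 0 < t → distSq x (x + √t • v) = t * (v.1 ^ 2 + v.2 ^ 2) := by
    intro t v ht
    simp only [distSq, Prod.fst_add, Prod.snd_add, Prod.smul_fst, Prod.smul_snd, smul_eq_mul]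
    linear_combination (v.1 ^ 2 + v.2 ^ 2) * Real.sq_sqrt ht.le
  have key : Tendsto (fun t : ℝ => ∫ v : ℝ × ℝ,
      (t : ℂ) * (heatKernel t x (x + √t • v) * Φ (x + √t • v))) (𝓝[>] 0)
      (𝓝 (∫ v : ℝ × ℝ, (((4 * Real.pi)⁻¹ * Real.exp (-(v.1 ^ 2 + v.2 ^ 2) / 4) : ℝ) : ℂ)
        * Ψ x)) := by
    refine tendsto_integral_filter_of_dominated_convergence
      (fun v => ((4 * Real.pi)⁻¹ * Real.exp (-(v.1 ^ 2 + v.2 ^ 2) / 4)) * B) ?_ ?_ ?_ ?_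
    · refine Eventually.of_forall fun t => Measurable.aestronglyMeasurable ?_
      have h1 : Measurable fun v : ℝ × ℝ => x + √t • v := by fun_prop
      exact (((continuous_heatKernel t x).measurable.comp h1).mul (hΦm.comp h1)).const_mul _
    · filter_upwards [self_mem_nhdsWithin] with t (ht : 0 < t)
      refine Eventually.of_forall fun v => ?_
      rw [norm_mul, norm_mul, heatKernel, norm_mul, norm_gauge, mul_one, hdist t v ht,
        Complex.norm_real, Real.norm_of_nonneg ht.le, ← mul_assoc]
      have h1 := norm_mehler_ofReal (ρ := t * (v.1 ^ 2 + v.2 ^ 2)) ht (by positivity)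
      have h2 : t * ((4 * Real.pi * t)⁻¹ * Real.exp (-(t * (v.1 ^ 2 + v.2 ^ 2)) / (4 * t)))
          = (4 * Real.pi)⁻¹ * Real.exp (-(v.1 ^ 2 + v.2 ^ 2) / 4) := by
        rw [show -(t * (v.1 ^ 2 + v.2 ^ 2)) / (4 * t) = -(v.1 ^ 2 + v.2 ^ 2) / 4 by field_simp]
        field_simp
      calc _ ≤ t * ((4 * Real.pi * t)⁻¹ * Real.exp (-(t * (v.1 ^ 2 + v.2 ^ 2)) / (4 * t))) * B := by
            gcongr
            exact hΦB _
        _ = _ := by rw [h2]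
    · refine Integrable.mul_const ?_ B
      -- The integral of a non-integrable function is `0` by convention, so the value `1` already
      -- proves integrability.
      by_contra hni
      have := integral_gaussian_plane
      rw [integral_undef hni] at this
      exact zero_ne_one this
    · refine Eventually.of_forall fun v => ?_
      have ht0 : Tendsto (fun t : ℝ => t) (𝓝[>] 0) (𝓝 0) := nhdsWithin_le_nhds
      have hpath : Tendsto (fun t : ℝ => x + √t • v) (𝓝[>] 0) (𝓝 x) := by
        have : Continuous fun t : ℝ => x + √t • v := by fun_prop
        have h' := (this.tendsto 0).mono_left (nhdsWithin_le_nhds (s := Ioi 0))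
        simpa using h'
      have hg : Tendsto (fun t : ℝ => gauge x (x + √t • v)) (𝓝[>] 0) (𝓝 1) := by
        have := ((continuous_gauge x).tendsto x).comp hpath
        rwa [show gauge x x = 1 by simp [gauge]] at this
      have hr : Tendsto (fun t : ℝ => t / Real.sinh t * (4 * Real.pi)⁻¹
          * Real.exp (-(t / Real.sinh t * Real.cosh t) * (v.1 ^ 2 + v.2 ^ 2) / 4)) (𝓝[>] 0)
          (𝓝 (1 * (4 * Real.pi)⁻¹ * Real.exp (-(1 * 1) * (v.1 ^ 2 + v.2 ^ 2) / 4))) := by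
        have hcosh : Tendsto Real.cosh (𝓝[>] 0) (𝓝 1) := by
          have := (Real.continuous_cosh.tendsto 0).mono_left (nhdsWithin_le_nhds (s := Ioi 0))
          rwa [Real.cosh_zero] at this
        exact (tendsto_div_sinh.mul_const _).mul ((Real.continuous_exp.tendsto _).comp
          ((((tendsto_div_sinh.mul hcosh).neg).mul_const _).div_const 4))
      have hc := ((Complex.continuous_ofReal.tendsto _).comp hr).mul
        (hg.mul (hΦx.comp hpath))
      have elim : ((1 * (4 * Real.pi)⁻¹ * Real.exp (-(1 * 1) * (v.1 ^ 2 + v.2 ^ 2) / 4) : ℝ) : ℂ)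
          * (1 * Ψ x) = (((4 * Real.pi)⁻¹ * Real.exp (-(v.1 ^ 2 + v.2 ^ 2) / 4) : ℝ) : ℂ) * Ψ x := by
        rw [one_mul, one_mul, one_mul]
        congr 4
        ring
      rw [← elim]
      refine hc.congr' ?_
      filter_upwards [self_mem_nhdsWithin] with t (ht : 0 < t)
      simp only [Function.comp_apply, heatKernel]
      rw [hdist t v ht, mehler_ofReal]
      have hs : Real.sinh t ≠ 0 := (Real.sinh_pos_iff.2 ht).ne'
      have e1 : t / Real.sinh t * (4 * Real.pi)⁻¹
          * Real.exp (-(t / Real.sinh t * Real.cosh t) * (v.1 ^ 2 + v.2 ^ 2) / 4)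
          = t * ((4 * Real.pi * Real.sinh t)⁻¹
            * Real.exp (-(Real.cosh t / Real.sinh t) * (t * (v.1 ^ 2 + v.2 ^ 2)) / 4)) := by
        rw [show -(t / Real.sinh t * Real.cosh t) * (v.1 ^ 2 + v.2 ^ 2) / 4
          = -(Real.cosh t / Real.sinh t) * (t * (v.1 ^ 2 + v.2 ^ 2)) / 4 by ring, mul_inv]
        ring
      rw [e1, Complex.ofReal_mul]
      ring
  rw [integral_mul_const, integral_complex_ofReal, integral_gaussian_plane, Complex.ofReal_one,
    one_mul] at key
  refine key.congr' ?_
  filter_upwards [self_mem_nhdsWithin] with t (ht : 0 < t)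
  exact (step t ht).symm

/-! ### Integrals of the majorant -/

/-- The singular factor of the majorant, with an exponential weight. -/
def singFactor (c a : ℝ) : ℝ := |a| ^ (-(1 / 2) : ℝ) * Real.exp (-a ^ 2 / 16) * Real.exp (c * |a|)

/-- The regular factor of the majorant, with an exponential weight. -/
def gaussFactor (c b : ℝ) : ℝ := Real.exp (-b ^ 2 / 16) * Real.exp (c * |b|)

lemma singFactor_nonneg (c a : ℝ) : 0 ≤ singFactor c a := by unfold singFactor; positivity

lemma gaussFactor_nonneg (c b : ℝ) : 0 ≤ gaussFactor c b := by unfold gaussFactor; positivity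

lemma measurable_singFactor (c : ℝ) : Measurable (singFactor c) := by unfold singFactor; fun_prop

lemma measurable_gaussFactor (c : ℝ) : Measurable (gaussFactor c) := by unfold gaussFactor; fun_prop

lemma majorant_mul_exp (c d a b : ℝ) :
    majorant a b * (Real.exp (c * |a|) * Real.exp (d * |b|)) = singFactor c a * gaussFactor d b := by
  unfold majorant singFactor gaussFactor; ring

lemma majorant_eq (a b : ℝ) : majorant a b = singFactor 0 a * gaussFactor 0 b := by
  simp [majorant, singFactor, gaussFactor]

/-- Completing the square, `c|b| ≤ 8c² + b²/32`: half of the Gaussian absorbs any exponential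
weight. -/
lemma gaussFactor_le (c b : ℝ) :
    gaussFactor c b ≤ Real.exp (8 * c ^ 2) * Real.exp (-(1 / 32) * b ^ 2) := by
  rw [gaussFactor, ← Real.exp_add, ← Real.exp_add]
  refine Real.exp_le_exp.2 ?_
  nlinarith [sq_nonneg (|b| - 16 * c), sq_abs b]

lemma integrable_of_even {f : ℝ → ℝ} (hf : ∀ a, f (-a) = f a) (hi : IntegrableOn f (Ioi 0)) :
    Integrable f := by
  have h2 : IntegrableOn f (Iic 0) := by
    rw [← Measure.map_neg_eq_self (volume : Measure ℝ)]
    let m : MeasurableEmbedding fun x : ℝ => -x := (Homeomorph.neg ℝ).measurableEmbedding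
    rw [m.integrableOn_map_iff]
    have : f ∘ (fun x => -x) = f := funext hf
    rw [this, neg_preimage, neg_Iic, neg_zero]
    exact (integrableOn_Ici_iff_integrableOn_Ioi (by simp)).2 hi
  rw [← integrableOn_univ, ← Iic_union_Ioi (a := (0 : ℝ))]
  exact h2.union hi

lemma integrable_gaussFactor (c : ℝ) : Integrable (gaussFactor c) := by
  refine ((integrable_exp_neg_mul_sq (b := 1 / 32) (by norm_num)).const_mul
    (Real.exp (8 * c ^ 2))).mono' (measurable_gaussFactor c).aestronglyMeasurable
    (Eventually.of_forall fun b => ?_)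
  rw [Real.norm_of_nonneg (gaussFactor_nonneg c b)]
  exact gaussFactor_le c b

lemma integrable_singFactor (c : ℝ) : Integrable (singFactor c) := by
  refine integrable_of_even (fun a => by simp [singFactor]) ?_
  have h := (integrableOn_rpow_mul_exp_neg_mul_sq (b := 1 / 32) (by norm_num)
    (s := -(1 / 2)) (by norm_num)).const_mul (Real.exp (8 * c ^ 2))
  refine Integrable.mono' h (measurable_singFactor c).aestronglyMeasurable ?_
  filter_upwards [self_mem_ae_restrict measurableSet_Ioi] with a (ha : 0 < a)
  rw [Real.norm_of_nonneg (singFactor_nonneg c a), singFactor, mul_assoc]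
  have h1 := gaussFactor_le c a
  rw [gaussFactor] at h1
  rw [abs_of_pos ha] at h1 ⊢
  have h2 : 0 ≤ a ^ (-(1 / 2) : ℝ) := by positivity
  calc _ ≤ a ^ (-(1 / 2) : ℝ) * (Real.exp (8 * c ^ 2) * Real.exp (-(1 / 32) * a ^ 2)) := by gcongr
    _ = _ := by ring

/-- `∫ |a|^{-1/2} exp (-a²/16 + c|a|) da`. -/
def singInt (c : ℝ) : ℝ≥0∞ := ∫⁻ a, ENNReal.ofReal (singFactor c a)

/-- `∫ exp (-b²/16 + c|b|) db`. -/
def gaussInt (c : ℝ) : ℝ≥0∞ := ∫⁻ b, ENNReal.ofReal (gaussFactor c b)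

lemma singInt_lt_top (c : ℝ) : singInt c < ⊤ := by
  have := (integrable_singFactor c).lintegral_lt_top
  exact this

lemma gaussInt_lt_top (c : ℝ) : gaussInt c < ⊤ := by
  have := (integrable_gaussFactor c).lintegral_lt_top
  exact this

/-- The majorant as a kernel on the plane. -/
def majKernel (x y : ℝ × ℝ) : ℝ := majorant (x.1 - y.1) (x.2 - y.2)

lemma majKernel_nonneg (x y : ℝ × ℝ) : 0 ≤ majKernel x y := majorant_nonneg _ _

lemma measurable_majKernel : Measurable (fun q : (ℝ × ℝ) × (ℝ × ℝ) => majKernel q.1 q.2) := by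
  unfold majKernel majorant; fun_prop

lemma majKernel_comm (x y : ℝ × ℝ) : majKernel x y = majKernel y x := by
  simp only [majKernel, majorant]
  rw [abs_sub_comm, show (x.1 - y.1) ^ 2 = (y.1 - x.1) ^ 2 by ring,
    show (x.2 - y.2) ^ 2 = (y.2 - x.2) ^ 2 by ring]

lemma vol_le : vol ≤ volume := Measure.restrict_le_self

lemma lintegral_majKernel_weighted (c d : ℝ) (y : ℝ × ℝ) :
    ∫⁻ x, ENNReal.ofReal (majKernel x y * (Real.exp (c * |x.1 - y.1|) * Real.exp (d * |x.2 - y.2|)))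
      ∂vol ≤ singInt c * gaussInt d := by
  refine (lintegral_mono' vol_le le_rfl).trans (le_of_eq ?_)
  simp_rw [majKernel, majorant_mul_exp, ENNReal.ofReal_mul (singFactor_nonneg _ _)]
  rw [Measure.volume_eq_prod, lintegral_prod_mul (f := fun a => ENNReal.ofReal (singFactor c (a - y.1)))
    (g := fun b => ENNReal.ofReal (gaussFactor d (b - y.2)))
    ((measurable_singFactor c).comp (by fun_prop)).ennreal_ofReal.aemeasurable
    ((measurable_gaussFactor d).comp (by fun_prop)).ennreal_ofReal.aemeasurable,
    lintegral_sub_right_eq_self (fun a => ENNReal.ofReal (singFactor c a)),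
    lintegral_sub_right_eq_self (fun a => ENNReal.ofReal (gaussFactor d a))]
  rfl

lemma lintegral_majKernel (x : ℝ × ℝ) :
    ∫⁻ y, ENNReal.ofReal (majKernel x y) ∂vol ≤ singInt 0 * gaussInt 0 := by
  have := lintegral_majKernel_weighted 0 0 x
  simp only [zero_mul, Real.exp_zero, mul_one] at this
  simpa only [majKernel_comm] using this

/-- Integration over the boundary line involves only the first variable. The singularity is placed
there and is only `|a|^{-1/2}`, so the bound is uniform in the distance to the boundary. -/
lemma lintegral_majKernel_boundary (x : ℝ × ℝ) :
    ∫⁻ s, ENNReal.ofReal (majKernel x (s, 0)) ≤ singInt 0 := by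
  have h : ∀ s, ENNReal.ofReal (majKernel x (s, 0)) ≤ ENNReal.ofReal (singFactor 0 (x.1 - s)) := by
    intro s
    refine ENNReal.ofReal_le_ofReal ?_
    rw [majKernel, majorant_eq]
    refine mul_le_of_le_one_right (singFactor_nonneg _ _) ?_
    simp only [gaussFactor, zero_mul, Real.exp_zero, mul_one, Real.exp_le_one_iff]
    nlinarith [sq_nonneg (x.2 - (s, (0 : ℝ)).2)]
  refine (lintegral_mono h).trans (le_of_eq ?_)
  exact lintegral_sub_left_eq_self (fun a => ENNReal.ofReal (singFactor 0 a)) x.1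

lemma integrable_majKernel (x : ℝ × ℝ) : Integrable (majKernel x) vol := by
  refine ⟨(measurable_majKernel.comp (by fun_prop : Measurable fun y : ℝ × ℝ =>
    (x, y))).aestronglyMeasurable, ?_⟩
  rw [hasFiniteIntegral_iff_ofReal (Eventually.of_forall fun y => majKernel_nonneg x y)]
  exact (lintegral_majKernel x).trans_lt
    (ENNReal.mul_lt_top (singInt_lt_top 0) (gaussInt_lt_top 0))

lemma integrable_majKernel_boundary (x : ℝ × ℝ) : Integrable (fun s => majKernel x (s, 0)) := by
  refine ⟨(measurable_majKernel.comp (by fun_prop : Measurable fun s : ℝ =>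
    (x, ((s, 0) : ℝ × ℝ)))).aestronglyMeasurable, ?_⟩
  rw [hasFiniteIntegral_iff_ofReal (Eventually.of_forall fun y => majKernel_nonneg x _)]
  exact (lintegral_majKernel_boundary x).trans_lt (singInt_lt_top 0)

/-! ### Schur estimates -/

/-- Cauchy–Schwarz for the measure with density `k`, applied to the functions `1` and `f`. -/
lemma lintegral_mul_sq_le {α : Type*} [MeasurableSpace α] {η : Measure α} {k f : α → ℝ≥0∞}
    (hk : Measurable k) (hf : Measurable f) :
    (∫⁻ a, k a * f a ∂η) ^ 2 ≤ (∫⁻ a, k a ∂η) * ∫⁻ a, k a * f a ^ 2 ∂η := by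
  have h := ENNReal.lintegral_mul_le_Lp_mul_Lq (μ := η.withDensity k) Real.HolderConjugate.two_two
    (f := fun _ => 1) (g := f) aemeasurable_const hf.aemeasurable
  simp only [Pi.mul_apply, one_mul, ENNReal.one_rpow] at h
  rw [lintegral_withDensity_eq_lintegral_mul _ hk hf,
    lintegral_withDensity_eq_lintegral_mul _ hk measurable_const,
    lintegral_withDensity_eq_lintegral_mul _ hk (hf.pow_const _)] at h
  simp only [Pi.mul_apply, mul_one] at h
  calc (∫⁻ a, k a * f a ∂η) ^ 2
      ≤ ((∫⁻ a, k a ∂η) ^ (1 / 2 : ℝ) * (∫⁻ a, k a * f a ^ (2 : ℝ) ∂η) ^ (1 / 2 : ℝ)) ^ 2 := by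
        gcongr
    _ = _ := by
        rw [mul_pow, ← ENNReal.rpow_natCast, ← ENNReal.rpow_natCast, ← ENNReal.rpow_mul,
          ← ENNReal.rpow_mul]
        norm_num

/-- Schur's test for a nonnegative kernel between weighted `L²` spaces. -/
lemma schur_test {α β : Type*} [MeasurableSpace α] [MeasurableSpace β] {ν : Measure α}
    {η : Measure β} [SFinite ν] [SFinite η] {k : α → β → ℝ≥0∞} (hk : Measurable (Function.uncurry k))
    {w : α → ℝ≥0∞} (hw : Measurable w) {w' f : β → ℝ≥0∞} (hw' : Measurable w')
    (hf : Measurable f) {A B : ℝ≥0∞}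
    (hA : ∀ x, ∫⁻ y, k x y ∂η ≤ A) (hB : ∀ᵐ y ∂η, ∫⁻ x, w x * k x y ∂ν ≤ B * w' y) :
    ∫⁻ x, w x * (∫⁻ y, k x y * f y ∂η) ^ 2 ∂ν ≤ A * B * ∫⁻ y, w' y * f y ^ 2 ∂η := by
  have hkx : ∀ x, Measurable (k x) := fun x => hk.comp measurable_prodMk_left
  have hky : ∀ y, Measurable fun x => k x y := fun y => hk.comp measurable_prodMk_right
  have hkf : Measurable (Function.uncurry fun x y => k x y * f y ^ 2) :=
    hk.mul ((hf.comp measurable_snd).pow_const 2)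
  have hwk : Measurable fun x => w x * ∫⁻ y, k x y * f y ^ 2 ∂η := hw.mul hkf.lintegral_prod_right
  have hwky : ∀ y, Measurable fun x => w x * k x y := fun y => hw.mul (hky y)
  have hkxf : ∀ x, Measurable fun y => k x y * f y ^ 2 := fun x => (hkx x).mul (hf.pow_const 2)
  have hwf : Measurable fun y => w' y * f y ^ 2 := hw'.mul (hf.pow_const 2)
  calc ∫⁻ x, w x * (∫⁻ y, k x y * f y ∂η) ^ 2 ∂ν
      ≤ ∫⁻ x, A * (w x * ∫⁻ y, k x y * f y ^ 2 ∂η) ∂ν := by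
        refine lintegral_mono fun x => ?_
        calc _ ≤ w x * ((∫⁻ y, k x y ∂η) * ∫⁻ y, k x y * f y ^ 2 ∂η) := by
              gcongr; exact lintegral_mul_sq_le (hkx x) hf
          _ ≤ w x * (A * ∫⁻ y, k x y * f y ^ 2 ∂η) := by gcongr; exact hA x
          _ = _ := by ring
    _ = A * ∫⁻ x, ∫⁻ y, w x * (k x y * f y ^ 2) ∂η ∂ν := by
        rw [lintegral_const_mul _ hwk]
        congr 2 with x
        rw [lintegral_const_mul _ (hkxf x)]
    _ = A * ∫⁻ y, ∫⁻ x, w x * (k x y * f y ^ 2) ∂ν ∂η := by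
        rw [lintegral_lintegral_swap]
        exact ((hw.comp measurable_fst).mul hkf).aemeasurable
    _ ≤ A * ∫⁻ y, B * (w' y * f y ^ 2) ∂η := by
        gcongr 1
        refine lintegral_mono_ae ?_
        filter_upwards [hB] with y hy
        calc ∫⁻ x, w x * (k x y * f y ^ 2) ∂ν = (∫⁻ x, w x * k x y ∂ν) * f y ^ 2 := by
              rw [← lintegral_mul_const _ (hwky y)]
              simp_rw [mul_assoc]
          _ ≤ B * w' y * f y ^ 2 := by gcongr
          _ = _ := by ring
    _ = _ := by rw [lintegral_const_mul _ hwf, mul_assoc]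

lemma measurable_majKernel_ofReal : Measurable (Function.uncurry fun x y : ℝ × ℝ =>
    ENNReal.ofReal (majKernel x y)) :=
  measurable_majKernel.ennreal_ofReal

/-- The kernel `majKernel` is bounded on weighted `L²` spaces over the half-plane. -/
lemma schur_halfPlane {c : ℝ} {w f : ℝ × ℝ → ℝ≥0∞} (hw : Measurable w) (hf : Measurable f)
    (hc : ∀ x y, 0 < x.2 → 0 < y.2 →
      w x ≤ ENNReal.ofReal (Real.exp (c * |x.1 - y.1|) * Real.exp (c * |x.2 - y.2|)) * w y) :
    ∫⁻ x, w x * (∫⁻ y, ENNReal.ofReal (majKernel x y) * f y ∂vol) ^ 2 ∂vol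
      ≤ singInt 0 * gaussInt 0 * (singInt c * gaussInt c) * ∫⁻ y, w y * f y ^ 2 ∂vol := by
  refine schur_test measurable_majKernel_ofReal hw hw hf lintegral_majKernel ?_
  filter_upwards [ae_vol_pos] with y hy
  calc ∫⁻ x, w x * ENNReal.ofReal (majKernel x y) ∂vol
      ≤ ∫⁻ x, ENNReal.ofReal (majKernel x y * (Real.exp (c * |x.1 - y.1|)
          * Real.exp (c * |x.2 - y.2|))) * w y ∂vol := by
        refine lintegral_mono_ae ?_
        filter_upwards [ae_vol_pos] with x hx
        rw [ENNReal.ofReal_mul (majKernel_nonneg x y)]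
        calc _ ≤ ENNReal.ofReal (Real.exp (c * |x.1 - y.1|) * Real.exp (c * |x.2 - y.2|)) * w y
              * ENNReal.ofReal (majKernel x y) := by gcongr; exact hc x y hx hy
          _ = _ := by ring
    _ ≤ singInt c * gaussInt c * w y := by
        have hm : Measurable fun x : ℝ × ℝ => ENNReal.ofReal (majKernel x y
          * (Real.exp (c * |x.1 - y.1|) * Real.exp (c * |x.2 - y.2|))) :=
          Measurable.ennreal_ofReal (Measurable.mul (measurable_majKernel.comp
            (by fun_prop : Measurable fun x : ℝ × ℝ => (x, y))) (by fun_prop))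
        rw [lintegral_mul_const _ hm]
        gcongr
        exact lintegral_majKernel_weighted c c y

/-- The boundary-layer operator with kernel `majKernel` is bounded on weighted `L²` spaces, and
small far away from the boundary. -/
lemma schur_boundary {c R : ℝ} {w f : ℝ → ℝ≥0∞} (hw : Measurable w) (hf : Measurable f)
    (hc : ∀ a b, w a ≤ ENNReal.ofReal (Real.exp (c * |a - b|)) * w b) :
    ∫⁻ x, {p : ℝ × ℝ | R ≤ p.2}.indicator (fun p => w p.1) x
        * (∫⁻ s, ENNReal.ofReal (majKernel x (s, 0)) * f s) ^ 2 ∂vol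
      ≤ singInt 0 * (ENNReal.ofReal (Real.exp (-R)) * (singInt c * gaussInt 1))
        * ∫⁻ s, w s * f s ^ 2 := by
  have hmk : Measurable (Function.uncurry fun (x : ℝ × ℝ) (s : ℝ) =>
      ENNReal.ofReal (majKernel x (s, 0))) :=
    (measurable_majKernel.comp (by fun_prop : Measurable fun q : (ℝ × ℝ) × ℝ =>
      (q.1, ((q.2, 0) : ℝ × ℝ)))).ennreal_ofReal
  have hmw : Measurable ({p : ℝ × ℝ | R ≤ p.2}.indicator fun p => w p.1) :=
    (hw.comp measurable_fst).indicator (measurableSet_le measurable_const measurable_snd)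
  refine schur_test hmk hmw hw hf lintegral_majKernel_boundary ?_
  refine Eventually.of_forall fun s => ?_
  calc ∫⁻ x, {p : ℝ × ℝ | R ≤ p.2}.indicator (fun p => w p.1) x
        * ENNReal.ofReal (majKernel x (s, 0)) ∂vol
      ≤ ∫⁻ x, ENNReal.ofReal (Real.exp (-R)) * (ENNReal.ofReal (majKernel x (s, 0)
          * (Real.exp (c * |x.1 - s|) * Real.exp (1 * |x.2 - 0|))) * w s) ∂vol := by
        refine lintegral_mono_ae ?_
        filter_upwards [ae_vol_pos] with x hx
        by_cases hR : R ≤ x.2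
        · rw [indicator_of_mem (by exact hR), one_mul, sub_zero, abs_of_pos hx]
          -- On `{μ ≥ R}` the factor `e^{μ - R}` is at least one. Inserting it yields the decay
          -- `e^{-R}`; the Gaussian in `μ` pays for `e^{μ}`, whence `gaussInt 1`.
          have h1 : Real.exp (c * |x.1 - s|)
              ≤ Real.exp (-R) * (Real.exp (c * |x.1 - s|) * Real.exp x.2) := by
            rw [← Real.exp_add, ← Real.exp_add]
            exact Real.exp_le_exp.2 (by linarith)
          calc w x.1 * ENNReal.ofReal (majKernel x (s, 0))
              ≤ ENNReal.ofReal (Real.exp (-R) * (Real.exp (c * |x.1 - s|) * Real.exp x.2)) * w s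
                * ENNReal.ofReal (majKernel x (s, 0)) := by
                gcongr
                exact (hc x.1 s).trans (by gcongr)
            _ = _ := by
                rw [ENNReal.ofReal_mul (Real.exp_nonneg _), ENNReal.ofReal_mul (majKernel_nonneg _ _)]
                ring
        · rw [indicator_of_notMem (by exact hR), zero_mul]
          exact zero_le
    _ ≤ ENNReal.ofReal (Real.exp (-R)) * (singInt c * gaussInt 1) * w s := by
        have hm : Measurable fun x : ℝ × ℝ => ENNReal.ofReal (majKernel x (s, 0)
          * (Real.exp (c * |x.1 - s|) * Real.exp (1 * |x.2 - 0|))) :=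
          Measurable.ennreal_ofReal (Measurable.mul (measurable_majKernel.comp
            (by fun_prop : Measurable fun x : ℝ × ℝ => (x, ((s, 0) : ℝ × ℝ)))) (by fun_prop))
        rw [lintegral_const_mul _ (hm.mul_const _), lintegral_mul_const _ hm, mul_assoc]
        gcongr
        exact lintegral_majKernel_weighted c 1 (s, 0)

/-! ### The resolvent kernel of the plane and the representation formula -/

/-- The radial part of the kernel of `(H - λ)⁻¹` on the plane. -/
def greenRadial (lam ρ : ℝ) : ℂ :=
  (∫ t in Ioc (0 : ℝ) 1, Complex.exp (lam * t) * mehler t ρ)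
    + Complex.I / (1 + Complex.exp (Complex.I * Real.pi * lam))
      * ∫ s in Ioc (0 : ℝ) Real.pi,
          Complex.exp (lam * (1 + Complex.I * s)) * mehler (1 + Complex.I * s) ρ

/-- The kernel of `(H - λ)⁻¹` on the plane. -/
def greenFn (lam : ℝ) (x y : ℝ × ℝ) : ℂ := greenRadial lam (distSq x y) * gauge x y

lemma measurable_mehler : Measurable (Function.uncurry mehler) := by
  unfold mehler Function.uncurry; fun_prop

lemma measurable_segment (lam : ℝ) : Measurable (fun q : ℝ × ℝ =>
    Complex.exp (lam * q.1) * mehler q.1 q.2) := by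
  have h1 : Measurable fun q : ℝ × ℝ => ((q.1 : ℂ), q.2) := by fun_prop
  have h2 : Measurable fun q : ℝ × ℝ => Complex.exp (lam * q.1) := by fun_prop
  have h3 := measurable_mehler.comp h1
  exact Measurable.mul h2 h3

lemma measurable_vertical (lam : ℝ) : Measurable (fun q : ℝ × ℝ =>
    Complex.exp (lam * (1 + Complex.I * q.1)) * mehler (1 + Complex.I * q.1) q.2) := by
  have h1 : Measurable fun q : ℝ × ℝ => (1 + Complex.I * (q.1 : ℂ), q.2) := by fun_prop
  have h2 : Measurable fun q : ℝ × ℝ => Complex.exp (lam * (1 + Complex.I * q.1)) := by fun_prop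
  have h3 := measurable_mehler.comp h1
  exact Measurable.mul h2 h3

lemma norm_segment_le (lam : ℝ) {t a b : ℝ} (ht : t ∈ Ioc (0 : ℝ) 1) (ha : a ≠ 0) :
    ‖Complex.exp (lam * t) * mehler t (a ^ 2 + b ^ 2)‖
      ≤ Real.exp |lam| * t ^ (-(3 / 4) : ℝ) * majorant a b := by
  rw [norm_mul, mul_assoc]
  refine mul_le_mul ?_ (norm_mehler_le_majorant ht.1 ht.2 ha) (norm_nonneg _) (Real.exp_nonneg _)
  rw [Complex.norm_exp, ← Complex.ofReal_mul, Complex.ofReal_re]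
  refine Real.exp_le_exp.2 ?_
  calc lam * t ≤ |lam| * t := by gcongr; exact ht.1.le; exact le_abs_self lam
    _ ≤ |lam| * 1 := by gcongr; exact ht.2
    _ = |lam| := mul_one _

lemma norm_vertical_le (lam : ℝ) {s a b : ℝ} (ha : a ≠ 0) :
    ‖Complex.exp (lam * (1 + Complex.I * s)) * mehler (1 + Complex.I * s) (a ^ 2 + b ^ 2)‖
      ≤ Real.exp |lam| * 2 * majorant a b := by
  rw [norm_mul, mul_assoc]
  refine mul_le_mul ?_ (norm_mehler_vertical_le ha s) (norm_nonneg _) (Real.exp_nonneg _)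
  rw [Complex.norm_exp]
  refine Real.exp_le_exp.2 ?_
  simp only [Complex.mul_re, Complex.ofReal_re, Complex.add_re, Complex.one_re, Complex.I_re,
    zero_mul, Complex.I_im, Complex.ofReal_im, mul_zero, sub_self, add_zero, mul_one, sub_zero]
  exact le_abs_self lam

lemma integrableOn_rpow_Ioc : IntegrableOn (fun t : ℝ => t ^ (-(3 / 4) : ℝ)) (Ioc 0 1) :=
  (intervalIntegrable_iff_integrableOn_Ioc_of_le zero_le_one).1
    (intervalIntegral.intervalIntegrable_rpow' (by norm_num))

lemma integral_rpow_Ioc : ∫ t in Ioc (0 : ℝ) 1, t ^ (-(3 / 4) : ℝ) = 4 := by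
  rw [← intervalIntegral.integral_of_le zero_le_one, integral_rpow (Or.inl (by norm_num))]
  norm_num

lemma measurable_greenRadial (lam : ℝ) : Measurable (greenRadial lam) := by
  refine Measurable.add ?_ (Measurable.const_mul ?_ _)
  · exact (measurable_segment lam).stronglyMeasurable.integral_prod_left'.measurable
  · exact (measurable_vertical lam).stronglyMeasurable.integral_prod_left'.measurable

/-- The constant in the bound for the resolvent kernel. -/
def greenConst (lam : ℝ) : ℝ :=
  Real.exp |lam| * (4 + ‖1 + Complex.exp (Complex.I * Real.pi * lam)‖⁻¹ * (2 * Real.pi))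

lemma norm_greenRadial_le (lam : ℝ) {a b : ℝ} (ha : a ≠ 0) :
    ‖greenRadial lam (a ^ 2 + b ^ 2)‖ ≤ greenConst lam * majorant a b := by
  have h1 : ‖∫ t in Ioc (0 : ℝ) 1, Complex.exp (lam * t) * mehler t (a ^ 2 + b ^ 2)‖
      ≤ Real.exp |lam| * 4 * majorant a b := by
    refine (norm_integral_le_of_norm_le ((integrableOn_rpow_Ioc.const_mul
      (Real.exp |lam|)).mul_const (majorant a b)) ?_).trans (le_of_eq ?_)
    · filter_upwards [self_mem_ae_restrict measurableSet_Ioc] with t ht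
      exact norm_segment_le lam ht ha
    · rw [integral_mul_const, integral_const_mul, integral_rpow_Ioc]
  have h2 : ‖∫ s in Ioc (0 : ℝ) Real.pi, Complex.exp (lam * (1 + Complex.I * s))
      * mehler (1 + Complex.I * s) (a ^ 2 + b ^ 2)‖
      ≤ Real.exp |lam| * 2 * majorant a b * Real.pi := by
    have := norm_setIntegral_le_of_norm_le_const (s := Ioc (0 : ℝ) Real.pi) (μ := volume)
      (f := fun s : ℝ => Complex.exp (lam * (1 + Complex.I * s))
        * mehler (1 + Complex.I * s) (a ^ 2 + b ^ 2)) (by simp)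
      (fun s _ => norm_vertical_le lam (b := b) (s := s) ha)
    simpa [Measure.real, Real.pi_pos.le] using this
  rw [greenRadial]
  refine (norm_add_le _ _).trans ?_
  rw [norm_mul, norm_div, Complex.norm_I, one_div]
  calc _ ≤ Real.exp |lam| * 4 * majorant a b
        + ‖1 + Complex.exp (Complex.I * Real.pi * lam)‖⁻¹
          * (Real.exp |lam| * 2 * majorant a b * Real.pi) := by gcongr
    _ = _ := by unfold greenConst; ring

lemma greenConst_nonneg (lam : ℝ) : 0 ≤ greenConst lam := by
  unfold greenConst; have := Real.pi_pos; positivity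

lemma norm_greenFn_le (lam : ℝ) {x y : ℝ × ℝ} (h : x.1 ≠ y.1) :
    ‖greenFn lam x y‖ ≤ greenConst lam * majKernel x y := by
  rw [greenFn, norm_mul, norm_gauge, mul_one]
  exact norm_greenRadial_le lam (sub_ne_zero.2 h)

/-- Fubini for time and space, with an abstract position map so that one proof serves both the
half-plane and the boundary line. The pointwise bound may fail where `x` and the source point have
equal first coordinates, a null set. -/
lemma integral_kernel_swap {Y : Type*} [MeasurableSpace Y] {η : Measure Y} [SFinite η]
    {A : ℝ → ℝ → ℂ} (hA : Measurable (Function.uncurry A)) {β : ℝ → ℝ} {I : Set ℝ}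
    (hI : MeasurableSet I) (hβ : IntegrableOn β I) (x : ℝ × ℝ) {pos : Y → ℝ × ℝ}
    (hpos : Measurable pos) {v : Y → ℂ} (hv : Measurable v)
    (hint : Integrable (fun y => majKernel x (pos y) * ‖v y‖) η)
    (hbd : ∀ t ∈ I, ∀ a b, a ≠ 0 → ‖A t (a ^ 2 + b ^ 2)‖ ≤ β t * majorant a b)
    (hne : ∀ᵐ y ∂η, x.1 ≠ (pos y).1) :
    Integrable (fun t => ∫ y, A t (distSq x (pos y)) * gauge x (pos y) * v y ∂η)
        (volume.restrict I) ∧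
      Integrable (fun y => (∫ t in I, A t (distSq x (pos y))) * gauge x (pos y) * v y) η ∧
      ∫ t in I, ∫ y, A t (distSq x (pos y)) * gauge x (pos y) * v y ∂η
        = ∫ y, (∫ t in I, A t (distSq x (pos y))) * gauge x (pos y) * v y ∂η := by
  have hmeas : Measurable (Function.uncurry fun t y =>
      A t (distSq x (pos y)) * gauge x (pos y) * v y) := by
    refine ((hA.comp (measurable_fst.prodMk ?_)).mul ?_).mul (hv.comp measurable_snd)
    · have : Measurable (distSq x) := by unfold distSq; fun_prop
      exact this.comp (hpos.comp measurable_snd)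
    · exact (continuous_gauge x).measurable.comp (hpos.comp measurable_snd)
  have hi : Integrable (Function.uncurry fun t y =>
      A t (distSq x (pos y)) * gauge x (pos y) * v y) ((volume.restrict I).prod η) := by
    refine (hβ.mul_prod hint).mono' hmeas.aestronglyMeasurable ?_
    have h1 : ∀ᵐ q ∂((volume.restrict I).prod η), q.1 ∈ I :=
      Measure.quasiMeasurePreserving_fst.ae (self_mem_ae_restrict hI)
    have h2 : ∀ᵐ q ∂((volume.restrict I).prod η), x.1 ≠ (pos q.2).1 :=
      Measure.quasiMeasurePreserving_snd.ae hne
    filter_upwards [h1, h2] with q hq1 hq2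
    simp only [Function.uncurry, norm_mul, norm_gauge, mul_one]
    rw [← mul_assoc]
    gcongr
    exact hbd q.1 hq1 _ _ (sub_ne_zero.2 hq2)
  refine ⟨hi.integral_prod_left, ?_, ?_⟩
  · refine hi.integral_prod_right.congr (Eventually.of_forall fun y => ?_)
    simp only [Function.uncurry, integral_mul_const]
  · rw [integral_integral_swap hi]
    simp only [integral_mul_const]

/-- `sinh` and `cosh` both change sign, so `coth` is unchanged and the prefactor flips. Formally
`e^{-iπH} = -1`, since the spectrum of the plane operator consists of odd integers. -/
lemma mehler_one_add_pi (ρ : ℝ) : mehler (1 + Complex.I * Real.pi) ρ = - mehler 1 ρ := by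
  have h1 : Complex.sinh (1 + Complex.I * Real.pi) = - Complex.sinh 1 := by
    rw [sinh_one_add]; simp
  have h2 : Complex.cosh (1 + Complex.I * Real.pi) = - Complex.cosh 1 := by
    rw [cosh_one_add]; simp
  rw [mehler, mehler, h1, h2, neg_div_neg_eq, mul_neg, inv_neg, neg_mul]

/-- Turns the time integral of `heatSource` into potentials with time-integrated kernels; it is
applied to the real segment and to the vertical one. -/
lemma integral_heatSource {Ψ : ℝ × ℝ → ℂ} (h : IsDirichlet Ψ) (lam : ℝ) (x : ℝ × ℝ)
    {z : ℝ → ℂ} (hz : Measurable fun q : ℝ × ℝ => Complex.exp (lam * z q.1) * mehler (z q.1) q.2)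
    {β : ℝ → ℝ} {I : Set ℝ} (hI : MeasurableSet I) (hβ : IntegrableOn β I)
    (hbd : ∀ t ∈ I, ∀ a b, a ≠ 0 →
      ‖Complex.exp (lam * z t) * mehler (z t) (a ^ 2 + b ^ 2)‖ ≤ β t * majorant a b) :
    IntegrableOn (fun t => Complex.exp (lam * z t) * heatSource lam Ψ x (z t)) I ∧
    Integrable (fun y => (∫ t in I, Complex.exp (lam * z t) * mehler (z t) (distSq x y))
      * gauge x y * resid lam Ψ y) vol ∧
    Integrable (fun s => (∫ t in I, Complex.exp (lam * z t) * mehler (z t) (distSq x (s, 0)))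
      * gauge x (s, 0) * dMu Ψ (s, 0)) ∧
    ∫ t in I, Complex.exp (lam * z t) * heatSource lam Ψ x (z t)
      = (∫ y, (∫ t in I, Complex.exp (lam * z t) * mehler (z t) (distSq x y))
          * gauge x y * resid lam Ψ y ∂vol)
        - ∫ s, (∫ t in I, Complex.exp (lam * z t) * mehler (z t) (distSq x (s, 0)))
          * gauge x (s, 0) * dMu Ψ (s, 0) := by
  have kR := (contDiff_resid lam h.smooth).continuous
  have kP := (contDiff_dMu h.smooth).continuous
  have cR : HasCompactSupport (resid lam Ψ) := hasCompactSupport_of_tsupport h.compact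
    fun p hp => resid_eq_zero hp
  have cP : HasCompactSupport (dMu Ψ) := hasCompactSupport_of_tsupport h.compact
    fun p hp => dMu_eq_zero hp
  obtain ⟨B, hB⟩ := cR.exists_bound_of_continuous kR
  obtain ⟨B', hB'⟩ := cP.exists_bound_of_continuous kP
  have hB0 : 0 ≤ B := (norm_nonneg _).trans (hB x)
  have hB0' : 0 ≤ B' := (norm_nonneg _).trans (hB' x)
  have kP0 : Continuous fun s : ℝ => dMu Ψ (s, 0) := kP.comp (by fun_prop)
  have i1 : Integrable (fun y => majKernel x y * ‖resid lam Ψ y‖) vol := by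
    refine ((integrable_majKernel x).mul_const B).mono'
      ((integrable_majKernel x).aestronglyMeasurable.mul kR.norm.aestronglyMeasurable)
      (Eventually.of_forall fun y => ?_)
    rw [Real.norm_of_nonneg (mul_nonneg (majKernel_nonneg _ _) (norm_nonneg _))]
    exact mul_le_mul_of_nonneg_left (hB y) (majKernel_nonneg _ _)
  have i2 : Integrable (fun s : ℝ => majKernel x (s, 0) * ‖dMu Ψ (s, 0)‖) := by
    refine ((integrable_majKernel_boundary x).mul_const B').mono'
      ((integrable_majKernel_boundary x).aestronglyMeasurable.mul kP0.norm.aestronglyMeasurable)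
      (Eventually.of_forall fun y => ?_)
    rw [Real.norm_of_nonneg (mul_nonneg (majKernel_nonneg _ _) (norm_nonneg _))]
    exact mul_le_mul_of_nonneg_left (hB' _) (majKernel_nonneg _ _)
  have hne : ∀ᵐ s : ℝ, x.1 ≠ s := by
    have : ∀ᵐ s : ℝ, s ≠ x.1 := by simp [ae_iff]
    filter_upwards [this] with s hs using hs.symm
  have n1 : ∀ᵐ y ∂vol, x.1 ≠ y.1 := by
    rw [vol_eq_prod]
    exact Measure.quasiMeasurePreserving_fst.ae hne
  obtain ⟨a1, a2, a3⟩ := integral_kernel_swap (A := fun t ρ => Complex.exp (lam * z t)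
    * mehler (z t) ρ) hz hI hβ x (pos := fun y : ℝ × ℝ => y) measurable_id kR.measurable i1 hbd n1
  obtain ⟨b1, b2, b3⟩ := integral_kernel_swap (A := fun t ρ => Complex.exp (lam * z t)
    * mehler (z t) ρ) hz hI hβ x (pos := fun s : ℝ => ((s, 0) : ℝ × ℝ)) (by fun_prop)
    kP0.measurable i2 hbd hne
  have e : ∀ t, Complex.exp (lam * z t) * heatSource lam Ψ x (z t)
      = (∫ y, Complex.exp (lam * z t) * mehler (z t) (distSq x y) * gauge x y * resid lam Ψ y ∂vol)
        - ∫ s, Complex.exp (lam * z t) * mehler (z t) (distSq x (s, 0)) * gauge x (s, 0)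
          * dMu Ψ (s, 0) := by
    intro t
    rw [heatSource, mul_sub, ← integral_const_mul, ← integral_const_mul]
    simp only [heatKernel, mul_assoc]
  refine ⟨(a1.sub b1).congr (Eventually.of_forall fun t => (e t).symm), a2, b2, ?_⟩
  simp_rw [e]
  rw [integral_sub a1 b1, a3, b3]

/-- Green's representation of a function with Dirichlet condition by its source and its normal
derivative at the boundary. -/
theorem representation {Ψ : ℝ × ℝ → ℂ} (h : IsDirichlet Ψ) {lam : ℝ}
    (hl : 1 + Complex.exp (Complex.I * Real.pi * lam) ≠ 0) {x : ℝ × ℝ} (hx : 0 < x.2) :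
    Ψ x = (∫ y, greenFn lam x y * resid lam Ψ y ∂vol)
      - ∫ s, greenFn lam x (s, 0) * dMu Ψ (s, 0) := by
  obtain ⟨p1, p2, p3, p4⟩ := integral_heatSource h lam x (z := fun t => (t : ℂ))
    (measurable_segment lam) measurableSet_Ioc (integrableOn_rpow_Ioc.const_mul (Real.exp |lam|))
    fun t ht a b ha => norm_segment_le lam ht ha
  obtain ⟨q1, q2, q3, q4⟩ := integral_heatSource h lam x (z := fun s => 1 + Complex.I * s)
    (measurable_vertical lam) (measurableSet_Ioc (a := 0) (b := Real.pi))
    (integrableOn_const (C := Real.exp |lam| * 2) (by simp))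
    fun t _ a b ha => norm_vertical_le lam ha
  set P := ∫ t in Ioc (0 : ℝ) 1, Complex.exp (lam * t) * heatSource lam Ψ x t with hP
  set Q := ∫ s in Ioc (0 : ℝ) Real.pi, Complex.exp (lam * (1 + Complex.I * s))
    * heatSource lam Ψ x (1 + Complex.I * s) with hQ
  set E := Complex.exp (Complex.I * Real.pi * lam) with hE
  set I1 := ∫ y, heatKernel 1 x y * Ψ y ∂vol with hI1
  -- Along the vertical segment from `1` to `1 + iπ` antiperiodicity returns the initial integral
  -- with factor `-e^{iπλ}`. Solving for it is possible exactly when `1 + e^{iπλ} ≠ 0`, and this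
  -- replaces the divergent integral over times larger than `1`.
  have vert : Complex.exp lam * I1 = Complex.I / (1 + E) * Q := by
    have := heat_path h lam x (z₀ := 1) (d := Complex.I) (a := 0) (b := Real.pi) Real.pi_pos.le
      (fun t _ => sinh_one_add_ne_zero t)
    rw [intervalIntegral.integral_of_le Real.pi_pos.le, ← hQ] at this
    have hK : ∀ y, heatKernel (1 + Complex.I * Real.pi) x y * Ψ y = -(heatKernel 1 x y * Ψ y) :=
      fun y => by rw [heatKernel, mehler_one_add_pi, heatKernel]; ring
    simp_rw [hK] at this
    rw [integral_neg, show (lam : ℂ) * (1 + Complex.I * Real.pi)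
      = lam + Complex.I * Real.pi * lam by ring, Complex.exp_add, ← hE] at this
    simp only [Complex.ofReal_zero, mul_zero, add_zero, mul_one] at this
    rw [← hI1] at this
    field_simp
    linear_combination -this
  -- Duhamel's formula on `[ε, 1]`; as `ε → 0` the heat kernel reproduces `Ψ x`.
  have seg : Complex.exp lam * I1 - Ψ x = - P := by
    have hlim : Tendsto (fun ε : ℝ => Complex.exp lam * I1
        - Complex.exp (lam * ε) * ∫ y, heatKernel ε x y * Ψ y ∂vol) (𝓝[>] 0)
        (𝓝 (Complex.exp lam * I1 - 1 * Ψ x)) := by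
      refine tendsto_const_nhds.sub (Tendsto.mul ?_ (tendsto_heatKernel h hx))
      have : Continuous fun ε : ℝ => Complex.exp (lam * ε) := by fun_prop
      have h0 := (this.tendsto 0).mono_left (nhdsWithin_le_nhds (s := Ioi 0))
      simpa using h0
    have hlim2 : Tendsto (fun ε : ℝ => -∫ t in ε..1, Complex.exp (lam * t)
        * heatSource lam Ψ x t) (𝓝[>] 0) (𝓝 (-P)) := by
      refine Tendsto.neg ?_
      have hc := intervalIntegral.continuousOn_primitive_interval_left (a := 0) (b := 1)
        (f := fun t : ℝ => Complex.exp (lam * t) * heatSource lam Ψ x t) (μ := volume)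
        (by rw [uIcc_of_le zero_le_one]; exact (integrableOn_Icc_iff_integrableOn_Ioc (by simp)).2 p1)
      have h0 := (hc 0 left_mem_uIcc).tendsto
      rw [intervalIntegral.integral_of_le zero_le_one, ← hP, uIcc_of_le zero_le_one] at h0
      refine h0.mono_left (nhdsWithin_le_of_mem ?_)
      filter_upwards [Ioo_mem_nhdsGT (zero_lt_one' ℝ)] with t ht using ⟨ht.1.le, ht.2.le⟩
    refine (one_mul (Ψ x) ▸ tendsto_nhds_unique hlim (hlim2.congr' ?_))
    filter_upwards [Ioo_mem_nhdsGT (zero_lt_one' ℝ)] with ε hε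
    have := heat_path h lam x (z₀ := 0) (d := 1) (a := ε) (b := 1) hε.2.le (fun t ht => by
      rw [uIcc_of_le hε.2.le] at ht
      rw [zero_add, one_mul, ← Complex.ofReal_sinh, Complex.ofReal_ne_zero]
      exact (Real.sinh_pos_iff.2 (hε.1.trans_le ht.1)).ne')
    simp only [zero_add, one_mul, Complex.ofReal_one, mul_one, neg_mul] at this
    exact this.symm
  have split : ∀ y, greenFn lam x y
      = (∫ t in Ioc (0 : ℝ) 1, Complex.exp (lam * t) * mehler t (distSq x y)) * gauge x y
        + Complex.I / (1 + E) * ((∫ s in Ioc (0 : ℝ) Real.pi,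
          Complex.exp (lam * (1 + Complex.I * s)) * mehler (1 + Complex.I * s) (distSq x y))
          * gauge x y) := fun y => by rw [greenFn, greenRadial]; ring
  have e1 : ∫ y, greenFn lam x y * resid lam Ψ y ∂vol = _ :=
    (integral_congr_ae (Eventually.of_forall fun y => by
      simp only [split y, add_mul, mul_assoc (Complex.I / (1 + E))])).trans
      (integral_add p2 (q2.const_mul (Complex.I / (1 + E))))
  have e2 : ∫ s, greenFn lam x (s, 0) * dMu Ψ (s, 0) = _ :=
    (integral_congr_ae (Eventually.of_forall fun s => by
      simp only [split (s, 0), add_mul, mul_assoc (Complex.I / (1 + E))])).trans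
      (integral_add p3 (q3.const_mul (Complex.I / (1 + E))))
  rw [e1, e2, integral_const_mul, integral_const_mul]
  -- Eliminating the heat integral at time `1` between the two segments leaves the resolvent kernel.
  linear_combination vert - seg + p4 + Complex.I / (1 + E) * q4

/-- With `t` the distance to the lower edge of the gap the modulus is `2 sin(πt/2)`, and Jordan's
inequality gives `sin(πt/2) ≥ min(t, 2 - t) ≥ δ`. -/
lemma norm_one_add_exp_ge {N : ℕ} {δ lam : ℝ}
    (hlam : lam ∈ Ioo (2 * (N : ℝ) - 1) (2 * (N : ℝ) + 1)) (hN : 1 ≤ N)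
    (hd : δ ≤ Metric.infDist lam landauLevels) :
    δ ≤ ‖1 + Complex.exp (Complex.I * Real.pi * lam)‖ := by
  have hlev : ∀ j : ℕ, δ ≤ |lam - (2 * (j : ℝ) + 1)| := fun j =>
    hd.trans ((Metric.infDist_le_dist_of_mem
      (show 2 * (j : ℝ) + 1 ∈ landauLevels from ⟨j, rfl⟩)).trans (le_of_eq (Real.dist_eq _ _)))
  have h1 : δ ≤ lam - (2 * N - 1) := by
    -- The lower edge `2N - 1` is the Landau level with index `N - 1`; the subtraction of natural
    -- numbers is genuine because `1 ≤ N`.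
    have := hlev (N - 1)
    rw [Nat.cast_sub hN, abs_of_pos (by push_cast; linarith [hlam.1])] at this
    push_cast at this; linarith
  have h2 : δ ≤ 2 * N + 1 - lam := by
    have := hlev N
    rw [abs_of_neg (by linarith [hlam.2])] at this
    linarith
  set t := lam - (2 * N - 1) with ht
  have ht0 : 0 < t := by rw [ht]; linarith [hlam.1]
  have ht2 : t < 2 := by rw [ht]; linarith [hlam.2]
  have hexp : Complex.exp (Complex.I * Real.pi * lam) = - Complex.exp ((Real.pi * t : ℝ) * Complex.I) := by
    have : Complex.I * Real.pi * lam
        = (Real.pi * t : ℝ) * Complex.I + ((N : ℤ) * (2 * Real.pi * Complex.I) - Real.pi * Complex.I) := by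
      rw [ht]; push_cast; ring
    rw [this, Complex.exp_add, Complex.exp_sub, Complex.exp_int_mul_two_pi_mul_I,
      Complex.exp_pi_mul_I]
    ring
  have hsq : ‖1 + Complex.exp (Complex.I * Real.pi * lam)‖ ^ 2
      = (2 * Real.sin (Real.pi * t / 2)) ^ 2 := by
    rw [hexp, Complex.exp_mul_I, ← Complex.ofReal_cos, ← Complex.ofReal_sin, Complex.sq_norm,
      Complex.normSq_apply]
    simp only [Complex.add_re, Complex.one_re, Complex.neg_re, Complex.ofReal_re, Complex.mul_re,
      Complex.ofReal_im, Complex.I_re, Complex.I_im, Complex.add_im, Complex.one_im, Complex.neg_im,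
      Complex.mul_im]
    have hc : Real.cos (Real.pi * t) = 1 - 2 * Real.sin (Real.pi * t / 2) ^ 2 := by
      rw [show Real.pi * t = 2 * (Real.pi * t / 2) by ring, Real.cos_two_mul, Real.cos_sq']; ring_nf
    nlinarith [Real.sin_sq_add_cos_sq (Real.pi * t)]
  have hpi := Real.pi_pos
  have hsin : min t (2 - t) ≤ Real.sin (Real.pi * t / 2) := by
    rcases le_total t 1 with h | h
    · have := Real.mul_le_sin (x := Real.pi * t / 2) (by positivity) (by nlinarith)
      refine (min_le_left _ _).trans (le_trans (le_of_eq ?_) this)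
      field_simp
    · have := Real.mul_le_sin (x := Real.pi - Real.pi * t / 2) (by nlinarith) (by nlinarith)
      rw [Real.sin_pi_sub] at this
      refine (min_le_right _ _).trans (le_trans (le_of_eq ?_) this)
      field_simp
  have hδ : δ ≤ Real.sin (Real.pi * t / 2) :=
    (le_min h1 (by rw [ht]; linarith)).trans hsin
  have hs0 : 0 ≤ Real.sin (Real.pi * t / 2) :=
    (le_min ht0.le (by linarith)).trans hsin
  have := (pow_left_inj₀ (norm_nonneg _) (by positivity) two_ne_zero).1 hsq
  linarith

/-- The bound for the resolvent kernel in terms of the gap. -/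
def greenBound (N : ℕ) (δ : ℝ) : ℝ :=
  Real.exp (2 * N + 1) * (4 + δ⁻¹ * (2 * Real.pi))

lemma greenConst_le {N : ℕ} {δ lam : ℝ} (hδ : 0 < δ)
    (hlam : lam ∈ Ioo (2 * (N : ℝ) - 1) (2 * (N : ℝ) + 1)) (hN : 1 ≤ N)
    (hd : δ ≤ Metric.infDist lam landauLevels) : greenConst lam ≤ greenBound N δ := by
  have h := norm_one_add_exp_ge hlam hN hd
  have hpi := Real.pi_pos
  have hN' : (1 : ℝ) ≤ N := by exact_mod_cast hN
  unfold greenConst greenBound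
  gcongr
  rw [abs_of_pos (by linarith [hlam.1])]
  exact hlam.2.le

/-! ### Slowly varying weights -/

/-- `1 / cosh ((θ - Θ) / ℓ)`. -/
def sech (l Θ θ : ℝ) : ℝ := (Real.cosh ((θ - Θ) / l))⁻¹

/-- The weight `1 / cosh² ((θ - Θ) / ℓ)`. -/
def sechSq (l Θ θ : ℝ) : ℝ := sech l Θ θ ^ 2

/-- The growth factor `1 + |Θ / M|`. -/
def growth (M Θ : ℝ) : ℝ := 1 + |Θ / M|

lemma one_le_growth (M Θ : ℝ) : 1 ≤ growth M Θ := by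
  unfold growth; linarith [abs_nonneg (Θ / M)]

lemma sech_pos (l Θ θ : ℝ) : 0 < sech l Θ θ := inv_pos.2 (Real.cosh_pos _)

lemma sech_le_one (l Θ θ : ℝ) : sech l Θ θ ≤ 1 := inv_le_one_of_one_le₀ (Real.one_le_cosh _)

lemma sechSq_pos (l Θ θ : ℝ) : 0 < sechSq l Θ θ := pow_pos (sech_pos l Θ θ) 2

lemma sechSq_le_one (l Θ θ : ℝ) : sechSq l Θ θ ≤ 1 :=
  pow_le_one₀ (sech_pos l Θ θ).le (sech_le_one l Θ θ)

lemma contDiff_sech (l Θ : ℝ) : ContDiff ℝ ∞ (sech l Θ) :=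
  (Real.contDiff_cosh.comp ((contDiff_id.sub contDiff_const).div_const l)).inv
    fun _ => (Real.cosh_pos _).ne'

lemma contDiff_sechSq (l Θ : ℝ) : ContDiff ℝ ∞ (sechSq l Θ) := (contDiff_sech l Θ).pow 2

lemma continuous_sechSq (l Θ : ℝ) : Continuous (sechSq l Θ) := (contDiff_sechSq l Θ).continuous

lemma abs_sinh_le_cosh (x : ℝ) : |Real.sinh x| ≤ Real.cosh x := by
  rw [abs_le]
  constructor
  · have := Real.cosh_add_sinh x
    linarith [Real.exp_pos x]
  · exact (Real.sinh_lt_cosh x).le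

lemma hasDerivAt_sech (l Θ θ : ℝ) : HasDerivAt (sech l Θ)
    (-(Real.sinh ((θ - Θ) / l) * (1 / l)) / Real.cosh ((θ - Θ) / l) ^ 2) θ := by
  have h1 : HasDerivAt (fun t : ℝ => (t - Θ) / l) (1 / l) θ :=
    ((hasDerivAt_id θ).sub_const Θ).div_const l
  exact (((Real.hasDerivAt_cosh _).comp θ h1).inv (Real.cosh_pos _).ne')

lemma abs_deriv_sech_le {l : ℝ} (hl : 0 < l) (Θ θ : ℝ) :
    |deriv (sech l Θ) θ| ≤ 1 / l * sech l Θ θ := by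
  rw [(hasDerivAt_sech l Θ θ).deriv, sech]
  set x := (θ - Θ) / l
  have hc := Real.cosh_pos x
  rw [abs_div, abs_neg, abs_mul, abs_of_pos (by positivity : 0 < 1 / l),
    abs_of_pos (by positivity : 0 < Real.cosh x ^ 2), div_le_iff₀ (by positivity)]
  have := abs_sinh_le_cosh x
  calc |Real.sinh x| * (1 / l) ≤ Real.cosh x * (1 / l) := by gcongr
    _ = _ := by field_simp

lemma abs_deriv_sechSq_le {l : ℝ} (hl : 0 < l) (Θ θ : ℝ) :
    |deriv (sechSq l Θ) θ| ≤ 2 / l * sechSq l Θ θ := by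
  have h : HasDerivAt (sechSq l Θ) (2 * sech l Θ θ * deriv (sech l Θ) θ) θ := by
    have := ((hasDerivAt_sech l Θ θ).differentiableAt.hasDerivAt).pow 2
    refine this.congr_deriv ?_
    simp
  have h2 := abs_deriv_sech_le hl Θ θ
  have h3 := sech_pos l Θ θ
  rw [h.deriv, abs_mul, abs_of_pos (by positivity)]
  calc _ ≤ 2 * sech l Θ θ * (1 / l * sech l Θ θ) := by gcongr
    _ = _ := by unfold sechSq; ring

lemma cosh_le_exp_mul_cosh (x y : ℝ) : Real.cosh x ≤ Real.exp |x - y| * Real.cosh y := by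
  have h : x = y + (x - y) := by ring
  conv_lhs => rw [h, Real.cosh_add]
  have h1 := abs_sinh_le_cosh y
  have h2 : Real.sinh y * Real.sinh (x - y) ≤ Real.cosh y * Real.sinh |x - y| := by
    refine (le_abs_self _).trans ?_
    rw [abs_mul, Real.abs_sinh (x - y)]
    gcongr
  rw [← Real.cosh_add_sinh |x - y|, Real.cosh_abs]
  linarith

/-- Slow variation at unit scale is what allows the weight to pass through the Gaussian kernel in
Schur's test; the rate `2` here is the parameter used there. -/
lemma sechSq_le_exp_mul {l : ℝ} (hl : 1 ≤ l) (Θ a b : ℝ) :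
    sechSq l Θ a ≤ Real.exp (2 * |a - b|) * sechSq l Θ b := by
  have h := cosh_le_exp_mul_cosh ((b - Θ) / l) ((a - Θ) / l)
  have h1 : |(b - Θ) / l - (a - Θ) / l| ≤ |a - b| := by
    rw [← sub_div, abs_div, abs_of_pos (by linarith : 0 < l), abs_sub_comm a b]
    rw [show b - Θ - (a - Θ) = b - a by ring]
    exact div_le_self (abs_nonneg _) hl
  have h2 : Real.cosh ((b - Θ) / l) ≤ Real.exp |a - b| * Real.cosh ((a - Θ) / l) :=
    h.trans (by gcongr)
  have ha := Real.cosh_pos ((a - Θ) / l)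
  have hb := Real.cosh_pos ((b - Θ) / l)
  have h3 : sech l Θ a ≤ Real.exp |a - b| * sech l Θ b := by
    rw [sech, sech, ← div_eq_mul_inv, le_div_iff₀ hb, inv_mul_le_iff₀ ha]
    linarith
  unfold sechSq
  calc sech l Θ a ^ 2 ≤ (Real.exp |a - b| * sech l Θ b) ^ 2 := by
        gcongr
        exact (sech_pos l Θ a).le
    _ = _ := by rw [mul_pow, ← Real.exp_nat_mul]; norm_num

lemma quarter_le_sechSq {l Θ θ : ℝ} (hl : 0 < l) (h : |θ - Θ| ≤ l) : 1 / 4 ≤ sechSq l Θ θ := by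
  have h1 : Real.cosh ((θ - Θ) / l) ≤ 2 := by
    have h2 : |(θ - Θ) / l| ≤ |(1 : ℝ)| := by
      rw [abs_div, abs_of_pos hl, abs_one]
      exact (div_le_one hl).2 h
    refine (Real.cosh_le_cosh.2 h2).trans ?_
    rw [Real.cosh_eq]
    have e1 := Real.exp_one_lt_d9
    have e2 : Real.exp (-1) ≤ 1 := Real.exp_le_one_iff.2 (by norm_num)
    linarith
  have h3 : 1 / 2 ≤ sech l Θ θ := by
    rw [sech, one_div]
    exact inv_anti₀ (Real.cosh_pos _) h1
  unfold sechSq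
  nlinarith

/-- The moment `∫ (1 + |y|)^k / cosh² (y / L) dy`. -/
def sechMoment (L : ℝ) (k : ℕ) : ℝ := ∫ y, sechSq L 0 y * (1 + |y|) ^ k

lemma sechSq_le_exp {L : ℝ} (hL : 0 < L) (y : ℝ) : sechSq L 0 y ≤ 4 * Real.exp (-(2 * |y| / L)) := by
  have h1 : Real.exp (|y| / L) / 2 ≤ Real.cosh ((y - 0) / L) := by
    rw [sub_zero, ← Real.cosh_abs, abs_div, abs_of_pos hL, Real.cosh_eq]
    have := Real.exp_pos (-(|y| / L))
    linarith
  have h2 : sech L 0 y ≤ 2 * Real.exp (-(|y| / L)) := by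
    rw [sech, Real.exp_neg]
    calc _ ≤ (Real.exp (|y| / L) / 2)⁻¹ := inv_anti₀ (by positivity) h1
      _ = _ := by field_simp
  unfold sechSq
  calc sech L 0 y ^ 2 ≤ (2 * Real.exp (-(|y| / L))) ^ 2 := by
        gcongr
        exact (sech_pos L 0 y).le
    _ = _ := by
        rw [mul_pow, ← Real.exp_nat_mul]
        norm_num
        ring_nf

lemma integrable_sechMoment {L : ℝ} (hL : 0 < L) (k : ℕ) :
    Integrable fun y => sechSq L 0 y * (1 + |y|) ^ k := by
  have hexp : Integrable fun y : ℝ => Real.exp (-(1 / L) * |y|) := by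
    refine integrable_of_even (fun y => by rw [abs_neg]) ?_
    refine (integrableOn_exp_mul_Ioi (a := -(1 / L)) (by simpa using hL) 0).congr_fun
      (fun y (hy : 0 < y) => ?_) measurableSet_Ioi
    rw [abs_of_pos hy]
  refine (hexp.const_mul (4 * (k.factorial * L ^ k * Real.exp (1 / L)))).mono'
    ((continuous_sechSq L 0).mul (by fun_prop)).aestronglyMeasurable
    (Eventually.of_forall fun y => ?_)
  have h1 := sechSq_le_exp hL y
  -- Half of the decay `e^{-2|y|/L}` is spent on the polynomial, by the `k`-th term of the
  -- exponential series.
  have h2 : (1 + |y|) ^ k ≤ k.factorial * L ^ k * Real.exp ((1 + |y|) / L) := by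
    have := Real.pow_div_factorial_le_exp ((1 + |y|) / L) (by positivity) k
    rw [div_pow, div_div, div_le_iff₀ (by positivity)] at this
    calc _ ≤ _ := this
      _ = _ := by ring
  rw [Real.norm_of_nonneg (mul_nonneg (sechSq_pos L 0 y).le (by positivity))]
  calc _ ≤ (4 * Real.exp (-(2 * |y| / L))) * (k.factorial * L ^ k * Real.exp ((1 + |y|) / L)) := by
        gcongr
    _ = 4 * (k.factorial * L ^ k)
        * (Real.exp (-(2 * |y| / L)) * Real.exp ((1 + |y|) / L)) := by ring
    _ = 4 * (k.factorial * L ^ k) * (Real.exp (1 / L) * Real.exp (-(1 / L) * |y|)) := by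
        rw [← Real.exp_add, ← Real.exp_add]
        congr 2
        ring
    _ = _ := by ring

lemma sechMoment_nonneg (L : ℝ) (k : ℕ) : 0 ≤ sechMoment L k :=
  integral_nonneg fun y => mul_nonneg (sechSq_pos L 0 y).le (by positivity)

lemma growth_le_mul (M x Θ : ℝ) :
    growth M x ≤ growth M Θ * (1 + |(x - Θ) / M|) := by
  have h1 : |x / M| ≤ |Θ / M| + |(x - Θ) / M| := by
    rw [show x / M = Θ / M + (x - Θ) / M by ring]
    exact abs_add_le _ _
  unfold growth
  nlinarith [abs_nonneg (Θ / M), abs_nonneg ((x - Θ) / M)]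

lemma sechSq_scale {L M : ℝ} (Θ x : ℝ) : sechSq (L * M) Θ x = sechSq L 0 ((x - Θ) / M) := by
  rw [sechSq, sechSq, sech, sech, sub_zero, div_div, mul_comm M L]

/-- `growth` is submultiplicative under translation, so its average against a weight centred at `Θ`
is comparable with its value at `Θ`. -/
lemma integrable_sechSq_growth {L M : ℝ} (hL : 0 < L) (hM : 0 < M) (k : ℕ) (Θ : ℝ) :
    Integrable (fun x => sechSq (L * M) Θ x * growth M x ^ k) ∧
    ∫ x, sechSq (L * M) Θ x * growth M x ^ k ≤ M * sechMoment L k * growth M Θ ^ k := by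
  set f : ℝ → ℝ := fun y => sechSq L 0 y * (1 + |y|) ^ k with hf
  have i1 : Integrable (fun x => f ((x - Θ) / M)) :=
    ((integrable_sechMoment hL k).comp_div hM.ne').comp_sub_right Θ
  have e1 : ∫ x, f ((x - Θ) / M) = M * sechMoment L k := by
    rw [integral_sub_right_eq_self (fun x => f (x / M)) Θ, Measure.integral_comp_div,
      abs_of_pos hM, smul_eq_mul]
    rfl
  have hbd : ∀ x, sechSq (L * M) Θ x * growth M x ^ k ≤ f ((x - Θ) / M) * growth M Θ ^ k := by
    intro x
    rw [sechSq_scale, hf]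
    have h := growth_le_mul M x Θ
    have h0 : 0 ≤ growth M x := zero_le_one.trans (one_le_growth M x)
    calc _ ≤ sechSq L 0 ((x - Θ) / M) * (growth M Θ * (1 + |(x - Θ) / M|)) ^ k := by
          gcongr
          exact (sechSq_pos _ _ _).le
      _ = _ := by rw [mul_pow]; ring
  have hcont : Continuous fun x => sechSq (L * M) Θ x * growth M x ^ k :=
    (continuous_sechSq _ _).mul (by unfold growth; fun_prop)
  have hi : Integrable (fun x => sechSq (L * M) Θ x * growth M x ^ k) := by
    refine (i1.mul_const (growth M Θ ^ k)).mono' hcont.aestronglyMeasurable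
      (Eventually.of_forall fun x => ?_)
    have h0 : 0 ≤ growth M x := zero_le_one.trans (one_le_growth M x)
    rw [Real.norm_of_nonneg (mul_nonneg (sechSq_pos _ _ _).le (by positivity))]
    exact hbd x
  refine ⟨hi, ?_⟩
  calc _ ≤ ∫ x, f ((x - Θ) / M) * growth M Θ ^ k := integral_mono hi (i1.mul_const _) hbd
    _ = _ := by rw [integral_mul_const, e1]

/-! ### Averaging -/

/-- A local integral is the average of local integrals over shorter intervals. -/
lemma lintegral_mul_le_average {M : ℝ} {F : ℝ → ℝ≥0∞} (hF : Measurable F)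
    {w w' : ℝ → ℝ≥0∞} (hw : Measurable w) (hw' : Measurable w')
    (h : ∀ θ τ, |θ - τ| < M → w θ ≤ w' τ) :
    ENNReal.ofReal (2 * M) * ∫⁻ θ, w θ * F θ
      ≤ ∫⁻ τ, w' τ * ∫⁻ θ in {θ | |θ - τ| < M}, F θ := by
  have hset : MeasurableSet {q : ℝ × ℝ | |q.2 - q.1| < M} :=
    measurableSet_lt (by fun_prop) measurable_const
  have hball : ∀ θ, {τ : ℝ | |θ - τ| < M} = Metric.ball θ M := fun θ => by
    ext τ; simp [Real.dist_eq, abs_sub_comm]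
  have hball' : ∀ τ, {θ : ℝ | |θ - τ| < M} = Metric.ball τ M := fun τ => by
    ext θ; simp [Real.dist_eq]
  have hm : Measurable (Function.uncurry fun τ θ : ℝ =>
      {q : ℝ × ℝ | |q.2 - q.1| < M}.indicator (fun q => w' q.1 * F q.2) (τ, θ)) :=
    ((hw'.comp measurable_fst).mul (hF.comp measurable_snd)).indicator hset
  calc ENNReal.ofReal (2 * M) * ∫⁻ θ, w θ * F θ
      = ∫⁻ θ, w θ * F θ * ENNReal.ofReal (2 * M) := by
        have hm' : Measurable fun θ => w θ * F θ := hw.mul hF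
        rw [lintegral_mul_const _ hm', mul_comm]
    _ ≤ ∫⁻ θ, ∫⁻ τ, {q : ℝ × ℝ | |q.2 - q.1| < M}.indicator (fun q => w' q.1 * F q.2) (τ, θ) := by
        refine lintegral_mono fun θ => ?_
        calc w θ * F θ * ENNReal.ofReal (2 * M) = ∫⁻ τ in Metric.ball θ M, w θ * F θ := by
              rw [setLIntegral_const, Real.volume_ball]
          _ ≤ ∫⁻ τ in Metric.ball θ M, w' τ * F θ := by
              refine setLIntegral_mono (hw'.mul_const _) fun τ hτ => ?_
              rw [← hball] at hτ
              gcongr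
              exact h θ τ hτ
          _ = _ := by
              rw [← lintegral_indicator Metric.isOpen_ball.measurableSet]
              congr 1 with τ
              simp only [indicator_apply, mem_ofPred_eq, ← hball]
    _ = ∫⁻ τ, ∫⁻ θ, {q : ℝ × ℝ | |q.2 - q.1| < M}.indicator (fun q => w' q.1 * F q.2) (τ, θ) :=
        (lintegral_lintegral_swap hm.aemeasurable).symm
    _ = _ := by
        congr 1 with τ
        rw [hball', ← lintegral_const_mul _ hF, ← lintegral_indicator Metric.isOpen_ball.measurableSet]
        congr 1 with θ

lemma lintegral_ball_le_sechSq {l M : ℝ} (hl : 0 < l) (hM : M ≤ l) (F : ℝ → ℝ≥0∞) (τ : ℝ) :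
    ∫⁻ θ in {θ | |θ - τ| < M}, F θ ≤ 4 * ∫⁻ θ, ENNReal.ofReal (sechSq l τ θ) * F θ := by
  have hball : {θ : ℝ | |θ - τ| < M} = Metric.ball τ M := by
    ext θ; simp [Real.dist_eq]
  rw [← lintegral_const_mul' _ _ (by norm_num), hball]
  rw [← lintegral_indicator Metric.isOpen_ball.measurableSet]
  refine lintegral_mono fun θ => ?_
  refine indicator_apply_le' (fun hθ => ?_) fun _ => zero_le
  rw [← hball] at hθ
  have h := quarter_le_sechSq (θ := θ) (Θ := τ) hl (hθ.le.trans hM)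
  rw [← mul_assoc, show (4 : ℝ≥0∞) = ENNReal.ofReal 4 by simp, ← ENNReal.ofReal_mul (by norm_num)]
  refine le_mul_of_one_le_left zero_le ?_
  rw [ENNReal.one_le_ofReal]
  linarith

/-- Growth of local masses, deduced from bounds for weighted masses. -/
lemma lintegral_strip_le {L M K : ℝ} (hL : 1 ≤ L) (hM : 0 < M) (hK : 0 ≤ K) (k : ℕ)
    {F : ℝ → ℝ≥0∞} (hF : Measurable F)
    (h : ∀ Θ, ∫⁻ θ, ENNReal.ofReal (sechSq (L * M) Θ θ) * F θ
      ≤ ENNReal.ofReal (M * K * growth M Θ ^ k)) (x : ℝ) :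
    ∫⁻ θ in {θ | |θ| < |x| + 2 * M}, F θ
      ≤ ENNReal.ofReal (12 * 4 ^ k * M * K * growth M x ^ (k + 1)) := by
  set r := |x| + 2 * M with hr
  have hLM : M ≤ L * M := by nlinarith
  have hxM : |x| = M * |x / M| := by rw [abs_div, abs_of_pos hM]; field_simp
  have hg : 1 + (r + M) / M ≤ 4 * growth M x := by
    rw [hr, hxM, growth]
    have : (M * |x / M| + 2 * M + M) / M = |x / M| + 3 := by field_simp; ring
    rw [this]
    linarith [abs_nonneg (x / M)]
  -- The strip is covered by intervals of length comparable to `M`; their number is of order `growth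
  -- M x`, which is where the additional power comes from.
  have hr3 : r + M ≤ 3 * M * growth M x := by
    rw [hr, hxM, growth]
    nlinarith [abs_nonneg (x / M)]
  have hset : ∀ s : ℝ, MeasurableSet {θ : ℝ | |θ| < s} := fun s =>
    measurableSet_lt (by fun_prop) measurable_const
  -- The mass of the strip is an average of masses over intervals of radius `M`, whose centres need
  -- only range over the strip enlarged by `M`.
  have hav := lintegral_mul_le_average (M := M) hF (w := {θ : ℝ | |θ| < r}.indicator 1)
    (w' := {θ : ℝ | |θ| < r + M}.indicator 1) (measurable_one.indicator (hset r))
    (measurable_one.indicator (hset (r + M))) (fun θ τ hθτ => by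
      by_cases hθ : |θ| < r
      · have : |τ| < r + M := by
          have : |τ| ≤ |θ| + |θ - τ| := by
            rw [show τ = θ - (θ - τ) by ring]; simpa using abs_sub θ (θ - τ)
          linarith
        rw [indicator_of_mem (by exact hθ), indicator_of_mem (by exact this)]
        exact le_rfl
      · rw [indicator_of_notMem (by exact hθ)]; exact zero_le)
  have e1 : ∫⁻ θ, {θ : ℝ | |θ| < r}.indicator 1 θ * F θ = ∫⁻ θ in {θ | |θ| < r}, F θ := by
    rw [← lintegral_indicator (hset r)]
    congr 1 with θ
    by_cases hθ : |θ| < r <;> simp [indicator, hθ]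
  rw [e1] at hav
  have hbd : ∫⁻ τ, {θ : ℝ | |θ| < r + M}.indicator 1 τ * ∫⁻ θ in {θ | |θ - τ| < M}, F θ
      ≤ ENNReal.ofReal (4 * (M * K * (4 * growth M x) ^ k)) * ENNReal.ofReal (2 * (r + M)) := by
    calc _ ≤ ∫⁻ τ in {θ : ℝ | |θ| < r + M}, ENNReal.ofReal (4 * (M * K * (4 * growth M x) ^ k)) := by
          rw [← lintegral_indicator (hset _)]
          refine lintegral_mono fun τ => ?_
          by_cases hτ : |τ| < r + M
          · rw [indicator_of_mem (by exact hτ), indicator_of_mem (by exact hτ), Pi.one_apply,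
              one_mul]
            refine (lintegral_ball_le_sechSq (by positivity) hLM F τ).trans ?_
            rw [ENNReal.ofReal_mul (by norm_num), show ENNReal.ofReal 4 = 4 by simp]
            gcongr
            refine (h τ).trans (ENNReal.ofReal_le_ofReal ?_)
            have : growth M τ ≤ 4 * growth M x := by
              refine le_trans ?_ hg
              rw [growth, abs_div, abs_of_pos hM]
              gcongr
            have h0 : 0 ≤ growth M τ := zero_le_one.trans (one_le_growth M τ)
            gcongr
          · rw [indicator_of_notMem (by exact hτ), zero_mul]; exact zero_le
      _ = _ := by
          rw [setLIntegral_const]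
          congr 1
          have : {θ : ℝ | |θ| < r + M} = Metric.ball 0 (r + M) := by
            ext θ; simp
          rw [this, Real.volume_ball]
  have hfin := hav.trans hbd
  rw [← ENNReal.ofReal_mul (by have := one_le_growth M x; positivity)] at hfin
  have h2M : ENNReal.ofReal (2 * M) ≠ 0 := by simpa using hM
  rw [mul_comm, ← ENNReal.le_div_iff_mul_le (Or.inl h2M) (Or.inl ENNReal.ofReal_ne_top),
    ← ENNReal.ofReal_div_of_pos (by positivity)] at hfin
  refine hfin.trans (ENNReal.ofReal_le_ofReal ?_)
  rw [div_le_iff₀ (by positivity)]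
  have hg0 : 0 ≤ growth M x := zero_le_one.trans (one_le_growth M x)
  calc 4 * (M * K * (4 * growth M x) ^ k) * (2 * (r + M))
      ≤ 4 * (M * K * (4 * growth M x) ^ k) * (2 * (3 * M * growth M x)) := by gcongr
    _ = _ := by rw [mul_pow]; ring

/-- Bounds for weighted masses, deduced from bounds for local masses. -/
lemma lintegral_sechSq_le {L M K : ℝ} (hL : 1 ≤ L) (hM : 0 < M) (hK : 0 ≤ K) (k : ℕ)
    {F : ℝ → ℝ≥0∞} (hF : Measurable F)
    (h : ∀ Θ, ∫⁻ θ in {θ | |θ - Θ| < M}, F θ ≤ ENNReal.ofReal (2 * M * K * growth M Θ ^ k))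
    (Θ : ℝ) :
    ∫⁻ θ, ENNReal.ofReal (sechSq (L * M) Θ θ) * F θ
      ≤ ENNReal.ofReal (Real.exp 2 * sechMoment L k * M * K * growth M Θ ^ k) := by
  have hL0 : 0 < L := by linarith
  have hmW : ∀ c : ℝ, Measurable fun θ => ENNReal.ofReal (c * sechSq (L * M) Θ θ) := fun c =>
    ((continuous_sechSq _ _).measurable.const_mul c).ennreal_ofReal
  have hmW1 : Measurable fun θ => ENNReal.ofReal (sechSq (L * M) Θ θ) :=
    (continuous_sechSq _ _).measurable.ennreal_ofReal
  -- Within distance `M` the rescaled variable moves by at most one, so the weight changes at most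
  -- by the factor `e²`.
  have hav := lintegral_mul_le_average (M := M) hF hmW1 (hmW (Real.exp 2)) (fun θ τ hθτ => by
      refine ENNReal.ofReal_le_ofReal ?_
      rw [sechSq_scale, sechSq_scale]
      refine (sechSq_le_exp_mul hL 0 _ ((τ - Θ) / M)).trans ?_
      gcongr
      · exact (sechSq_pos _ _ _).le
      rw [← sub_div, abs_div, abs_of_pos hM, show θ - Θ - (τ - Θ) = θ - τ by ring]
      have : |θ - τ| / M ≤ 1 := (div_le_one hM).2 hθτ.le
      linarith)
  obtain ⟨hi, hle⟩ := integrable_sechSq_growth hL0 hM k Θ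
  have hg0 : ∀ τ, 0 ≤ growth M τ := fun τ => zero_le_one.trans (one_le_growth M τ)
  have hbd : ∫⁻ τ, ENNReal.ofReal (Real.exp 2 * sechSq (L * M) Θ τ)
        * ∫⁻ θ in {θ | |θ - τ| < M}, F θ
      ≤ ENNReal.ofReal (2 * M * (Real.exp 2 * sechMoment L k * M * K * growth M Θ ^ k)) := by
    calc _ ≤ ∫⁻ τ, ENNReal.ofReal ((Real.exp 2 * (2 * M * K))
            * (sechSq (L * M) Θ τ * growth M τ ^ k)) := by
          refine lintegral_mono fun τ => ?_
          calc _ ≤ ENNReal.ofReal (Real.exp 2 * sechSq (L * M) Θ τ)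
                * ENNReal.ofReal (2 * M * K * growth M τ ^ k) := by gcongr; exact h τ
            _ = _ := by
              rw [← ENNReal.ofReal_mul (mul_nonneg (Real.exp_nonneg _) (sechSq_pos _ _ _).le)]
              congr 1; ring
      _ = ENNReal.ofReal (∫ τ, (Real.exp 2 * (2 * M * K))
            * (sechSq (L * M) Θ τ * growth M τ ^ k)) := by
          rw [ofReal_integral_eq_lintegral_ofReal (hi.const_mul _)]
          exact Eventually.of_forall fun τ => mul_nonneg (by positivity)
            (mul_nonneg (sechSq_pos _ _ _).le (pow_nonneg (hg0 τ) k))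
      _ ≤ _ := by
          refine ENNReal.ofReal_le_ofReal ?_
          rw [integral_const_mul]
          calc _ ≤ (Real.exp 2 * (2 * M * K)) * (M * sechMoment L k * growth M Θ ^ k) := by gcongr
            _ = _ := by ring
  have hfin := hav.trans hbd
  rw [ENNReal.ofReal_mul (p := 2 * M) (by positivity)] at hfin
  exact (ENNReal.mul_le_mul_iff_right (by simpa using hM) ENNReal.ofReal_ne_top).1 hfin

/-! ### Potentials -/

/-- The volume potential with kernel `greenFn`. -/
def greenPot (lam : ℝ) (f : ℝ × ℝ → ℂ) (x : ℝ × ℝ) : ℂ := ∫ y, greenFn lam x y * f y ∂vol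

/-- The boundary potential with kernel `greenFn`. -/
def boundaryPot (lam : ℝ) (b : ℝ → ℂ) (x : ℝ × ℝ) : ℂ := ∫ s, greenFn lam x (s, 0) * b s

lemma ae_vol_fst_ne (a : ℝ) : ∀ᵐ y ∂vol, a ≠ y.1 := by
  rw [vol_eq_prod]
  refine Measure.quasiMeasurePreserving_fst.ae (p := fun t => a ≠ t) ?_
  filter_upwards [compl_mem_ae_iff.2 (measure_singleton a)] with t ht
  exact fun h => ht h.symm

lemma ae_ne' (a : ℝ) : ∀ᵐ s : ℝ, a ≠ s := by
  filter_upwards [compl_mem_ae_iff.2 (measure_singleton (μ := volume) a)] with t ht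
  exact fun h => ht h.symm

lemma measurable_greenFn (lam : ℝ) : Measurable (Function.uncurry (greenFn lam)) := by
  unfold greenFn
  refine Measurable.mul (f := fun q : (ℝ × ℝ) × (ℝ × ℝ) => greenRadial lam (distSq q.1 q.2))
    (g := fun q : (ℝ × ℝ) × (ℝ × ℝ) => gauge q.1 q.2) ?_ ?_
  · exact (measurable_greenRadial lam).comp (by unfold distSq; fun_prop)
  · unfold gauge
    fun_prop

lemma measurable_greenPot (lam : ℝ) {f : ℝ × ℝ → ℂ} (hf : Measurable f) :
    Measurable (greenPot lam f) :=
  (StronglyMeasurable.integral_prod_right (ν := vol) (f := fun x y => greenFn lam x y * f y)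
    ((measurable_greenFn lam).mul (hf.comp measurable_snd)).stronglyMeasurable).measurable

lemma enorm_greenPot_le {lam B : ℝ} (hB : greenConst lam ≤ B) (f : ℝ × ℝ → ℂ) (x : ℝ × ℝ) :
    ‖greenPot lam f x‖ₑ ≤ ENNReal.ofReal B * ∫⁻ y, ENNReal.ofReal (majKernel x y) * ‖f y‖ₑ ∂vol := by
  rw [← lintegral_const_mul' _ _ ENNReal.ofReal_ne_top]
  refine (enorm_integral_le_lintegral_enorm _).trans (lintegral_mono_ae ?_)
  filter_upwards [ae_vol_fst_ne x.1] with y hy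
  rw [enorm_mul, ← mul_assoc, ← ENNReal.ofReal_mul ((greenConst_nonneg lam).trans hB)]
  gcongr
  rw [← ofReal_norm]
  refine ENNReal.ofReal_le_ofReal ((norm_greenFn_le lam hy).trans ?_)
  exact mul_le_mul_of_nonneg_right hB (majKernel_nonneg x y)

lemma enorm_boundaryPot_le {lam B : ℝ} (hB : greenConst lam ≤ B) (b : ℝ → ℂ) (x : ℝ × ℝ) :
    ‖boundaryPot lam b x‖ₑ
      ≤ ENNReal.ofReal B * ∫⁻ s, ENNReal.ofReal (majKernel x (s, 0)) * ‖b s‖ₑ := by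
  rw [← lintegral_const_mul' _ _ ENNReal.ofReal_ne_top]
  refine (enorm_integral_le_lintegral_enorm _).trans (lintegral_mono_ae ?_)
  filter_upwards [ae_ne' x.1] with s hs
  rw [enorm_mul, ← mul_assoc, ← ENNReal.ofReal_mul ((greenConst_nonneg lam).trans hB)]
  gcongr
  rw [← ofReal_norm]
  refine ENNReal.ofReal_le_ofReal ((norm_greenFn_le lam (y := (s, 0)) hs).trans ?_)
  exact mul_le_mul_of_nonneg_right hB (majKernel_nonneg _ _)

/-- The operator bound for volume potentials on weighted spaces. -/
def potConst (c B : ℝ) : ℝ := B ^ 2 * (singInt 0 * gaussInt 0 * (singInt c * gaussInt c)).toReal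

/-- The operator bound for boundary potentials on weighted spaces. -/
def boundaryConst (c B : ℝ) : ℝ := B ^ 2 * (singInt 0 * (singInt c * gaussInt 1)).toReal

lemma potConst_nonneg (c B : ℝ) : 0 ≤ potConst c B := by unfold potConst; positivity

lemma boundaryConst_nonneg (c B : ℝ) : 0 ≤ boundaryConst c B := by unfold boundaryConst; positivity

lemma ofReal_potConst (c B : ℝ) : ENNReal.ofReal (potConst c B)
    = ENNReal.ofReal (B ^ 2) * (singInt 0 * gaussInt 0 * (singInt c * gaussInt c)) := by
  rw [potConst, ENNReal.ofReal_mul (sq_nonneg B), ENNReal.ofReal_toReal]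
  have := (singInt_lt_top 0).ne
  have := (singInt_lt_top c).ne
  have := (gaussInt_lt_top 0).ne
  have := (gaussInt_lt_top c).ne
  finiteness

lemma ofReal_boundaryConst (c B : ℝ) : ENNReal.ofReal (boundaryConst c B)
    = ENNReal.ofReal (B ^ 2) * (singInt 0 * (singInt c * gaussInt 1)) := by
  rw [boundaryConst, ENNReal.ofReal_mul (sq_nonneg B), ENNReal.ofReal_toReal]
  have := (singInt_lt_top 0).ne
  have := (singInt_lt_top c).ne
  have := (gaussInt_lt_top 1).ne
  finiteness

lemma lintegral_greenPot_le {lam B c : ℝ} (hB : greenConst lam ≤ B) {w : ℝ × ℝ → ℝ≥0∞}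
    (hw : Measurable w) {f : ℝ × ℝ → ℂ} (hf : Measurable f)
    (hc : ∀ x y, 0 < x.2 → 0 < y.2 →
      w x ≤ ENNReal.ofReal (Real.exp (c * |x.1 - y.1|) * Real.exp (c * |x.2 - y.2|)) * w y) :
    ∫⁻ x, w x * ‖greenPot lam f x‖ₑ ^ 2 ∂vol
      ≤ ENNReal.ofReal (potConst c B) * ∫⁻ x, w x * ‖f x‖ₑ ^ 2 ∂vol := by
  have hB0 := (greenConst_nonneg lam).trans hB
  calc _ ≤ ∫⁻ x, ENNReal.ofReal (B ^ 2) * (w x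
        * (∫⁻ y, ENNReal.ofReal (majKernel x y) * ‖f y‖ₑ ∂vol) ^ 2) ∂vol := by
        refine lintegral_mono fun x => ?_
        calc _ ≤ w x * (ENNReal.ofReal B
              * ∫⁻ y, ENNReal.ofReal (majKernel x y) * ‖f y‖ₑ ∂vol) ^ 2 := by
              gcongr
              exact enorm_greenPot_le hB f x
          _ = _ := by rw [mul_pow, ENNReal.ofReal_pow hB0]; ring
    _ ≤ _ := by
        rw [lintegral_const_mul' _ _ ENNReal.ofReal_ne_top, ofReal_potConst, mul_assoc]
        gcongr
        exact schur_halfPlane hw hf.enorm hc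

lemma lintegral_boundaryPot_le {lam B c R : ℝ} (hB : greenConst lam ≤ B) {w : ℝ → ℝ≥0∞}
    (hw : Measurable w) {b : ℝ → ℂ} (hb : Measurable b)
    (hc : ∀ s t, w s ≤ ENNReal.ofReal (Real.exp (c * |s - t|)) * w t) :
    ∫⁻ x, {p : ℝ × ℝ | R ≤ p.2}.indicator (fun p => w p.1) x * ‖boundaryPot lam b x‖ₑ ^ 2 ∂vol
      ≤ ENNReal.ofReal (boundaryConst c B * Real.exp (-R)) * ∫⁻ s, w s * ‖b s‖ₑ ^ 2 := by
  have hB0 := (greenConst_nonneg lam).trans hB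
  calc _ ≤ ∫⁻ x, ENNReal.ofReal (B ^ 2) * ({p : ℝ × ℝ | R ≤ p.2}.indicator (fun p => w p.1) x
        * (∫⁻ s, ENNReal.ofReal (majKernel x (s, 0)) * ‖b s‖ₑ) ^ 2) ∂vol := by
        refine lintegral_mono fun x => ?_
        calc _ ≤ {p : ℝ × ℝ | R ≤ p.2}.indicator (fun p => w p.1) x * (ENNReal.ofReal B
              * ∫⁻ s, ENNReal.ofReal (majKernel x (s, 0)) * ‖b s‖ₑ) ^ 2 := by
              gcongr
              exact enorm_boundaryPot_le hB b x
          _ = _ := by rw [mul_pow, ENNReal.ofReal_pow hB0]; ring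
    _ ≤ _ := by
        rw [lintegral_const_mul' _ _ ENNReal.ofReal_ne_top,
          ENNReal.ofReal_mul (boundaryConst_nonneg c B), ofReal_boundaryConst]
        calc _ ≤ ENNReal.ofReal (B ^ 2) * (singInt 0 * (ENNReal.ofReal (Real.exp (-R))
              * (singInt c * gaussInt 1)) * ∫⁻ s, w s * ‖b s‖ₑ ^ 2) := by
              gcongr
              exact schur_boundary hw hb.enorm hc
          _ = _ := by ring

lemma enorm_sub_sq_le (a b : ℂ) : ‖a - b‖ₑ ^ 2 ≤ 2 * (‖a‖ₑ ^ 2 + ‖b‖ₑ ^ 2) := by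
  have h : ‖a - b‖ ^ 2 ≤ 2 * (‖a‖ ^ 2 + ‖b‖ ^ 2) := by
    have := norm_sub_le a b
    nlinarith [norm_nonneg (a - b), sq_nonneg (‖a‖ - ‖b‖)]
  have h2 := ENNReal.ofReal_le_ofReal h
  rw [ENNReal.ofReal_mul (by norm_num), ENNReal.ofReal_add (by positivity) (by positivity),
    ENNReal.ofReal_pow (norm_nonneg _), ENNReal.ofReal_pow (norm_nonneg _),
    ENNReal.ofReal_pow (norm_nonneg _), ofReal_norm, ofReal_norm,
    ofReal_norm] at h2
  simpa using h2

lemma ofReal_integral_mul_sq {α : Type*} [MeasurableSpace α] {ν : Measure α} {w : α → ℝ} {f : α → ℂ}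
    (hw : ∀ x, 0 ≤ w x) (hi : Integrable (fun x => w x * ‖f x‖ ^ 2) ν) :
    ENNReal.ofReal (∫ x, w x * ‖f x‖ ^ 2 ∂ν) = ∫⁻ x, ENNReal.ofReal (w x) * ‖f x‖ₑ ^ 2 ∂ν := by
  rw [ofReal_integral_eq_lintegral_ofReal hi
    (Eventually.of_forall fun x => mul_nonneg (hw x) (sq_nonneg _))]
  congr 1 with x
  rw [ENNReal.ofReal_mul (hw x), ENNReal.ofReal_pow (norm_nonneg _), ofReal_norm]

/-! ### Bounds away from the boundary -/

/-- The admissible spectral parameters: real, in a spectral gap and bounded. -/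
structure Admissible (Λ B lam : ℝ) : Prop where
  abs_le : |lam| ≤ Λ
  ne : 1 + Complex.exp (Complex.I * Real.pi * lam) ≠ 0
  le : greenConst lam ≤ B

/-- The constant of `bulk_le`. -/
def bulkConst (B : ℝ) : ℝ := 2 * (potConst 2 B + boundaryConst 2 B)

lemma bulkConst_nonneg (B : ℝ) : 0 ≤ bulkConst B := by
  have := potConst_nonneg 2 B
  have := boundaryConst_nonneg 2 B
  unfold bulkConst; positivity

lemma IsDirichlet.integrable_weight {Ψ : ℝ × ℝ → ℂ} (h : IsDirichlet Ψ) {W : ℝ → ℝ}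
    (hW : Continuous W) {f : ℝ × ℝ → ℂ} (hf : Continuous f) (h0 : ∀ p ∉ tsupport Ψ, f p = 0) :
    Integrable (fun p => W p.1 * ‖f p‖ ^ 2) vol :=
  integrable_of_tsupport h.compact ((hW.comp continuous_fst).mul (hf.norm.pow 2)) fun p hp => by
    simp [h0 p hp]

lemma IsDirichlet.integrable_sq {Ψ : ℝ × ℝ → ℂ} (h : IsDirichlet Ψ) {f : ℝ × ℝ → ℂ}
    (hf : Continuous f) (h0 : ∀ p ∉ tsupport Ψ, f p = 0) : Integrable (fun p => ‖f p‖ ^ 2) vol := by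
  simpa using h.integrable_weight (W := fun _ => 1) continuous_const hf h0

lemma IsDirichlet.integrable_trace {Ψ : ℝ × ℝ → ℂ} (h : IsDirichlet Ψ) {W : ℝ → ℝ}
    (hW : Continuous W) : Integrable (fun s => W s * ‖dMu Ψ (s, 0)‖ ^ 2) := by
  have hc : Continuous (dMu Ψ) := (contDiff_dMu h.smooth).continuous
  have : HasCompactSupport fun p : ℝ × ℝ => W p.1 * ‖dMu Ψ p‖ ^ 2 :=
    hasCompactSupport_of_tsupport h.compact fun p hp => by simp [dMu_eq_zero hp]
  exact ((hW.mul (((hc.comp (by fun_prop : Continuous fun s : ℝ => (s, (0 : ℝ)))).norm).pow 2)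
    ).integrable_of_hasCompactSupport (hasCompactSupport_slice_fst this 0))

/-- Here the spectral gap acts. By `representation` the function is a volume potential, bounded for
slow weights, minus a boundary potential, which gains `e^{-R}` on `{μ ≥ R}`. Hence mass far from the
boundary must come from the source. -/
theorem bulk_le {Λ B lam : ℝ} (ha : Admissible Λ B lam) {Ψ : ℝ × ℝ → ℂ} (h : IsDirichlet Ψ)
    {W : ℝ → ℝ} (hW : Continuous W) (hW0 : ∀ s, 0 ≤ W s)
    (hWe : ∀ s t, W s ≤ Real.exp (2 * |s - t|) * W t) (R : ℝ) :
    ∫ p in {p | R ≤ p.2}, W p.1 * ‖Ψ p‖ ^ 2 ∂vol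
      ≤ bulkConst B * ((∫ p, W p.1 * ‖resid lam Ψ p‖ ^ 2 ∂vol)
        + Real.exp (-R) * ∫ s, W s * ‖dMu Ψ (s, 0)‖ ^ 2) := by
  have hs := h.smooth
  have cg := (contDiff_resid lam hs).continuous
  have cb : Continuous fun s : ℝ => dMu Ψ (s, 0) :=
    (contDiff_dMu hs).continuous.comp (by fun_prop)
  have ig := h.integrable_weight hW cg fun p hp => resid_eq_zero hp
  have ib := h.integrable_trace hW
  have iΨ := h.integrable_weight hW hs.continuous h.eq_zero
  have mset : MeasurableSet {p : ℝ × ℝ | R ≤ p.2} := measurableSet_le measurable_const measurable_snd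
  have hPC := potConst_nonneg 2 B
  have hBC := boundaryConst_nonneg 2 B
  have Ig0 : 0 ≤ ∫ p, W p.1 * ‖resid lam Ψ p‖ ^ 2 ∂vol :=
    integral_nonneg fun p => mul_nonneg (hW0 _) (sq_nonneg _)
  have Ib0 : 0 ≤ ∫ s, W s * ‖dMu Ψ (s, 0)‖ ^ 2 :=
    integral_nonneg fun p => mul_nonneg (hW0 _) (sq_nonneg _)
  have hw : Measurable fun s => ENNReal.ofReal (W s) := hW.measurable.ennreal_ofReal
  have key : ENNReal.ofReal (∫ p in {p | R ≤ p.2}, W p.1 * ‖Ψ p‖ ^ 2 ∂vol)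
      ≤ ENNReal.ofReal (2 * (potConst 2 B * (∫ p, W p.1 * ‖resid lam Ψ p‖ ^ 2 ∂vol)
        + boundaryConst 2 B * Real.exp (-R) * ∫ s, W s * ‖dMu Ψ (s, 0)‖ ^ 2)) := by
    rw [ofReal_integral_mul_sq (w := fun p : ℝ × ℝ => W p.1) (fun p => hW0 p.1) iΨ.integrableOn, ← lintegral_indicator mset,
      ENNReal.ofReal_mul (by norm_num), ENNReal.ofReal_add (by positivity) (by positivity),
      ENNReal.ofReal_mul hPC, ENNReal.ofReal_mul (by positivity),
      ofReal_integral_mul_sq (w := fun p : ℝ × ℝ => W p.1) (fun p => hW0 p.1) ig, ofReal_integral_mul_sq hW0 ib]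
    have hm1 : Measurable fun x : ℝ × ℝ => ENNReal.ofReal (W x.1) := hw.comp measurable_fst
    calc _ ≤ ∫⁻ x, 2 * (ENNReal.ofReal (W x.1) * ‖greenPot lam (resid lam Ψ) x‖ₑ ^ 2
          + {p : ℝ × ℝ | R ≤ p.2}.indicator (fun p => ENNReal.ofReal (W p.1)) x
            * ‖boundaryPot lam (fun s => dMu Ψ (s, 0)) x‖ₑ ^ 2) ∂vol := by
          refine lintegral_mono_ae ?_
          filter_upwards [ae_vol_pos] with x hx
          by_cases hR : R ≤ x.2
          · rw [indicator_of_mem (by exact hR), indicator_of_mem (by exact hR),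
              representation h ha.ne hx]
            calc _ ≤ ENNReal.ofReal (W x.1) * (2 * (‖greenPot lam (resid lam Ψ) x‖ₑ ^ 2
                  + ‖boundaryPot lam (fun s => dMu Ψ (s, 0)) x‖ₑ ^ 2)) := by
                  gcongr
                  exact enorm_sub_sq_le _ _
              _ = _ := by ring
          · rw [indicator_of_notMem (by exact hR)]
            exact zero_le
      _ ≤ 2 * ((∫⁻ x, ENNReal.ofReal (W x.1) * ‖greenPot lam (resid lam Ψ) x‖ₑ ^ 2 ∂vol)
          + ∫⁻ x, {p : ℝ × ℝ | R ≤ p.2}.indicator (fun p => ENNReal.ofReal (W p.1)) x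
            * ‖boundaryPot lam (fun s => dMu Ψ (s, 0)) x‖ₑ ^ 2 ∂vol) := by
          rw [lintegral_const_mul' _ _ (by norm_num)]
          rw [lintegral_add_left]
          exact hm1.mul ((measurable_greenPot lam cg.measurable).enorm.pow_const 2)
      _ ≤ _ := by
          rw [show ENNReal.ofReal 2 = 2 by simp]
          gcongr
          · refine lintegral_greenPot_le ha.le hm1 cg.measurable fun x y _ _ => ?_
            rw [← ENNReal.ofReal_mul (by positivity)]
            refine ENNReal.ofReal_le_ofReal ((hWe x.1 y.1).trans ?_)
            gcongr
            · exact hW0 _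
            · exact le_mul_of_one_le_right (Real.exp_nonneg _) (Real.one_le_exp (by positivity))
          · refine lintegral_boundaryPot_le ha.le hw cb.measurable fun s t => ?_
            rw [← ENNReal.ofReal_mul (Real.exp_nonneg _)]
            exact ENNReal.ofReal_le_ofReal (hWe s t)
  have := (ENNReal.ofReal_le_ofReal_iff (by positivity)).1 key
  refine this.trans ?_
  have he := Real.exp_pos (-R)
  unfold bulkConst
  nlinarith [mul_nonneg hPC (mul_nonneg he.le Ib0), mul_nonneg hBC Ig0]

section

/-! ### Weighted masses and energies -/

/-- The mass of `f` near `θ = Θ` at the scale `l`. -/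
def mass (l Θ : ℝ) (f : ℝ × ℝ → ℂ) : ℝ := ∫ p, sechSq l Θ p.1 * ‖f p‖ ^ 2 ∂vol

/-- The energy of `f` near `θ = Θ` at the scale `l`. -/
def energy (l Θ : ℝ) (f : ℝ × ℝ → ℂ) : ℝ := mass l Θ f + mass l Θ (covD f) + mass l Θ (dMu f)

/-- The mass of the normal derivative near `θ = Θ` at the scale `l`. -/
def traceMass (l Θ : ℝ) (f : ℝ × ℝ → ℂ) : ℝ := ∫ s, sechSq l Θ s * ‖dMu f (s, 0)‖ ^ 2

/-- The current near `θ = Θ` at the scale `l`. -/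
def currentMass (l Θ : ℝ) (f : ℝ × ℝ → ℂ) : ℝ :=
  ∫ p, sechSq l Θ p.1 * (conj (f p) * covD f p).im ∂vol

lemma mass_nonneg (l Θ : ℝ) (f : ℝ × ℝ → ℂ) : 0 ≤ mass l Θ f :=
  integral_nonneg fun _ => mul_nonneg (sechSq_pos _ _ _).le (sq_nonneg _)

lemma traceMass_nonneg (l Θ : ℝ) (f : ℝ × ℝ → ℂ) : 0 ≤ traceMass l Θ f :=
  integral_nonneg fun _ => mul_nonneg (sechSq_pos _ _ _).le (sq_nonneg _)

lemma mass_le_energy (l Θ : ℝ) (f : ℝ × ℝ → ℂ) : mass l Θ f ≤ energy l Θ f := by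
  unfold energy
  linarith [mass_nonneg l Θ (covD f), mass_nonneg l Θ (dMu f)]

lemma energy_nonneg (l Θ : ℝ) (f : ℝ × ℝ → ℂ) : 0 ≤ energy l Θ f :=
  (mass_nonneg l Θ f).trans (mass_le_energy l Θ f)

lemma fderiv_comp_fst {χ : ℝ → ℝ} (hχ : ContDiff ℝ ∞ χ) (p : ℝ × ℝ) :
    fderiv ℝ (fun p : ℝ × ℝ => χ p.1) p (1, 0) = deriv χ p.1 ∧
    fderiv ℝ (fun p : ℝ × ℝ => χ p.1) p (0, 1) = 0 := by
  have hd : DifferentiableAt ℝ χ p.1 := hχ.differentiable (by simp) p.1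
  have := hd.hasDerivAt.hasFDerivAt.comp p (hasFDerivAt_fst (𝕜 := ℝ) (p := p))
  have h2 : fderiv ℝ (fun p : ℝ × ℝ => χ p.1) p = _ := this.fderiv
  rw [h2]
  constructor <;> simp

variable {lam Λ B : ℝ} {Ψ : ℝ × ℝ → ℂ}

lemma norm_landau_le (hl : |lam| ≤ Λ) (f : ℝ × ℝ → ℂ) (p : ℝ × ℝ) :
    ‖landau f p‖ ≤ ‖resid lam f p‖ + Λ * ‖f p‖ := by
  have : landau f p = resid lam f p + lam * f p := by simp [resid]
  rw [this]
  refine (norm_add_le _ _).trans ?_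
  rw [norm_mul, Complex.norm_real, Real.norm_eq_abs]
  gcongr

/-- A cutoff in `θ` alone is allowed, since `Ψ` itself vanishes on the boundary. -/
lemma energy_theta_le (hl : |lam| ≤ Λ) (h : IsDirichlet Ψ) {χ : ℝ → ℝ} (hχ : ContDiff ℝ ∞ χ) :
    ∫ p, χ p.1 ^ 2 * (‖covD Ψ p‖ ^ 2 + ‖dMu Ψ p‖ ^ 2) ∂vol
      ≤ ∫ p, (((1 + 2 * Λ) * χ p.1 ^ 2 + 4 * deriv χ p.1 ^ 2) * ‖Ψ p‖ ^ 2
        + χ p.1 ^ 2 * ‖resid lam Ψ p‖ ^ 2) ∂vol := by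
  have hs := h.smooth
  have cχ := hχ.continuous
  have cχ' : Continuous (deriv χ) := hχ.continuous_deriv (by simp)
  have cΨ := hs.continuous
  have cL := (contDiff_landau hs).continuous
  have cg := (contDiff_resid lam hs).continuous
  have hz := h.eq_zero
  have he := energy_le (χ := fun p => χ p.1) (hχ.comp contDiff_fst) hs (Or.inr h.compact)
    (fun θ => Or.inr (h.zero θ))
  simp only [(fderiv_comp_fst hχ _).1, (fderiv_comp_fst hχ _).2] at he
  refine he.trans ?_
  have i1 : Integrable (fun p => χ p.1 ^ 2 * (‖Ψ p‖ * ‖landau Ψ p‖)) vol :=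
    integrable_of_tsupport h.compact (by fun_prop) fun p hp => by simp [hz p hp]
  have i2 : Integrable (fun p => (deriv χ p.1 ^ 2 + 0 ^ 2) * ‖Ψ p‖ ^ 2) vol :=
    integrable_of_tsupport h.compact (by fun_prop) fun p hp => by simp [hz p hp]
  rw [← integral_const_mul, ← integral_const_mul, ← integral_add (i1.const_mul 2) (i2.const_mul 4)]
  refine integral_mono ((i1.const_mul 2).add (i2.const_mul 4))
    (integrable_of_tsupport h.compact (by fun_prop) fun p hp => by
      simp [hz p hp, resid_eq_zero hp]) fun p => ?_
  have hL := norm_landau_le hl Ψ p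
  have e : ‖Ψ p‖ * ‖landau Ψ p‖ ≤ ‖Ψ p‖ * (‖resid lam Ψ p‖ + Λ * ‖Ψ p‖) := by gcongr
  have e2 : 2 * (‖Ψ p‖ * ‖landau Ψ p‖) ≤ (1 + 2 * Λ) * ‖Ψ p‖ ^ 2 + ‖resid lam Ψ p‖ ^ 2 := by
    nlinarith [sq_nonneg (‖Ψ p‖ - ‖resid lam Ψ p‖)]
  have e3 := mul_le_mul_of_nonneg_left e2 (sq_nonneg (χ p.1))
  simp only
  linarith

lemma IsDirichlet.integrable_mass (h : IsDirichlet Ψ) (l Θ : ℝ) {f : ℝ × ℝ → ℂ}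
    (hf : Continuous f) (h0 : ∀ p ∉ tsupport Ψ, f p = 0) :
    Integrable (fun p => sechSq l Θ p.1 * ‖f p‖ ^ 2) vol :=
  h.integrable_weight (continuous_sechSq l Θ) hf h0

/-- For `l ≥ 1` the derivative of `sech` is bounded by `sech`, so the term with the differentiated
cutoff adds only `4` to the coefficient `1 + 2Λ` of the mass; one more unit is the mass contained in
the energy. -/
lemma energy_le_mass (hl : |lam| ≤ Λ) (h : IsDirichlet Ψ) {l : ℝ} (hl1 : 1 ≤ l) (Θ : ℝ) :
    energy l Θ Ψ ≤ (6 + 2 * Λ) * mass l Θ Ψ + mass l Θ (resid lam Ψ) := by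
  have hs := h.smooth
  have hz := h.eq_zero
  have iΨ := h.integrable_mass l Θ hs.continuous hz
  have iD := h.integrable_mass l Θ (contDiff_covD hs).continuous fun p hp => covD_eq_zero hp
  have iP := h.integrable_mass l Θ (contDiff_dMu hs).continuous fun p hp => dMu_eq_zero hp
  have ig := h.integrable_mass l Θ (contDiff_resid lam hs).continuous
    fun p hp => resid_eq_zero (lam := lam) hp
  have he := energy_theta_le hl h (contDiff_sech l Θ)
  have e1 : ∫ p, sech l Θ p.1 ^ 2 * (‖covD Ψ p‖ ^ 2 + ‖dMu Ψ p‖ ^ 2) ∂vol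
      = mass l Θ (covD Ψ) + mass l Θ (dMu Ψ) := by
    rw [mass, mass, ← integral_add iD iP]
    congr 1 with p
    rw [sechSq]; ring
  have e2 : ∫ p, (((1 + 2 * Λ) * sech l Θ p.1 ^ 2 + 4 * deriv (sech l Θ) p.1 ^ 2) * ‖Ψ p‖ ^ 2
        + sech l Θ p.1 ^ 2 * ‖resid lam Ψ p‖ ^ 2) ∂vol
      ≤ (5 + 2 * Λ) * mass l Θ Ψ + mass l Θ (resid lam Ψ) := by
    rw [mass, mass, ← integral_const_mul, ← integral_add (iΨ.const_mul _) ig]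
    have cχ' : Continuous (deriv (sech l Θ)) := (contDiff_sech l Θ).continuous_deriv (by simp)
    have cχ := (contDiff_sech l Θ).continuous
    have cΨ := hs.continuous
    have cg := (contDiff_resid lam hs).continuous
    refine integral_mono (integrable_of_tsupport h.compact (by fun_prop) fun p hp => by
      simp [hz p hp, resid_eq_zero hp]) ((iΨ.const_mul _).add ig) fun p => ?_
    have hd := abs_deriv_sech_le (by linarith : 0 < l) Θ p.1
    have hp := sech_pos l Θ p.1
    have hd2 : |deriv (sech l Θ) p.1| ≤ sech l Θ p.1 :=
      hd.trans (mul_le_of_le_one_left hp.le ((div_le_one (by linarith)).2 hl1))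
    have hd3 : deriv (sech l Θ) p.1 ^ 2 ≤ sech l Θ p.1 ^ 2 := by
      rw [← sq_abs]; gcongr
    have := mul_le_mul_of_nonneg_right hd3 (sq_nonneg ‖Ψ p‖)
    simp only [sechSq]
    linarith
  rw [e1] at he
  unfold energy
  linarith

/-- The constant of `energy_le_trace`. -/
def traceConst (Λ B : ℝ) : ℝ := (6 + 2 * Λ) * bulkConst B + 1

lemma Admissible.nonneg (ha : Admissible Λ B lam) : 0 ≤ Λ := (abs_nonneg _).trans ha.abs_le

lemma one_le_traceConst (hΛ : 0 ≤ Λ) (B : ℝ) : 1 ≤ traceConst Λ B := by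
  have := bulkConst_nonneg B
  unfold traceConst
  have : 0 ≤ (6 + 2 * Λ) * bulkConst B := by positivity
  linarith

lemma bulk_sechSq_le (ha : Admissible Λ B lam) (h : IsDirichlet Ψ) {l : ℝ} (hl1 : 1 ≤ l)
    (Θ R : ℝ) : ∫ p in {p | R ≤ p.2}, sechSq l Θ p.1 * ‖Ψ p‖ ^ 2 ∂vol
      ≤ bulkConst B * (mass l Θ (resid lam Ψ) + Real.exp (-R) * traceMass l Θ Ψ) :=
  bulk_le ha h (continuous_sechSq l Θ) (fun s => (sechSq_pos l Θ s).le)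
    (fun s t => sechSq_le_exp_mul hl1 Θ s t) R

/-- The bulk bound at `R = 0` covers the whole half-plane: up to the source, all energy is generated
by the normal derivative on the boundary. -/
lemma energy_le_trace (ha : Admissible Λ B lam) (h : IsDirichlet Ψ) {l : ℝ} (hl1 : 1 ≤ l)
    (Θ : ℝ) :
    energy l Θ Ψ ≤ traceConst Λ B * (traceMass l Θ Ψ + mass l Θ (resid lam Ψ)) := by
  have h1 := energy_le_mass ha.abs_le h hl1 Θ
  have h2 := bulk_sechSq_le ha h hl1 Θ 0
  have e : ∫ p in {p | 0 ≤ p.2}, sechSq l Θ p.1 * ‖Ψ p‖ ^ 2 ∂vol = mass l Θ Ψ := by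
    have : vol.restrict {p | 0 ≤ p.2} = vol := by
      rw [vol, Measure.restrict_restrict (measurableSet_le measurable_const measurable_snd)]
      congr 1
      exact inter_eq_right.2 fun p (hp : 0 < p.2) => hp.le
    rw [this, mass]
  rw [e, neg_zero, Real.exp_zero, one_mul] at h2
  have h3 := traceMass_nonneg l Θ Ψ
  have h4 := mass_nonneg l Θ (resid lam Ψ)
  have hΛ := ha.nonneg
  have h5 := mul_le_mul_of_nonneg_left h2 (by positivity : 0 ≤ 6 + 2 * Λ)
  unfold traceConst
  linarith

lemma norm_re_conj_mul_le (a b : ℂ) : |(conj a * b).re| ≤ ‖a‖ * ‖b‖ := by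
  refine (Complex.abs_re_le_norm _).trans ?_
  rw [norm_mul, Complex.norm_conj]

lemma norm_im_conj_mul_le (a b : ℂ) : |(conj a * b).im| ≤ ‖a‖ * ‖b‖ := by
  refine (Complex.abs_im_le_norm _).trans ?_
  rw [norm_mul, Complex.norm_conj]

lemma continuous_re_conj_mul {f g : ℝ × ℝ → ℂ} (hf : Continuous f) (hg : Continuous g) :
    Continuous fun p => (conj (f p) * g p).re :=
  Complex.continuous_re.comp ((Complex.continuous_conj.comp hf).mul hg)

lemma continuous_im_conj_mul {f g : ℝ × ℝ → ℂ} (hf : Continuous f) (hg : Continuous g) :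
    Continuous fun p => (conj (f p) * g p).im :=
  Complex.continuous_im.comp ((Complex.continuous_conj.comp hf).mul hg)

/-- The momentum identity with `W = sechSq`. Since `M ≥ 1`, the weight satisfies `|W'| ≤ (2/L)W`, so
the term with `W'` is small for large `L`; the source term is split by Young's inequality with
factors `1/L` and `L`. -/
lemma half_traceMass_le (lam : ℝ) (h : IsDirichlet Ψ) {L M : ℝ} (hL : 1 ≤ L) (hM : 1 ≤ M) (Θ : ℝ) :
    1 / 2 * traceMass (L * M) Θ Ψ ≤ currentMass (L * M) Θ Ψ + 2 / L * energy (L * M) Θ Ψ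
      + L * mass (L * M) Θ (resid lam Ψ) := by
  have hs := h.smooth
  have hL0 : 0 < L := by linarith
  have hl : 0 < L * M := by positivity
  set l := L * M with hldef
  have hz := h.eq_zero
  have cW := continuous_sechSq l Θ
  have cW' : Continuous (deriv (sechSq l Θ)) := (contDiff_sechSq l Θ).continuous_deriv (by simp)
  have cΨ := hs.continuous
  have cD := (contDiff_covD hs).continuous
  have cP := (contDiff_dMu hs).continuous
  have cg := (contDiff_resid lam hs).continuous
  have iΨ := h.integrable_mass l Θ cΨ hz
  have iD := h.integrable_mass l Θ cD fun p hp => covD_eq_zero hp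
  have iP := h.integrable_mass l Θ cP fun p hp => dMu_eq_zero hp
  have ig := h.integrable_mass l Θ cg fun p hp => resid_eq_zero (lam := lam) hp
  have hm := momentum_identity h lam (contDiff_sechSq l Θ)
  have cPD := continuous_re_conj_mul cP cD
  have cPg := continuous_re_conj_mul cP cg
  have i1 : Integrable (fun p => deriv (sechSq l Θ) p.1 * (conj (dMu Ψ p) * covD Ψ p).re) vol :=
    integrable_of_tsupport h.compact ((cW'.comp continuous_fst).mul cPD) fun p hp => by
      simp [covD_eq_zero hp]
  have i2 : Integrable (fun p => sechSq l Θ p.1 * (conj (dMu Ψ p) * resid lam Ψ p).re) vol :=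
    integrable_of_tsupport h.compact ((cW.comp continuous_fst).mul cPg) fun p hp => by
      simp [resid_eq_zero hp]
  have b1 : - ∫ p, deriv (sechSq l Θ) p.1 * (conj (dMu Ψ p) * covD Ψ p).re ∂vol
      ≤ 1 / L * mass l Θ (covD Ψ) + 1 / L * mass l Θ (dMu Ψ) := by
    rw [mass, mass, ← integral_const_mul, ← integral_const_mul, ← integral_add (iD.const_mul _)
      (iP.const_mul _), ← integral_neg]
    refine integral_mono i1.neg ((iD.const_mul _).add (iP.const_mul _)) fun p => ?_
    have hd := abs_deriv_sechSq_le hl Θ p.1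
    have hn := norm_re_conj_mul_le (dMu Ψ p) (covD Ψ p)
    have hW := sechSq_pos l Θ p.1
    have hlL : 2 / l ≤ 2 / L := by
      gcongr
      rw [hldef]; nlinarith
    calc -(deriv (sechSq l Θ) p.1 * (conj (dMu Ψ p) * covD Ψ p).re)
        ≤ |deriv (sechSq l Θ) p.1| * |(conj (dMu Ψ p) * covD Ψ p).re| := by
          rw [← abs_mul]; exact neg_le_abs _
      _ ≤ (2 / L * sechSq l Θ p.1) * (‖dMu Ψ p‖ * ‖covD Ψ p‖) := by
          gcongr
          exact hd.trans (by gcongr)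
      _ = 1 / L * sechSq l Θ p.1 * (2 * (‖dMu Ψ p‖ * ‖covD Ψ p‖)) := by ring
      _ ≤ 1 / L * sechSq l Θ p.1 * (‖covD Ψ p‖ ^ 2 + ‖dMu Ψ p‖ ^ 2) := by
          gcongr
          nlinarith [sq_nonneg (‖dMu Ψ p‖ - ‖covD Ψ p‖)]
      _ = _ := by ring
  have b2 : ∫ p, sechSq l Θ p.1 * (conj (dMu Ψ p) * resid lam Ψ p).re ∂vol
      ≤ 1 / L * mass l Θ (dMu Ψ) + L * mass l Θ (resid lam Ψ) := by
    rw [mass, mass, ← integral_const_mul, ← integral_const_mul, ← integral_add (iP.const_mul _)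
      (ig.const_mul _)]
    refine integral_mono i2 ((iP.const_mul _).add (ig.const_mul _)) fun p => ?_
    have hn := norm_re_conj_mul_le (dMu Ψ p) (resid lam Ψ p)
    have hW := sechSq_pos l Θ p.1
    calc sechSq l Θ p.1 * (conj (dMu Ψ p) * resid lam Ψ p).re
        ≤ sechSq l Θ p.1 * (‖dMu Ψ p‖ * ‖resid lam Ψ p‖) := by
          gcongr
          exact (le_abs_self _).trans hn
      _ ≤ sechSq l Θ p.1 * (1 / L * ‖dMu Ψ p‖ ^ 2 + L * ‖resid lam Ψ p‖ ^ 2) := by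
          gcongr
          have h3 : 0 ≤ 1 / L * (‖dMu Ψ p‖ - L * ‖resid lam Ψ p‖) ^ 2 := by positivity
          have h4 : 1 / L * (‖dMu Ψ p‖ - L * ‖resid lam Ψ p‖) ^ 2
            = 1 / L * ‖dMu Ψ p‖ ^ 2 - 2 * (‖dMu Ψ p‖ * ‖resid lam Ψ p‖)
              + L * ‖resid lam Ψ p‖ ^ 2 := by field_simp; ring
          have h5 : 0 ≤ ‖dMu Ψ p‖ * ‖resid lam Ψ p‖ := by positivity
          linarith
      _ = _ := by ring
  have hΨ := mass_nonneg l Θ Ψ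
  have hD := mass_nonneg l Θ (covD Ψ)
  have h2L : 2 / L = 1 / L + 1 / L := by ring
  have hLi : 0 ≤ 1 / L := by positivity
  have e : 2 / L * energy l Θ Ψ = 2 / L * mass l Θ Ψ + 1 / L * mass l Θ (covD Ψ)
    + 1 / L * mass l Θ (covD Ψ) + 1 / L * mass l Θ (dMu Ψ) + 1 / L * mass l Θ (dMu Ψ) := by
    unfold energy; ring
  have := mul_nonneg hLi hD
  have : 0 ≤ 2 / L * mass l Θ Ψ := by positivity
  unfold traceMass currentMass
  linarith

/-- The length scale at which the edge current controls the energy. -/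
def scale (Λ B : ℝ) : ℝ := 8 * traceConst Λ B

lemma eight_le_scale (hΛ : 0 ≤ Λ) (B : ℝ) : 8 ≤ scale Λ B := by
  unfold scale; linarith [one_le_traceConst hΛ B]

/-- The scale is chosen so that `2/L` times `traceConst` equals `1/4`. Half the trace dominates this
quarter, which is absorbed on the left. The current on the right carries its sign: edge transport is
one-directional. -/
lemma traceMass_le_current (ha : Admissible Λ B lam) (h : IsDirichlet Ψ) {M : ℝ} (hM : 1 ≤ M)
    (Θ : ℝ) : traceMass (scale Λ B * M) Θ Ψ ≤ 4 * currentMass (scale Λ B * M) Θ Ψ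
      + 4 * (1 + scale Λ B) * mass (scale Λ B * M) Θ (resid lam Ψ) := by
  have hL := eight_le_scale ha.nonneg B
  have h1 := half_traceMass_le lam h (by linarith : 1 ≤ scale Λ B) hM Θ
  have h2 := energy_le_trace ha h (by nlinarith : 1 ≤ scale Λ B * M) Θ
  have hC := one_le_traceConst ha.nonneg B
  have h3 := mul_le_mul_of_nonneg_left h2 (by positivity : 0 ≤ 2 / scale Λ B)
  have e : 2 / scale Λ B * (traceConst Λ B * (traceMass (scale Λ B * M) Θ Ψ
      + mass (scale Λ B * M) Θ (resid lam Ψ)))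
      = 1 / 4 * (traceMass (scale Λ B * M) Θ Ψ + mass (scale Λ B * M) Θ (resid lam Ψ)) := by
    rw [show (2 : ℝ) / scale Λ B = 1 / 4 / traceConst Λ B by unfold scale; field_simp; norm_num]
    field_simp
  rw [e] at h3
  have := mass_nonneg (scale Λ B * M) Θ (resid lam Ψ)
  linarith

lemma currentMass_le_energy (h : IsDirichlet Ψ) (l Θ : ℝ) :
    currentMass l Θ Ψ ≤ 1 / 2 * energy l Θ Ψ := by
  have hs := h.smooth
  have hz := h.eq_zero
  have cW := continuous_sechSq l Θ
  have cΨ := hs.continuous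
  have cD := (contDiff_covD hs).continuous
  have iΨ := h.integrable_mass l Θ cΨ hz
  have iD := h.integrable_mass l Θ cD fun p hp => covD_eq_zero hp
  have : currentMass l Θ Ψ ≤ 1 / 2 * mass l Θ Ψ + 1 / 2 * mass l Θ (covD Ψ) := by
    rw [currentMass, mass, mass, ← integral_const_mul, ← integral_const_mul,
      ← integral_add (iΨ.const_mul _) (iD.const_mul _)]
    refine integral_mono (integrable_of_tsupport h.compact ((cW.comp continuous_fst).mul
      (continuous_im_conj_mul cΨ cD)) fun p hp => by simp [hz p hp])
      ((iΨ.const_mul _).add (iD.const_mul _)) fun p => ?_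
    have hn := (le_abs_self _).trans (norm_im_conj_mul_le (Ψ p) (covD Ψ p))
    have hW := sechSq_pos l Θ p.1
    calc _ ≤ sechSq l Θ p.1 * (‖Ψ p‖ * ‖covD Ψ p‖) := by gcongr
      _ ≤ sechSq l Θ p.1 * (1 / 2 * ‖Ψ p‖ ^ 2 + 1 / 2 * ‖covD Ψ p‖ ^ 2) := by
          gcongr
          nlinarith [sq_nonneg (‖Ψ p‖ - ‖covD Ψ p‖)]
      _ = _ := by ring
  have := mass_nonneg l Θ (dMu Ψ)
  unfold energy
  linarith

end

section

/-! ### A smooth cutoff function -/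

/-- A smooth even bump function, equal to `1` on `[-1, 1]` and to `0` outside `(-2, 2)`. -/
def cutoffBump : ContDiffBump (0 : ℝ) := ⟨1, 2, one_pos, one_lt_two⟩

/-- A smooth function, equal to `1` on `[-1, 1]` and to `0` outside `(-2, 2)`. -/
def cutoff (x : ℝ) : ℝ := cutoffBump x

lemma contDiff_cutoff : ContDiff ℝ ∞ cutoff := cutoffBump.contDiff

lemma cutoff_nonneg (x : ℝ) : 0 ≤ cutoff x := cutoffBump.nonneg

lemma cutoff_le_one (x : ℝ) : cutoff x ≤ 1 := cutoffBump.le_one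

lemma cutoff_eq_one {x : ℝ} (hx : |x| ≤ 1) : cutoff x = 1 :=
  cutoffBump.one_of_mem_closedBall (by
    change x ∈ Metric.closedBall 0 1; simpa using hx)

lemma cutoff_eq_zero {x : ℝ} (hx : 2 ≤ |x|) : cutoff x = 0 :=
  cutoffBump.zero_of_le_dist (by change 2 ≤ dist x 0; simpa using hx)

lemma hasCompactSupport_cutoff : HasCompactSupport cutoff := cutoffBump.hasCompactSupport

/-- The endpoints `|x| = 2` are included because the minimal value `0` is attained there. -/
lemma deriv_cutoff_eq_zero {x : ℝ} (hx : 2 ≤ |x|) : deriv cutoff x = 0 := by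
  have hmin : IsLocalMin cutoff x := Eventually.of_forall fun y => by
    rw [cutoff_eq_zero hx]; exact cutoff_nonneg y
  exact hmin.deriv_eq_zero

lemma exists_cutoff_bound : ∃ c : ℝ, (∀ x, |deriv cutoff x| ≤ c) ∧ ∀ x, |deriv (deriv cutoff) x| ≤ c := by
  have h1 : ContDiff ℝ ∞ (deriv cutoff) :=
    (contDiff_infty_iff_deriv.1 contDiff_cutoff).2
  obtain ⟨c, hc⟩ := h1.continuous.bounded_above_of_compact_support hasCompactSupport_cutoff.deriv
  obtain ⟨d, hd⟩ := (h1.continuous_deriv (by simp)).bounded_above_of_compact_support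
    hasCompactSupport_cutoff.deriv.deriv
  exact ⟨max c d, fun x => (hc x).trans (le_max_left _ _), fun x => (hd x).trans (le_max_right _ _)⟩

/-- A bound for the first two derivatives of `cutoff`. -/
def cutoffBound : ℝ := exists_cutoff_bound.choose

lemma abs_deriv_cutoff_le (x : ℝ) : |deriv cutoff x| ≤ cutoffBound :=
  exists_cutoff_bound.choose_spec.1 x

lemma abs_deriv_deriv_cutoff_le (x : ℝ) : |deriv (deriv cutoff) x| ≤ cutoffBound :=
  exists_cutoff_bound.choose_spec.2 x

lemma cutoffBound_nonneg : 0 ≤ cutoffBound := (abs_nonneg _).trans (abs_deriv_cutoff_le 0)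

/-! ### The edge current -/

/-- The strip `{|θ| < r}`. -/
def strip (r : ℝ) : Set (ℝ × ℝ) := {p | |p.1| < r}

lemma measurableSet_strip (r : ℝ) : MeasurableSet (strip r) :=
  measurableSet_lt (by fun_prop) measurable_const

variable {lam Λ B : ℝ} {Ψ : ℝ × ℝ → ℂ}

lemma integral_mul_flux (h : IsDirichlet Ψ) {W : ℝ → ℝ} (hW : Continuous W) :
    Integrable (fun θ => W θ * flux Ψ θ) ∧
    ∫ θ, W θ * flux Ψ θ = ∫ p, W p.1 * (conj (Ψ p) * covD Ψ p).im ∂vol := by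
  have cΨ := h.smooth.continuous
  have cD := (contDiff_covD h.smooth).continuous
  have hi : Integrable (fun p => W p.1 * (conj (Ψ p) * covD Ψ p).im) vol :=
    integrable_of_tsupport h.compact ((hW.comp continuous_fst).mul (continuous_im_conj_mul cΨ cD))
      fun p hp => by simp [covD_eq_zero hp]
  rw [vol_eq_prod] at hi ⊢
  have e : (fun θ => W θ * flux Ψ θ) = fun θ => ∫ μ in Ioi (0 : ℝ),
      W θ * (conj (Ψ (θ, μ)) * covD Ψ (θ, μ)).im := by
    ext θ; rw [flux, integral_const_mul]
  rw [integral_prod _ hi, e]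
  exact ⟨hi.integral_prod_left, rfl⟩

lemma setIntegral_strip {F : ℝ × ℝ → ℝ} (hF : Integrable F vol) (r : ℝ) :
    ∫ p in strip r, F p ∂vol = ∫ θ in {θ : ℝ | |θ| < r}, ∫ μ in Ioi (0 : ℝ), F (θ, μ) := by
  have : strip r = {θ : ℝ | |θ| < r} ×ˢ univ := by ext p; simp [strip]
  rw [vol_eq_prod] at hF ⊢
  rw [this, setIntegral_prod _ hF.integrableOn]
  simp

/-- Conservation of the current: the interval between `y` and `x` lies in the strip of half-width
`|x| + r`, whatever the order of the two points. -/
lemma flux_le_flux_add (lam : ℝ) (h : IsDirichlet Ψ) {r x y : ℝ} (hy : |y| < r) :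
    flux Ψ x ≤ flux Ψ y + ∫ p in strip (|x| + r), ‖Ψ p‖ * ‖resid lam Ψ p‖ ∂vol := by
  have cΨ := h.smooth.continuous
  have cg := (contDiff_resid lam h.smooth).continuous
  have cI := continuous_im_conj_mul cΨ cg
  have i1 : Integrable (fun p => ‖Ψ p‖ * ‖resid lam Ψ p‖) vol :=
    integrable_of_tsupport h.compact (by fun_prop) fun p hp => by simp [resid_eq_zero hp]
  have hc : HasCompactSupport fun p => (conj (Ψ p) * resid lam Ψ p).im :=
    hasCompactSupport_of_tsupport h.compact fun p hp => by simp [resid_eq_zero hp]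
  have hc2 : HasCompactSupport fun p => ‖Ψ p‖ * ‖resid lam Ψ p‖ :=
    hasCompactSupport_of_tsupport h.compact fun p hp => by simp [resid_eq_zero hp]
  have hf := flux_sub_flux h lam x y
  have i2 : Integrable fun θ => ∫ μ in Ioi (0 : ℝ), ‖Ψ (θ, μ)‖ * ‖resid lam Ψ (θ, μ)‖ := by
    rw [vol_eq_prod] at i1
    exact i1.integral_prod_left
  have hq : ∀ θ, |∫ μ in Ioi (0 : ℝ), (conj (Ψ (θ, μ)) * resid lam Ψ (θ, μ)).im|
      ≤ ∫ μ in Ioi (0 : ℝ), ‖Ψ (θ, μ)‖ * ‖resid lam Ψ (θ, μ)‖ := fun θ => by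
    rw [← Real.norm_eq_abs]
    exact norm_integral_le_of_norm_le (integrable_slice_snd (by fun_prop) hc2 θ)
      (Eventually.of_forall fun μ => norm_im_conj_mul_le _ _)
  rw [setIntegral_strip i1]
  have hb : |∫ θ in y..x, ∫ μ in Ioi (0 : ℝ), (conj (Ψ (θ, μ)) * resid lam Ψ (θ, μ)).im|
      ≤ ∫ θ in {θ : ℝ | |θ| < |x| + r}, ∫ μ in Ioi (0 : ℝ), ‖Ψ (θ, μ)‖ * ‖resid lam Ψ (θ, μ)‖ := by
    rw [← Real.norm_eq_abs, intervalIntegral.norm_integral_eq_norm_integral_uIoc]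
    refine (norm_integral_le_of_norm_le i2.integrableOn (Eventually.of_forall hq)).trans ?_
    refine setIntegral_mono_set i2.integrableOn (Eventually.of_forall fun θ =>
      integral_nonneg fun μ => by positivity) (LE.le.eventuallyLE fun θ hθ => ?_)
    have hθ' := uIoc_subset_uIcc hθ
    have h1 := abs_le.1 (le_refl |x|)
    have h2 := abs_lt.1 hy
    have h3 := abs_nonneg x
    have h4 := abs_nonneg y
    rw [mem_uIcc] at hθ'
    change |θ| < |x| + r
    rw [abs_lt]
    rcases hθ' with hθ' | hθ' <;> constructor <;> linarith [hθ'.1, hθ'.2, h1.1, h1.2, h2.1, h2.2]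
  have := abs_le.1 hb
  linarith [this.1]

/-! ### Local masses from weighted masses -/

lemma measurable_slice_lintegral {f : ℝ × ℝ → ℂ} (hf : Continuous f) :
    Measurable fun θ => ∫⁻ μ in Ioi (0 : ℝ), ‖f (θ, μ)‖ₑ ^ 2 :=
  Measurable.lintegral_prod_right' (f := fun p : ℝ × ℝ => ‖f p‖ₑ ^ 2) (hf.measurable.enorm.pow_const 2)

lemma lintegral_vol_weight {f : ℝ × ℝ → ℂ} (hf : Measurable f) {w : ℝ → ℝ≥0∞} (hw : Measurable w) :
    ∫⁻ p, w p.1 * ‖f p‖ₑ ^ 2 ∂vol = ∫⁻ θ, w θ * ∫⁻ μ in Ioi (0 : ℝ), ‖f (θ, μ)‖ₑ ^ 2 := by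
  rw [vol_eq_prod, lintegral_prod]
  · congr 1 with θ
    have hm : Measurable fun μ => ‖f (θ, μ)‖ₑ ^ 2 :=
      (hf.comp measurable_prodMk_left).enorm.pow_const 2
    exact lintegral_const_mul (w θ) hm
  · exact ((hw.comp measurable_fst).mul (hf.enorm.pow_const 2)).aemeasurable

lemma setLIntegral_strip {f : ℝ × ℝ → ℂ} (hf : Measurable f) (r : ℝ) :
    ∫⁻ p in strip r, ‖f p‖ₑ ^ 2 ∂vol
      = ∫⁻ θ in {θ : ℝ | |θ| < r}, ∫⁻ μ in Ioi (0 : ℝ), ‖f (θ, μ)‖ₑ ^ 2 := by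
  have hm : MeasurableSet {θ : ℝ | |θ| < r} := measurableSet_lt (by fun_prop) measurable_const
  have h := lintegral_vol_weight hf (w := {θ : ℝ | |θ| < r}.indicator 1)
    (measurable_one.indicator hm)
  rw [← lintegral_indicator (measurableSet_strip r), ← lintegral_indicator hm]
  refine (lintegral_congr fun p => ?_).trans (h.trans (lintegral_congr fun θ => ?_))
  · by_cases hp : |p.1| < r <;> simp [indicator, strip, hp]
  · by_cases hp : |θ| < r <;> simp [indicator, hp]

/-- `lintegral_strip_le` in the form used below: a strip of half-width `|x| + 2M` costs one power of
growth more than a single weighted mass. -/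
lemma integral_strip_le (h : IsDirichlet Ψ) {f : ℝ × ℝ → ℂ} (hf : Continuous f)
    (h0 : ∀ p ∉ tsupport Ψ, f p = 0) {L M K : ℝ} (hL : 1 ≤ L) (hM : 0 < M) (hK : 0 ≤ K) (k : ℕ)
    (hb : ∀ Θ, mass (L * M) Θ f ≤ M * K * growth M Θ ^ k) (x : ℝ) :
    ∫ p in strip (|x| + 2 * M), ‖f p‖ ^ 2 ∂vol ≤ 12 * 4 ^ k * M * K * growth M x ^ (k + 1) := by
  have hg := one_le_growth M x
  have hi : Integrable (fun p => 1 * ‖f p‖ ^ 2) vol :=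
    h.integrable_weight (W := fun _ => 1) continuous_const hf h0
  have := ofReal_integral_mul_sq (w := fun _ : ℝ × ℝ => 1) (fun _ => zero_le_one)
    (hi.integrableOn (s := strip (|x| + 2 * M)))
  simp only [one_mul, ENNReal.ofReal_one] at this
  rw [← ENNReal.ofReal_le_ofReal_iff (by positivity), this, setLIntegral_strip hf.measurable]
  refine lintegral_strip_le hL hM hK k (measurable_slice_lintegral hf) (fun Θ => ?_) x
  rw [← lintegral_vol_weight hf.measurable (continuous_sechSq _ _).measurable.ennreal_ofReal,
    ← ofReal_integral_mul_sq (w := fun p : ℝ × ℝ => sechSq (L * M) Θ p.1)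
      (fun p => (sechSq_pos _ _ _).le) (h.integrable_mass _ _ hf h0)]
  exact ENNReal.ofReal_le_ofReal (hb Θ)

end

section

variable {lam Λ B : ℝ} {Ψ : ℝ × ℝ → ℂ}

/-! ### Bounds for the current -/

/-- The constant of `flux_le`. -/
def currentConst (Λ : ℝ) : ℝ := 1 + Λ + 2 * cutoffBound ^ 2

lemma hasDerivAt_cutoff_div (M y : ℝ) :
    HasDerivAt (fun y => cutoff (y / M)) (deriv cutoff (y / M) / M) y := by
  have h1 : HasDerivAt (fun t : ℝ => t / M) (1 / M) y := (hasDerivAt_id y).div_const M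
  have h2 := ((contDiff_cutoff.differentiable (by simp)) (y / M)).hasDerivAt.comp y h1
  refine h2.congr_deriv (by ring)

/-- The current at one `y` is not controlled by masses, but its average over `|y| < 2M` is, by the
energy estimate. Averaging the conservation law in `y` therefore bounds the current at any `x` by
the mass near `0` and the injected current. -/
lemma flux_le (hl : |lam| ≤ Λ) (h : IsDirichlet Ψ) {M : ℝ} (hM : 1 ≤ M) (x : ℝ) :
    flux Ψ x ≤ currentConst Λ / M * ((∫ p in strip (2 * M), ‖Ψ p‖ ^ 2 ∂vol)
        + ∫ p in strip (2 * M), ‖resid lam Ψ p‖ ^ 2 ∂vol)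
      + ∫ p in strip (|x| + 2 * M), ‖Ψ p‖ * ‖resid lam Ψ p‖ ∂vol := by
  have hM0 : 0 < M := by linarith
  have hΛ : 0 ≤ Λ := (abs_nonneg _).trans hl
  have hs := h.smooth
  have cΨ := hs.continuous
  have cD := (contDiff_covD hs).continuous
  have cg := (contDiff_resid lam hs).continuous
  have hz := h.eq_zero
  set χ : ℝ → ℝ := fun y => cutoff (y / M) with hχ
  set T := ∫ p in strip (|x| + 2 * M), ‖Ψ p‖ * ‖resid lam Ψ p‖ ∂vol with hT
  have sχ : ContDiff ℝ ∞ χ := contDiff_cutoff.comp (contDiff_id.div_const M)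
  have cχ := sχ.continuous
  have cχ' : Continuous (deriv χ) := sχ.continuous_deriv (by simp)
  have hχ0 : ∀ y, 2 * M ≤ |y| → χ y = 0 := fun y hy => cutoff_eq_zero (by
    rw [abs_div, abs_of_pos hM0, le_div_iff₀ hM0]; exact hy)
  have hχ'0 : ∀ y, 2 * M ≤ |y| → deriv χ y = 0 := fun y hy => by
    rw [(hasDerivAt_cutoff_div M y).deriv, deriv_cutoff_eq_zero, zero_div]
    rw [abs_div, abs_of_pos hM0, le_div_iff₀ hM0]; exact hy
  have hχ'b : ∀ y, deriv χ y ^ 2 ≤ cutoffBound ^ 2 := fun y => by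
    rw [(hasDerivAt_cutoff_div M y).deriv, ← sq_abs, abs_div, abs_of_pos hM0]
    gcongr
    exact (div_le_self (abs_nonneg _) hM).trans (abs_deriv_cutoff_le _)
  have hχ2 : ∀ y, χ y ^ 2 ≤ 1 := fun y => pow_le_one₀ (cutoff_nonneg _) (cutoff_le_one _)
  have hcs : HasCompactSupport fun y => χ y ^ 2 :=
    HasCompactSupport.intro (isCompact_Icc (a := -(2 * M)) (b := 2 * M)) fun y hy => by
      rw [hχ0 y, zero_pow two_ne_zero]
      by_contra hlt
      exact hy (abs_le.1 (not_le.1 hlt).le)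
  have iχ : Integrable fun y => χ y ^ 2 := (cχ.pow 2).integrable_of_hasCompactSupport hcs
  have hI : 2 * M ≤ ∫ y, χ y ^ 2 := by
    calc 2 * M = ∫ y in Icc (-M) M, (1 : ℝ) := by
          rw [setIntegral_const, smul_eq_mul, mul_one, Real.volume_real_Icc_of_le (by linarith)]; ring
      _ ≤ ∫ y in Icc (-M) M, χ y ^ 2 := by
          refine setIntegral_mono_on (integrableOn_const (by simp)) iχ.integrableOn measurableSet_Icc
            fun y hy => ?_
          rw [hχ]
          simp only
          rw [cutoff_eq_one, one_pow]
          rw [abs_div, abs_of_pos hM0, div_le_one hM0]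
          exact abs_le.2 hy
      _ ≤ _ := setIntegral_le_integral iχ (Eventually.of_forall fun y => sq_nonneg _)
  obtain ⟨iF, eF⟩ := integral_mul_flux h (W := fun y => χ y ^ 2) (cχ.pow 2)
  -- The conservation law is multiplied by `χ(y)²`, which vanishes outside `|y| < 2M`, and
  -- integrated in `y`.
  have hav : flux Ψ x * (∫ y, χ y ^ 2) ≤ (∫ y, χ y ^ 2 * flux Ψ y) + T * ∫ y, χ y ^ 2 := by
    rw [← integral_const_mul, ← integral_const_mul, ← integral_add iF (iχ.const_mul T)]
    refine integral_mono (iχ.const_mul _) (iF.add (iχ.const_mul T)) fun y => ?_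
    simp only
    by_cases hy : |y| < 2 * M
    · have := mul_le_mul_of_nonneg_left (flux_le_flux_add lam h (x := x) hy) (sq_nonneg (χ y))
      linarith
    · rw [hχ0 y (not_lt.1 hy)]; simp
  have iD : Integrable (fun p => χ p.1 ^ 2 * ‖covD Ψ p‖ ^ 2) vol :=
    h.integrable_weight (cχ.pow 2) cD fun p hp => covD_eq_zero hp
  have iP : Integrable (fun p => χ p.1 ^ 2 * ‖dMu Ψ p‖ ^ 2) vol :=
    h.integrable_weight (cχ.pow 2) (contDiff_dMu hs).continuous fun p hp => dMu_eq_zero hp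
  have i1 := h.integrable_sq cΨ hz
  have i2 := h.integrable_sq cg fun p hp => resid_eq_zero hp
  have he := energy_theta_le hl h sχ
  have iE : Integrable (fun p => ((1 + 2 * Λ) * χ p.1 ^ 2 + 4 * deriv χ p.1 ^ 2) * ‖Ψ p‖ ^ 2
      + χ p.1 ^ 2 * ‖resid lam Ψ p‖ ^ 2) vol :=
    integrable_of_tsupport h.compact (by fun_prop) fun p hp => by simp [hz p hp, resid_eq_zero hp]
  have iχΨ : Integrable (fun p => χ p.1 ^ 2 * ‖Ψ p‖ ^ 2) vol := h.integrable_weight (cχ.pow 2) cΨ hz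
  have hY : ∫ y, χ y ^ 2 * flux Ψ y ≤ currentConst Λ * ((∫ p in strip (2 * M), ‖Ψ p‖ ^ 2 ∂vol)
        + ∫ p in strip (2 * M), ‖resid lam Ψ p‖ ^ 2 ∂vol) := by
    rw [eF]
    calc ∫ p, χ p.1 ^ 2 * (conj (Ψ p) * covD Ψ p).im ∂vol
        ≤ ∫ p, (1 / 2 * (χ p.1 ^ 2 * ‖Ψ p‖ ^ 2)
          + 1 / 2 * (χ p.1 ^ 2 * (‖covD Ψ p‖ ^ 2 + ‖dMu Ψ p‖ ^ 2))) ∂vol := by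
          refine integral_mono (integrable_of_tsupport h.compact
            (((cχ.pow 2).comp continuous_fst).mul (continuous_im_conj_mul cΨ cD))
            fun p hp => by simp [hz p hp]) ((iχΨ.const_mul _).add (Integrable.const_mul
              ((iD.add iP).congr (Eventually.of_forall fun p => by simp; ring)) _)) fun p => ?_
          have hn := (le_abs_self _).trans (norm_im_conj_mul_le (Ψ p) (covD Ψ p))
          have h2 : (conj (Ψ p) * covD Ψ p).im
              ≤ 1 / 2 * ‖Ψ p‖ ^ 2 + 1 / 2 * (‖covD Ψ p‖ ^ 2 + ‖dMu Ψ p‖ ^ 2) := by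
            nlinarith [sq_nonneg (‖Ψ p‖ - ‖covD Ψ p‖), sq_nonneg ‖dMu Ψ p‖]
          have := mul_le_mul_of_nonneg_left h2 (sq_nonneg (χ p.1))
          simp only
          linarith
      _ = 1 / 2 * (∫ p, χ p.1 ^ 2 * ‖Ψ p‖ ^ 2 ∂vol)
          + 1 / 2 * ∫ p, χ p.1 ^ 2 * (‖covD Ψ p‖ ^ 2 + ‖dMu Ψ p‖ ^ 2) ∂vol := by
          rw [integral_add (iχΨ.const_mul _) (Integrable.const_mul
              ((iD.add iP).congr (Eventually.of_forall fun p => by simp; ring)) _),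
            integral_const_mul, integral_const_mul]
      _ ≤ 1 / 2 * (∫ p, χ p.1 ^ 2 * ‖Ψ p‖ ^ 2 ∂vol)
          + 1 / 2 * ∫ p, (((1 + 2 * Λ) * χ p.1 ^ 2 + 4 * deriv χ p.1 ^ 2) * ‖Ψ p‖ ^ 2
            + χ p.1 ^ 2 * ‖resid lam Ψ p‖ ^ 2) ∂vol := by gcongr
      _ = ∫ p, (1 / 2 * (χ p.1 ^ 2 * ‖Ψ p‖ ^ 2)
          + 1 / 2 * (((1 + 2 * Λ) * χ p.1 ^ 2 + 4 * deriv χ p.1 ^ 2) * ‖Ψ p‖ ^ 2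
            + χ p.1 ^ 2 * ‖resid lam Ψ p‖ ^ 2)) ∂vol := by
          rw [integral_add (iχΨ.const_mul _) (iE.const_mul _), integral_const_mul,
            integral_const_mul]
      _ ≤ ∫ p, (strip (2 * M)).indicator
          (fun p => currentConst Λ * (‖Ψ p‖ ^ 2 + ‖resid lam Ψ p‖ ^ 2)) p ∂vol := by
          refine integral_mono ((iχΨ.const_mul _).add (iE.const_mul _))
            (((i1.add i2).const_mul _).indicator (measurableSet_strip _)) fun p => ?_
          simp only
          by_cases hp : |p.1| < 2 * M
          · rw [indicator_of_mem (by exact hp)]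
            have a1 := mul_le_mul_of_nonneg_right (hχ2 p.1) (sq_nonneg ‖Ψ p‖)
            have a2 := mul_le_mul_of_nonneg_right (hχ'b p.1) (sq_nonneg ‖Ψ p‖)
            have a3 := mul_le_mul_of_nonneg_right (hχ2 p.1) (sq_nonneg ‖resid lam Ψ p‖)
            have a4 := mul_le_mul_of_nonneg_left a1 hΛ
            have a5 : 0 ≤ (Λ + 2 * cutoffBound ^ 2) * ‖resid lam Ψ p‖ ^ 2 := by positivity
            have a6 := sq_nonneg ‖resid lam Ψ p‖
            unfold currentConst
            linarith
          · rw [indicator_of_notMem (by exact hp), hχ0 _ (not_lt.1 hp), hχ'0 _ (not_lt.1 hp)]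
            simp
      _ = _ := by
          rw [integral_indicator (measurableSet_strip _), integral_const_mul,
            integral_add i1.integrableOn i2.integrableOn]
  have hX0 : 0 ≤ currentConst Λ * ((∫ p in strip (2 * M), ‖Ψ p‖ ^ 2 ∂vol)
        + ∫ p in strip (2 * M), ‖resid lam Ψ p‖ ^ 2 ∂vol) := by
    unfold currentConst
    have : 0 ≤ ∫ p in strip (2 * M), ‖Ψ p‖ ^ 2 ∂vol := integral_nonneg fun _ => sq_nonneg _
    have : 0 ≤ ∫ p in strip (2 * M), ‖resid lam Ψ p‖ ^ 2 ∂vol := integral_nonneg fun _ => sq_nonneg _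
    positivity
  set X := currentConst Λ * ((∫ p in strip (2 * M), ‖Ψ p‖ ^ 2 ∂vol)
        + ∫ p in strip (2 * M), ‖resid lam Ψ p‖ ^ 2 ∂vol) with hX
  set I := ∫ y, χ y ^ 2 with hIdef
  have hIM : M ≤ I := by linarith
  rw [div_mul_eq_mul_div, ← hX]
  have h1 : (flux Ψ x - T) * I ≤ X := by linarith
  have h2 : flux Ψ x - T ≤ X / M := by
    rw [le_div_iff₀ hM0]
    -- Replacing the integral `I` by its lower bound `M` is legitimate for a nonnegative left side;
    -- otherwise the claim is trivial.
    rcases le_total (flux Ψ x - T) 0 with h3 | h3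
    · nlinarith
    · exact (mul_le_mul_of_nonneg_left hIM h3).trans h1
  linarith

/-- This is where `m` becomes `m + 1`. On the strip the masses of `Ψ` and of the source grow with
exponents `2m + 3` and `2m + 1`, so their geometric mean grows with exponent `2m + 2`. The parameter
`κ` makes the contribution of `Ψ` as small as desired. -/
lemma integral_strip_mul_le (h : IsDirichlet Ψ) {L M K S κ : ℝ} (hL : 1 ≤ L) (hM : 0 < M)
    (hK : 0 ≤ K) (hS : 0 ≤ S) (hκ : 0 < κ) (m : ℕ)
    (hΨ : ∀ Θ, mass (L * M) Θ Ψ ≤ M * S * growth M Θ ^ (2 * m + 2))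
    (hg : ∀ Θ, mass (L * M) Θ (resid lam Ψ) ≤ M * K * growth M Θ ^ (2 * m)) (x : ℝ) :
    ∫ p in strip (|x| + 2 * M), ‖Ψ p‖ * ‖resid lam Ψ p‖ ∂vol
      ≤ 12 * 4 ^ (2 * m + 2) * (κ * S + M ^ 2 * K / κ) * growth M x ^ (2 * m + 2) := by
  have cΨ := h.smooth.continuous
  have cg := (contDiff_resid lam h.smooth).continuous
  have hz := h.eq_zero
  have h1 := integral_strip_le h cΨ hz hL hM hS (2 * m + 2) hΨ x
  have h2 := integral_strip_le h cg (fun p hp => resid_eq_zero hp) hL hM hK (2 * m) hg x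
  have hw := one_le_growth M x
  set w := growth M x with hwdef
  have hw0 : 0 < w := by linarith
  -- Young's inequality with a weight that depends on `x`, so that both products carry the same
  -- power of growth.
  set s := κ / (M * w) with hs
  have hs0 : 0 < s := by positivity
  have i1 := h.integrable_sq cΨ hz
  have i2 := h.integrable_sq cg fun p hp => resid_eq_zero hp
  have i3 : Integrable (fun p => ‖Ψ p‖ * ‖resid lam Ψ p‖) vol :=
    integrable_of_tsupport h.compact (by fun_prop) fun p hp => by simp [hz p hp]
  calc ∫ p in strip (|x| + 2 * M), ‖Ψ p‖ * ‖resid lam Ψ p‖ ∂vol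
      ≤ ∫ p in strip (|x| + 2 * M), (s * ‖Ψ p‖ ^ 2 + s⁻¹ * ‖resid lam Ψ p‖ ^ 2) ∂vol := by
        refine integral_mono i3.integrableOn
          ((i1.integrableOn.const_mul _).add (i2.integrableOn.const_mul _)) fun p => ?_
        have a1 : 0 ≤ s⁻¹ * (s * ‖Ψ p‖ - ‖resid lam Ψ p‖) ^ 2 := by positivity
        have a2 : s⁻¹ * (s * ‖Ψ p‖ - ‖resid lam Ψ p‖) ^ 2 = s * ‖Ψ p‖ ^ 2
          - 2 * (‖Ψ p‖ * ‖resid lam Ψ p‖) + s⁻¹ * ‖resid lam Ψ p‖ ^ 2 := by field_simp; ring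
        have a3 : 0 ≤ ‖Ψ p‖ * ‖resid lam Ψ p‖ := by positivity
        simp only
        linarith
    _ = s * (∫ p in strip (|x| + 2 * M), ‖Ψ p‖ ^ 2 ∂vol)
        + s⁻¹ * ∫ p in strip (|x| + 2 * M), ‖resid lam Ψ p‖ ^ 2 ∂vol := by
        rw [integral_add (i1.integrableOn.const_mul _) (i2.integrableOn.const_mul _),
          integral_const_mul, integral_const_mul]
    _ ≤ s * (12 * 4 ^ (2 * m + 2) * M * S * w ^ (2 * m + 2 + 1))
        + s⁻¹ * (12 * 4 ^ (2 * m) * M * K * w ^ (2 * m + 1)) := by gcongr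
    _ = 12 * 4 ^ (2 * m + 2) * (κ * S) * w ^ (2 * m + 2)
        + 12 * 4 ^ (2 * m) * (M ^ 2 * K / κ) * w ^ (2 * m + 2) := by
        rw [hs]; field_simp; ring
    _ ≤ 12 * 4 ^ (2 * m + 2) * (κ * S) * w ^ (2 * m + 2)
        + 12 * 4 ^ (2 * m + 2) * (M ^ 2 * K / κ) * w ^ (2 * m + 2) := by
        gcongr
        · norm_num
        · omega
    _ = _ := by ring

lemma currentMass_le (h : IsDirichlet Ψ) {L M P Q : ℝ} (hL : 0 < L) (hM : 0 < M) (k : ℕ)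
    (hP : 0 ≤ P) (hQ : 0 ≤ Q) (hf : ∀ x, flux Ψ x ≤ P + Q * growth M x ^ k) (Θ : ℝ) :
    currentMass (L * M) Θ Ψ
      ≤ M * (P * sechMoment L 0 + Q * sechMoment L k) * growth M Θ ^ k := by
  obtain ⟨i0, e0⟩ := integrable_sechSq_growth hL hM 0 Θ
  obtain ⟨ik, ek⟩ := integrable_sechSq_growth hL hM k Θ
  obtain ⟨iF, eF⟩ := integral_mul_flux h (continuous_sechSq (L * M) Θ)
  have hg := one_le_growth M Θ
  rw [currentMass, ← eF]
  calc ∫ θ, sechSq (L * M) Θ θ * flux Ψ θ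
      ≤ ∫ θ, (P * (sechSq (L * M) Θ θ * growth M θ ^ 0)
        + Q * (sechSq (L * M) Θ θ * growth M θ ^ k)) := by
        refine integral_mono iF ((i0.const_mul P).add (ik.const_mul Q)) fun θ => ?_
        have := mul_le_mul_of_nonneg_left (hf θ) (sechSq_pos (L * M) Θ θ).le
        simp only [pow_zero]
        linarith
    _ = P * (∫ θ, sechSq (L * M) Θ θ * growth M θ ^ 0)
        + Q * ∫ θ, sechSq (L * M) Θ θ * growth M θ ^ k := by
        rw [integral_add (i0.const_mul P) (ik.const_mul Q), integral_const_mul, integral_const_mul]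
    _ ≤ P * (M * sechMoment L 0 * growth M Θ ^ 0) + Q * (M * sechMoment L k * growth M Θ ^ k) := by
        gcongr
    _ ≤ P * (M * sechMoment L 0 * growth M Θ ^ k) + Q * (M * sechMoment L k * growth M Θ ^ k) := by
        have := sechMoment_nonneg L 0
        gcongr
        omega
    _ = _ := by ring

/-- Below height `R` removing the weight costs `(1+R)^{2n}`; above it the bulk bound costs only
`e^{-R}` times the trace. The free parameter `R` is fixed in the bootstrap. -/
lemma integral_strip_le_weighted (ha : Admissible Λ B lam) (h : IsDirichlet Ψ) {M R a : ℝ}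
    (hM : 1 ≤ M) (n : ℕ) (hR : 0 ≤ R)
    (hA : ∫ p in strip (2 * M), ((1 + p.2) ^ (2 * n))⁻¹ * ‖Ψ p‖ ^ 2 ∂vol ≤ M * a) :
    ∫ p in strip (2 * M), ‖Ψ p‖ ^ 2 ∂vol ≤ (1 + R) ^ (2 * n) * (M * a)
      + 4 * (bulkConst B * (mass (scale Λ B * M) 0 (resid lam Ψ)
        + Real.exp (-R) * traceMass (scale Λ B * M) 0 Ψ)) := by
  have hL := eight_le_scale ha.nonneg B
  set l := scale Λ B * M with hl
  have hlM : 2 * M ≤ l := by rw [hl]; nlinarith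
  have hz := h.eq_zero
  have cΨ := h.smooth.continuous
  have i1 := h.integrable_sq cΨ hz
  have i2 : Integrable (fun p : ℝ × ℝ => ((1 + p.2) ^ (2 * n))⁻¹ * ‖Ψ p‖ ^ 2) vol := by
    refine i1.mono' (by fun_prop) ?_
    filter_upwards [ae_vol_pos] with p hp
    rw [Real.norm_of_nonneg (by positivity)]
    exact mul_le_of_le_one_left (sq_nonneg _)
      (inv_le_one_of_one_le₀ (one_le_pow₀ (by linarith)))
  have i3 := h.integrable_mass l 0 cΨ hz
  have mR : MeasurableSet {p : ℝ × ℝ | R ≤ p.2} := measurableSet_le measurable_const measurable_snd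
  have hb := bulk_sechSq_le ha h (by linarith : 1 ≤ l) 0 R
  calc ∫ p in strip (2 * M), ‖Ψ p‖ ^ 2 ∂vol
      = ∫ p, (strip (2 * M)).indicator (fun p => ‖Ψ p‖ ^ 2) p ∂vol :=
        (integral_indicator (measurableSet_strip _)).symm
    _ ≤ ∫ p, ((1 + R) ^ (2 * n) * (strip (2 * M)).indicator
          (fun p => ((1 + p.2) ^ (2 * n))⁻¹ * ‖Ψ p‖ ^ 2) p
        + 4 * {p : ℝ × ℝ | R ≤ p.2}.indicator (fun p => sechSq l 0 p.1 * ‖Ψ p‖ ^ 2) p) ∂vol := by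
        refine integral_mono_ae (i1.indicator (measurableSet_strip _))
          (((i2.indicator (measurableSet_strip _)).const_mul _).add
            ((i3.indicator mR).const_mul _)) ?_
        filter_upwards [ae_vol_pos] with p hp
        have hn : 0 ≤ sechSq l 0 p.1 * ‖Ψ p‖ ^ 2 := mul_nonneg (sechSq_pos _ _ _).le (sq_nonneg _)
        by_cases hs : |p.1| < 2 * M
        · simp only [indicator_of_mem (show p ∈ strip (2 * M) from hs)]
          by_cases hpR : R ≤ p.2
          · rw [indicator_of_mem (by exact hpR)]
            have hq := quarter_le_sechSq (l := l) (Θ := 0) (θ := p.1) (by linarith)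
              (by rw [sub_zero]; linarith)
            have := mul_le_mul_of_nonneg_right hq (sq_nonneg ‖Ψ p‖)
            have : 0 ≤ (1 + R) ^ (2 * n) * (((1 + p.2) ^ (2 * n))⁻¹ * ‖Ψ p‖ ^ 2) := by positivity
            linarith
          · rw [indicator_of_notMem (by exact hpR), mul_zero, add_zero, ← mul_assoc]
            refine le_mul_of_one_le_left (sq_nonneg _) ?_
            rw [← div_eq_mul_inv, one_le_div (by positivity)]
            have := (not_le.1 hpR).le
            gcongr
        · simp only [indicator_of_notMem (show p ∉ strip (2 * M) from hs), mul_zero, zero_add]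
          exact mul_nonneg (by norm_num) (indicator_nonneg (fun q _ =>
            mul_nonneg (sechSq_pos _ _ _).le (sq_nonneg _)) _)
    _ = (1 + R) ^ (2 * n) * (∫ p in strip (2 * M), ((1 + p.2) ^ (2 * n))⁻¹ * ‖Ψ p‖ ^ 2 ∂vol)
        + 4 * ∫ p in {p | R ≤ p.2}, sechSq l 0 p.1 * ‖Ψ p‖ ^ 2 ∂vol := by
        rw [integral_add ((i2.indicator (measurableSet_strip _)).const_mul _)
            ((i3.indicator mR).const_mul _), integral_const_mul, integral_const_mul,
          integral_indicator (measurableSet_strip _), integral_indicator mR]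
    _ ≤ _ := by gcongr

/-! ### Closing the unweighted estimate -/

set_option maxHeartbeats 800000 in
/-- One step of the bootstrap for the unweighted estimate. -/
lemma energy_bootstrap (hΛ : 0 ≤ Λ) (B : ℝ) (m n : ℕ) :
    ∃ C : ℝ, 0 ≤ C ∧ ∀ {lam : ℝ}, Admissible Λ B lam → ∀ {M : ℝ}, 1 ≤ M →
      ∀ {Ψ : ℝ × ℝ → ℂ}, IsDirichlet Ψ → ∀ {K a S : ℝ}, 0 ≤ K → 0 ≤ a → 0 ≤ S →
      (∫ p in strip (2 * M), ((1 + p.2) ^ (2 * n))⁻¹ * ‖Ψ p‖ ^ 2 ∂vol ≤ M * a) →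
      (∀ Θ, mass (scale Λ B * M) Θ (resid lam Ψ) ≤ M * K * growth M Θ ^ (2 * m)) →
      (∀ Θ, energy (scale Λ B * M) Θ Ψ ≤ M * S * growth M Θ ^ (2 * m + 2)) →
      ∀ Θ, energy (scale Λ B * M) Θ Ψ
        ≤ M * (S / 2 + C * (a + M ^ 2 * K)) * growth M Θ ^ (2 * m + 2) := by
  set L := scale Λ B with hLdef
  have hL8 : 8 ≤ L := eight_le_scale hΛ B
  set C1 := traceConst Λ B
  have hC1 : 1 ≤ C1 := one_le_traceConst hΛ B
  set Cb := bulkConst B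
  have hCb : 0 ≤ Cb := bulkConst_nonneg B
  set c2 := currentConst Λ with hc2def
  have hc2 : 0 ≤ c2 := by rw [hc2def]; unfold currentConst; positivity
  set m0 := sechMoment L 0
  have hm0 : 0 ≤ m0 := sechMoment_nonneg L 0
  set mk := sechMoment L (2 * m + 2)
  have hmk : 0 ≤ mk := sechMoment_nonneg L _
  set α := 4 * C1 * m0 * c2 with hα
  have hα0 : 0 ≤ α := by positivity
  set β := α * (8 * Cb) with hβ
  have hβ0 : 0 ≤ β := by positivity
  set γ := 4 * C1 * mk * (12 * 4 ^ (2 * m + 2)) with hγ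
  have hγ0 : 0 ≤ γ := by positivity
  set ν := α * (4 * Cb * (5 + 4 * L) + 12 * 4 ^ (2 * m)) + C1 * (5 + 4 * L) with hν
  have hν0 : 0 ≤ ν := by positivity
  -- The old bound `S` returns in two places: through the injected current, with coefficient `γκ`,
  -- and through the mass near `0` above height `R`, with coefficient `βe^{-R}`. Both are made at
  -- most `1/4`.
  set κ := 1 / (4 * (γ + 1)) with hκ
  have hκ0 : 0 < κ := by positivity
  have hγκ : γ * κ ≤ 1 / 4 := by
    rw [hκ, mul_one_div, div_le_iff₀ (by positivity)]; linarith
  -- Chosen through `e^R ≥ R + 1 ≥ 4β`.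
  set R := 4 * (β + 1) with hR
  have hR0 : 0 ≤ R := by positivity
  have hβR : β * Real.exp (-R) ≤ 1 / 4 := by
    have h1 := Real.add_one_le_exp R
    rw [Real.exp_neg, ← div_eq_mul_inv, div_le_iff₀ (Real.exp_pos R)]
    linarith
  refine ⟨α * (1 + R) ^ (2 * n) + ν + γ / κ, by positivity, ?_⟩
  intro lam hadm M hM Ψ h K a S hK ha hS hA hg hE Θ
  have hM0 : 0 < M := by linarith
  have hg0 : growth M 0 = 1 := by simp [growth]
  have hw := one_le_growth M Θ
  have hG0 : mass (L * M) 0 (resid lam Ψ) ≤ M * K := by simpa [hg0] using hg 0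
  have hE0 : energy (L * M) 0 Ψ ≤ M * S := by simpa [hg0] using hE 0
  have hcur := traceMass_le_current hadm h hM
  -- A crude bound by `S` suffices here, since this trace enters only multiplied by `e^{-R}`.
  have hB0 : traceMass (L * M) 0 Ψ ≤ 2 * (M * S) + 4 * (1 + L) * (M * K) := by
    have h1 := hcur 0
    have h2 := currentMass_le_energy h (L * M) 0
    have h3 : 4 * (1 + L) * mass (L * M) 0 (resid lam Ψ) ≤ 4 * (1 + L) * (M * K) := by gcongr
    linarith
  have hI := integral_strip_le_weighted hadm h hM n hR0 hA
  have hexp1 : Real.exp (-R) ≤ 1 := Real.exp_le_one_iff.2 (by linarith)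
  have hIΨ : ∫ p in strip (2 * M), ‖Ψ p‖ ^ 2 ∂vol ≤ M * ((1 + R) ^ (2 * n) * a
      + 8 * Cb * Real.exp (-R) * S + 4 * Cb * (5 + 4 * L) * K) := by
    refine hI.trans ?_
    have h1 : Cb * (mass (L * M) 0 (resid lam Ψ) + Real.exp (-R) * traceMass (L * M) 0 Ψ)
        ≤ Cb * (M * K + (Real.exp (-R) * (2 * (M * S)) + 1 * (4 * (1 + L) * (M * K)))) := by
      have h2 : Real.exp (-R) * traceMass (L * M) 0 Ψ
          ≤ Real.exp (-R) * (2 * (M * S)) + 1 * (4 * (1 + L) * (M * K)) := by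
        calc _ ≤ Real.exp (-R) * (2 * (M * S) + 4 * (1 + L) * (M * K)) := by gcongr
          _ = Real.exp (-R) * (2 * (M * S)) + Real.exp (-R) * (4 * (1 + L) * (M * K)) := by ring
          _ ≤ _ := by gcongr
      gcongr
    linarith
  have hIg : ∫ p in strip (2 * M), ‖resid lam Ψ p‖ ^ 2 ∂vol ≤ M * (12 * 4 ^ (2 * m) * K) := by
    have := integral_strip_le h (contDiff_resid lam h.smooth).continuous
      (fun p hp => resid_eq_zero hp) (by linarith : 1 ≤ L) hM0 hK (2 * m) hg 0
    rw [abs_zero, zero_add, hg0, one_pow, mul_one] at this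
    linarith
  set P := c2 * ((1 + R) ^ (2 * n) * a + 8 * Cb * Real.exp (-R) * S
    + (4 * Cb * (5 + 4 * L) + 12 * 4 ^ (2 * m)) * K) with hP
  set Q := 12 * 4 ^ (2 * m + 2) * (κ * S + M ^ 2 * K / κ) with hQ
  -- The part `P` comes from the neighbourhood of `θ = 0` and does not grow; only the current
  -- injected by the source grows.
  have hflux : ∀ x, flux Ψ x ≤ P + Q * growth M x ^ (2 * m + 2) := fun x => by
    have h1 := flux_le hadm.abs_le h hM x
    have h2 := integral_strip_mul_le h (by linarith : 1 ≤ L) hM0 hK hS hκ0 m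
      (fun Θ => (mass_le_energy _ _ _).trans (hE Θ)) hg x
    have h3 : c2 / M * ((∫ p in strip (2 * M), ‖Ψ p‖ ^ 2 ∂vol)
        + ∫ p in strip (2 * M), ‖resid lam Ψ p‖ ^ 2 ∂vol) ≤ P := by
      calc _ ≤ c2 / M * (M * ((1 + R) ^ (2 * n) * a + 8 * Cb * Real.exp (-R) * S
          + 4 * Cb * (5 + 4 * L) * K) + M * (12 * 4 ^ (2 * m) * K)) := by gcongr
        _ = P := by rw [hP]; field_simp; ring
    linarith
  have hcm := currentMass_le h (by linarith : 0 < L) hM0 (2 * m + 2) (by positivity)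
    (by positivity) hflux Θ
  have htr := energy_le_trace hadm h (by nlinarith : 1 ≤ L * M) Θ
  have hgΘ : mass (L * M) Θ (resid lam Ψ) ≤ M * K * growth M Θ ^ (2 * m + 2) :=
    (hg Θ).trans (by gcongr; omega)
  set w := growth M Θ ^ (2 * m + 2) with hwdef
  have hw0 : 0 ≤ w := by positivity
  have hfin : energy (L * M) Θ Ψ ≤ C1 * (4 * (M * (P * m0 + Q * mk) * w) + (5 + 4 * L) * (M * K * w)) := by
    refine htr.trans ?_
    have h1 := hcur Θ
    have h2 : (5 + 4 * L) * mass (L * M) Θ (resid lam Ψ) ≤ (5 + 4 * L) * (M * K * w) := by gcongr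
    refine mul_le_mul_of_nonneg_left ?_ (by linarith)
    have h3 : currentMass (L * M) Θ Ψ ≤ M * (P * m0 + Q * mk) * w := hcm
    linarith
  refine hfin.trans ?_
  have hrew : C1 * (4 * (M * (P * m0 + Q * mk) * w) + (5 + 4 * L) * (M * K * w))
      = M * w * (α * (1 + R) ^ (2 * n) * a + (β * Real.exp (-R) + γ * κ) * S + ν * K
        + γ / κ * (M ^ 2 * K)) := by
    rw [hP, hQ, hβ, hγ, hν, hα]; ring
  rw [hrew, show M * (S / 2 + (α * (1 + R) ^ (2 * n) + ν + γ / κ) * (a + M ^ 2 * K)) * w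
    = M * w * (S / 2 + (α * (1 + R) ^ (2 * n) + ν + γ / κ) * (a + M ^ 2 * K)) by ring]
  refine mul_le_mul_of_nonneg_left ?_ (by positivity)
  have e1 : (β * Real.exp (-R) + γ * κ) * S ≤ 1 / 2 * S :=
    mul_le_mul_of_nonneg_right (by linarith) hS
  have e2 : ν * K ≤ ν * (M ^ 2 * K) :=
    mul_le_mul_of_nonneg_left (le_mul_of_one_le_left hK (one_le_pow₀ hM)) hν0
  have e3 : 0 ≤ α * (1 + R) ^ (2 * n) * (M ^ 2 * K) := by positivity
  have e4 : 0 ≤ (ν + γ / κ) * a := by positivity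
  linarith

/-- The estimate for smooth functions with an unweighted bound for the source. -/
theorem energy_estimate (hΛ : 0 ≤ Λ) (B : ℝ) (m n : ℕ) :
    ∃ C : ℝ, 0 ≤ C ∧ ∀ {lam : ℝ}, Admissible Λ B lam → ∀ {M : ℝ}, 1 ≤ M →
      ∀ {Ψ : ℝ × ℝ → ℂ}, IsDirichlet Ψ → ∀ {K a : ℝ}, 0 ≤ K → 0 ≤ a →
      (∫ p in strip (2 * M), ((1 + p.2) ^ (2 * n))⁻¹ * ‖Ψ p‖ ^ 2 ∂vol ≤ M * a) →
      (∀ Θ, mass (scale Λ B * M) Θ (resid lam Ψ) ≤ M * K * growth M Θ ^ (2 * m)) →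
      ∀ Θ, energy (scale Λ B * M) Θ Ψ ≤ M * (C * (a + M ^ 2 * K)) * growth M Θ ^ (2 * m + 2) := by
  obtain ⟨C, hC, hboot⟩ := energy_bootstrap hΛ B m n
  refine ⟨2 * C, by positivity, ?_⟩
  intro lam hadm M hM Ψ h K a hK ha hA hg
  have hM0 : 0 < M := by linarith
  set L := scale Λ B
  have hgp : ∀ Θ, 1 ≤ growth M Θ ^ (2 * m + 2) := fun Θ => one_le_pow₀ (one_le_growth M Θ)
  set f : ℝ → ℝ := fun Θ => energy (L * M) Θ Ψ / (M * growth M Θ ^ (2 * m + 2)) with hf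
  have hmb : ∀ {f : ℝ × ℝ → ℂ}, Continuous f → (∀ p ∉ tsupport Ψ, f p = 0) →
      ∀ Θ, mass (L * M) Θ f ≤ ∫ p, ‖f p‖ ^ 2 ∂vol := fun {f} hf h0 Θ => by
    refine integral_mono (h.integrable_mass _ _ hf h0)
      (integrable_of_tsupport h.compact (by fun_prop) fun p hp => by simp [h0 p hp]) fun p => ?_
    exact mul_le_of_le_one_left (sq_nonneg _) (sechSq_le_one _ _ _)
  -- Compact support gives a finite supremum. This is only qualitative, but without it `S/2` could
  -- not be absorbed.
  have hbdd : BddAbove (range f) := by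
    refine ⟨((∫ p, ‖Ψ p‖ ^ 2 ∂vol) + (∫ p, ‖covD Ψ p‖ ^ 2 ∂vol) + ∫ p, ‖dMu Ψ p‖ ^ 2 ∂vol) / 1, ?_⟩
    rintro _ ⟨Θ, rfl⟩
    have b1 := hmb h.smooth.continuous h.eq_zero Θ
    have b2 := hmb (contDiff_covD h.smooth).continuous (fun p hp => covD_eq_zero hp) Θ
    have b3 := hmb (contDiff_dMu h.smooth).continuous (fun p hp => dMu_eq_zero hp) Θ
    have := energy_nonneg (L * M) Θ Ψ
    have h1 : 1 ≤ M * growth M Θ ^ (2 * m + 2) := one_le_mul_of_one_le_of_one_le hM (hgp Θ)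
    rw [hf]
    simp only
    gcongr
    unfold energy at this ⊢
    linarith
  set S := ⨆ Θ, f Θ with hS
  have hf0 : ∀ Θ, 0 ≤ f Θ := fun Θ => by
    have := energy_nonneg (L * M) Θ Ψ
    have := hgp Θ
    rw [hf]; positivity
  have hS0 : 0 ≤ S := (hf0 0).trans (le_ciSup hbdd 0)
  have hE : ∀ Θ, energy (L * M) Θ Ψ ≤ M * S * growth M Θ ^ (2 * m + 2) := fun Θ => by
    have h1 := le_ciSup hbdd Θ
    have h2 := hgp Θ
    rw [hf] at h1
    simp only at h1
    rw [div_le_iff₀ (by positivity)] at h1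
    linarith
  -- The bootstrap step is fed with the best constant `S`; taking the supremum over `Θ` bounds `S`
  -- by half of itself plus the data.
  have hSle : S ≤ S / 2 + C * (a + M ^ 2 * K) := by
    refine ciSup_le fun Θ => ?_
    have h1 := hboot hadm hM h hK ha hS0 hA hg hE Θ
    have h2 := hgp Θ
    rw [hf]
    simp only
    rw [div_le_iff₀ (by positivity)]
    linarith
  intro Θ
  refine (hE Θ).trans ?_
  have h2 := hgp Θ
  gcongr
  linarith

end

/-! ### Symmetry of the resolvent kernel -/

lemma conj_mehler (z : ℂ) (ρ : ℝ) : conj (mehler z ρ) = mehler (conj z) ρ := by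
  simp only [mehler, map_mul, map_inv₀, ← Complex.exp_conj, Complex.conj_ofReal, map_neg, map_div₀,
    Complex.sinh_conj, Complex.cosh_conj, map_ofNat]

lemma conj_gauge (x y : ℝ × ℝ) : conj (gauge x y) = gauge y x := by
  simp only [gauge, ← Complex.exp_conj, map_neg, map_mul, Complex.conj_I, Complex.conj_ofReal]
  congr 1
  push_cast
  ring

lemma mehler_add_pi (z : ℂ) (ρ : ℝ) : mehler (z + Real.pi * Complex.I) ρ = - mehler z ρ := by
  have h1 : Complex.sinh (z + Real.pi * Complex.I) = - Complex.sinh z := by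
    rw [Complex.sinh_add, Complex.cosh_mul_I, Complex.sinh_mul_I]; simp
  have h2 : Complex.cosh (z + Real.pi * Complex.I) = - Complex.cosh z := by
    rw [Complex.cosh_add, Complex.cosh_mul_I, Complex.sinh_mul_I]; simp
  rw [mehler, mehler, h1, h2, neg_div_neg_eq, mul_neg, inv_neg, neg_mul]

/-- Conjugation maps the vertical segment to its mirror image; a shift by `iπ` and the reflection `s
↦ π - s` bring it back with factor `-e^{-iπλ}`. This is compensated by the conjugate of the
prefactor. -/
lemma conj_greenRadial (lam ρ : ℝ) : conj (greenRadial lam ρ) = greenRadial lam ρ := by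
  have hE0 : Complex.exp (Complex.I * Real.pi * lam) ≠ 0 := Complex.exp_ne_zero _
  have hEc : conj (Complex.exp (Complex.I * Real.pi * lam))
      = (Complex.exp (Complex.I * Real.pi * lam))⁻¹ := by
    rw [← Complex.exp_conj, ← Complex.exp_neg]
    simp
  set E := Complex.exp (Complex.I * Real.pi * lam) with hE
  set f : ℝ → ℂ := fun s => Complex.exp (lam * (1 + Complex.I * s)) * mehler (1 + Complex.I * s) ρ
    with hf
  have hfs : ∀ s : ℝ, conj (f s) = -E⁻¹ * f (Real.pi - s) := by
    intro s
    have e1 : (1 : ℂ) + Complex.I * ((Real.pi - s : ℝ) : ℂ)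
        = (1 - Complex.I * s) + Real.pi * Complex.I := by push_cast; ring
    simp only [hf]
    rw [e1, mehler_add_pi, map_mul, conj_mehler, ← Complex.exp_conj,
      show (lam : ℂ) * (1 - Complex.I * s + Real.pi * Complex.I)
        = lam * (1 - Complex.I * s) + Complex.I * Real.pi * lam by ring, Complex.exp_add, ← hE]
    simp only [map_mul, map_add, map_one, Complex.conj_I, Complex.conj_ofReal]
    rw [show (1 : ℂ) + -Complex.I * s = 1 - Complex.I * s by ring]
    field_simp
  have hV : conj (∫ s in Ioc (0 : ℝ) Real.pi, f s) = -E⁻¹ * ∫ s in Ioc (0 : ℝ) Real.pi, f s := by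
    rw [← integral_conj, ← intervalIntegral.integral_of_le Real.pi_pos.le,
      ← intervalIntegral.integral_of_le Real.pi_pos.le]
    simp_rw [hfs]
    rw [intervalIntegral.integral_const_mul, intervalIntegral.integral_comp_sub_left (fun s => f s)]
    simp
  have hS : conj (∫ t in Ioc (0 : ℝ) 1, Complex.exp (lam * t) * mehler t ρ)
      = ∫ t in Ioc (0 : ℝ) 1, Complex.exp (lam * t) * mehler t ρ := by
    rw [← integral_conj]
    congr 1 with t
    simp [conj_mehler, ← Complex.exp_conj]
  unfold greenRadial
  change conj (_ + Complex.I / (1 + E) * ∫ s in Ioc (0 : ℝ) Real.pi, f s)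
    = _ + Complex.I / (1 + E) * ∫ s in Ioc (0 : ℝ) Real.pi, f s
  rw [map_add, hS, map_mul, hV, map_div₀, Complex.conj_I, map_add, map_one, hEc]
  congr 1
  rw [show (1 : ℂ) + E⁻¹ = (1 + E) / E by field_simp; ring]
  -- At a Landau level the prefactor is a division by zero, hence `0` by convention, and the claim
  -- remains true.
  by_cases h : 1 + E = 0
  · simp [h]
  · field_simp

/-- Self-adjointness of the resolvent at real `λ`, used to move the kernel from one factor of a
pairing to the other. -/
lemma conj_greenFn (lam : ℝ) (x y : ℝ × ℝ) : conj (greenFn lam x y) = greenFn lam y x := by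
  have : distSq x y = distSq y x := by unfold distSq; ring
  rw [greenFn, map_mul, conj_greenRadial, conj_gauge, this, greenFn]

/-! ### Smoothness of the resolvent kernel off the diagonal -/

/-- Laplace transforms are smooth. -/
lemma contDiffOn_laplace {α : Type*} [MeasurableSpace α] {ν : Measure α} {c : α → ℂ}
    (hc : Measurable c) (n : ℕ) : ∀ {A : α → ℂ}, Measurable A →
      (∀ k : ℕ, ∀ r : ℝ, 0 < r →
        Integrable (fun t => ‖A t‖ * ‖c t‖ ^ k * Real.exp (-(c t).re * r)) ν) →
      (∀ᵐ t ∂ν, 0 ≤ (c t).re) →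
      ContDiffOn ℝ n (fun ρ : ℝ => ∫ t, A t * Complex.exp (-c t * ρ) ∂ν) (Ioi 0) := by
  have hnorm : ∀ (t : α) (ρ : ℝ), ‖Complex.exp (-c t * ρ)‖ = Real.exp (-(c t).re * ρ) :=
    fun t ρ => by rw [Complex.norm_exp]; simp
  -- Differentiation under the integral replaces `A` by `-cA`. The hypothesis is imposed for all
  -- powers of `c` so that it survives this replacement and the induction can proceed.
  have key : ∀ {A : α → ℂ}, Measurable A →
      (∀ k : ℕ, ∀ r : ℝ, 0 < r →
        Integrable (fun t => ‖A t‖ * ‖c t‖ ^ k * Real.exp (-(c t).re * r)) ν) →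
      (∀ᵐ t ∂ν, 0 ≤ (c t).re) → ∀ ρ : ℝ, 0 < ρ →
      HasDerivAt (fun ρ : ℝ => ∫ t, A t * Complex.exp (-c t * ρ) ∂ν)
        (∫ t, (A t * -c t) * Complex.exp (-c t * ρ) ∂ν) ρ := by
    intro A hA hi hre ρ hρ
    refine (hasDerivAt_integral_of_dominated_loc_of_deriv_le (s := Ioi (ρ / 2)) (x₀ := ρ)
      (F := fun (x : ℝ) t => A t * Complex.exp (-c t * x))
      (F' := fun (x : ℝ) t => A t * -c t * Complex.exp (-c t * x))
      -- Near `ρ` every argument exceeds `ρ/2`, and `Re c ≥ 0` makes the exponential monotone.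
      (bound := fun t => ‖A t‖ * ‖c t‖ ^ 1 * Real.exp (-(c t).re * (ρ / 2)))
      (Ioi_mem_nhds (by linarith)) (Eventually.of_forall fun x => by fun_prop) ?_ (by fun_prop) ?_
      (hi 1 (ρ / 2) (by linarith)) ?_).2
    · refine (hi 0 ρ hρ).mono' (by fun_prop) (Eventually.of_forall fun t => ?_)
      rw [norm_mul, hnorm, pow_zero, mul_one]
    · filter_upwards [hre] with t ht x hx
      have hx' : ρ / 2 < x := hx
      rw [norm_mul, norm_mul, norm_neg, hnorm, pow_one]
      refine mul_le_mul_of_nonneg_left (Real.exp_le_exp.2 ?_) (by positivity)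
      nlinarith
    · refine Eventually.of_forall fun t x _ => ?_
      have h1 : HasDerivAt (fun x : ℝ => -c t * (x : ℂ)) (-c t) x := by
        simpa using (Complex.ofRealCLM.hasDerivAt (x := x)).const_mul (-c t)
      exact (h1.cexp.const_mul (A t)).congr_deriv (by ring)
  induction n with
  | zero =>
    intro A hA hi hre
    exact contDiffOn_zero.2 fun ρ hρ => (key hA hi hre ρ hρ).continuousAt.continuousWithinAt
  | succ n ih =>
    intro A hA hi hre
    push_cast
    rw [contDiffOn_succ_iff_deriv_of_isOpen isOpen_Ioi]
    refine ⟨fun ρ hρ => (key hA hi hre ρ hρ).differentiableAt.differentiableWithinAt,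
      by simp, ?_⟩
    refine (ih (A := fun t => A t * -c t) (by fun_prop) (fun k r hr => ?_) hre).congr
      fun ρ hρ => (key hA hi hre ρ hρ).deriv
    refine (hi (k + 1) r hr).congr (Eventually.of_forall fun t => ?_)
    simp only [norm_mul, norm_neg]
    ring

/-- Both time integrals are Laplace transforms in `ρ` with rate `c = coth z / 4`. On the real
segment the singular prefactor `1/sinh t` is at most `4c`, and `c^{k+1}e^{-cr}` is bounded for each
`r > 0`; the vertical segment is compact and avoids the zeros of `sinh`. -/
lemma contDiffOn_greenRadial (lam : ℝ) : ContDiffOn ℝ ∞ (greenRadial lam) (Ioi 0) := by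
  rw [contDiffOn_infty]
  intro n
  have form : ∀ (z : ℝ → ℂ) (I : Set ℝ) (ρ : ℝ),
      ∫ t in I, Complex.exp (lam * z t) * mehler (z t) ρ
        = ∫ t in I, (Complex.exp (lam * z t) * (4 * Real.pi * Complex.sinh (z t))⁻¹)
          * Complex.exp (-(Complex.cosh (z t) / Complex.sinh (z t) / 4) * ρ) := fun z I ρ => by
    congr 1 with t
    rw [mehler, ← mul_assoc, show -(Complex.cosh (z t) / Complex.sinh (z t)) * (ρ : ℂ) / 4
      = -(Complex.cosh (z t) / Complex.sinh (z t) / 4) * ρ by ring]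
  unfold greenRadial
  refine ContDiffOn.add ?_ (contDiffOn_const.mul ?_)
  · simp_rw [form (fun t => (t : ℂ))]
    refine contDiffOn_laplace (by fun_prop) n (by fun_prop) (fun k r hr => ?_) ?_
    · refine Integrable.mono' (g := fun _ => Real.exp |lam| * (4 * ((k + 1).factorial / r ^ (k + 1))))
        (integrableOn_const (by simp)) (by fun_prop) ?_
      filter_upwards [self_mem_ae_restrict measurableSet_Ioc] with t ht
      have ht0 := ht.1
      have hs : 0 < Real.sinh t := Real.sinh_pos_iff.2 ht0
      set c := Real.cosh t / Real.sinh t / 4 with hc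
      have hc0 : 0 < c := by have := Real.cosh_pos t; positivity
      have e1 : Complex.cosh t / Complex.sinh t / 4 = (c : ℂ) := by rw [hc]; push_cast; rfl
      have hpi : 1 ≤ 4 * Real.pi := by linarith [Real.pi_gt_three]
      have e2 : ‖(4 * (Real.pi : ℂ) * Complex.sinh t)⁻¹‖ ≤ 4 * c := by
        rw [norm_inv, ← Complex.ofReal_sinh]
        simp only [norm_mul, Complex.norm_real, Real.norm_of_nonneg hs.le,
          Real.norm_of_nonneg Real.pi_pos.le, Complex.norm_ofNat]
        calc (4 * Real.pi * Real.sinh t)⁻¹ ≤ (1 * Real.sinh t)⁻¹ := by gcongr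
          _ = 1 / Real.sinh t := by rw [one_mul, one_div]
          _ ≤ Real.cosh t / Real.sinh t := by gcongr; exact Real.one_le_cosh t
          _ = 4 * c := by rw [hc]; ring
      have e3 : ‖Complex.exp ((lam : ℂ) * t)‖ ≤ Real.exp |lam| := by
        rw [Complex.norm_exp]
        refine Real.exp_le_exp.2 ?_
        rw [← Complex.ofReal_mul, Complex.ofReal_re]
        calc lam * t ≤ |lam| * t := by gcongr; exact le_abs_self _
          _ ≤ |lam| := mul_le_of_le_one_right (abs_nonneg _) ht.2
      have e4 : c ^ (k + 1) * Real.exp (-c * r) ≤ (k + 1).factorial / r ^ (k + 1) := by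
        have := Real.pow_div_factorial_le_exp (c * r) (by positivity) (k + 1)
        rw [neg_mul, Real.exp_neg, ← div_eq_mul_inv, div_le_div_iff₀ (Real.exp_pos _) (by positivity),
          ← mul_pow]
        rwa [div_le_iff₀ (by positivity), mul_comm (Real.exp _)] at this
      rw [e1, Complex.ofReal_re, Complex.norm_real, Real.norm_of_nonneg hc0.le,
        Real.norm_of_nonneg (by positivity), norm_mul]
      calc _ ≤ (Real.exp |lam| * (4 * c)) * c ^ k * Real.exp (-c * r) := by gcongr
        _ = Real.exp |lam| * (4 * (c ^ (k + 1) * Real.exp (-c * r))) := by ring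
        _ ≤ _ := by gcongr
    · filter_upwards [self_mem_ae_restrict measurableSet_Ioc] with t ht
      have hs : 0 < Real.sinh t := Real.sinh_pos_iff.2 ht.1
      have e1 : Complex.cosh t / Complex.sinh t / 4 = ((Real.cosh t / Real.sinh t / 4 : ℝ) : ℂ) := by
        push_cast; rfl
      rw [e1, Complex.ofReal_re]
      have := Real.cosh_pos t
      positivity
  · simp_rw [form (fun s => 1 + Complex.I * (s : ℂ))]
    refine contDiffOn_laplace (by fun_prop) n (by fun_prop) (fun k r hr => ?_) ?_
    · have hcont : Continuous fun s : ℝ => ‖Complex.exp (lam * (1 + Complex.I * (s : ℂ)))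
          * (4 * Real.pi * Complex.sinh (1 + Complex.I * (s : ℂ)))⁻¹‖
          * ‖Complex.cosh (1 + Complex.I * (s : ℂ)) / Complex.sinh (1 + Complex.I * (s : ℂ)) / 4‖ ^ k
          * Real.exp (-(Complex.cosh (1 + Complex.I * (s : ℂ))
            / Complex.sinh (1 + Complex.I * (s : ℂ)) / 4).re * r) := by
        have c1 : Continuous fun s : ℝ => Complex.sinh (1 + Complex.I * (s : ℂ)) := by fun_prop
        have c2 : Continuous fun s : ℝ => Complex.cosh (1 + Complex.I * (s : ℂ)) := by fun_prop
        have c3 : Continuous fun s : ℝ => Complex.cosh (1 + Complex.I * (s : ℂ))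
            / Complex.sinh (1 + Complex.I * (s : ℂ)) / 4 :=
          (c2.div c1 sinh_one_add_ne_zero).div_const 4
        have c4 : Continuous fun s : ℝ => (4 * Real.pi * Complex.sinh (1 + Complex.I * (s : ℂ)))⁻¹ :=
          (continuous_const.mul c1).inv₀ fun s => mul_ne_zero
            (mul_ne_zero (by norm_num) (Complex.ofReal_ne_zero.2 Real.pi_ne_zero))
            (sinh_one_add_ne_zero s)
        have c5 : Continuous fun s : ℝ => Complex.exp (lam * (1 + Complex.I * (s : ℂ))) := by fun_prop
        exact ((c5.mul c4).norm.mul (c3.norm.pow k)).mul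
          (Real.continuous_exp.comp ((Complex.continuous_re.comp c3).neg.mul_const r))
      exact (hcont.integrableOn_Icc).mono_set Ioc_subset_Icc_self
    · refine Eventually.of_forall fun s => ?_
      have := half_le_re_coth s
      rw [show (4 : ℂ) = ((4 : ℝ) : ℂ) by norm_num, Complex.div_ofReal_re]
      linarith

/-! ### Boundary potentials away from the boundary -/

/-- Off the boundary line the squared distance to a boundary point is at least `μ² > 0`, where the
kernel is smooth. The potential is read as a convolution in the boundary variable, evaluated at `0`,
with the point `p` as a parameter. -/
lemma contDiffOn_boundaryPot (lam : ℝ) {b : ℝ → ℂ} (hb : Continuous b) (hc : HasCompactSupport b) :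
    ContDiffOn ℝ ∞ (boundaryPot lam b) {p | p.2 ≠ 0} := by
  obtain ⟨r, hr0, hr⟩ : ∃ r : ℝ, 0 < r ∧ ∀ s, r < |s| → b s = 0 := by
    obtain ⟨r, hr⟩ := hc.isCompact.isBounded.subset_closedBall 0
    refine ⟨max r 1, by positivity, fun s hs => image_eq_zero_of_notMem_tsupport fun h => ?_⟩
    have := hr h
    rw [Metric.mem_closedBall, dist_zero_right, Real.norm_eq_abs] at this
    exact absurd (this.trans (le_max_left r 1)) (not_le.2 hs)
  -- The cutoff gives the convolution kernel compact support in `t`; it equals `1` wherever `b` does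
  -- not vanish, so the integral is unchanged.
  set g : ℝ × ℝ → ℝ → ℂ := fun p t => (cutoff (t / r) : ℂ) * greenFn lam p (-t, 0) with hg
  have hset : IsOpen {p : ℝ × ℝ | p.2 ≠ 0} := isOpen_ne_fun continuous_snd continuous_const
  have hconv := contDiffOn_convolution_right_with_param_comp (𝕜 := ℝ) (n := ⊤) (μ := volume)
    (ContinuousLinearMap.mul ℝ ℂ) (s := {p : ℝ × ℝ | p.2 ≠ 0}) (v := fun _ : ℝ × ℝ => (0 : ℝ))
    (f := b) (g := g) (k := Icc (-(2 * r)) (2 * r)) contDiffOn_const hset isCompact_Icc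
    (fun p t _ ht => ?_) hb.locallyIntegrable ?_
  · refine hconv.congr fun p _ => ?_
    rw [boundaryPot, convolution_def]
    congr 1 with s
    simp only [hg, ContinuousLinearMap.mul_apply', zero_sub, neg_neg]
    by_cases hs : |s| ≤ r
    · rw [cutoff_eq_one]
      · push_cast; ring
      · rw [abs_div, abs_neg, abs_of_pos hr0, div_le_one hr0]; exact hs
    · rw [hr s (not_le.1 hs)]; simp
  · simp only [hg]
    rw [cutoff_eq_zero]
    · simp
    · rw [abs_div, abs_of_pos hr0, le_div_iff₀ hr0]
      by_contra hlt
      exact ht (abs_le.1 (not_le.1 hlt).le)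
  · have h1 : ContDiff ℝ ∞ fun q : (ℝ × ℝ) × ℝ => ((cutoff (q.2 / r) : ℝ) : ℂ) :=
      Complex.ofRealCLM.contDiff.comp (contDiff_cutoff.comp (contDiff_snd.div_const r))
    have h2 : ContDiff ℝ ∞ fun q : (ℝ × ℝ) × ℝ => distSq q.1 (-q.2, 0) := by
      unfold distSq; fun_prop
    have h3 : ContDiff ℝ ∞ fun q : (ℝ × ℝ) × ℝ => gauge q.1 (-q.2, 0) := by
      have e : ContDiff ℝ ∞ Complex.exp := Complex.contDiff_exp
      have h4 : ContDiff ℝ ∞ fun q : (ℝ × ℝ) × ℝ =>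
          (((q.1.1 - (-q.2)) * (q.1.2 + 0) / 2 : ℝ) : ℂ) :=
        Complex.ofRealCLM.contDiff.comp (f := fun q : (ℝ × ℝ) × ℝ =>
          (q.1.1 - (-q.2)) * (q.1.2 + 0) / 2) (by fun_prop)
      exact e.comp (contDiff_const.mul h4).neg
    have h5 : ContDiffOn ℝ ∞ (fun q : (ℝ × ℝ) × ℝ => greenRadial lam (distSq q.1 (-q.2, 0)))
        ({p : ℝ × ℝ | p.2 ≠ 0} ×ˢ univ) := by
      refine (contDiffOn_greenRadial lam).comp h2.contDiffOn fun q hq => ?_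
      have : q.1.2 ≠ 0 := hq.1
      change 0 < (q.1.1 - -q.2) ^ 2 + (q.1.2 - 0) ^ 2
      rw [sub_zero]
      positivity
    exact h1.contDiffOn.mul (h5.mul h3.contDiffOn)

/-- A smooth function that agrees with the boundary potential for `|μ| ≥ 1/2`. -/
def extPot (lam : ℝ) (b : ℝ → ℂ) (p : ℝ × ℝ) : ℂ :=
  ((1 - cutoff (4 * p.2) : ℝ) : ℂ) * boundaryPot lam b p

lemma contDiff_extPot (lam : ℝ) {b : ℝ → ℂ} (hb : Continuous b) (hc : HasCompactSupport b) :
    ContDiff ℝ ∞ (extPot lam b) := by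
  rw [contDiff_iff_contDiffAt]
  intro p
  have h1 : ContDiff ℝ ∞ fun p : ℝ × ℝ => ((1 - cutoff (4 * p.2) : ℝ) : ℂ) :=
    contDiff_ofReal_comp (contDiff_const.sub (contDiff_cutoff.comp (contDiff_const.mul contDiff_snd)))
  by_cases hp : p.2 = 0
  · have hev : extPot lam b =ᶠ[𝓝 p] fun _ => 0 := by
      have ho : IsOpen {q : ℝ × ℝ | |q.2| < 1 / 4} := isOpen_lt (by fun_prop) continuous_const
      filter_upwards [ho.mem_nhds (show |p.2| < 1 / 4 by rw [hp]; norm_num)] with q hq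
      have hq' : |q.2| < 1 / 4 := hq
      rw [extPot, cutoff_eq_one]
      · simp
      · rw [abs_mul, abs_of_pos (by norm_num : (0 : ℝ) < 4)]; linarith
    exact contDiffAt_const.congr_of_eventuallyEq hev
  · have hset : IsOpen {p : ℝ × ℝ | p.2 ≠ 0} := isOpen_ne_fun continuous_snd continuous_const
    exact h1.contDiffAt.mul ((contDiffOn_boundaryPot lam hb hc).contDiffAt (hset.mem_nhds hp))

lemma extPot_eq {lam : ℝ} {b : ℝ → ℂ} {p : ℝ × ℝ} (hp : 1 / 2 ≤ p.2) :
    extPot lam b p = boundaryPot lam b p := by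
  rw [extPot, cutoff_eq_zero]
  · simp
  · rw [abs_of_nonneg (by linarith)]; linarith

section

/-! ### Product rules -/

lemma dTheta_add {f g : ℝ × ℝ → ℂ} {p : ℝ × ℝ} (hf : DifferentiableAt ℝ f p)
    (hg : DifferentiableAt ℝ g p) : dTheta (fun q => f q + g q) p = dTheta f p + dTheta g p := by
  simp only [dTheta]
  rw [fderiv_fun_add hf hg]; rfl

lemma dMu_add {f g : ℝ × ℝ → ℂ} {p : ℝ × ℝ} (hf : DifferentiableAt ℝ f p)
    (hg : DifferentiableAt ℝ g p) : dMu (fun q => f q + g q) p = dMu f p + dMu g p := by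
  simp only [dMu]
  rw [fderiv_fun_add hf hg]; rfl

lemma covD_add {f g : ℝ × ℝ → ℂ} {p : ℝ × ℝ} (hf : DifferentiableAt ℝ f p)
    (hg : DifferentiableAt ℝ g p) : covD (fun q => f q + g q) p = covD f p + covD g p := by
  simp only [covD, dTheta_add hf hg]; ring

lemma resid_add (lam : ℝ) {f g : ℝ × ℝ → ℂ} (hf : ContDiff ℝ ∞ f) (hg : ContDiff ℝ ∞ g)
    (p : ℝ × ℝ) : resid lam (fun q => f q + g q) p = resid lam f p + resid lam g p := by
  have d := fun {f : ℝ × ℝ → ℂ} (hf : ContDiff ℝ ∞ f) p => differentiable_of_smooth hf p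
  have e1 : dMu (fun q => f q + g q) = fun q => dMu f q + dMu g q :=
    funext fun q => dMu_add (d hf q) (d hg q)
  have e2 : covD (fun q => f q + g q) = fun q => covD f q + covD g q :=
    funext fun q => covD_add (d hf q) (d hg q)
  simp only [resid, landau]
  rw [e1, e2, dMu_add (d (contDiff_dMu hf) p) (d (contDiff_dMu hg) p),
    covD_add (d (contDiff_covD hf) p) (d (contDiff_covD hg) p)]
  ring

lemma resid_neg (lam : ℝ) (f : ℝ × ℝ → ℂ) (p : ℝ × ℝ) :
    resid lam (fun q => - f q) p = - resid lam f p := by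
  have e1 : ∀ f : ℝ × ℝ → ℂ, dMu (fun q => - f q) = fun q => - dMu f q := fun f => funext fun q => by
    simp only [dMu]; rw [fderiv_fun_neg]; rfl
  have e2 : ∀ f : ℝ × ℝ → ℂ, covD (fun q => - f q) = fun q => - covD f q :=
    fun f => funext fun q => by
      simp only [covD, dTheta]; rw [fderiv_fun_neg, neg_apply]; ring
  simp only [resid, landau, e1, e2]
  ring

lemma resid_mul (lam : ℝ) {c f : ℝ × ℝ → ℂ} (hc : ContDiff ℝ ∞ c) (hf : ContDiff ℝ ∞ f)
    (p : ℝ × ℝ) : resid lam (fun q => c q * f q) p = c p * resid lam f p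
      - 2 * (dTheta c p * covD f p + dMu c p * dMu f p)
      - (dTheta (dTheta c) p + dMu (dMu c) p) * f p := by
  have d := fun {f : ℝ × ℝ → ℂ} (hf : ContDiff ℝ ∞ f) p => differentiable_of_smooth hf p
  have e1 : dMu (fun q => c q * f q) = fun q => dMu c q * f q + c q * dMu f q :=
    funext fun q => dMu_mul (d hc q) (d hf q)
  have e2 : covD (fun q => c q * f q) = fun q => dTheta c q * f q + c q * covD f q :=
    funext fun q => covD_mul (d hc q) (d hf q)
  have sP := contDiff_dMu hf
  have sD := contDiff_covD hf
  have sc := contDiff_dMu hc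
  have sc' := contDiff_dTheta hc
  simp only [resid, landau]
  rw [e1, e2, dMu_add (d (sc.mul hf) p) (d (hc.mul sP) p),
    covD_add (d (sc'.mul hf) p) (d (hc.mul sD) p),
    dMu_mul (d sc p) (d hf p), dMu_mul (d hc p) (d sP p), covD_mul (d sc' p) (d hf p),
    covD_mul (d hc p) (d sD p)]
  ring

/-! ### The equation for boundary potentials -/

lemma IsTest.isDirichlet {φ : ℝ × ℝ → ℂ} (h : IsTest φ) : IsDirichlet φ where
  smooth := h.smooth
  compact := h.compact
  zero _ := image_eq_zero_of_notMem_tsupport fun hp => lt_irrefl (0 : ℝ) (h.supp hp)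

lemma IsTest.dMu_zero {φ : ℝ × ℝ → ℂ} (h : IsTest φ) (θ : ℝ) : dMu φ (θ, 0) = 0 :=
  dMu_eq_zero fun hp => lt_irrefl (0 : ℝ) (h.supp hp)

/-- Justifies Fubini in `greenPot_duality`; the singularity is controlled by the integrable
majorant. -/
lemma integrable_greenFn_mul (lam : ℝ) {f g : ℝ × ℝ → ℂ} (hf : Continuous f)
    (hfc : HasCompactSupport f) (hg : Continuous g) (hgc : HasCompactSupport g) :
    Integrable (fun q : (ℝ × ℝ) × (ℝ × ℝ) => greenFn lam q.2 q.1 * g q.2 * f q.1)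
      (vol.prod vol) := by
  have hm : Measurable fun q : (ℝ × ℝ) × (ℝ × ℝ) => greenFn lam q.2 q.1 * g q.2 * f q.1 :=
    (((measurable_greenFn lam).comp measurable_swap).mul (hg.measurable.comp measurable_snd)).mul
      (hf.measurable.comp measurable_fst)
  obtain ⟨C, hC⟩ := hg.bounded_above_of_compact_support hgc
  have hC0 : 0 ≤ C := (norm_nonneg _).trans (hC 0)
  refine ⟨hm.aestronglyMeasurable, ?_⟩
  rw [hasFiniteIntegral_iff_enorm, lintegral_prod _ hm.enorm.aemeasurable]
  have hi := (integrable_vol hf hfc).2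
  rw [hasFiniteIntegral_iff_enorm] at hi
  have hbd : ∀ x, ∫⁻ y, ‖greenFn lam y x * g y * f x‖ₑ ∂vol
      ≤ ENNReal.ofReal (C * greenConst lam) * (singInt 0 * gaussInt 0) * ‖f x‖ₑ := by
    intro x
    calc ∫⁻ y, ‖greenFn lam y x * g y * f x‖ₑ ∂vol
        ≤ ∫⁻ y, (ENNReal.ofReal (C * greenConst lam) * ‖f x‖ₑ)
            * ENNReal.ofReal (majKernel x y) ∂vol := by
          refine lintegral_mono_ae ?_
          filter_upwards [ae_vol_fst_ne x.1] with y hy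
          have h1 : ‖greenFn lam y x * g y * f x‖ ≤ C * greenConst lam * ‖f x‖ * majKernel x y := by
            rw [norm_mul, norm_mul]
            have h2 := norm_greenFn_le lam (x := y) (y := x) hy.symm
            rw [majKernel_comm] at h2
            calc _ ≤ (greenConst lam * majKernel x y) * C * ‖f x‖ := by
                  gcongr
                  · exact mul_nonneg (greenConst_nonneg lam) (majKernel_nonneg _ _)
                  · exact hC y
              _ = _ := by ring
          have h2 := ENNReal.ofReal_le_ofReal h1
          have hG := greenConst_nonneg lam
          rw [ofReal_norm, ENNReal.ofReal_mul (by positivity), ENNReal.ofReal_mul (by positivity),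
            ofReal_norm] at h2
          exact h2
      _ ≤ _ := by
          rw [lintegral_const_mul' _ _ (by finiteness)]
          calc _ ≤ ENNReal.ofReal (C * greenConst lam) * ‖f x‖ₑ * (singInt 0 * gaussInt 0) := by
                gcongr
                exact lintegral_majKernel x
            _ = _ := by ring
  refine (lintegral_mono hbd).trans_lt ?_
  have h1 := (singInt_lt_top 0).ne
  have h2 := (gaussInt_lt_top 0).ne
  rw [lintegral_const_mul' _ _ (by finiteness)]
  exact ENNReal.mul_lt_top (by finiteness) hi

/-- The volume potential solves the equation weakly: by symmetry the kernel moves onto the test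
function, and `representation`, which has no boundary term there, returns that test function. -/
lemma greenPot_duality {lam : ℝ} (hl : 1 + Complex.exp (Complex.I * Real.pi * lam) ≠ 0)
    {g φ : ℝ × ℝ → ℂ} (hg : Continuous g) (hgc : HasCompactSupport g) (hφ : IsTest φ) :
    ∫ x, conj (greenPot lam g x) * resid lam φ x ∂vol = ∫ y, conj (g y) * φ y ∂vol := by
  have hR := (contDiff_resid lam hφ.smooth).continuous
  have hRc : HasCompactSupport (resid lam φ) :=
    hasCompactSupport_of_tsupport hφ.compact fun p hp => resid_eq_zero hp
  have hgcj : HasCompactSupport fun y => conj (g y) :=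
    hasCompactSupport_of_tsupport hgc fun p hp => by simp [image_eq_zero_of_notMem_tsupport hp]
  have hi := integrable_greenFn_mul lam hR hRc (Complex.continuous_conj.comp hg) hgcj
  have e1 : ∀ x, conj (greenPot lam g x) * resid lam φ x
      = ∫ y, greenFn lam y x * conj (g y) * resid lam φ x ∂vol := fun x => by
    rw [integral_mul_const, greenPot, ← integral_conj]
    simp only [map_mul, conj_greenFn]
  simp_rw [e1]
  rw [integral_integral_swap hi]
  refine integral_congr_ae ?_
  filter_upwards [ae_vol_pos] with y hy
  have hrep := representation hφ.isDirichlet hl hy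
  simp only [hφ.dMu_zero, mul_zero, integral_zero, sub_zero] at hrep
  calc ∫ x, greenFn lam y x * conj (g y) * resid lam φ x ∂vol
      = ∫ x, conj (g y) * (greenFn lam y x * resid lam φ x) ∂vol := by
        congr 1 with x; ring
    _ = _ := by rw [integral_const_mul, ← hrep]

variable {Ψ : ℝ × ℝ → ℂ}

/-- The boundary values of the normal derivative. -/
def normalTrace (f : ℝ × ℝ → ℂ) (s : ℝ) : ℂ := dMu f (s, 0)

lemma IsDirichlet.continuous_normalTrace (h : IsDirichlet Ψ) : Continuous (normalTrace Ψ) :=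
  (contDiff_dMu h.smooth).continuous.comp (by fun_prop)

lemma IsDirichlet.hasCompactSupport_normalTrace (h : IsDirichlet Ψ) :
    HasCompactSupport (normalTrace Ψ) :=
  hasCompactSupport_slice_fst (F := dMu Ψ)
    (hasCompactSupport_of_tsupport h.compact fun _ hp => dMu_eq_zero hp) 0

lemma IsDirichlet.contDiff_extPot (h : IsDirichlet Ψ) (lam : ℝ) :
    ContDiff ℝ ∞ (extPot lam (normalTrace Ψ)) :=
  HalfPlane.contDiff_extPot lam h.continuous_normalTrace h.hasCompactSupport_normalTrace

/-- The representation formula rearranged: away from the boundary `Ψ + extPot` is the volume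
potential of the source, with no reference to boundary data. -/
lemma add_extPot_eq {lam : ℝ} (hl : 1 + Complex.exp (Complex.I * Real.pi * lam) ≠ 0)
    (h : IsDirichlet Ψ) {p : ℝ × ℝ} (hp : 1 / 2 ≤ p.2) :
    Ψ p + extPot lam (normalTrace Ψ) p = greenPot lam (resid lam Ψ) p := by
  rw [extPot_eq hp, representation h hl (by linarith : 0 < p.2)]
  simp only [greenPot, boundaryPot, normalTrace]
  ring

lemma integral_conj_mul_resid (lam : ℝ) {u φ : ℝ × ℝ → ℂ} (hu : ContDiff ℝ ∞ u) (hφ : IsTest φ) :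
    ∫ p, conj (u p) * resid lam φ p ∂vol = ∫ p, conj (resid lam u p) * φ p ∂vol := by
  have hg := green_identity hu hφ.isDirichlet
  simp only [hφ.dMu_zero, mul_zero, integral_zero, add_zero] at hg
  have hz : ∀ p ∉ tsupport φ, φ p = 0 := fun p hp => image_eq_zero_of_notMem_tsupport hp
  have cu := (contDiff_conj hu).continuous
  have cL := (contDiff_landau hφ.smooth).continuous
  have cLu := (contDiff_conj (contDiff_landau hu)).continuous
  have cφ := hφ.smooth.continuous
  have i1 : Integrable (fun p => conj (u p) * landau φ p) vol :=
    integrable_of_tsupport hφ.compact (cu.mul cL) fun p hp => by simp [landau_eq_zero hp]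
  have i2 : Integrable (fun p => (lam : ℂ) * (conj (u p) * φ p)) vol :=
    integrable_of_tsupport hφ.compact (continuous_const.mul (cu.mul cφ)) fun p hp => by
      simp [hz p hp]
  have i3 : Integrable (fun p => conj (landau u p) * φ p) vol :=
    integrable_of_tsupport hφ.compact (cLu.mul cφ) fun p hp => by simp [hz p hp]
  have e1 : ∀ p, conj (u p) * resid lam φ p
      = conj (u p) * landau φ p - lam * (conj (u p) * φ p) := fun p => by
    simp only [resid]; ring
  have e2 : ∀ p, conj (resid lam u p) * φ p
      = conj (landau u p) * φ p - lam * (conj (u p) * φ p) := fun p => by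
    simp only [resid, map_sub, map_mul, Complex.conj_ofReal]; ring
  simp_rw [e1, e2]
  rw [integral_sub i1 i2, integral_sub i3 i2, hg]

/-- There `extPot` is the difference of the volume potential and `Ψ`, which solve the same equation
weakly. A smooth function with vanishing weak residual has vanishing residual. -/
lemma resid_extPot {lam : ℝ} (hl : 1 + Complex.exp (Complex.I * Real.pi * lam) ≠ 0)
    (h : IsDirichlet Ψ) {p : ℝ × ℝ} (hp : 1 / 2 < p.2) :
    resid lam (extPot lam (normalTrace Ψ)) p = 0 := by
  set E := extPot lam (normalTrace Ψ) with hE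
  have sE : ContDiff ℝ ∞ E := h.contDiff_extPot lam
  have cF : Continuous fun p => conj (resid lam E p) :=
    (contDiff_conj (contDiff_resid lam sE)).continuous
  set U : Set (ℝ × ℝ) := {p | 1 / 2 < p.2} with hU
  have oU : IsOpen U := isOpen_lt continuous_const continuous_snd
  have cg := (contDiff_resid lam h.smooth).continuous
  have hgc : HasCompactSupport (resid lam Ψ) :=
    hasCompactSupport_of_tsupport h.compact fun p hp => resid_eq_zero hp
  have hae : ∀ᵐ p, p ∈ U → conj (resid lam E p) = 0 := by
    refine oU.ae_eq_zero_of_integral_contDiff_smul_eq_zero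
      (cF.locallyIntegrable.locallyIntegrableOn U) fun f hf hfc hfs => ?_
    set φ : ℝ × ℝ → ℂ := fun p => (f p : ℂ) with hφdef
    have hφs : tsupport φ ⊆ tsupport f := by
      refine closure_mono fun p hp => ?_
      simpa [hφdef] using hp
    have hφ : IsTest φ :=
      { smooth := contDiff_ofReal_comp hf
        compact := HasCompactSupport.intro hfc.isCompact fun p hp => by
          simp [hφdef, image_eq_zero_of_notMem_tsupport hp]
        supp := fun p hp => by
          have : 1 / 2 < p.2 := hfs (hφs hp)
          exact (by norm_num : (0 : ℝ) < 1 / 2).trans this }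
    have e0 : ∫ p, f p • conj (resid lam E p) = ∫ p, conj (resid lam E p) * φ p ∂vol := by
      rw [vol, setIntegral_eq_integral_of_forall_compl_eq_zero]
      · congr 1 with p
        rw [Complex.real_smul, mul_comm]
      · intro p hp
        rw [image_eq_zero_of_notMem_tsupport fun hq => hp (hφ.supp hq), mul_zero]
    rw [e0, ← integral_conj_mul_resid lam sE hφ]
    have d1 := greenPot_duality hl cg hgc hφ
    have d2 := integral_conj_mul_resid lam h.smooth hφ
    have cR := (contDiff_resid lam hφ.smooth).continuous
    have i1 : Integrable (fun p => conj (Ψ p) * resid lam φ p) vol :=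
      integrable_of_tsupport hφ.compact ((contDiff_conj h.smooth).continuous.mul cR) fun p hp => by
        simp [resid_eq_zero hp]
    have i2 : Integrable (fun p => conj (E p) * resid lam φ p) vol :=
      integrable_of_tsupport hφ.compact ((contDiff_conj sE).continuous.mul cR) fun p hp => by
        simp [resid_eq_zero hp]
    have d3 : ∫ x, conj (greenPot lam (resid lam Ψ) x) * resid lam φ x ∂vol
        = ∫ x, (conj (Ψ x) * resid lam φ x + conj (E x) * resid lam φ x) ∂vol := by
      congr 1 with x
      by_cases hx : x ∈ tsupport φ
      · have : 1 / 2 < x.2 := hfs (hφs hx)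
        rw [← add_extPot_eq hl h this.le, map_add]; ring
      · simp [resid_eq_zero hx]
    rw [integral_add i1 i2] at d3
    linear_combination d1 - d2 - d3
  -- Continuity upgrades the almost everywhere statement to every point of the open set.
  have heq : EqOn (fun p => conj (resid lam E p)) 0 U := by
    refine Measure.eqOn_open_of_ae_eq (μ := volume) ?_ oU cF.continuousOn continuousOn_const
    rw [EventuallyEq, ae_restrict_iff' oU.measurableSet]
    exact hae
  have := heq (show p ∈ U from hp)
  simpa using this

end

/-! ### Derivatives of cutoff functions -/

lemma contDiff_deriv {f : ℝ → ℝ} (hf : ContDiff ℝ ∞ f) : ContDiff ℝ ∞ (deriv f) :=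
  (contDiff_infty_iff_deriv.1 hf).2

lemma deriv_cutoff_eq_zero' {x : ℝ} (hx : |x| ≤ 1) : deriv cutoff x = 0 := by
  have hmax : IsLocalMax cutoff x := Eventually.of_forall fun y => by
    rw [cutoff_eq_one hx]; exact cutoff_le_one y
  exact hmax.deriv_eq_zero

lemma deriv_deriv_cutoff_eq_zero {x : ℝ} (hx : |x| < 1 ∨ 2 < |x|) : deriv (deriv cutoff) x = 0 := by
  have hev : deriv cutoff =ᶠ[𝓝 x] fun _ => 0 := by
    rcases hx with hx | hx
    · filter_upwards [(isOpen_lt continuous_abs continuous_const).mem_nhds hx] with y hy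
      exact deriv_cutoff_eq_zero' (le_of_lt hy)
    · filter_upwards [(isOpen_lt continuous_const continuous_abs).mem_nhds hx] with y hy
      exact deriv_cutoff_eq_zero (le_of_lt hy)
  rw [hev.deriv_eq, deriv_const]

/-- The function `cutoff` at the scale `R`. -/
def scaledCut (R x : ℝ) : ℝ := cutoff (x / R)

lemma contDiff_scaledCut (R : ℝ) : ContDiff ℝ ∞ (scaledCut R) :=
  contDiff_cutoff.comp (contDiff_id.div_const R)

lemma deriv_scaledCut (R : ℝ) : deriv (scaledCut R) = fun x => deriv cutoff (x / R) / R :=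
  funext fun x => (hasDerivAt_cutoff_div R x).deriv

lemma deriv_deriv_scaledCut (R : ℝ) :
    deriv (deriv (scaledCut R)) = fun x => deriv (deriv cutoff) (x / R) / R ^ 2 := by
  rw [deriv_scaledCut]
  ext x
  have h1 : HasDerivAt (fun t : ℝ => t / R) (1 / R) x := (hasDerivAt_id x).div_const R
  have h2 := ((((contDiff_deriv contDiff_cutoff).differentiable (by simp))
    (x / R)).hasDerivAt.comp x h1).div_const R
  rw [show deriv (deriv cutoff) (x / R) / R ^ 2 = deriv (deriv cutoff) (x / R) * (1 / R) / R by ring]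
  exact h2.deriv

lemma abs_deriv_scaledCut_le {R : ℝ} (hR : 0 < R) (x : ℝ) : |deriv (scaledCut R) x| ≤ cutoffBound / R := by
  rw [deriv_scaledCut, abs_div, abs_of_pos hR]
  gcongr
  exact abs_deriv_cutoff_le _

lemma abs_deriv_deriv_scaledCut_le {R : ℝ} (hR : 0 < R) (x : ℝ) :
    |deriv (deriv (scaledCut R)) x| ≤ cutoffBound / R ^ 2 := by
  rw [deriv_deriv_scaledCut, abs_div, abs_of_pos (by positivity : 0 < R ^ 2)]
  gcongr
  exact abs_deriv_deriv_cutoff_le _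

lemma scaledCut_eq_one {R : ℝ} (hR : 0 < R) {x : ℝ} (hx : |x| ≤ R) : scaledCut R x = 1 :=
  cutoff_eq_one (by rw [abs_div, abs_of_pos hR, div_le_one hR]; exact hx)

lemma scaledCut_eq_zero {R : ℝ} (hR : 0 < R) {x : ℝ} (hx : 2 * R ≤ |x|) : scaledCut R x = 0 :=
  cutoff_eq_zero (by rw [abs_div, abs_of_pos hR, le_div_iff₀ hR]; exact hx)

lemma scaledCut_nonneg (R x : ℝ) : 0 ≤ scaledCut R x := cutoff_nonneg _

lemma scaledCut_le_one (R x : ℝ) : scaledCut R x ≤ 1 := cutoff_le_one _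

lemma abs_scaledCut_le_one (R x : ℝ) : |scaledCut R x| ≤ 1 := by
  rw [abs_of_nonneg (scaledCut_nonneg R x)]; exact scaledCut_le_one R x

lemma contDiff_mul_split {a b : ℝ → ℝ} (ha : ContDiff ℝ ∞ a) (hb : ContDiff ℝ ∞ b) :
    ContDiff ℝ ∞ fun p : ℝ × ℝ => a p.1 * b p.2 :=
  (ha.comp contDiff_fst).mul (hb.comp contDiff_snd)

lemma fderiv_mul_split {a b : ℝ → ℝ} (ha : ContDiff ℝ ∞ a) (hb : ContDiff ℝ ∞ b) (p : ℝ × ℝ) :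
    fderiv ℝ (fun p : ℝ × ℝ => a p.1 * b p.2) p (1, 0) = deriv a p.1 * b p.2 ∧
    fderiv ℝ (fun p : ℝ × ℝ => a p.1 * b p.2) p (0, 1) = a p.1 * deriv b p.2 := by
  have da : HasFDerivAt (fun p : ℝ × ℝ => a p.1) _ p :=
    ((ha.differentiable (by simp)) p.1).hasDerivAt.hasFDerivAt.comp p
      (hasFDerivAt_fst (𝕜 := ℝ) (p := p))
  have db : HasFDerivAt (fun p : ℝ × ℝ => b p.2) _ p :=
    ((hb.differentiable (by simp)) p.2).hasDerivAt.hasFDerivAt.comp p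
      (hasFDerivAt_snd (𝕜 := ℝ) (p := p))
  have h : HasFDerivAt (fun p : ℝ × ℝ => a p.1 * b p.2) _ p := da.mul db
  rw [h.fderiv]
  constructor <;> simp [mul_comm]

lemma dTheta_mul_split {a b : ℝ → ℝ} (ha : ContDiff ℝ ∞ a) (hb : ContDiff ℝ ∞ b) :
    dTheta (fun p : ℝ × ℝ => ((a p.1 * b p.2 : ℝ) : ℂ))
      = fun p => ((deriv a p.1 * b p.2 : ℝ) : ℂ) := by
  ext p
  rw [dTheta_ofReal (χ := fun p : ℝ × ℝ => a p.1 * b p.2)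
    ((contDiff_mul_split ha hb).differentiable (by simp) p), (fderiv_mul_split ha hb p).1]

lemma dMu_mul_split {a b : ℝ → ℝ} (ha : ContDiff ℝ ∞ a) (hb : ContDiff ℝ ∞ b) :
    dMu (fun p : ℝ × ℝ => ((a p.1 * b p.2 : ℝ) : ℂ))
      = fun p => ((a p.1 * deriv b p.2 : ℝ) : ℂ) := by
  ext p
  rw [dMu_ofReal (χ := fun p : ℝ × ℝ => a p.1 * b p.2)
    ((contDiff_mul_split ha hb).differentiable (by simp) p), (fderiv_mul_split ha hb p).2]

/-! ### Slowly varying weights in both variables -/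

/-- A weight in `θ` with logarithmic derivative bounded by `1`. -/
structure SlowWeight (a : ℝ → ℝ) : Prop where
  smooth : ContDiff ℝ ∞ a
  nonneg : ∀ s, 0 ≤ a s
  deriv_le : ∀ s, |deriv a s| ≤ a s
  le_exp : ∀ s t, a s ≤ Real.exp |s - t| * a t

lemma slowWeight_one : SlowWeight fun _ => 1 where
  smooth := contDiff_const
  nonneg _ := zero_le_one
  deriv_le _ := by simp
  le_exp _ _ := by rw [mul_one]; exact Real.one_le_exp (abs_nonneg _)

lemma slowWeight_sech {l : ℝ} (hl : 1 ≤ l) (Θ : ℝ) : SlowWeight (sech l Θ) where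
  smooth := contDiff_sech l Θ
  nonneg s := (sech_pos l Θ s).le
  deriv_le s := (abs_deriv_sech_le (by linarith) Θ s).trans
    (mul_le_of_le_one_left (sech_pos _ _ _).le ((div_le_one (by linarith)).2 hl))
  le_exp s t := by
    have h := sechSq_le_exp_mul hl Θ s t
    refine (pow_le_pow_iff_left₀ (sech_pos _ _ _).le
      (mul_nonneg (Real.exp_nonneg _) (sech_pos _ _ _).le) two_ne_zero).1 ?_
    rw [mul_pow, ← Real.exp_nat_mul]
    exact_mod_cast h

/-- The mass of `(1 + μ)^{-n} f` with the weight `a²`. -/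
def wmass (n : ℕ) (a : ℝ → ℝ) (f : ℝ × ℝ → ℂ) : ℝ≥0∞ :=
  ∫⁻ p, ENNReal.ofReal (a p.1 ^ 2 * ((1 + p.2) ^ (2 * n))⁻¹) * ‖f p‖ₑ ^ 2 ∂vol

/-- The polynomial weight also varies slowly, because `1 + y₂ ≤ (1 + x₂)e^{|x₂ - y₂|}` on the
half-plane. The rate `2n + 2` covers the power `2n` and the squared weight in `θ` at once. -/
lemma wmass_greenPot_le {lam B : ℝ} (hB : greenConst lam ≤ B) (n : ℕ) {a : ℝ → ℝ}
    (ha : SlowWeight a) {f : ℝ × ℝ → ℂ} (hf : Measurable f) :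
    wmass n a (greenPot lam f) ≤ ENNReal.ofReal (potConst (2 * n + 2) B) * wmass n a f := by
  have ham := ha.smooth.continuous.measurable
  refine lintegral_greenPot_le hB (by fun_prop) hf fun x y hx hy => ?_
  rw [← ENNReal.ofReal_mul (by positivity)]
  refine ENNReal.ofReal_le_ofReal ?_
  set d := |x.1 - y.1|
  set e := |x.2 - y.2| with he
  have hd : 0 ≤ d := abs_nonneg _
  have he0 : 0 ≤ e := abs_nonneg _
  have h1 : a x.1 ^ 2 ≤ Real.exp ((2 * n + 2) * d) * a y.1 ^ 2 := by
    calc a x.1 ^ 2 ≤ (Real.exp d * a y.1) ^ 2 := by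
          gcongr
          · exact ha.nonneg _
          · exact ha.le_exp _ _
      _ = Real.exp (2 * d) * a y.1 ^ 2 := by rw [mul_pow, ← Real.exp_nat_mul]; norm_num
      _ ≤ _ := by
          gcongr
          have : (0 : ℝ) ≤ n := n.cast_nonneg
          nlinarith
  have h2 : ((1 + x.2) ^ (2 * n))⁻¹ ≤ Real.exp ((2 * n + 2) * e) * ((1 + y.2) ^ (2 * n))⁻¹ := by
    rw [← div_eq_mul_inv, le_div_iff₀ (by positivity), inv_mul_le_iff₀ (by positivity)]
    have h3 : 1 + y.2 ≤ (1 + x.2) * Real.exp e := by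
      have h4 := Real.add_one_le_exp e
      have h5 : y.2 ≤ x.2 + e := by rw [he]; linarith [neg_abs_le (x.2 - y.2)]
      nlinarith
    calc (1 + y.2) ^ (2 * n) ≤ ((1 + x.2) * Real.exp e) ^ (2 * n) := by gcongr
      _ = (1 + x.2) ^ (2 * n) * Real.exp (2 * n * e) := by
          rw [mul_pow, ← Real.exp_nat_mul]; push_cast; rfl
      _ ≤ _ := by
          gcongr
          linarith
  calc _ ≤ (Real.exp ((2 * n + 2) * d) * a y.1 ^ 2)
        * (Real.exp ((2 * n + 2) * e) * ((1 + y.2) ^ (2 * n))⁻¹) := by gcongr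
    _ = _ := by ring

/-! ### Energy in the interior -/

/-- The constant of `lintegral_dMu_band_le`. -/
def bandConst (Λ : ℝ) : ℝ := 1 + 2 * Λ + 4 * ((1 + cutoffBound) ^ 2 + (2 * cutoffBound) ^ 2)

/-- The band `{1 ≤ μ ≤ 2}`. -/
def band : Set (ℝ × ℝ) := {p | 1 ≤ p.2 ∧ p.2 ≤ 2}

/-- The band `{1/2 < μ < 5/2}`. -/
def wideBand : Set (ℝ × ℝ) := {p | 1 / 2 < p.2 ∧ p.2 < 5 / 2}

lemma measurableSet_band : MeasurableSet band :=
  (measurableSet_le measurable_const measurable_snd).inter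
    (measurableSet_le measurable_snd measurable_const)

lemma measurableSet_wideBand : MeasurableSet wideBand :=
  (measurableSet_lt measurable_const measurable_snd).inter
    (measurableSet_lt measurable_snd measurable_const)

lemma hasDerivAt_cutoff_affine (x : ℝ) :
    HasDerivAt (fun x => cutoff (2 * x - 3)) (2 * deriv cutoff (2 * x - 3)) x := by
  have h1 : HasDerivAt (fun t : ℝ => 2 * t - 3) 2 x := by
    simpa using ((hasDerivAt_id x).const_mul 2).sub_const 3
  exact (((contDiff_cutoff.differentiable (by simp)) (2 * x - 3)).hasDerivAt.comp x h1).congr_deriv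
    (by ring)

lemma lintegral_energy_le {χ : ℝ × ℝ → ℝ} {v : ℝ × ℝ → ℂ} (sχ : ContDiff ℝ ∞ χ)
    (kχ : HasCompactSupport χ) (hv : ContDiff ℝ ∞ v) (h0 : ∀ θ, χ (θ, 0) = 0 ∨ v (θ, 0) = 0) :
    ∫⁻ p, ENNReal.ofReal (χ p ^ 2 * (‖covD v p‖ ^ 2 + ‖dMu v p‖ ^ 2)) ∂vol
      ≤ ∫⁻ p, ENNReal.ofReal (2 * (χ p ^ 2 * (‖v p‖ * ‖landau v p‖))
        + 4 * ((fderiv ℝ χ p (1, 0) ^ 2 + fderiv ℝ χ p (0, 1) ^ 2) * ‖v p‖ ^ 2)) ∂vol := by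
  have cv := hv.continuous
  have cP := (contDiff_dMu hv).continuous
  have cD := (contDiff_covD hv).continuous
  have cL := (contDiff_landau hv).continuous
  have cχ := sχ.continuous
  have cf : ∀ e, Continuous fun p => fderiv ℝ χ p e := fun e =>
    (sχ.continuous_fderiv (by simp)).clm_apply continuous_const
  have cf1 := cf (1, 0)
  have cf2 := cf (0, 1)
  have hz : ∀ p ∉ tsupport χ, χ p = 0 := fun p hp => image_eq_zero_of_notMem_tsupport hp
  have hz' : ∀ p ∉ tsupport χ, fderiv ℝ χ p = 0 := fun p hp =>
    image_eq_zero_of_notMem_tsupport fun h => hp (tsupport_fderiv_subset ℝ h)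
  have hint : ∀ {F : ℝ × ℝ → ℝ}, Continuous F → (∀ p ∉ tsupport χ, F p = 0) →
      Integrable F vol := fun hF h0 => integrable_vol hF (HasCompactSupport.intro kχ.isCompact h0)
  have i1 : Integrable (fun p => χ p ^ 2 * (‖covD v p‖ ^ 2 + ‖dMu v p‖ ^ 2)) vol :=
    hint (by fun_prop) fun p hp => by simp [hz p hp]
  have i2 : Integrable (fun p => χ p ^ 2 * (‖v p‖ * ‖landau v p‖)) vol :=
    hint (by fun_prop) fun p hp => by simp [hz p hp]
  have i3 : Integrable (fun p => (fderiv ℝ χ p (1, 0) ^ 2 + fderiv ℝ χ p (0, 1) ^ 2)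
      * ‖v p‖ ^ 2) vol :=
    hint (by fun_prop) fun p hp => by simp [hz' p hp]
  have hen := energy_le sχ hv (Or.inl kχ) h0
  rw [← integral_const_mul, ← integral_const_mul,
    ← integral_add (i2.const_mul 2) (i3.const_mul 4)] at hen
  have hle := ENNReal.ofReal_le_ofReal hen
  rw [ofReal_integral_eq_lintegral_ofReal i1 (Eventually.of_forall fun p => by positivity)] at hle
  exact hle.trans_eq (ofReal_integral_eq_lintegral_ofReal ((i2.const_mul 2).add (i3.const_mul 4))
    (Eventually.of_forall fun p => by simp only [Pi.zero_apply]; positivity))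

/-- An interior energy estimate. The equation is needed only for `μ > 1/2`, and no global
integrability of `u` is assumed, so cutoffs in `θ` are removed at the end by Fatou's lemma. -/
lemma lintegral_dMu_band_le {lam Λ : ℝ} (hl : |lam| ≤ Λ) {u g : ℝ × ℝ → ℂ} (hu : ContDiff ℝ ∞ u)
    (hg : ∀ p : ℝ × ℝ, 1 / 2 < p.2 → resid lam u p = g p) {a : ℝ → ℝ} (ha : SlowWeight a) :
    ∫⁻ p in band, ENNReal.ofReal (a p.1 ^ 2) * ‖dMu u p‖ₑ ^ 2 ∂vol
      ≤ ∫⁻ p in wideBand, ENNReal.ofReal (bandConst Λ * (a p.1 ^ 2 * (‖u p‖ ^ 2 + ‖g p‖ ^ 2)))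
        ∂vol := by
  have hΛ : 0 ≤ Λ := (abs_nonneg _).trans hl
  have hc0 := cutoffBound_nonneg
  have ca := ha.smooth.continuous
  have cu := hu.continuous
  have cP := (contDiff_dMu hu).continuous
  -- Equal to `1` on `[1, 2]` and `0` outside `(1/2, 5/2)`.
  set β : ℝ → ℝ := fun x => cutoff (2 * x - 3) with hβ
  have sβ : ContDiff ℝ ∞ β := contDiff_cutoff.comp ((contDiff_const.mul contDiff_id).sub contDiff_const)
  have hβ0 : ∀ x, ¬ (1 / 2 < x ∧ x < 5 / 2) → β x = 0 ∧ deriv β x = 0 := fun x hx => by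
    have h2 : 2 ≤ |2 * x - 3| := by
      rw [le_abs]
      by_contra hcon
      push Not at hcon
      exact hx ⟨by linarith [hcon.2], by linarith [hcon.1]⟩
    refine ⟨cutoff_eq_zero h2, ?_⟩
    rw [(hasDerivAt_cutoff_affine x).deriv, deriv_cutoff_eq_zero h2, mul_zero]
  -- The truncation at scale `k + 1` only provides compact support; the bounds for it and its
  -- derivative are uniform in `k`.
  set A : ℕ → ℝ → ℝ := fun k x => a x * scaledCut (k + 1) x with hA
  have sA : ∀ k, ContDiff ℝ ∞ (A k) := fun k => ha.smooth.mul (contDiff_scaledCut _)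
  have hA1 : ∀ k x, A k x ^ 2 ≤ a x ^ 2 := fun k x => by
    have h1 := ha.nonneg x
    have h2 := scaledCut_nonneg (k + 1) x
    have h3 := scaledCut_le_one (k + 1) x
    simp only [hA]
    gcongr
    exact mul_le_of_le_one_right h1 h3
  have hA2 : ∀ k x, deriv (A k) x ^ 2 ≤ (1 + cutoffBound) ^ 2 * a x ^ 2 := fun k x => by
    have hk : (0 : ℝ) < k + 1 := by positivity
    have hd : deriv (A k) x = deriv a x * scaledCut (k + 1) x + a x * deriv (scaledCut (k + 1)) x :=
      deriv_fun_mul (ha.smooth.differentiable (by simp) x)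
        ((contDiff_scaledCut _).differentiable (by simp) x)
    have h1 : |deriv (A k) x| ≤ (1 + cutoffBound) * a x := by
      rw [hd]
      refine (abs_add_le _ _).trans ?_
      rw [abs_mul, abs_mul, abs_of_nonneg (ha.nonneg x), abs_of_nonneg (scaledCut_nonneg _ _)]
      have h2 := abs_deriv_scaledCut_le hk x
      have h3 : cutoffBound / (k + 1) ≤ cutoffBound := div_le_self hc0 (by linarith)
      have h4 := ha.deriv_le x
      have h5 := scaledCut_le_one (k + 1) x
      have h6 := ha.nonneg x
      calc _ ≤ a x * 1 + a x * cutoffBound := by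
            gcongr
            · exact scaledCut_nonneg _ _
            · exact h2.trans h3
        _ = _ := by ring
    rw [← sq_abs, ← mul_pow]
    gcongr
  set χ : ℕ → ℝ × ℝ → ℝ := fun k p => A k p.1 * β p.2 with hχ
  have sχ : ∀ k, ContDiff ℝ ∞ (χ k) := fun k => contDiff_mul_split (sA k) sβ
  have cχ : ∀ k, HasCompactSupport (χ k) := fun k => by
    have hk : (0 : ℝ) < k + 1 := by positivity
    refine HasCompactSupport.intro (K := Icc (-(2 * (k + 1 : ℝ))) (2 * (k + 1)) ×ˢ Icc (1 / 2) (5 / 2))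
      (isCompact_Icc.prod isCompact_Icc) fun p hp => ?_
    simp only [hχ, hA]
    by_cases h1 : 1 / 2 < p.2 ∧ p.2 < 5 / 2
    · rw [scaledCut_eq_zero hk]
      · simp
      by_contra hlt
      exact hp ⟨abs_le.1 (not_le.1 hlt).le, h1.1.le, h1.2.le⟩
    · rw [(hβ0 p.2 h1).1, mul_zero]
  have hkey : ∀ k, ∫⁻ p, ENNReal.ofReal (χ k p ^ 2 * ‖dMu u p‖ ^ 2) ∂vol
      ≤ ∫⁻ p in wideBand, ENNReal.ofReal (bandConst Λ * (a p.1 ^ 2 * (‖u p‖ ^ 2 + ‖g p‖ ^ 2)))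
        ∂vol := by
    intro k
    refine (lintegral_mono fun p => ENNReal.ofReal_le_ofReal (mul_le_mul_of_nonneg_left
      (le_add_of_nonneg_left (sq_nonneg ‖covD u p‖)) (sq_nonneg _))).trans
      ((lintegral_energy_le (sχ k) (cχ k) hu fun θ => Or.inl ?_).trans ?_)
    · simp only [hχ]
      rw [(hβ0 0 (by norm_num)).1, mul_zero]
    rw [← lintegral_indicator measurableSet_wideBand]
    refine lintegral_mono fun p => ?_
    have hf := fderiv_mul_split (sA k) sβ p
    have e1 : fderiv ℝ (χ k) p (1, 0) = deriv (A k) p.1 * β p.2 := hf.1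
    have e2 : fderiv ℝ (χ k) p (0, 1) = A k p.1 * deriv β p.2 := hf.2
    by_cases hp : 1 / 2 < p.2 ∧ p.2 < 5 / 2
    · rw [indicator_of_mem (by exact hp)]
      refine ENNReal.ofReal_le_ofReal ?_
      have hL := norm_landau_le hl u p
      rw [hg p hp.1] at hL
      have hb1 : β p.2 ^ 2 ≤ 1 := pow_le_one₀ (cutoff_nonneg _) (cutoff_le_one _)
      have hb2 : deriv β p.2 ^ 2 ≤ (2 * cutoffBound) ^ 2 := by
        rw [(hasDerivAt_cutoff_affine p.2).deriv, ← sq_abs, abs_mul, abs_two]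
        gcongr
        exact abs_deriv_cutoff_le _
      have q1 : χ k p ^ 2 ≤ a p.1 ^ 2 := by
        simp only [hχ, mul_pow]
        calc _ ≤ a p.1 ^ 2 * 1 := mul_le_mul (hA1 k _) hb1 (sq_nonneg _) (sq_nonneg _)
          _ = _ := mul_one _
      have q2 : fderiv ℝ (χ k) p (1, 0) ^ 2 + fderiv ℝ (χ k) p (0, 1) ^ 2
          ≤ ((1 + cutoffBound) ^ 2 + (2 * cutoffBound) ^ 2) * a p.1 ^ 2 := by
        rw [e1, e2, mul_pow, mul_pow]
        calc _ ≤ ((1 + cutoffBound) ^ 2 * a p.1 ^ 2) * 1 + a p.1 ^ 2 * (2 * cutoffBound) ^ 2 :=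
              add_le_add (mul_le_mul (hA2 k _) hb1 (sq_nonneg _) (by positivity))
                (mul_le_mul (hA1 k _) hb2 (sq_nonneg _) (sq_nonneg _))
          _ = _ := by ring
      have q3 : 2 * (‖u p‖ * ‖landau u p‖) ≤ (1 + 2 * Λ) * ‖u p‖ ^ 2 + ‖g p‖ ^ 2 := by
        have : ‖u p‖ * ‖landau u p‖ ≤ ‖u p‖ * (‖g p‖ + Λ * ‖u p‖) := by gcongr
        nlinarith [sq_nonneg (‖u p‖ - ‖g p‖)]
      calc 2 * (χ k p ^ 2 * (‖u p‖ * ‖landau u p‖))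
            + 4 * ((fderiv ℝ (χ k) p (1, 0) ^ 2 + fderiv ℝ (χ k) p (0, 1) ^ 2) * ‖u p‖ ^ 2)
          = χ k p ^ 2 * (2 * (‖u p‖ * ‖landau u p‖))
            + 4 * ((fderiv ℝ (χ k) p (1, 0) ^ 2 + fderiv ℝ (χ k) p (0, 1) ^ 2) * ‖u p‖ ^ 2) := by ring
        _ ≤ a p.1 ^ 2 * ((1 + 2 * Λ) * ‖u p‖ ^ 2 + ‖g p‖ ^ 2)
            + 4 * ((((1 + cutoffBound) ^ 2 + (2 * cutoffBound) ^ 2) * a p.1 ^ 2) * ‖u p‖ ^ 2) := by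
            gcongr
        _ ≤ _ := by
            have h1 : 0 ≤ (2 * Λ + 4 * ((1 + cutoffBound) ^ 2 + (2 * cutoffBound) ^ 2))
              * (a p.1 ^ 2 * ‖g p‖ ^ 2) := by positivity
            unfold bandConst
            linarith
    · rw [e1, e2]
      simp only [hχ]
      rw [(hβ0 p.2 hp).1, (hβ0 p.2 hp).2]
      simp
  calc ∫⁻ p in band, ENNReal.ofReal (a p.1 ^ 2) * ‖dMu u p‖ₑ ^ 2 ∂vol
      ≤ ∫⁻ p, liminf (fun k => ENNReal.ofReal (χ k p ^ 2 * ‖dMu u p‖ ^ 2)) atTop ∂vol := by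
        rw [← lintegral_indicator measurableSet_band]
        refine lintegral_mono fun p => ?_
        refine indicator_apply_le' (fun hp => ?_) fun _ => zero_le
        refine le_liminf_of_le (by isBoundedDefault) ?_
        filter_upwards [eventually_ge_atTop ⌈|p.1|⌉₊] with k hk
        have h1 : |p.1| ≤ k + 1 := by
          have : (⌈|p.1|⌉₊ : ℝ) ≤ k := by exact_mod_cast hk
          linarith [Nat.le_ceil |p.1|]
        simp only [hχ, hA, hβ]
        rw [scaledCut_eq_one (by positivity) h1, cutoff_eq_one, mul_one, mul_one,
          ENNReal.ofReal_mul (sq_nonneg _), ENNReal.ofReal_pow (norm_nonneg _), ofReal_norm]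
        rw [abs_le]
        constructor <;> linarith [hp.1, hp.2]
    _ ≤ liminf (fun k => ∫⁻ p, ENNReal.ofReal (χ k p ^ 2 * ‖dMu u p‖ ^ 2) ∂vol) atTop := by
        refine lintegral_liminf_le fun k => ?_
        have := (sχ k).continuous.measurable
        have := cP.measurable
        fun_prop
    _ ≤ _ := by
        refine liminf_le_of_le (by isBoundedDefault) fun b hb => ?_
        obtain ⟨k, hk⟩ := hb.exists
        exact hk.trans (hkey k)

section

variable {lam Λ B : ℝ} {Ψ : ℝ × ℝ → ℂ}

/-! ### Subtraction of the interior part -/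

/-- The part of `Ψ` near the boundary, obtained by subtracting the volume potential of its source
away from the boundary. -/
def innerPart (lam : ℝ) (Ψ : ℝ × ℝ → ℂ) (p : ℝ × ℝ) : ℂ :=
  ((1 * cutoff p.2 : ℝ) : ℂ) * (Ψ p + extPot lam (normalTrace Ψ) p) + -extPot lam (normalTrace Ψ) p

lemma innerPart_eq (lam : ℝ) (Ψ : ℝ × ℝ → ℂ) (p : ℝ × ℝ) : innerPart lam Ψ p
    = Ψ p - ((1 - cutoff p.2 : ℝ) : ℂ) * (Ψ p + extPot lam (normalTrace Ψ) p) := by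
  rw [innerPart]; push_cast; ring

lemma IsDirichlet.contDiff_innerPart (h : IsDirichlet Ψ) (lam : ℝ) :
    ContDiff ℝ ∞ (innerPart lam Ψ) :=
  ((contDiff_ofReal_comp (contDiff_mul_split (a := fun _ => 1) contDiff_const contDiff_cutoff)).mul
    (h.smooth.add (h.contDiff_extPot lam))).add (h.contDiff_extPot lam).neg

lemma IsDirichlet.innerPart_zero (h : IsDirichlet Ψ) (lam θ : ℝ) : innerPart lam Ψ (θ, 0) = 0 := by
  rw [innerPart_eq, cutoff_eq_one (by simp), h.zero]; simp

/-- Leibniz' rule for the cutoff. The term `(1 - cutoff)` times the residual of `extPot` disappears: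
for `μ > 1/2` the residual is zero, and for smaller `μ` the cutoff is `1`. What remains lives in `μ
≤ 2`. -/
lemma resid_innerPart (hl : 1 + Complex.exp (Complex.I * Real.pi * lam) ≠ 0) (h : IsDirichlet Ψ)
    {p : ℝ × ℝ} (hp : 0 < p.2) :
    resid lam (innerPart lam Ψ) p = ((cutoff p.2 : ℝ) : ℂ) * resid lam Ψ p
      - 2 * (((deriv cutoff p.2 : ℝ) : ℂ) * dMu (fun q => Ψ q + extPot lam (normalTrace Ψ) q) p)
      - ((deriv (deriv cutoff) p.2 : ℝ) : ℂ) * (Ψ p + extPot lam (normalTrace Ψ) p) := by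
  have sE := h.contDiff_extPot lam
  have su : ContDiff ℝ ∞ fun q => Ψ q + extPot lam (normalTrace Ψ) q := h.smooth.add sE
  have one : ContDiff ℝ ∞ fun _ : ℝ => (1 : ℝ) := contDiff_const
  have sη := contDiff_ofReal_comp (contDiff_mul_split one contDiff_cutoff)
  have zero : ContDiff ℝ ∞ fun _ : ℝ => (0 : ℝ) := contDiff_const
  unfold innerPart
  rw [resid_add lam (sη.mul su) sE.neg, resid_neg, resid_mul lam sη su, resid_add lam h.smooth sE,
    dTheta_mul_split one contDiff_cutoff, dMu_mul_split one contDiff_cutoff, deriv_const',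
    dTheta_mul_split zero contDiff_cutoff, dMu_mul_split one (contDiff_deriv contDiff_cutoff),
    deriv_const']
  have hE : (1 - ((cutoff p.2 : ℝ) : ℂ)) * resid lam (extPot lam (normalTrace Ψ)) p = 0 := by
    rcases lt_or_ge (1 / 2) p.2 with h1 | h1
    · rw [resid_extPot hl h h1, mul_zero]
    · rw [cutoff_eq_one (by rw [abs_of_pos hp]; linarith)]; simp
  push_cast
  linear_combination -hE

lemma inv_pow_le_one {n : ℕ} {x : ℝ} (hx : 0 < x) : ((1 + x) ^ (2 * n))⁻¹ ≤ 1 :=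
  inv_le_one_of_one_le₀ (one_le_pow₀ (by linarith))

lemma one_le_mul_inv_pow (n : ℕ) {x : ℝ} (hx : 0 < x) (hx' : x ≤ 3) :
    1 ≤ 4 ^ (2 * n) * ((1 + x) ^ (2 * n))⁻¹ := by
  rw [← div_eq_mul_inv, one_le_div (by positivity)]
  gcongr
  linarith

lemma norm_sq_sub_sub_le (a b c : ℂ) :
    ‖a - b - c‖ ^ 2 ≤ 3 * (‖a‖ ^ 2 + ‖b‖ ^ 2 + ‖c‖ ^ 2) := by
  have h : ‖a - b - c‖ ≤ ‖a‖ + ‖b‖ + ‖c‖ :=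
    (norm_sub_le _ _).trans (by gcongr; exact norm_sub_le _ _)
  calc ‖a - b - c‖ ^ 2 ≤ (‖a‖ + ‖b‖ + ‖c‖) ^ 2 := by gcongr
    _ ≤ _ := by nlinarith [sq_nonneg (‖a‖ - ‖b‖), sq_nonneg (‖a‖ - ‖c‖), sq_nonneg (‖b‖ - ‖c‖)]

/-- The constant of `lintegral_resid_innerPart_le`. -/
def innerConst (Λ B : ℝ) (n : ℕ) : ℝ :=
  4 ^ (2 * n) * (3 + (12 * cutoffBound ^ 2 * bandConst Λ + 3 * cutoffBound ^ 2)
    * (potConst (2 * n + 2) B + 1))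

lemma bandConst_nonneg (hΛ : 0 ≤ Λ) : 0 ≤ bandConst Λ := by
  unfold bandConst; positivity

lemma innerConst_nonneg (hΛ : 0 ≤ Λ) (B : ℝ) (n : ℕ) : 0 ≤ innerConst Λ B n := by
  have := bandConst_nonneg hΛ
  have := potConst_nonneg (2 * n + 2) B
  unfold innerConst; positivity

lemma ofReal_mul_sq_norm {x : ℝ} (hx : 0 ≤ x) (z : ℂ) :
    ENNReal.ofReal (x * ‖z‖ ^ 2) = ENNReal.ofReal x * ‖z‖ₑ ^ 2 := by
  rw [ENNReal.ofReal_mul hx, ENNReal.ofReal_pow (norm_nonneg _), ofReal_norm]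

/-- The new source vanishes for `μ > 2`, where the weight `(1+μ)^{-2n}` is comparable to `1`; this
is how an unweighted bound arises from a weighted one. In the band `u` is the volume potential of
`g`, and its normal derivative is controlled by `lintegral_dMu_band_le`. -/
lemma lintegral_resid_innerPart_le (ha : Admissible Λ B lam) (h : IsDirichlet Ψ) (n : ℕ)
    {a : ℝ → ℝ} (hs : SlowWeight a) :
    ∫⁻ p, ENNReal.ofReal (a p.1 ^ 2) * ‖resid lam (innerPart lam Ψ) p‖ₑ ^ 2 ∂vol
      ≤ ENNReal.ofReal (innerConst Λ B n) * wmass n a (resid lam Ψ) := by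
  have hΛ := ha.nonneg
  have hc0 := cutoffBound_nonneg
  have hb0 := bandConst_nonneg hΛ
  set g := resid lam Ψ with hg
  set u : ℝ × ℝ → ℂ := fun q => Ψ q + extPot lam (normalTrace Ψ) q with hu
  have sE := h.contDiff_extPot lam
  have su : ContDiff ℝ ∞ u := h.smooth.add sE
  have cg := (contDiff_resid lam h.smooth).continuous
  have cP := (contDiff_dMu su).continuous
  have am := hs.smooth.continuous.measurable
  have hug : ∀ p : ℝ × ℝ, 1 / 2 < p.2 → resid lam u p = g p := fun p hp => by
    rw [hu, resid_add lam h.smooth sE, resid_extPot ha.ne h hp, add_zero]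
  have huG : ∀ p : ℝ × ℝ, 1 / 2 ≤ p.2 → u p = greenPot lam g p := fun p hp =>
    add_extPot_eq ha.ne h hp
  set P := potConst (2 * n + 2) B with hP
  have hP0 : 0 ≤ P := potConst_nonneg _ _
  set w : ℝ × ℝ → ℝ := fun p => a p.1 ^ 2 * ((1 + p.2) ^ (2 * n))⁻¹ with hw
  set c := (4 : ℝ) ^ (2 * n) with hc
  have hG := wmass_greenPot_le ha.le n hs cg.measurable
  -- the mass of `g` and of the volume potential
  have b1 : ∀ p : ℝ × ℝ, 0 < p.2 → p.2 ≤ 3 → a p.1 ^ 2 ≤ c * w p := fun p h1 h2 => by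
    have := one_le_mul_inv_pow n h1 h2
    calc a p.1 ^ 2 = a p.1 ^ 2 * 1 := (mul_one _).symm
      _ ≤ a p.1 ^ 2 * (c * ((1 + p.2) ^ (2 * n))⁻¹) := by gcongr
      _ = _ := by rw [hw]; ring
  have hw0 : ∀ p : ℝ × ℝ, 0 < p.2 → 0 ≤ w p := fun p hp => by rw [hw]; positivity
  have hmG := measurable_greenPot lam cg.measurable
  have hmw : Measurable w := by rw [hw]; fun_prop
  have hcP := lintegral_dMu_band_le ha.abs_le su hug hs
  have hwide : ∫⁻ p in wideBand, ENNReal.ofReal (bandConst Λ * (a p.1 ^ 2 * (‖u p‖ ^ 2 + ‖g p‖ ^ 2)))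
      ∂vol ≤ ENNReal.ofReal (bandConst Λ * c) * (wmass n a (greenPot lam g) + wmass n a g) := by
    rw [← lintegral_indicator measurableSet_wideBand, wmass, wmass,
      ← lintegral_add_left (by fun_prop), ← lintegral_const_mul' _ _ ENNReal.ofReal_ne_top]
    refine lintegral_mono_ae ?_
    filter_upwards [ae_vol_pos] with p hp
    refine indicator_apply_le' (fun hpb => ?_) fun _ => zero_le
    have hb := b1 p hp (by linarith [hpb.2])
    have hwp := hw0 p hp
    rw [huG p hpb.1.le, ← ofReal_mul_sq_norm hwp, ← ofReal_mul_sq_norm hwp,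
      ← ENNReal.ofReal_add (by positivity) (by positivity), ← ENNReal.ofReal_mul (by positivity)]
    refine ENNReal.ofReal_le_ofReal ?_
    calc bandConst Λ * (a p.1 ^ 2 * (‖greenPot lam g p‖ ^ 2 + ‖g p‖ ^ 2))
        ≤ bandConst Λ * ((c * w p) * (‖greenPot lam g p‖ ^ 2 + ‖g p‖ ^ 2)) := by gcongr
      _ = _ := by ring
  have hsum : wmass n a (greenPot lam g) + wmass n a g ≤ ENNReal.ofReal (P + 1) * wmass n a g := by
    rw [ENNReal.ofReal_add hP0 zero_le_one, add_mul, ENNReal.ofReal_one, one_mul]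
    gcongr
  calc ∫⁻ p, ENNReal.ofReal (a p.1 ^ 2) * ‖resid lam (innerPart lam Ψ) p‖ₑ ^ 2 ∂vol
      ≤ ∫⁻ p, (ENNReal.ofReal (3 * c) * (ENNReal.ofReal (w p) * ‖g p‖ₑ ^ 2)
        + (ENNReal.ofReal (12 * cutoffBound ^ 2) * band.indicator (fun p =>
          ENNReal.ofReal (a p.1 ^ 2) * ‖dMu u p‖ₑ ^ 2) p
        + ENNReal.ofReal (3 * cutoffBound ^ 2 * c)
          * (ENNReal.ofReal (w p) * ‖greenPot lam g p‖ₑ ^ 2))) ∂vol := by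
        refine lintegral_mono_ae ?_
        filter_upwards [ae_vol_pos] with p hp
        rw [resid_innerPart ha.ne h hp]
        have hwp := hw0 p hp
        have h3 := norm_sq_sub_sub_le (((cutoff p.2 : ℝ) : ℂ) * g p)
          (2 * (((deriv cutoff p.2 : ℝ) : ℂ) * dMu u p)) (((deriv (deriv cutoff) p.2 : ℝ) : ℂ) * u p)
        simp only [norm_mul, Complex.norm_real, mul_pow, Real.norm_eq_abs, Complex.norm_ofNat] at h3
        have k1 := abs_deriv_cutoff_le p.2
        have k2 := abs_deriv_deriv_cutoff_le p.2
        have k3 : |cutoff p.2| ≤ 1 := by rw [abs_of_nonneg (cutoff_nonneg _)]; exact cutoff_le_one _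
        rw [← ofReal_mul_sq_norm (sq_nonneg _), ← ofReal_mul_sq_norm hwp, ← ofReal_mul_sq_norm hwp]
        by_cases hpb : p ∈ band
        · have hup : u p = greenPot lam g p := huG p (by linarith [hpb.1])
          rw [hup] at h3
          rw [indicator_of_mem hpb, ← ofReal_mul_sq_norm (sq_nonneg _), ← ENNReal.ofReal_mul (by positivity),
            ← ENNReal.ofReal_mul (by positivity), ← ENNReal.ofReal_mul (by positivity),
            ← ENNReal.ofReal_add (by positivity) (by positivity),
            ← ENNReal.ofReal_add (by positivity) (by positivity)]
          refine ENNReal.ofReal_le_ofReal ?_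
          have hb := b1 p hp (by linarith [hpb.2])
          change a p.1 ^ 2 * ‖_ - _ * u p‖ ^ 2 ≤ _
          rw [hup]
          calc _ ≤ a p.1 ^ 2 * (3 * (|cutoff p.2| ^ 2 * ‖g p‖ ^ 2
                + 2 ^ 2 * (|deriv cutoff p.2| ^ 2 * ‖dMu u p‖ ^ 2)
                + |deriv (deriv cutoff) p.2| ^ 2 * ‖greenPot lam g p‖ ^ 2)) := by gcongr
            _ ≤ a p.1 ^ 2 * (3 * (1 ^ 2 * ‖g p‖ ^ 2
                + 2 ^ 2 * (cutoffBound ^ 2 * ‖dMu u p‖ ^ 2)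
                + cutoffBound ^ 2 * ‖greenPot lam g p‖ ^ 2)) := by gcongr
            _ = a p.1 ^ 2 * (3 * ‖g p‖ ^ 2) + 12 * cutoffBound ^ 2 * (a p.1 ^ 2 * ‖dMu u p‖ ^ 2)
                + a p.1 ^ 2 * (3 * cutoffBound ^ 2 * ‖greenPot lam g p‖ ^ 2) := by ring
            _ ≤ (c * w p) * (3 * ‖g p‖ ^ 2) + 12 * cutoffBound ^ 2 * (a p.1 ^ 2 * ‖dMu u p‖ ^ 2)
                + (c * w p) * (3 * cutoffBound ^ 2 * ‖greenPot lam g p‖ ^ 2) := by gcongr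
            _ = _ := by ring
        · have hp12 : p.2 < 1 ∨ 2 < p.2 := by
            by_contra hcon
            push Not at hcon
            exact hpb hcon
          have z1 : deriv cutoff p.2 = 0 := by
            rcases hp12 with h1 | h1
            · exact deriv_cutoff_eq_zero' (by rw [abs_of_pos hp]; exact h1.le)
            · exact deriv_cutoff_eq_zero (by rw [abs_of_pos hp]; exact h1.le)
          have z2 : deriv (deriv cutoff) p.2 = 0 :=
            deriv_deriv_cutoff_eq_zero (by rwa [abs_of_pos hp])
          refine le_add_right ?_
          rw [← ENNReal.ofReal_mul (by positivity)]
          refine ENNReal.ofReal_le_ofReal ?_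
          rw [z1, z2]
          simp only [Complex.ofReal_zero, zero_mul, mul_zero, sub_zero, norm_mul, mul_pow,
            Complex.norm_real, Real.norm_eq_abs]
          rcases hp12 with h1 | h1
          · have hb := b1 p hp (by linarith)
            calc a p.1 ^ 2 * (|cutoff p.2| ^ 2 * ‖g p‖ ^ 2) ≤ (c * w p) * (1 ^ 2 * ‖g p‖ ^ 2) := by
                  gcongr
              _ ≤ _ := by
                  have : 0 ≤ c * (w p * ‖g p‖ ^ 2) := by positivity
                  linarith
          · rw [cutoff_eq_zero (by rw [abs_of_pos hp]; exact h1.le)]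
            simp only [abs_zero, ne_eq, OfNat.ofNat_ne_zero, not_false_eq_true, zero_pow, zero_mul,
              mul_zero]
            positivity
    _ = ENNReal.ofReal (3 * c) * wmass n a g + (ENNReal.ofReal (12 * cutoffBound ^ 2)
          * (∫⁻ p in band, ENNReal.ofReal (a p.1 ^ 2) * ‖dMu u p‖ₑ ^ 2 ∂vol)
        + ENNReal.ofReal (3 * cutoffBound ^ 2 * c) * wmass n a (greenPot lam g)) := by
        have cgm := cg.measurable
        have cPm := cP.measurable
        have m1 : Measurable fun p => ENNReal.ofReal (3 * c) * (ENNReal.ofReal (w p) * ‖g p‖ₑ ^ 2) := by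
          fun_prop
        have m2 : Measurable fun p => ENNReal.ofReal (12 * cutoffBound ^ 2) * band.indicator (fun p =>
          ENNReal.ofReal (a p.1 ^ 2) * ‖dMu u p‖ₑ ^ 2) p :=
          ((by fun_prop : Measurable fun p : ℝ × ℝ =>
            ENNReal.ofReal (a p.1 ^ 2) * ‖dMu u p‖ₑ ^ 2).indicator measurableSet_band).const_mul _
        rw [lintegral_add_left m1, lintegral_add_left m2,
          lintegral_const_mul' _ _ ENNReal.ofReal_ne_top,
          lintegral_const_mul' _ _ ENNReal.ofReal_ne_top,
          lintegral_const_mul' _ _ ENNReal.ofReal_ne_top, lintegral_indicator measurableSet_band]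
        rfl
    _ ≤ ENNReal.ofReal (3 * c) * wmass n a g + (ENNReal.ofReal (12 * cutoffBound ^ 2)
          * (ENNReal.ofReal (bandConst Λ * c) * (ENNReal.ofReal (P + 1) * wmass n a g))
        + ENNReal.ofReal (3 * cutoffBound ^ 2 * c) * (ENNReal.ofReal (P + 1) * wmass n a g)) := by
        gcongr
        · exact hcP.trans (hwide.trans (by gcongr))
        · exact le_self_add.trans hsum
    _ = _ := by
        rw [innerConst, ← hP, ← hc, ← mul_assoc, ← mul_assoc, ← mul_assoc,
          ← ENNReal.ofReal_mul (by positivity), ← ENNReal.ofReal_mul (by positivity),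
          ← ENNReal.ofReal_mul (by positivity), ← add_mul, ← add_mul,
          ← ENNReal.ofReal_add (by positivity) (by positivity),
          ← ENNReal.ofReal_add (by positivity) (by positivity)]
        congr 2
        ring

end

section

variable {lam Λ B : ℝ} {Ψ : ℝ × ℝ → ℂ}

/-! ### Truncation to compact supports -/

/-- The product cutoff at scale `R` in both variables. -/
def boxCut (R : ℝ) (p : ℝ × ℝ) : ℝ := scaledCut R p.1 * scaledCut R p.2

lemma contDiff_boxCut (R : ℝ) : ContDiff ℝ ∞ (boxCut R) :=
  contDiff_mul_split (contDiff_scaledCut R) (contDiff_scaledCut R)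

lemma boxCut_nonneg (R : ℝ) (p : ℝ × ℝ) : 0 ≤ boxCut R p :=
  mul_nonneg (scaledCut_nonneg _ _) (scaledCut_nonneg _ _)

lemma boxCut_le_one (R : ℝ) (p : ℝ × ℝ) : boxCut R p ≤ 1 :=
  mul_le_one₀ (scaledCut_le_one _ _) (scaledCut_nonneg _ _) (scaledCut_le_one _ _)

lemma boxCut_eq_one {R : ℝ} (hR : 0 < R) {p : ℝ × ℝ} (h1 : |p.1| ≤ R) (h2 : |p.2| ≤ R) :
    boxCut R p = 1 := by
  rw [boxCut, scaledCut_eq_one hR h1, scaledCut_eq_one hR h2, one_mul]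

lemma hasCompactSupport_boxCut {R : ℝ} (hR : 0 < R) : HasCompactSupport (boxCut R) := by
  refine HasCompactSupport.intro (K := Icc (-(2 * R)) (2 * R) ×ˢ Icc (-(2 * R)) (2 * R))
    (isCompact_Icc.prod isCompact_Icc) fun p hp => ?_
  rw [boxCut]
  by_cases h1 : 2 * R ≤ |p.1|
  · rw [scaledCut_eq_zero hR h1, zero_mul]
  · rw [scaledCut_eq_zero (x := p.2) hR, mul_zero]
    by_contra h2
    exact hp ⟨abs_le.1 (not_le.1 h1).le, abs_le.1 (not_le.1 h2).le⟩

lemma abs_fderiv_boxCut_le {R : ℝ} (hR : 0 < R) (p : ℝ × ℝ) :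
    |fderiv ℝ (boxCut R) p (1, 0)| ≤ cutoffBound / R ∧
    |fderiv ℝ (boxCut R) p (0, 1)| ≤ cutoffBound / R := by
  have h := fderiv_mul_split (contDiff_scaledCut R) (contDiff_scaledCut R) p
  have h0 : 0 ≤ cutoffBound / R := div_nonneg cutoffBound_nonneg hR.le
  unfold boxCut
  rw [h.1, h.2, abs_mul, abs_mul, abs_of_nonneg (scaledCut_nonneg R p.1),
    abs_of_nonneg (scaledCut_nonneg R p.2)]
  exact ⟨(mul_le_mul (abs_deriv_scaledCut_le hR _) (scaledCut_le_one _ _) (scaledCut_nonneg _ _)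
    h0).trans_eq (mul_one _), (mul_le_mul (scaledCut_le_one _ _) (abs_deriv_scaledCut_le hR _)
    (abs_nonneg _) zero_le_one).trans_eq (one_mul _)⟩

lemma eventually_abs_lt (p : ℝ × ℝ) : ∀ᶠ k : ℕ in atTop, |p.1| < (k : ℝ) + 1 ∧ |p.2| < (k : ℝ) + 1 := by
  filter_upwards [eventually_ge_atTop (max ⌈|p.1|⌉₊ ⌈|p.2|⌉₊)] with k hk
  have e1 : (⌈|p.1|⌉₊ : ℝ) ≤ k := by exact_mod_cast (le_max_left _ _).trans hk
  have e2 : (⌈|p.2|⌉₊ : ℝ) ≤ k := by exact_mod_cast (le_max_right _ _).trans hk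
  exact ⟨by linarith [Nat.le_ceil |p.1|], by linarith [Nat.le_ceil |p.2|]⟩

lemma norm_ofReal_mul_le {x y c d : ℝ} (hx : |x| ≤ c) (hy : |y| ≤ d) : ‖((x * y : ℝ) : ℂ)‖ ≤ c * d := by
  rw [Complex.norm_real, Real.norm_eq_abs, abs_mul]
  exact mul_le_mul hx hy (abs_nonneg _) ((abs_nonneg _).trans hx)

/-- Finiteness only: box cutoffs in the energy estimate and Fatou's lemma. It makes the truncation
error of the non-compactly supported `innerPart` tend to zero. -/
lemma lintegral_energy_ne_top {v : ℝ × ℝ → ℂ} (hv : ContDiff ℝ ∞ v)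
    (h0 : ∀ θ, v (θ, 0) = 0) (h1 : ∫⁻ p, ‖v p‖ₑ ^ 2 ∂vol ≠ ⊤)
    (h2 : ∫⁻ p, ‖resid lam v p‖ₑ ^ 2 ∂vol ≠ ⊤) :
    ∫⁻ p, (‖covD v p‖ₑ ^ 2 + ‖dMu v p‖ₑ ^ 2) ∂vol ≠ ⊤ := by
  have hc0 := cutoffBound_nonneg
  have cv := hv.continuous
  have cP := (contDiff_dMu hv).continuous
  have cD := (contDiff_covD hv).continuous
  set A : ℝ := 1 + 2 * |lam| + 8 * cutoffBound ^ 2 with hA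
  have hA0 : 0 ≤ A := by positivity
  set T : ℝ≥0∞ := ∫⁻ p, (ENNReal.ofReal A * ‖v p‖ₑ ^ 2 + ‖resid lam v p‖ₑ ^ 2) ∂vol with hT
  have hTt : T ≠ ⊤ := by
    have := cv.measurable
    rw [hT, lintegral_add_left (by fun_prop), lintegral_const_mul' _ _ ENNReal.ofReal_ne_top]
    exact ENNReal.add_ne_top.2 ⟨ENNReal.mul_ne_top ENNReal.ofReal_ne_top h1, h2⟩
  have hkey : ∀ k : ℕ, ∫⁻ p, ENNReal.ofReal (boxCut (k + 1) p ^ 2 * (‖covD v p‖ ^ 2 + ‖dMu v p‖ ^ 2))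
      ∂vol ≤ T := by
    intro k
    have hk : (0 : ℝ) < k + 1 := by positivity
    set χ := boxCut (k + 1) with hχ
    have sχ : ContDiff ℝ ∞ χ := contDiff_boxCut _
    have kχ : HasCompactSupport χ := hasCompactSupport_boxCut hk
    refine (lintegral_energy_le sχ kχ hv fun θ => Or.inr (h0 θ)).trans (lintegral_mono fun p => ?_)
    rw [← ofReal_mul_sq_norm hA0, ← ofReal_norm, ← ENNReal.ofReal_pow (norm_nonneg _),
      ← ENNReal.ofReal_add (by positivity) (by positivity)]
    refine ENNReal.ofReal_le_ofReal ?_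
    have hL := norm_landau_le le_rfl v p (lam := lam)
    have hχ1 : χ p ^ 2 ≤ 1 := pow_le_one₀ (boxCut_nonneg _ _) (boxCut_le_one _ _)
    have hcb : cutoffBound / (k + 1) ≤ cutoffBound := div_le_self hc0 (by linarith [k.cast_nonneg (α := ℝ)])
    have hf := abs_fderiv_boxCut_le hk p
    have q1 : fderiv ℝ χ p (1, 0) ^ 2 ≤ cutoffBound ^ 2 := by
      rw [← sq_abs]; gcongr; exact hf.1.trans hcb
    have q2 : fderiv ℝ χ p (0, 1) ^ 2 ≤ cutoffBound ^ 2 := by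
      rw [← sq_abs]; gcongr; exact hf.2.trans hcb
    have q3 : 2 * (‖v p‖ * ‖landau v p‖) ≤ (1 + 2 * |lam|) * ‖v p‖ ^ 2 + ‖resid lam v p‖ ^ 2 := by
      have : ‖v p‖ * ‖landau v p‖ ≤ ‖v p‖ * (‖resid lam v p‖ + |lam| * ‖v p‖) := by gcongr
      nlinarith [sq_nonneg (‖v p‖ - ‖resid lam v p‖)]
    calc _ ≤ 2 * (1 * (‖v p‖ * ‖landau v p‖)) + 4 * ((cutoffBound ^ 2 + cutoffBound ^ 2) * ‖v p‖ ^ 2) := by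
          gcongr
      _ ≤ _ := by rw [hA]; linarith
  refine ne_top_of_le_ne_top hTt ?_
  calc ∫⁻ p, (‖covD v p‖ₑ ^ 2 + ‖dMu v p‖ₑ ^ 2) ∂vol
      ≤ ∫⁻ p, liminf (fun k : ℕ => ENNReal.ofReal (boxCut (k + 1) p ^ 2
        * (‖covD v p‖ ^ 2 + ‖dMu v p‖ ^ 2))) atTop ∂vol := by
        refine lintegral_mono fun p => ?_
        refine le_liminf_of_le (by isBoundedDefault) ?_
        filter_upwards [eventually_abs_lt p] with k hk
        rw [boxCut_eq_one (by positivity) hk.1.le hk.2.le, one_pow, one_mul,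
          ENNReal.ofReal_add (by positivity) (by positivity), ENNReal.ofReal_pow (norm_nonneg _),
          ENNReal.ofReal_pow (norm_nonneg _), ofReal_norm, ofReal_norm]
    _ ≤ liminf (fun k : ℕ => ∫⁻ p, ENNReal.ofReal (boxCut (k + 1) p ^ 2
        * (‖covD v p‖ ^ 2 + ‖dMu v p‖ ^ 2)) ∂vol) atTop := by
        refine lintegral_liminf_le fun k => ?_
        have := (contDiff_boxCut (k + 1)).continuous.measurable
        have := cP.measurable
        have := cD.measurable
        fun_prop
    _ ≤ _ := by
        refine liminf_le_of_le (by isBoundedDefault) fun b hb => ?_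
        obtain ⟨k, hk⟩ := hb.exists
        exact hk.trans (hkey k)

/-- The commutator of the operator with a cutoff at scale `R` contains only derivatives of the
cutoff, each of size at most a multiple of `1/R`. -/
lemma resid_boxCut_mul_le {R : ℝ} (hR : 1 ≤ R) {v : ℝ × ℝ → ℂ} (hv : ContDiff ℝ ∞ v) (p : ℝ × ℝ) :
    ‖resid lam (fun q => (boxCut R q : ℂ) * v q) p - (boxCut R p : ℂ) * resid lam v p‖ₑ ^ 2
      ≤ ENNReal.ofReal (24 * cutoffBound ^ 2 / R)
        * (‖v p‖ₑ ^ 2 + (‖covD v p‖ₑ ^ 2 + ‖dMu v p‖ₑ ^ 2)) := by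
  have hR0 : 0 < R := by linarith
  have hc0 := cutoffBound_nonneg
  have sc := contDiff_scaledCut R
  have sc' := contDiff_deriv sc
  have s1 : ContDiff ℝ ∞ fun q => (boxCut R q : ℂ) := contDiff_ofReal_comp (contDiff_boxCut R)
  rw [resid_mul lam s1 hv]
  unfold boxCut
  rw [dTheta_mul_split sc sc, dMu_mul_split sc sc, dTheta_mul_split sc' sc, dMu_mul_split sc sc']
  set t := scaledCut R p.1
  set s := scaledCut R p.2
  set t' := deriv (scaledCut R) p.1
  set s' := deriv (scaledCut R) p.2
  set t'' := deriv (deriv (scaledCut R)) p.1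
  set s'' := deriv (deriv (scaledCut R)) p.2
  set γ := cutoffBound / R with hγ
  have hγ0 : 0 ≤ γ := by positivity
  have ht : |t| ≤ 1 := abs_scaledCut_le_one _ _
  have hs : |s| ≤ 1 := abs_scaledCut_le_one _ _
  have ht' : |t'| ≤ γ := abs_deriv_scaledCut_le hR0 _
  have hs' : |s'| ≤ γ := abs_deriv_scaledCut_le hR0 _
  have hle : cutoffBound / R ^ 2 ≤ γ := by
    rw [hγ]; gcongr; nlinarith
  have ht'' : |t''| ≤ γ := (abs_deriv_deriv_scaledCut_le hR0 _).trans hle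
  have hs'' : |s''| ≤ γ := (abs_deriv_deriv_scaledCut_le hR0 _).trans hle
  have hn : ‖((t * s : ℝ) : ℂ) * resid lam v p
        - 2 * (((t' * s : ℝ) : ℂ) * covD v p + ((t * s' : ℝ) : ℂ) * dMu v p)
        - (((t'' * s : ℝ) : ℂ) + ((t * s'' : ℝ) : ℂ)) * v p - ((t * s : ℝ) : ℂ) * resid lam v p‖
      ≤ 2 * γ * (‖v p‖ + ‖covD v p‖ + ‖dMu v p‖) := by
    rw [show ((t * s : ℝ) : ℂ) * resid lam v p
        - 2 * (((t' * s : ℝ) : ℂ) * covD v p + ((t * s' : ℝ) : ℂ) * dMu v p)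
        - (((t'' * s : ℝ) : ℂ) + ((t * s'' : ℝ) : ℂ)) * v p - ((t * s : ℝ) : ℂ) * resid lam v p
      = -(2 * (((t' * s : ℝ) : ℂ) * covD v p + ((t * s' : ℝ) : ℂ) * dMu v p)
        + (((t'' * s : ℝ) : ℂ) + ((t * s'' : ℝ) : ℂ)) * v p) by ring, norm_neg]
    calc _ ≤ 2 * (‖((t' * s : ℝ) : ℂ)‖ * ‖covD v p‖ + ‖((t * s' : ℝ) : ℂ)‖ * ‖dMu v p‖)
          + (‖((t'' * s : ℝ) : ℂ)‖ + ‖((t * s'' : ℝ) : ℂ)‖) * ‖v p‖ := by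
          refine (norm_add_le _ _).trans (add_le_add ?_ ?_)
          · rw [norm_mul, Complex.norm_ofNat, ← norm_mul, ← norm_mul]
            exact mul_le_mul_of_nonneg_left (norm_add_le _ _) zero_le_two
          · rw [norm_mul]
            exact mul_le_mul_of_nonneg_right (norm_add_le _ _) (norm_nonneg _)
      _ ≤ 2 * (γ * 1 * ‖covD v p‖ + 1 * γ * ‖dMu v p‖) + (γ * 1 + 1 * γ) * ‖v p‖ := by
          have k1 := norm_ofReal_mul_le ht' hs
          have k2 := norm_ofReal_mul_le ht hs'
          have k3 := norm_ofReal_mul_le ht'' hs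
          have k4 := norm_ofReal_mul_le ht hs''
          exact add_le_add (mul_le_mul_of_nonneg_left (add_le_add
            (mul_le_mul_of_nonneg_right k1 (norm_nonneg _))
            (mul_le_mul_of_nonneg_right k2 (norm_nonneg _))) zero_le_two)
            (mul_le_mul_of_nonneg_right (add_le_add k3 k4) (norm_nonneg _))
      _ = _ := by ring
  rw [← ofReal_norm, ← ofReal_norm, ← ofReal_norm, ← ofReal_norm, ← ENNReal.ofReal_pow (norm_nonneg _),
    ← ENNReal.ofReal_pow (norm_nonneg _), ← ENNReal.ofReal_pow (norm_nonneg _),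
    ← ENNReal.ofReal_pow (norm_nonneg _), ← ENNReal.ofReal_add (by positivity) (by positivity),
    ← ENNReal.ofReal_add (by positivity) (by positivity), ← ENNReal.ofReal_mul (by positivity)]
  refine ENNReal.ofReal_le_ofReal ?_
  have hγ2 : γ ^ 2 ≤ cutoffBound ^ 2 / R := by
    rw [hγ, div_pow]; gcongr; nlinarith
  set x := ‖v p‖
  set y := ‖covD v p‖
  set z := ‖dMu v p‖
  have hxyz : (x + y + z) ^ 2 ≤ 3 * (x ^ 2 + (y ^ 2 + z ^ 2)) := by
    nlinarith [sq_nonneg (x - y), sq_nonneg (x - z), sq_nonneg (y - z)]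
  calc _ ≤ (2 * γ * (x + y + z)) ^ 2 := pow_le_pow_left₀ (norm_nonneg _) hn 2
    _ = 4 * γ ^ 2 * (x + y + z) ^ 2 := by ring
    _ ≤ 4 * (cutoffBound ^ 2 / R) * (3 * (x ^ 2 + (y ^ 2 + z ^ 2))) := by
        exact mul_le_mul (by linarith) hxyz (sq_nonneg _) (by positivity)
    _ ≤ _ := by
        have : 0 ≤ (cutoffBound ^ 2 / R) * (x ^ 2 + (y ^ 2 + z ^ 2)) := by positivity
        rw [mul_div_assoc]
        linarith

/-- The commutator error is a finite energy divided by `R`. How large `R` must be is irrelevant, as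
it enters no constant. -/
lemma exists_boxCut_resid_le {v : ℝ × ℝ → ℂ} (hv : ContDiff ℝ ∞ v)
    (h0 : ∀ θ, v (θ, 0) = 0) (h1 : ∫⁻ p, ‖v p‖ₑ ^ 2 ∂vol ≠ ⊤)
    (h2 : ∫⁻ p, ‖resid lam v p‖ₑ ^ 2 ∂vol ≠ ⊤) (R₀ : ℝ) {η : ℝ} (hη : 0 < η) :
    ∃ R, R₀ ≤ R ∧ 1 ≤ R ∧ ∫⁻ p, ‖resid lam (fun q => (boxCut R q : ℂ) * v q) p
      - (boxCut R p : ℂ) * resid lam v p‖ₑ ^ 2 ∂vol ≤ ENNReal.ofReal η := by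
  have hc0 := cutoffBound_nonneg
  set S := ∫⁻ p, (‖v p‖ₑ ^ 2 + (‖covD v p‖ₑ ^ 2 + ‖dMu v p‖ₑ ^ 2)) ∂vol with hS
  have hSt : S ≠ ⊤ := by
    have := hv.continuous.measurable
    rw [hS, lintegral_add_left (by fun_prop)]
    exact ENNReal.add_ne_top.2 ⟨h1, lintegral_energy_ne_top hv h0 h1 h2⟩
  set x := 24 * cutoffBound ^ 2 * S.toReal with hx
  have hx0 : 0 ≤ x := by positivity
  refine ⟨max R₀ (max 1 (x / η)), le_max_left _ _, (le_max_left _ _).trans (le_max_right _ _), ?_⟩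
  set R := max R₀ (max 1 (x / η))
  have hR : 1 ≤ R := (le_max_left _ _).trans (le_max_right _ _)
  have hRx : x / η ≤ R := (le_max_right _ _).trans (le_max_right _ _)
  calc _ ≤ ∫⁻ p, ENNReal.ofReal (24 * cutoffBound ^ 2 / R)
        * (‖v p‖ₑ ^ 2 + (‖covD v p‖ₑ ^ 2 + ‖dMu v p‖ₑ ^ 2)) ∂vol :=
        lintegral_mono fun p => resid_boxCut_mul_le hR hv p
    _ = ENNReal.ofReal (24 * cutoffBound ^ 2 / R) * S :=
        lintegral_const_mul' _ _ ENNReal.ofReal_ne_top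
    _ = ENNReal.ofReal (x / R) := by
        rw [← ENNReal.ofReal_toReal hSt, ← ENNReal.ofReal_mul (by positivity)]
        congr 1
        rw [hx]; ring
    _ ≤ _ := by
        refine ENNReal.ofReal_le_ofReal ?_
        rw [div_le_iff₀ (by linarith)]
        rw [div_le_iff₀ hη] at hRx
        linarith

lemma isDirichlet_boxCut_mul {R : ℝ} (hR : 0 < R) {v : ℝ × ℝ → ℂ} (hv : ContDiff ℝ ∞ v)
    (h0 : ∀ θ, v (θ, 0) = 0) : IsDirichlet fun q => (boxCut R q : ℂ) * v q where
  smooth := (contDiff_ofReal_comp (contDiff_boxCut R)).mul hv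
  compact := ((hasCompactSupport_boxCut hR).comp_left (g := fun x : ℝ => (x : ℂ)) (by simp)).mul_right
  zero θ := by rw [h0, mul_zero]

end

section

variable {lam Λ B : ℝ} {Ψ : ℝ × ℝ → ℂ}

/-! ### The weighted estimate -/

lemma norm_one_sub_cutoff_le (x : ℝ) : ‖((1 - cutoff x : ℝ) : ℂ)‖ₑ ≤ 1 := by
  rw [← ofReal_norm, Complex.norm_real, Real.norm_eq_abs, abs_of_nonneg (by linarith [cutoff_le_one x])]
  exact ENNReal.ofReal_le_one.2 (by linarith [cutoff_nonneg x])

lemma enorm_boxCut_mul_le (R : ℝ) (p : ℝ × ℝ) (z : ℂ) : ‖(boxCut R p : ℂ) * z‖ₑ ≤ ‖z‖ₑ := by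
  rw [enorm_mul]
  refine mul_le_of_le_one_left' ?_
  rw [← ofReal_norm, Complex.norm_real, Real.norm_eq_abs, abs_of_nonneg (boxCut_nonneg _ _)]
  exact ENNReal.ofReal_le_one.2 (boxCut_le_one _ _)

/-- For `μ ≥ 1/2` the bracket is the volume potential; for smaller `μ` the cutoff is `1` and there
is nothing to bound. -/
lemma enorm_correction_le (ha : Admissible Λ B lam) (h : IsDirichlet Ψ) {p : ℝ × ℝ} (hp : 0 < p.2) :
    ‖((1 - cutoff p.2 : ℝ) : ℂ) * (Ψ p + extPot lam (normalTrace Ψ) p)‖ₑ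
      ≤ ‖greenPot lam (resid lam Ψ) p‖ₑ := by
  rcases le_or_gt (1 / 2) p.2 with h1 | h1
  · rw [add_extPot_eq ha.ne h h1, enorm_mul]
    exact mul_le_of_le_one_left' (norm_one_sub_cutoff_le _)
  · rw [cutoff_eq_one (by rw [abs_of_pos hp]; linarith)]; simp

lemma enorm_innerPart_sq_le (ha : Admissible Λ B lam) (h : IsDirichlet Ψ) {p : ℝ × ℝ} (hp : 0 < p.2) :
    ‖innerPart lam Ψ p‖ₑ ^ 2 ≤ 2 * (‖Ψ p‖ₑ ^ 2 + ‖greenPot lam (resid lam Ψ) p‖ₑ ^ 2) := by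
  rw [innerPart_eq]
  refine (enorm_sub_sq_le _ _).trans ?_
  gcongr
  exact enorm_correction_le ha h hp

lemma enorm_sq_le_innerPart (ha : Admissible Λ B lam) (h : IsDirichlet Ψ) {p : ℝ × ℝ} (hp : 0 < p.2) :
    ‖Ψ p‖ₑ ^ 2 ≤ 2 * (‖innerPart lam Ψ p‖ₑ ^ 2 + ‖greenPot lam (resid lam Ψ) p‖ₑ ^ 2) := by
  have e : Ψ p = innerPart lam Ψ p
      - -(((1 - cutoff p.2 : ℝ) : ℂ) * (Ψ p + extPot lam (normalTrace Ψ) p)) := by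
    rw [innerPart_eq]; ring
  have h2 := enorm_sub_sq_le (innerPart lam Ψ p)
    (-(((1 - cutoff p.2 : ℝ) : ℂ) * (Ψ p + extPot lam (normalTrace Ψ) p)))
  rw [← e, enorm_neg] at h2
  refine h2.trans ?_
  gcongr
  exact enorm_correction_le ha h hp

lemma lintegral_enorm_sq_eq_wmass (f : ℝ × ℝ → ℂ) :
    ∫⁻ p, ‖f p‖ₑ ^ 2 ∂vol = wmass 0 (fun _ => 1) f := by
  simp [wmass]

lemma lintegral_enorm_sq_ne_top {f : ℝ × ℝ → ℂ} (hf : Continuous f) (hc : HasCompactSupport f) :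
    ∫⁻ p, ‖f p‖ₑ ^ 2 ∂vol ≠ ⊤ := by
  have hi : Integrable (fun p => (1 : ℝ) * ‖f p‖ ^ 2) vol := by
    refine integrable_vol (by fun_prop) (HasCompactSupport.intro hc.isCompact fun p hp => ?_)
    rw [image_eq_zero_of_notMem_tsupport hp]; simp
  have := ofReal_integral_mul_sq (fun _ => zero_le_one) hi
  simp only [ENNReal.ofReal_one, one_mul] at this
  rw [← this]
  exact ENNReal.ofReal_ne_top

lemma IsDirichlet.wmass_resid_ne_top (h : IsDirichlet Ψ) (lam : ℝ) :
    wmass 0 (fun _ => 1) (resid lam Ψ) ≠ ⊤ := by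
  rw [← lintegral_enorm_sq_eq_wmass]
  exact lintegral_enorm_sq_ne_top (contDiff_resid lam h.smooth).continuous
    (HasCompactSupport.intro h.compact.isCompact fun p hp => resid_eq_zero hp)

lemma lintegral_innerPart_ne_top (ha : Admissible Λ B lam) (h : IsDirichlet Ψ) :
    ∫⁻ p, ‖innerPart lam Ψ p‖ₑ ^ 2 ∂vol ≠ ⊤ := by
  have hm := h.smooth.continuous.measurable
  have hG := wmass_greenPot_le ha.le 0 slowWeight_one
    (contDiff_resid lam h.smooth).continuous.measurable
  refine ne_top_of_le_ne_top (b := 2 * (∫⁻ p, ‖Ψ p‖ₑ ^ 2 ∂vol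
    + wmass 0 (fun _ => 1) (greenPot lam (resid lam Ψ)))) ?_ ?_
  · exact ENNReal.mul_ne_top ENNReal.ofNat_ne_top (ENNReal.add_ne_top.2 ⟨lintegral_enorm_sq_ne_top h.smooth.continuous h.compact,
      ne_top_of_le_ne_top (ENNReal.mul_ne_top ENNReal.ofReal_ne_top (h.wmass_resid_ne_top lam)) hG⟩)
  · rw [← lintegral_enorm_sq_eq_wmass, ← lintegral_add_left (by fun_prop),
      ← lintegral_const_mul' _ _ ENNReal.ofNat_ne_top]
    refine lintegral_mono_ae ?_
    filter_upwards [ae_vol_pos] with p hp using enorm_innerPart_sq_le ha h hp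

lemma lintegral_resid_innerPart_ne_top (ha : Admissible Λ B lam) (h : IsDirichlet Ψ) :
    ∫⁻ p, ‖resid lam (innerPart lam Ψ) p‖ₑ ^ 2 ∂vol ≠ ⊤ := by
  have h1 := lintegral_resid_innerPart_le ha h 0 slowWeight_one
  simp only [one_pow, ENNReal.ofReal_one, one_mul] at h1
  exact ne_top_of_le_ne_top (ENNReal.mul_ne_top ENNReal.ofReal_ne_top (h.wmass_resid_ne_top lam)) h1

lemma exists_abs_le_of_hasCompactSupport {f : ℝ × ℝ → ℂ} (hf : HasCompactSupport f) :
    ∃ R, ∀ p, f p ≠ 0 → |p.1| ≤ R ∧ |p.2| ≤ R := by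
  obtain ⟨R, hR⟩ := hf.isCompact.isBounded.exists_norm_le
  refine ⟨R, fun p hp => ?_⟩
  have h := hR p (subset_tsupport _ hp)
  exact ⟨(norm_fst_le p).trans h, (norm_snd_le p).trans h⟩

lemma setLIntegral_strip_le_wmass {l r : ℝ} (hr : 0 < r) (hl : r ≤ l) (n : ℕ) (f : ℝ × ℝ → ℂ) :
    ∫⁻ p in strip r, ENNReal.ofReal (((1 + p.2) ^ (2 * n))⁻¹) * ‖f p‖ₑ ^ 2 ∂vol
      ≤ 4 * wmass n (sech l 0) f := by
  rw [wmass, ← lintegral_const_mul' _ _ ENNReal.ofNat_ne_top,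
    ← lintegral_indicator (measurableSet_strip r)]
  refine lintegral_mono_ae ?_
  filter_upwards [ae_vol_pos] with p hp
  refine indicator_apply_le' (fun hpr => ?_) fun _ => zero_le
  rw [← mul_assoc]
  gcongr
  rw [← ENNReal.ofReal_ofNat 4, ← ENNReal.ofReal_mul (by norm_num)]
  refine ENNReal.ofReal_le_ofReal ?_
  have hq : 1 / 4 ≤ sech l 0 p.1 ^ 2 := quarter_le_sechSq (hr.trans_le hl)
    (by rw [sub_zero]; exact (le_of_lt hpr).trans hl)
  have : 0 ≤ ((1 + p.2) ^ (2 * n))⁻¹ := by positivity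
  nlinarith

lemma growth_zero (M : ℝ) : growth M 0 = 1 := by simp [growth]

set_option maxHeartbeats 1000000 in
/-- The a priori estimate with polynomial weights, for smooth compactly supported functions. -/
theorem weighted_estimate (hΛ : 0 ≤ Λ) (B : ℝ) (m n : ℕ) :
    ∃ C : ℝ, 0 ≤ C ∧ ∀ {lam : ℝ}, Admissible Λ B lam → ∀ {M : ℝ}, 1 ≤ M → ∀ {Ψ : ℝ × ℝ → ℂ},
      IsDirichlet Ψ → ∀ {K a : ℝ}, 0 < K → 0 ≤ a →
      (∫⁻ p in strip (2 * M), ENNReal.ofReal (((1 + p.2) ^ (2 * n))⁻¹) * ‖Ψ p‖ₑ ^ 2 ∂vol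
        ≤ ENNReal.ofReal (M * a)) →
      (∀ Θ, wmass n (sech (scale Λ B * M) Θ) (resid lam Ψ)
        ≤ ENNReal.ofReal (M * K * growth M Θ ^ (2 * m))) →
      ∀ Θ, wmass n (sech (scale Λ B * M) Θ) Ψ
        ≤ ENNReal.ofReal (M * (C * (a + M ^ 2 * K)) * growth M Θ ^ (2 * m + 2)) := by
  obtain ⟨C, hC, hest⟩ := energy_estimate hΛ B m n
  set P := potConst (2 * n + 2) B with hP
  set I := innerConst Λ B n with hI
  have hP0 : 0 ≤ P := potConst_nonneg _ _
  have hI0 : 0 ≤ I := innerConst_nonneg hΛ B n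
  refine ⟨2 * (C * (4 + 8 * P + 2 * I)) + 2 * P, by positivity, ?_⟩
  intro lam ha M hM Ψ h K a hK ha0 hA hG Θ
  set l := scale Λ B * M with hl
  have h8 := eight_le_scale hΛ B
  have hl8 : 8 * M ≤ l := by rw [hl]; gcongr
  have hl1 : 1 ≤ l := by linarith
  set g := resid lam Ψ with hg
  set v := innerPart lam Ψ with hv
  have sv : ContDiff ℝ ∞ v := h.contDiff_innerPart lam
  have v0 : ∀ θ, v (θ, 0) = 0 := h.innerPart_zero lam
  obtain ⟨R₀, hR₀⟩ := exists_abs_le_of_hasCompactSupport h.compact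
  -- The box contains the support of `Ψ`, and the truncation error is at most `K`, hence comparable
  -- to the source; this is why `K` must be positive.
  obtain ⟨R, hRR, hR1, herr⟩ := exists_boxCut_resid_le sv v0 (lintegral_innerPart_ne_top ha h)
    (lintegral_resid_innerPart_ne_top ha h) R₀ hK
  have hR0 : 0 < R := by linarith
  set V : ℝ × ℝ → ℂ := fun q => (boxCut R q : ℂ) * v q with hV
  have dV : IsDirichlet V := isDirichlet_boxCut_mul hR0 sv v0
  have hgr : ∀ x, 1 ≤ growth M x := one_le_growth M
  have cg : Continuous g := (contDiff_resid lam h.smooth).continuous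
  have hGG : ∀ x, wmass n (sech l x) (greenPot lam g)
      ≤ ENNReal.ofReal (P * (M * K * growth M x ^ (2 * m))) := fun x => by
    rw [ENNReal.ofReal_mul hP0]
    exact (wmass_greenPot_le ha.le n (slowWeight_sech hl1 x) cg.measurable).trans
      (by gcongr; exact hG x)
  -- The truncated inner part meets the unweighted hypothesis of `energy_estimate`, with `K`
  -- enlarged by a constant factor.
  have hmass : ∀ x, mass l x (resid lam V) ≤ M * ((2 * I + 2) * K) * growth M x ^ (2 * m) := by
    intro x
    have cV := (contDiff_resid lam dV.smooth).continuous
    have hi := dV.integrable_mass l x cV fun p hp => resid_eq_zero hp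
    have hgx : 1 ≤ growth M x ^ (2 * m) := one_le_pow₀ (hgr x)
    have hpos : 0 ≤ M * ((2 * I + 2) * K) * growth M x ^ (2 * m) := by positivity
    rw [← ENNReal.ofReal_le_ofReal_iff hpos, mass,
      ofReal_integral_mul_sq (w := fun p : ℝ × ℝ => sechSq l x p.1) (f := resid lam V)
        (fun p => (sechSq_pos l x p.1).le) hi]
    have cb := (contDiff_boxCut R).continuous
    have cr := (contDiff_resid lam sv).continuous
    have hmd : Measurable fun p => 2 * ‖resid lam V p - (boxCut R p : ℂ) * resid lam v p‖ₑ ^ 2 := by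
      have := (cV.sub ((Complex.continuous_ofReal.comp cb).mul cr)).measurable
      exact (this.enorm.pow_const 2).const_mul 2
    calc ∫⁻ p, ENNReal.ofReal (sechSq l x p.1) * ‖resid lam V p‖ₑ ^ 2 ∂vol
        ≤ ∫⁻ p, (2 * ‖resid lam V p - (boxCut R p : ℂ) * resid lam v p‖ₑ ^ 2
          + 2 * (ENNReal.ofReal (sech l x p.1 ^ 2) * ‖resid lam v p‖ₑ ^ 2)) ∂vol := by
          refine lintegral_mono fun p => ?_
          have h3 := enorm_sub_sq_le (resid lam V p - (boxCut R p : ℂ) * resid lam v p)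
            (-((boxCut R p : ℂ) * resid lam v p))
          rw [sub_neg_eq_add, sub_add_cancel, enorm_neg] at h3
          have h4 := enorm_boxCut_mul_le R p (resid lam v p)
          have h5 : ENNReal.ofReal (sechSq l x p.1) ≤ 1 :=
            ENNReal.ofReal_le_one.2 (sechSq_le_one _ _ _)
          calc _ ≤ ENNReal.ofReal (sechSq l x p.1)
                * (2 * (‖resid lam V p - (boxCut R p : ℂ) * resid lam v p‖ₑ ^ 2
                  + ‖(boxCut R p : ℂ) * resid lam v p‖ₑ ^ 2)) := mul_le_mul_right h3 _
            _ = ENNReal.ofReal (sechSq l x p.1)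
                  * (2 * ‖resid lam V p - (boxCut R p : ℂ) * resid lam v p‖ₑ ^ 2)
                + 2 * (ENNReal.ofReal (sechSq l x p.1)
                  * ‖(boxCut R p : ℂ) * resid lam v p‖ₑ ^ 2) := by ring
            _ ≤ _ := by
                refine add_le_add (mul_le_of_le_one_left' h5) ?_
                rw [sechSq]
                gcongr
      _ = 2 * (∫⁻ p, ‖resid lam V p - (boxCut R p : ℂ) * resid lam v p‖ₑ ^ 2 ∂vol)
          + 2 * ∫⁻ p, ENNReal.ofReal (sech l x p.1 ^ 2) * ‖resid lam v p‖ₑ ^ 2 ∂vol := by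
          rw [lintegral_add_left hmd, lintegral_const_mul' _ _ ENNReal.ofNat_ne_top,
            lintegral_const_mul' _ _ ENNReal.ofNat_ne_top]
      _ ≤ 2 * ENNReal.ofReal K + 2 * (ENNReal.ofReal I
          * ENNReal.ofReal (M * K * growth M x ^ (2 * m))) := by
          refine add_le_add (mul_le_mul_right herr _) (mul_le_mul_right ?_ _)
          exact (lintegral_resid_innerPart_le ha h n (slowWeight_sech hl1 x)).trans
            (mul_le_mul_right (hG x) _)
      _ ≤ _ := by
          rw [← ENNReal.ofReal_ofNat 2, ← ENNReal.ofReal_mul hI0, ← ENNReal.ofReal_mul zero_le_two,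
            ← ENNReal.ofReal_mul zero_le_two, ← ENNReal.ofReal_add (by positivity) (by positivity)]
          refine ENNReal.ofReal_le_ofReal ?_
          have h1 : K * 1 ≤ K * (M * growth M x ^ (2 * m)) := by
            gcongr
            nlinarith
          linarith
  have hVv : ∀ p, ‖V p‖ₑ ≤ ‖v p‖ₑ := fun p => enorm_boxCut_mul_le R p (v p)
  -- Near `θ = 0` the inner part differs from `Ψ` at most by the volume potential, whose weighted
  -- mass is bounded by the source.
  have hstrip : ∫ p in strip (2 * M), ((1 + p.2) ^ (2 * n))⁻¹ * ‖V p‖ ^ 2 ∂vol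
      ≤ M * (2 * a + 8 * (P * K)) := by
    have cV := dV.smooth.continuous
    have hw : ∀ᵐ p ∂vol.restrict (strip (2 * M)), 0 ≤ ((1 + p.2) ^ (2 * n))⁻¹ * ‖V p‖ ^ 2 := by
      filter_upwards [ae_restrict_of_ae ae_vol_pos] with p hp
      positivity
    have hpos : 0 ≤ M * (2 * a + 8 * (P * K)) := by positivity
    rw [integral_eq_lintegral_of_nonneg_ae hw (by
      have : Measurable fun p : ℝ × ℝ => ((1 + p.2) ^ (2 * n))⁻¹ * ‖V p‖ ^ 2 := by
        have := cV.measurable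
        fun_prop
      exact this.aestronglyMeasurable)]
    refine ENNReal.toReal_le_of_le_ofReal hpos ?_
    have hm : Measurable fun p : ℝ × ℝ =>
        2 * (ENNReal.ofReal (((1 + p.2) ^ (2 * n))⁻¹) * ‖Ψ p‖ₑ ^ 2) := by
      have := h.smooth.continuous.measurable
      fun_prop
    calc ∫⁻ p in strip (2 * M), ENNReal.ofReal (((1 + p.2) ^ (2 * n))⁻¹ * ‖V p‖ ^ 2) ∂vol
        ≤ ∫⁻ p in strip (2 * M), (2 * (ENNReal.ofReal (((1 + p.2) ^ (2 * n))⁻¹) * ‖Ψ p‖ₑ ^ 2)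
          + 2 * (ENNReal.ofReal (((1 + p.2) ^ (2 * n))⁻¹) * ‖greenPot lam g p‖ₑ ^ 2)) ∂vol := by
          refine lintegral_mono_ae ?_
          filter_upwards [ae_restrict_of_ae ae_vol_pos] with p hp
          rw [ofReal_mul_sq_norm (by positivity)]
          calc _ ≤ ENNReal.ofReal (((1 + p.2) ^ (2 * n))⁻¹)
                * (2 * (‖Ψ p‖ₑ ^ 2 + ‖greenPot lam g p‖ₑ ^ 2)) := by
                refine mul_le_mul_right ?_ _
                exact (pow_le_pow_left' (hVv p) 2).trans (enorm_innerPart_sq_le ha h hp)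
            _ = _ := by ring
      _ ≤ 2 * ENNReal.ofReal (M * a) + 2 * (4 * ENNReal.ofReal (P * (M * K))) := by
          rw [lintegral_add_left hm, lintegral_const_mul' _ _ ENNReal.ofNat_ne_top,
            lintegral_const_mul' _ _ ENNReal.ofNat_ne_top]
          refine add_le_add (mul_le_mul_right hA _) (mul_le_mul_right ?_ _)
          refine (setLIntegral_strip_le_wmass (by linarith) (by linarith : 2 * M ≤ l) n _).trans
            (mul_le_mul_right ?_ _)
          have := hGG 0
          rwa [growth_zero, one_pow, mul_one] at this
      _ = _ := by
          rw [← ENNReal.ofReal_ofNat 2, ← ENNReal.ofReal_ofNat 4, ← ENNReal.ofReal_mul zero_le_two,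
            ← ENNReal.ofReal_mul (by norm_num), ← ENNReal.ofReal_mul zero_le_two,
            ← ENNReal.ofReal_add (by positivity) (by positivity)]
          congr 1
          ring
  have hen := (mass_le_energy l Θ V).trans
    (hest ha hM dV (by positivity) (by positivity) hstrip hmass Θ)
  have hi := dV.integrable_mass l Θ dV.smooth.continuous
    fun p hp => image_eq_zero_of_notMem_tsupport hp
  have hen2 := ENNReal.ofReal_le_ofReal hen
  rw [mass, ofReal_integral_mul_sq (w := fun p : ℝ × ℝ => sechSq l Θ p.1) (f := V)
    (fun p => (sechSq_pos l Θ p.1).le) hi] at hen2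
  have hgx : 1 ≤ growth M Θ ^ (2 * m) := one_le_pow₀ (hgr Θ)
  have cs : Continuous (sechSq l Θ) := continuous_sechSq l Θ
  have hm : Measurable fun p : ℝ × ℝ => 2 * (ENNReal.ofReal (sechSq l Θ p.1) * ‖V p‖ₑ ^ 2) := by
    have := dV.smooth.continuous.measurable
    have := cs.measurable
    fun_prop
  have hgp : growth M Θ ^ (2 * m) ≤ growth M Θ ^ (2 * m + 2) := pow_le_pow_right₀ (hgr Θ) (by omega)
  have hg0 : 0 ≤ growth M Θ := zero_le_one.trans (hgr Θ)
  calc wmass n (sech l Θ) Ψ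
      ≤ ∫⁻ p, (2 * (ENNReal.ofReal (sechSq l Θ p.1) * ‖V p‖ₑ ^ 2)
        + 2 * (ENNReal.ofReal (sech l Θ p.1 ^ 2 * ((1 + p.2) ^ (2 * n))⁻¹)
          * ‖greenPot lam g p‖ₑ ^ 2)) ∂vol := by
        refine lintegral_mono_ae ?_
        filter_upwards [ae_vol_pos] with p hp
        -- Where `Ψ` does not vanish the box cutoff is `1`, so `V` agrees with the inner part and
        -- `Ψ` is recovered from it and the volume potential.
        by_cases hz : Ψ p = 0
        · simp [hz]
        · have hb := hR₀ p hz
          have hVp : V p = innerPart lam Ψ p := by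
            simp only [hV]
            rw [boxCut_eq_one hR0 (hb.1.trans hRR) (hb.2.trans hRR), Complex.ofReal_one, one_mul]
          have h3 := enorm_sq_le_innerPart ha h hp
          have h4 : sech l Θ p.1 ^ 2 * ((1 + p.2) ^ (2 * n))⁻¹ ≤ sechSq l Θ p.1 := by
            rw [sechSq]
            exact mul_le_of_le_one_right (sq_nonneg _) (inv_pow_le_one hp)
          rw [hVp]
          calc _ ≤ ENNReal.ofReal (sech l Θ p.1 ^ 2 * ((1 + p.2) ^ (2 * n))⁻¹)
                * (2 * (‖innerPart lam Ψ p‖ₑ ^ 2 + ‖greenPot lam (resid lam Ψ) p‖ₑ ^ 2)) :=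
                mul_le_mul_right h3 _
            _ = 2 * (ENNReal.ofReal (sech l Θ p.1 ^ 2 * ((1 + p.2) ^ (2 * n))⁻¹)
                  * ‖innerPart lam Ψ p‖ₑ ^ 2)
                + 2 * (ENNReal.ofReal (sech l Θ p.1 ^ 2 * ((1 + p.2) ^ (2 * n))⁻¹)
                  * ‖greenPot lam (resid lam Ψ) p‖ₑ ^ 2) := by ring
            _ ≤ _ := by gcongr
    _ = 2 * (∫⁻ p, ENNReal.ofReal (sechSq l Θ p.1) * ‖V p‖ₑ ^ 2 ∂vol)
        + 2 * wmass n (sech l Θ) (greenPot lam g) := by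
        rw [lintegral_add_left hm, lintegral_const_mul' _ _ ENNReal.ofNat_ne_top,
          lintegral_const_mul' _ _ ENNReal.ofNat_ne_top, wmass]
    _ ≤ 2 * ENNReal.ofReal (M * (C * (2 * a + 8 * (P * K) + M ^ 2 * ((2 * I + 2) * K)))
          * growth M Θ ^ (2 * m + 2))
        + 2 * ENNReal.ofReal (P * (M * K * growth M Θ ^ (2 * m))) :=
        add_le_add (mul_le_mul_right hen2 _) (mul_le_mul_right (hGG Θ) _)
    _ ≤ _ := by
        rw [← ENNReal.ofReal_ofNat 2, ← ENNReal.ofReal_mul zero_le_two,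
          ← ENNReal.ofReal_mul zero_le_two, ← ENNReal.ofReal_add (by positivity) (by positivity)]
        refine ENNReal.ofReal_le_ofReal ?_
        set G := growth M Θ ^ (2 * m + 2)
        have hM2 : K ≤ M ^ 2 * K := le_mul_of_one_le_left hK.le (one_le_pow₀ hM)
        have hG0 : 0 ≤ G := by positivity
        have e1 : 2 * a + 8 * (P * K) + M ^ 2 * ((2 * I + 2) * K)
            ≤ (4 + 8 * P + 2 * I) * (a + M ^ 2 * K) := by
          have t1 : P * K ≤ P * (M ^ 2 * K) := by gcongr
          have t2 : 0 ≤ P * a := by positivity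
          have t3 : 0 ≤ I * a := by positivity
          have t4 : 0 ≤ M ^ 2 * K := by positivity
          nlinarith
        have e2 : P * (M * K * growth M Θ ^ (2 * m)) ≤ P * (M * (a + M ^ 2 * K) * G) := by
          gcongr
          linarith
        calc _ ≤ 2 * (M * (C * ((4 + 8 * P + 2 * I) * (a + M ^ 2 * K))) * G)
              + 2 * (P * (M * (a + M ^ 2 * K) * G)) := by gcongr
          _ = _ := by ring

end

/-! ### Mollification in the plane -/

lemma lintegral_enorm_sq_eq {α : Type*} [MeasurableSpace α] {ν : Measure α} (f : α → ℂ) :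
    ∫⁻ x, ‖f x‖ₑ ^ 2 ∂ν = eLpNorm f 2 ν ^ 2 := by
  have h := eLpNorm_nnreal_pow_eq_lintegral (f := f) (p := 2) (μ := ν) two_ne_zero
  simp only [NNReal.coe_ofNat, ENNReal.coe_ofNat] at h
  simpa using h.symm

/-- Continuity of translations in `L²`. -/
lemma tendsto_lintegral_translate {F : ℝ × ℝ → ℂ} (hF : MemLp F 2 volume) :
    Tendsto (fun h => ∫⁻ x, ‖F (x - h) - F x‖ₑ ^ 2) (𝓝 (0 : ℝ × ℝ)) (𝓝 0) := by
  let g : C(ℝ × ℝ, C(ℝ × ℝ, ℝ × ℝ)) :=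
    (ContinuousMap.mk (fun a : (ℝ × ℝ) × (ℝ × ℝ) => a.2 - a.1) (by fun_prop)).curry
  have hg : ∀ h, MeasurePreserving (g h) volume volume := fun h => measurePreserving_sub_right volume h
  have h1 := ((continuous_const (y := hF.toLp F)).compMeasurePreservingLp g.continuous hg
    ENNReal.ofNat_ne_top).tendsto 0
  have h2 := ENNReal.Tendsto.pow (n := 2) (tendsto_iff_edist_tendsto_0.1 h1)
  have e0 : ∀ h, ⇑(Lp.compMeasurePreserving (g h) (hg h) (hF.toLp F)) =ᵐ[volume] fun x => F (x - h) :=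
    fun h => (Lp.coeFn_compMeasurePreserving _ (hg h)).trans
      ((hg h).quasiMeasurePreserving.ae_eq_comp hF.coeFn_toLp)
  refine (h2.congr fun h => ?_).trans_eq (by simp)
  rw [Lp.edist_def, ← lintegral_enorm_sq_eq]
  refine lintegral_congr_ae ?_
  filter_upwards [e0 h, e0 0] with x hx h0
  rw [Pi.sub_apply, hx, h0, sub_zero]

/-- An even one-dimensional bump function of integral one with support of size `1 / (j + 1)`. -/
def lineBump (j : ℕ) : ContDiffBump (0 : ℝ) where
  rIn := 1 / (2 * (j + 1))
  rOut := 1 / (j + 1)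
  rIn_pos := by positivity
  rIn_lt_rOut := by
    rw [div_lt_div_iff_of_pos_left one_pos (by positivity) (by positivity)]
    have : (0 : ℝ) < j + 1 := by positivity
    linarith

/-- The product mollifier. -/
def planeBump (j : ℕ) (p : ℝ × ℝ) : ℝ :=
  (lineBump j).normed volume p.1 * (lineBump j).normed volume p.2

lemma planeBump_nonneg (j : ℕ) (p : ℝ × ℝ) : 0 ≤ planeBump j p :=
  mul_nonneg ((lineBump j).nonneg_normed _) ((lineBump j).nonneg_normed _)

lemma contDiff_planeBump (j : ℕ) : ContDiff ℝ ∞ (planeBump j) :=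
  contDiff_mul_split (lineBump j).contDiff_normed (lineBump j).contDiff_normed

lemma planeBump_eq_zero {j : ℕ} {p : ℝ × ℝ} (hp : 1 / ((j : ℝ) + 1) ≤ ‖p‖) : planeBump j p = 0 := by
  have h : ∀ x : ℝ, 1 / ((j : ℝ) + 1) ≤ |x| → (lineBump j).normed volume x = 0 := fun x hx => by
    rw [← Function.notMem_support, ContDiffBump.support_normed_eq]
    simp only [Metric.mem_ball, dist_zero_right, Real.norm_eq_abs, not_lt]
    exact hx
  rw [planeBump]
  rcases le_max_iff.1 (Prod.norm_def p ▸ hp) with h1 | h1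
  · rw [h _ h1, zero_mul]
  · rw [h _ h1, mul_zero]

lemma hasCompactSupport_planeBump (j : ℕ) : HasCompactSupport (planeBump j) := by
  refine HasCompactSupport.intro (isCompact_closedBall 0 (1 / ((j : ℝ) + 1))) fun p hp => ?_
  rw [Metric.mem_closedBall, dist_zero_right, not_le] at hp
  exact planeBump_eq_zero hp.le

lemma planeBump_neg_snd (j : ℕ) (a b : ℝ) : planeBump j (a, -b) = planeBump j (a, b) := by
  simp only [planeBump, ContDiffBump.normed_neg]

lemma integral_planeBump (j : ℕ) : ∫ p, planeBump j p = 1 := by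
  unfold planeBump
  rw [Measure.volume_eq_prod, integral_prod_mul, ContDiffBump.integral_normed, mul_one]

/-- Convolution of `F` with a kernel `k`. -/
def conv (F k : ℝ × ℝ → ℂ) (x : ℝ × ℝ) : ℂ := ∫ y, F y * k (x - y)

lemma conv_eq (F k : ℝ × ℝ → ℂ) :
    conv F k = convolution F k (ContinuousLinearMap.mul ℝ ℂ) volume := rfl

lemma contDiff_conv {F k : ℝ × ℝ → ℂ} (hF : LocallyIntegrable F) (hk : ContDiff ℝ ∞ k)
    (hc : HasCompactSupport k) : ContDiff ℝ ∞ (conv F k) :=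
  hc.contDiff_convolution_right (ContinuousLinearMap.mul ℝ ℂ) hF hk

lemma fderiv_conv {F k : ℝ × ℝ → ℂ} (hF : LocallyIntegrable F) (hk : ContDiff ℝ ∞ k)
    (hc : HasCompactSupport k) (x e : ℝ × ℝ) :
    fderiv ℝ (conv F k) x e = conv F (fun y => fderiv ℝ k y e) x := by
  have h := hc.hasFDerivAt_convolution_right (ContinuousLinearMap.mul ℝ ℂ) hF
    (hk.of_le (by simp)) x
  rw [conv_eq, h.fderiv, convolution_precompR_apply _ hF (hc.fderiv ℝ)
    (hk.continuous_fderiv (by simp))]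
  rfl

/-- The complex-valued mollifier. -/
def moll (j : ℕ) (p : ℝ × ℝ) : ℂ := (planeBump j p : ℂ)

lemma contDiff_moll (j : ℕ) : ContDiff ℝ ∞ (moll j) := contDiff_ofReal_comp (contDiff_planeBump j)

lemma hasCompactSupport_moll (j : ℕ) : HasCompactSupport (moll j) :=
  (hasCompactSupport_planeBump j).comp_left (g := fun x : ℝ => (x : ℂ)) (by simp)

/-- The mollifier is a probability density, so Cauchy–Schwarz moves the square inside the average
over translations. -/
lemma lintegral_conv_moll_sub_le {F : ℝ × ℝ → ℂ} (hF : MemLp F 2 volume) (hm : Measurable F)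
    (j : ℕ) : ∫⁻ x, ‖conv F (moll j) x - F x‖ₑ ^ 2
      ≤ ∫⁻ y, ENNReal.ofReal (planeBump j y) * ∫⁻ x, ‖F (x - y) - F x‖ₑ ^ 2 := by
  have cb := (contDiff_planeBump j).continuous
  have ib : Integrable (planeBump j) := cb.integrable_of_hasCompactSupport (hasCompactSupport_planeBump j)
  have hone : ∫⁻ y, ENNReal.ofReal (planeBump j y) = 1 := by
    rw [← ofReal_integral_eq_lintegral_ofReal ib (Eventually.of_forall (planeBump_nonneg j)),
      integral_planeBump, ENNReal.ofReal_one]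
  have hli := hF.locallyIntegrable (by norm_num)
  have hpt : ∀ x, ‖conv F (moll j) x - F x‖ₑ ^ 2
      ≤ ∫⁻ y, ENNReal.ofReal (planeBump j y) * ‖F (x - y) - F x‖ₑ ^ 2 := by
    intro x
    have i1 : Integrable fun y => F y * moll j (x - y) :=
      (hasCompactSupport_moll j).convolutionExists_right (ContinuousLinearMap.mul ℝ ℂ) hli
        (contDiff_moll j).continuous x
    have i2 : Integrable fun y => F (x - y) * moll j y := by
      have := i1.comp_sub_left x
      simpa only [sub_sub_cancel] using this
    have i3 : Integrable fun y => F x * moll j y := by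
      have : Integrable (fun y => (planeBump j y : ℂ)) := ib.ofReal
      exact this.const_mul _
    have e1 : conv F (moll j) x = ∫ y, F (x - y) * moll j y := by
      rw [conv, ← integral_sub_left_eq_self _ volume x]
      simp only [sub_sub_cancel]
    have e2 : F x = ∫ y, F x * moll j y := by
      rw [integral_const_mul]
      unfold moll
      rw [integral_complex_ofReal, integral_planeBump, Complex.ofReal_one, mul_one]
    have e3 : conv F (moll j) x - F x = ∫ y, (F (x - y) - F x) * moll j y := by
      rw [e1]
      nth_rw 1 [e2]
      rw [← integral_sub i2 i3]
      simp only [sub_mul]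
    have e4 : ‖conv F (moll j) x - F x‖ₑ
        ≤ ∫⁻ y, ENNReal.ofReal (planeBump j y) * ‖F (x - y) - F x‖ₑ := by
      rw [e3]
      refine (enorm_integral_le_lintegral_enorm _).trans_eq (lintegral_congr fun y => ?_)
      rw [enorm_mul, mul_comm, moll, ← ofReal_norm (planeBump j y : ℂ), Complex.norm_real,
        Real.norm_eq_abs, abs_of_nonneg (planeBump_nonneg j y)]
    calc _ ≤ (∫⁻ y, ENNReal.ofReal (planeBump j y) * ‖F (x - y) - F x‖ₑ) ^ 2 :=
          pow_le_pow_left' e4 2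
      _ ≤ _ := lintegral_mul_sq_le (by fun_prop) (by fun_prop)
      _ = _ := by rw [hone, one_mul]
  refine (lintegral_mono hpt).trans_eq ?_
  have cbm := cb.measurable
  rw [lintegral_lintegral_swap (by fun_prop)]
  refine lintegral_congr fun y => ?_
  exact lintegral_const_mul' _ _ ENNReal.ofReal_ne_top

lemma tendsto_conv_moll {F : ℝ × ℝ → ℂ} (hF : MemLp F 2 volume) :
    Tendsto (fun j => ∫⁻ x, ‖conv F (moll j) x - F x‖ₑ ^ 2) atTop (𝓝 0) := by
  -- Neither the convolution nor the integral changes when `F` is modified on a null set.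
  wlog hm : Measurable F generalizing F
  · have hae := hF.1.ae_eq_mk
    have := this ((memLp_congr_ae hae).1 hF) hF.1.stronglyMeasurable_mk.measurable
    refine this.congr fun j => ?_
    have hconv : conv (hF.1.mk F) (moll j) = conv F (moll j) := by
      ext x
      refine integral_congr_ae ?_
      filter_upwards [hae] with y hy
      rw [hy]
    rw [hconv]
    refine lintegral_congr_ae ?_
    filter_upwards [hae] with y hy
    rw [hy]
  rw [ENNReal.tendsto_nhds_zero]
  intro ε hε
  have h1 := (tendsto_lintegral_translate hF).eventually (Iic_mem_nhds hε)
  obtain ⟨r, hr, hball⟩ := Metric.eventually_nhds_iff.1 h1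
  obtain ⟨j₀, hj₀⟩ := exists_nat_one_div_lt hr
  filter_upwards [eventually_ge_atTop j₀] with j hj
  have ib : Integrable (planeBump j) := (contDiff_planeBump j).continuous.integrable_of_hasCompactSupport
    (hasCompactSupport_planeBump j)
  calc _ ≤ ∫⁻ y, ENNReal.ofReal (planeBump j y) * ∫⁻ x, ‖F (x - y) - F x‖ₑ ^ 2 :=
        lintegral_conv_moll_sub_le hF hm j
    _ ≤ ∫⁻ y, ENNReal.ofReal (planeBump j y) * ε := by
        refine lintegral_mono fun y => ?_
        by_cases hy : 1 / ((j : ℝ) + 1) ≤ ‖y‖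
        · simp [planeBump_eq_zero hy]
        · refine mul_le_mul_right (hball ?_) _
          rw [dist_zero_right]
          refine (not_le.1 hy).trans_le (le_trans ?_ hj₀.le)
          gcongr
    _ = ε := by
        have := (contDiff_planeBump j).continuous.measurable
        rw [lintegral_mul_const _ (by fun_prop),
          ← ofReal_integral_eq_lintegral_ofReal ib (Eventually.of_forall (planeBump_nonneg j)),
          integral_planeBump, ENNReal.ofReal_one, one_mul]

/-! ### Even and odd extensions -/

/-- Reflection in the boundary line. -/
def refl (p : ℝ × ℝ) : ℝ × ℝ := (p.1, -p.2)

lemma measurePreserving_refl : MeasurePreserving refl volume volume :=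
  (MeasurePreserving.id (volume : Measure ℝ)).prod (Measure.measurePreserving_neg (volume : Measure ℝ))

lemma contDiff_refl : ContDiff ℝ ∞ refl := contDiff_fst.prodMk contDiff_snd.neg

/-- Extension to the plane, even for `s = 1` and odd for `s = -1`. -/
def ext (s : ℂ) (f : ℝ × ℝ → ℂ) (p : ℝ × ℝ) : ℂ :=
  halfPlane.indicator f p + s * halfPlane.indicator f (refl p)

lemma memLp_indicator {f : ℝ × ℝ → ℂ} (hf : MemLp f 2 vol) : MemLp (halfPlane.indicator f) 2 volume :=
  (memLp_indicator_iff_restrict measurableSet_halfPlane).2 hf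

lemma memLp_ext (s : ℂ) {f : ℝ × ℝ → ℂ} (hf : MemLp f 2 vol) : MemLp (ext s f) 2 volume :=
  (memLp_indicator hf).add
    (((memLp_indicator hf).comp_measurePreserving measurePreserving_refl).const_mul s)

lemma ext_eq {s : ℂ} {f : ℝ × ℝ → ℂ} {p : ℝ × ℝ} (hp : 0 < p.2) : ext s f p = f p := by
  have h1 : p ∈ halfPlane := hp
  have h2 : refl p ∉ halfPlane := fun h => by
    have : 0 < -p.2 := h
    linarith
  rw [ext, indicator_of_mem h1, indicator_of_notMem h2, mul_zero, add_zero]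

lemma tendsto_conv_ext (s : ℂ) {f : ℝ × ℝ → ℂ} (hf : MemLp f 2 vol) :
    Tendsto (fun j => ∫⁻ x, ‖conv (ext s f) (moll j) x - f x‖ₑ ^ 2 ∂vol) atTop (𝓝 0) := by
  refine tendsto_of_tendsto_of_tendsto_of_le_of_le tendsto_const_nhds
    (tendsto_conv_moll (memLp_ext s hf)) (fun _ => zero_le) fun j => ?_
  refine (lintegral_mono_ae ?_).trans (setLIntegral_le_lintegral halfPlane _)
  filter_upwards [ae_vol_pos] with p hp
  rw [ext_eq hp]

/-- The kernel `k(x - ·) + s k(x - refl ·)`. -/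
def pairKernel (s : ℂ) (k : ℝ × ℝ → ℂ) (x y : ℝ × ℝ) : ℂ := k (x - y) + s * k (x - refl y)

/-- Moves the reflection from the function to the kernel, so that only an integral over the
half-plane remains and weak derivatives there can be used. In the odd case the paired kernel
vanishes on the boundary. -/
lemma conv_ext (s : ℂ) {f k : ℝ × ℝ → ℂ} (hf : MemLp f 2 vol) (hk : Continuous k)
    (hc : HasCompactSupport k) (x : ℝ × ℝ) :
    conv (ext s f) k x = ∫ y, f y * pairKernel s k x y ∂vol := by
  have hli := (memLp_indicator hf).locallyIntegrable (by norm_num)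
  have hme : MeasurableEmbedding refl :=
    (Homeomorph.prodCongr (Homeomorph.refl ℝ) (Homeomorph.neg ℝ)).measurableEmbedding
  have hrr : ∀ y, refl (refl y) = y := fun y => by simp [refl]
  have i1 : Integrable fun y => halfPlane.indicator f y * k (x - y) :=
    hc.convolutionExists_right (ContinuousLinearMap.mul ℝ ℂ) hli hk x
  have kr : Continuous fun y => k (x - refl y) := hk.comp (continuous_const.sub contDiff_refl.continuous)
  have i2 : Integrable fun y => halfPlane.indicator f y * k (x - refl y) := by
    have hcr : HasCompactSupport fun y => k (x - refl y) :=
      hc.comp_homeomorph ((Homeomorph.prodCongr (Homeomorph.refl ℝ) (Homeomorph.neg ℝ)).trans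
        (Homeomorph.subLeft x))
    have := hli.integrable_smul_right_of_hasCompactSupport kr hcr
    simpa only [smul_eq_mul] using this
  have i3 : Integrable fun y => halfPlane.indicator f (refl y) * k (x - y) := by
    have := (measurePreserving_refl.integrable_comp_emb hme).2 i2
    simpa only [Function.comp_def, hrr] using this
  have e3 : ∫ y, halfPlane.indicator f (refl y) * k (x - y)
      = ∫ y, halfPlane.indicator f y * k (x - refl y) := by
    rw [← measurePreserving_refl.integral_comp hme fun y => halfPlane.indicator f y * k (x - refl y)]
    simp only [hrr]
  calc conv (ext s f) k x = ∫ y, (halfPlane.indicator f y * k (x - y)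
        + s * (halfPlane.indicator f (refl y) * k (x - y))) := by
        refine integral_congr_ae (Eventually.of_forall fun y => ?_)
        simp only [ext]; ring
    _ = ∫ y, (halfPlane.indicator f y * k (x - y) + s * (halfPlane.indicator f y * k (x - refl y))) := by
        rw [integral_add i1 (i3.const_mul s), integral_add i1 (i2.const_mul s), integral_const_mul,
          integral_const_mul, e3]
    _ = ∫ y, halfPlane.indicator (fun y => f y * pairKernel s k x y) y := by
        refine integral_congr_ae (Eventually.of_forall fun y => ?_)
        by_cases hy : y ∈ halfPlane
        · simp only [indicator_of_mem hy, pairKernel]; ring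
        · simp only [indicator_of_notMem hy]; ring
    _ = _ := integral_indicator measurableSet_halfPlane

lemma contDiff_pairKernel (s : ℂ) {k : ℝ × ℝ → ℂ} (hk : ContDiff ℝ ∞ k) (x : ℝ × ℝ) :
    ContDiff ℝ ∞ (pairKernel s k x) :=
  (hk.comp (contDiff_const.sub contDiff_id)).add
    (contDiff_const.mul (hk.comp (contDiff_const.sub contDiff_refl)))

lemma hasCompactSupport_pairKernel (s : ℂ) {k : ℝ × ℝ → ℂ} (hc : HasCompactSupport k) (x : ℝ × ℝ) :
    HasCompactSupport (pairKernel s k x) := by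
  have h1 : HasCompactSupport fun y => k (x - y) := hc.comp_homeomorph (Homeomorph.subLeft x)
  have h2 : HasCompactSupport fun y => k (x - refl y) :=
    hc.comp_homeomorph ((Homeomorph.prodCongr (Homeomorph.refl ℝ) (Homeomorph.neg ℝ)).trans
      (Homeomorph.subLeft x))
  exact h1.add h2.mul_left

lemma fderiv_pairKernel (s : ℂ) {k : ℝ × ℝ → ℂ} (hk : ContDiff ℝ ∞ k) (x y e : ℝ × ℝ) :
    fderiv ℝ (pairKernel s k x) y e
      = -(fderiv ℝ k (x - y) e + s * fderiv ℝ k (x - refl y) (refl e)) := by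
  have hr : HasFDerivAt refl ((ContinuousLinearMap.fst ℝ ℝ ℝ).prod (-ContinuousLinearMap.snd ℝ ℝ ℝ)) y :=
    hasFDerivAt_fst.prodMk hasFDerivAt_snd.neg
  have d1 := ((hk.differentiable (by simp)) (x - y)).hasFDerivAt.comp y ((hasFDerivAt_id y).const_sub x)
  have d2 := ((hk.differentiable (by simp)) (x - refl y)).hasFDerivAt.comp y (hr.const_sub x)
  have h : HasFDerivAt (pairKernel s k x) _ y := d1.add (d2.const_mul s)
  rw [h.fderiv]
  have e1 : refl e = (e.1, -e.2) := rfl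
  simp [e1]
  ring

/-! ### Weak derivatives -/

lemma integrable_mul_of_locallyIntegrableOn {w k : ℝ × ℝ → ℂ} {K : Set (ℝ × ℝ)}
    (hw : LocallyIntegrableOn w halfPlane) (hk : Continuous k) (hK : IsCompact K)
    (hKU : K ⊆ halfPlane) (h0 : ∀ p ∉ K, k p = 0) : Integrable (fun p => w p * k p) vol := by
  have h1 : IntegrableOn (fun p => w p * k p) K volume :=
    (hw.integrableOn_compact_subset hKU hK).mul_continuousOn hk.continuousOn hK
  have h2 : Integrable (fun p => w p * k p) volume :=
    (integrableOn_iff_integrable_of_support_subset fun p hp => by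
      by_contra hpK
      exact hp (by simp [h0 p hpK])).1 h1
  exact h2.integrableOn

lemma IsTest.continuous_fderiv_apply {φ : ℝ × ℝ → ℂ} (h : IsTest φ) (e : ℝ × ℝ) :
    Continuous fun p => fderiv ℝ φ p e :=
  (h.smooth.continuous_fderiv (by simp)).clm_apply continuous_const

lemma IsTest.integrable_mul {φ w : ℝ × ℝ → ℂ} (h : IsTest φ) (hw : LocallyIntegrableOn w halfPlane) :
    Integrable (fun p => w p * φ p) vol :=
  integrable_mul_of_locallyIntegrableOn hw h.smooth.continuous h.compact.isCompact h.supp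
    fun _ => image_eq_zero_of_notMem_tsupport

lemma IsTest.integrable_mul_fderiv {φ w : ℝ × ℝ → ℂ} (h : IsTest φ)
    (hw : LocallyIntegrableOn w halfPlane) (e : ℝ × ℝ) :
    Integrable (fun p => w p * fderiv ℝ φ p e) vol :=
  integrable_mul_of_locallyIntegrableOn hw (h.continuous_fderiv_apply e) h.compact.isCompact h.supp
    fun p hp => by
      rw [image_eq_zero_of_notMem_tsupport fun h => hp (tsupport_fderiv_subset ℝ h)]; rfl

/-- Uniqueness of weak derivatives. `MemH2`, `MemH10` and `SolvesH0` each supply their own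
representatives, and these must be identified. -/
lemma HasWeakDeriv.ae_eq {e : ℝ × ℝ} {u u' w w' : ℝ × ℝ → ℂ} (h : HasWeakDeriv e u w)
    (h' : HasWeakDeriv e u' w') (hu : u =ᵐ[vol] u') : w =ᵐ[vol] w' := by
  have key := isOpen_halfPlane.ae_eq_zero_of_integral_contDiff_smul_eq_zero (μ := volume)
    (f := fun p => w p - w' p) (h.locInt_deriv.sub h'.locInt_deriv) fun χ sχ cχ hχ => by
      have ht : IsTest fun p => (χ p : ℂ) :=
        ⟨contDiff_ofReal_comp sχ, cχ.comp_left (g := fun x : ℝ => (x : ℂ)) (by simp),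
          (closure_mono fun p hp => by simpa using hp).trans hχ⟩
      have e1 : ∫ p, χ p • (w p - w' p) = ∫ p, χ p • (w p - w' p) ∂vol := by
        refine (setIntegral_eq_integral_of_forall_compl_eq_zero fun p hp => ?_).symm
        rw [image_eq_zero_of_notMem_tsupport fun h => hp (hχ h), zero_smul]
      have e2 : ∫ p, χ p • (w p - w' p) ∂vol = ∫ p, (w p * (χ p : ℂ) - w' p * (χ p : ℂ)) ∂vol :=
        integral_congr_ae (Eventually.of_forall fun p => by
          simp only [Complex.real_smul]; ring)
      have e3 : ∫ p, u p * fderiv ℝ (fun p => (χ p : ℂ)) p e ∂vol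
          = ∫ p, u' p * fderiv ℝ (fun p => (χ p : ℂ)) p e ∂vol :=
        integral_congr_ae (by filter_upwards [hu] with p hp; rw [hp])
      rw [e1, e2, integral_sub (ht.integrable_mul h.locInt_deriv) (ht.integrable_mul h'.locInt_deriv)]
      have b1 := h.byParts _ ht
      have b2 := h'.byParts _ ht
      linear_combination b1 - b2 - e3
  rw [EventuallyEq, vol, ae_restrict_iff' measurableSet_halfPlane]
  filter_upwards [key] with p hp hpU
  exact sub_eq_zero.1 (hp hpU)

lemma HasWeakDeriv.covariant {u uθ uθθ : ℝ × ℝ → ℂ} (h : HasWeakDTheta u uθ)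
    (h' : HasWeakDTheta uθ uθθ) : HasWeakDTheta (fun p => uθ p + Complex.I * (p.2 : ℂ) * u p)
      fun p => uθθ p + Complex.I * (p.2 : ℂ) * uθ p := by
  have cμ : Continuous fun p : ℝ × ℝ => Complex.I * (p.2 : ℂ) := by fun_prop
  have li : ∀ {f : ℝ × ℝ → ℂ}, LocallyIntegrableOn f halfPlane →
      LocallyIntegrableOn (fun p => Complex.I * (p.2 : ℂ) * f p) halfPlane := fun hf =>
    hf.continuousOn_mul cμ.continuousOn isOpen_halfPlane.isLocallyClosed
  refine ⟨h'.locInt.add (li h.locInt), h'.locInt_deriv.add (li h.locInt_deriv), fun φ hφ => ?_⟩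
  have sμ : ContDiff ℝ ∞ fun p : ℝ × ℝ => Complex.I * (p.2 : ℂ) :=
    contDiff_const.mul (contDiff_ofReal_comp contDiff_snd)
  have hφ' : IsTest fun p => Complex.I * (p.2 : ℂ) * φ p :=
    ⟨sμ.mul hφ.smooth, hφ.compact.mul_left,
      (closure_mono (Function.support_mul_subset_right _ _)).trans hφ.supp⟩
  have ed : ∀ p, fderiv ℝ (fun p : ℝ × ℝ => Complex.I * (p.2 : ℂ) * φ p) p (1, 0)
      = Complex.I * (p.2 : ℂ) * fderiv ℝ φ p (1, 0) := fun p => by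
    have h2 : HasFDerivAt (fun q : ℝ × ℝ => (q.2 : ℂ)) _ p :=
      Complex.ofRealCLM.hasFDerivAt.comp p (hasFDerivAt_snd (𝕜 := ℝ) (p := p))
    have h1 : HasFDerivAt (fun p : ℝ × ℝ => Complex.I * (p.2 : ℂ) * φ p) _ p :=
      (h2.const_mul Complex.I).mul (hφ.smooth.differentiable (by simp) p).hasFDerivAt
    rw [h1.fderiv]
    simp
  have b1 := h'.byParts φ hφ
  have b2 := h.byParts _ hφ'
  have i2 := hφ'.integrable_mul_fderiv h.locInt (1, 0)
  have e1 : ∫ p, (uθ p + Complex.I * (p.2 : ℂ) * u p) * fderiv ℝ φ p (1, 0) ∂vol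
      = ∫ p, (uθ p * fderiv ℝ φ p (1, 0)
        + u p * fderiv ℝ (fun p : ℝ × ℝ => Complex.I * (p.2 : ℂ) * φ p) p (1, 0)) ∂vol :=
    integral_congr_ae (Eventually.of_forall fun p => by simp only [ed]; ring)
  have e2 : ∫ p, (uθθ p + Complex.I * (p.2 : ℂ) * uθ p) * φ p ∂vol
      = ∫ p, (uθθ p * φ p + uθ p * (Complex.I * (p.2 : ℂ) * φ p)) ∂vol :=
    integral_congr_ae (Eventually.of_forall fun p => by ring)
  rw [e1, e2, integral_add (hφ.integrable_mul_fderiv h'.locInt _) i2,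
    integral_add (hφ.integrable_mul h'.locInt_deriv) (hφ'.integrable_mul h.locInt_deriv), b1, b2]
  ring

/-! ### Integration by parts up to the boundary -/

/-- A smooth step from `0` on `{x ≤ 1 / (j + 1)}` to `1` on `{2 / (j + 1) ≤ x}`. -/
def stepUp (j : ℕ) (x : ℝ) : ℝ := Real.smoothTransition ((j + 1) * x - 1)

lemma contDiff_stepUp (j : ℕ) : ContDiff ℝ ∞ (stepUp j) :=
  Real.smoothTransition.contDiff.comp ((contDiff_const.mul contDiff_id).sub contDiff_const)

lemma deriv_smoothTransition_eq_zero {x : ℝ} (hx : 1 < x) : deriv Real.smoothTransition x = 0 := by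
  have : Real.smoothTransition =ᶠ[𝓝 x] fun _ => 1 := by
    filter_upwards [Ioi_mem_nhds hx] with y hy using Real.smoothTransition.one_of_one_le (le_of_lt hy)
  rw [this.deriv_eq, deriv_const]

lemma exists_abs_deriv_smoothTransition_le : ∃ C, ∀ x, |deriv Real.smoothTransition x| ≤ C := by
  have hc : Continuous (deriv Real.smoothTransition) :=
    (contDiff_deriv Real.smoothTransition.contDiff).continuous
  refine hc.bounded_above_of_compact_support (HasCompactSupport.intro (isCompact_Icc (a := 0) (b := 1))
    fun x hx => ?_)
  by_cases h1 : 1 < x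
  · exact deriv_smoothTransition_eq_zero h1
  · have h0 : x < 0 := by
      by_contra h0
      exact hx ⟨not_lt.1 h0, not_lt.1 h1⟩
    have : Real.smoothTransition =ᶠ[𝓝 x] fun _ => 0 := by
      filter_upwards [Iio_mem_nhds h0] with y hy using Real.smoothTransition.zero_of_nonpos (le_of_lt hy)
    rw [this.deriv_eq, deriv_const]

lemma deriv_stepUp (j : ℕ) (x : ℝ) :
    deriv (stepUp j) x = (j + 1) * deriv Real.smoothTransition ((j + 1) * x - 1) := by
  have h1 : HasDerivAt (fun t : ℝ => ((j : ℝ) + 1) * t - 1) (j + 1) x := by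
    simpa using ((hasDerivAt_id x).const_mul ((j : ℝ) + 1)).sub_const 1
  have h2 := ((Real.smoothTransition.contDiff (n := 1)).differentiable (by simp)
    ((j + 1) * x - 1)).hasDerivAt.comp x h1
  rw [mul_comm]
  exact h2.deriv

lemma integrable_indicator_norm {u : ℝ × ℝ → ℂ} (hu : MemLp u 2 vol) {K : Set (ℝ × ℝ)}
    (hK : IsCompact K) (D : ℝ) : Integrable (K.indicator fun p => D * ‖u p‖) vol := by
  have hfin : vol K < ⊤ := (Measure.restrict_apply_le _ _).trans_lt hK.measure_lt_top
  have : IsFiniteMeasure (vol.restrict K) := ⟨by simpa using hfin⟩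
  rw [integrable_indicator_iff hK.measurableSet]
  exact (((hu.restrict K).integrable (by norm_num)).norm).const_mul D

/-- Integration by parts against functions that need not vanish near the boundary. -/
lemma HasWeakDeriv.byParts_of_zero {e : ℝ × ℝ} {u w : ℝ × ℝ → ℂ} (h : HasWeakDeriv e u w)
    (hu : MemLp u 2 vol) (hw : MemLp w 2 vol) {χ : ℝ × ℝ → ℂ} (sχ : ContDiff ℝ ∞ χ)
    (cχ : HasCompactSupport χ) (hχ : ∀ θ, χ (θ, 0) = 0) :
    ∫ p, u p * fderiv ℝ χ p e ∂vol = -∫ p, w p * χ p ∂vol := by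
  obtain ⟨C, hC⟩ := exists_abs_deriv_smoothTransition_le
  have hC0 : 0 ≤ C := (abs_nonneg _).trans (hC 0)
  have cf : Continuous fun p => fderiv ℝ χ p e :=
    (sχ.continuous_fderiv (by simp)).clm_apply continuous_const
  obtain ⟨C₀, hC₀⟩ := sχ.continuous.bounded_above_of_compact_support cχ
  obtain ⟨C₁, hC₁⟩ := cf.bounded_above_of_compact_support (cχ.fderiv_apply (𝕜 := ℝ) e)
  obtain ⟨Lp, hLp⟩ := sχ.lipschitzWith_of_hasCompactSupport cχ (by simp)
  -- The linear vanishing of `χ` at the boundary compensates the derivative of the step, which is of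
  -- order `j` but lives only where `μ ≤ 2/(j+1)`. The products are bounded uniformly in `j`, and
  -- dominated convergence applies.
  have hlip : ∀ p : ℝ × ℝ, ‖χ p‖ ≤ Lp * |p.2| := fun p => by
    have := hLp.dist_le_mul p (p.1, 0)
    rw [dist_eq_norm, hχ, sub_zero, Prod.dist_eq, dist_self, Real.dist_eq, sub_zero,
      max_eq_right (abs_nonneg _)] at this
    exact this
  set φ : ℕ → ℝ × ℝ → ℂ := fun j p => (stepUp j p.2 : ℂ) * χ p with hφ
  have sstep : ∀ j, ContDiff ℝ ∞ fun p : ℝ × ℝ => (stepUp j p.2 : ℂ) := fun j =>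
    contDiff_ofReal_comp ((contDiff_stepUp j).comp contDiff_snd)
  have tφ : ∀ j, IsTest (φ j) := fun j => by
    refine ⟨(sstep j).mul sχ, cχ.mul_left, ?_⟩
    have hj : (0 : ℝ) < j + 1 := by positivity
    have hcl : IsClosed {p : ℝ × ℝ | 1 / ((j : ℝ) + 1) ≤ p.2} := isClosed_le continuous_const continuous_snd
    refine (closure_minimal (fun p hp => ?_) hcl).trans fun p hp => lt_of_lt_of_le (one_div_pos.2 hj) hp
    by_contra hlt
    refine hp ?_
    have : stepUp j p.2 = 0 := Real.smoothTransition.zero_of_nonpos (by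
      have := not_le.1 (show ¬ 1 / ((j : ℝ) + 1) ≤ p.2 from hlt)
      rw [lt_div_iff₀ hj] at this
      linarith)
    simp only [hφ, this, Complex.ofReal_zero, zero_mul]
  have dφ : ∀ j p, fderiv ℝ (φ j) p e = (stepUp j p.2 : ℂ) * fderiv ℝ χ p e
      + ((e.2 * deriv (stepUp j) p.2 : ℝ) : ℂ) * χ p := fun j p => by
    have h2 : HasFDerivAt (fun q : ℝ × ℝ => (stepUp j q.2 : ℂ)) _ p :=
      Complex.ofRealCLM.hasFDerivAt.comp p ((((contDiff_stepUp j).differentiable (by simp)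
        p.2).hasDerivAt.hasFDerivAt).comp p (hasFDerivAt_snd (𝕜 := ℝ) (p := p)))
    have h1 : HasFDerivAt (φ j) _ p := h2.mul (sχ.differentiable (by simp) p).hasFDerivAt
    rw [h1.fderiv]
    simp [mul_comm]
  have hev : ∀ p : ℝ × ℝ, 0 < p.2 → ∀ᶠ j : ℕ in atTop, stepUp j p.2 = 1 ∧ deriv (stepUp j) p.2 = 0 := by
    intro p hp
    filter_upwards [eventually_ge_atTop ⌈2 / p.2⌉₊] with j hj
    have h1 : 2 / p.2 < j + 1 := by
      have : (⌈2 / p.2⌉₊ : ℝ) ≤ j := by exact_mod_cast hj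
      linarith [Nat.le_ceil (2 / p.2)]
    rw [div_lt_iff₀ hp] at h1
    refine ⟨Real.smoothTransition.one_of_one_le (by linarith), ?_⟩
    rw [deriv_stepUp, deriv_smoothTransition_eq_zero (by linarith), mul_zero]
  have hzero : ∀ p ∉ tsupport χ, χ p = 0 ∧ fderiv ℝ χ p e = 0 := fun p hp =>
    ⟨image_eq_zero_of_notMem_tsupport hp, by
      rw [image_eq_zero_of_notMem_tsupport fun h => hp (tsupport_fderiv_subset ℝ h)]; rfl⟩
  have hst : ∀ j x, ‖(stepUp j x : ℂ)‖ ≤ 1 := fun j x => by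
    rw [Complex.norm_real, Real.norm_eq_abs, stepUp,
      abs_of_nonneg (Real.smoothTransition.nonneg _)]
    exact Real.smoothTransition.le_one _
  have t1 : Tendsto (fun j => ∫ p, u p * fderiv ℝ (φ j) p e ∂vol) atTop
      (𝓝 (∫ p, u p * fderiv ℝ χ p e ∂vol)) := by
    refine tendsto_integral_of_dominated_convergence
      ((tsupport χ).indicator fun p => (C₁ + |e.2| * (2 * C * Lp)) * ‖u p‖)
      (fun j => ((tφ j).integrable_mul_fderiv h.locInt e).1)
      (integrable_indicator_norm hu cχ.isCompact _) (fun j => ?_) ?_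
    · filter_upwards [ae_vol_pos] with p hp
      by_cases hpK : p ∈ tsupport χ
      · rw [indicator_of_mem hpK, norm_mul, mul_comm, dφ]
        refine mul_le_mul_of_nonneg_right ?_ (norm_nonneg _)
        refine (norm_add_le _ _).trans (add_le_add ?_ ?_)
        · rw [norm_mul]
          exact (mul_le_of_le_one_left (norm_nonneg _) (hst _ _)).trans (hC₁ p)
        · rw [norm_mul, Complex.norm_real, Real.norm_eq_abs, abs_mul, mul_assoc]
          refine mul_le_mul_of_nonneg_left ?_ (abs_nonneg _)
          have hj : (0 : ℝ) < j + 1 := by positivity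
          rw [deriv_stepUp, abs_mul, abs_of_pos hj]
          by_cases h2 : 1 < ((j : ℝ) + 1) * p.2 - 1
          · rw [deriv_smoothTransition_eq_zero h2, abs_zero, mul_zero, zero_mul]
            positivity
          · calc _ ≤ ((j + 1) * C) * (Lp * |p.2|) :=
                  mul_le_mul (mul_le_mul_of_nonneg_left (hC _) hj.le) (hlip p) (norm_nonneg _)
                    (by positivity)
              _ = C * Lp * ((j + 1) * p.2) := by rw [abs_of_pos hp]; ring
              _ ≤ C * Lp * 2 := mul_le_mul_of_nonneg_left (by linarith) (by positivity)
              _ = _ := by ring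
      · rw [indicator_of_notMem hpK, dφ, (hzero p hpK).1, (hzero p hpK).2]
        simp
    · filter_upwards [ae_vol_pos] with p hp
      refine tendsto_const_nhds.congr' ?_
      filter_upwards [hev p hp] with j hj
      rw [dφ, hj.1, hj.2]
      simp
  have t2 : Tendsto (fun j => ∫ p, w p * φ j p ∂vol) atTop (𝓝 (∫ p, w p * χ p ∂vol)) := by
    refine tendsto_integral_of_dominated_convergence
      ((tsupport χ).indicator fun p => C₀ * ‖w p‖)
      (fun j => ((tφ j).integrable_mul h.locInt_deriv).1)
      (integrable_indicator_norm hw cχ.isCompact _) (fun j => Eventually.of_forall fun p => ?_) ?_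
    · by_cases hpK : p ∈ tsupport χ
      · rw [indicator_of_mem hpK, norm_mul, mul_comm]
        refine mul_le_mul_of_nonneg_right ?_ (norm_nonneg _)
        simp only [hφ, norm_mul]
        exact (mul_le_of_le_one_left (norm_nonneg _) (hst _ _)).trans (hC₀ p)
      · simp [indicator_of_notMem hpK, hφ, (hzero p hpK).1]
    · filter_upwards [ae_vol_pos] with p hp
      refine tendsto_const_nhds.congr' ?_
      filter_upwards [hev p hp] with j hj
      simp only [hφ, hj.1, Complex.ofReal_one, one_mul]
  refine tendsto_nhds_unique t1 (t2.neg.congr fun j => ?_)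
  exact ((h.byParts _ (tφ j)).symm)

lemma tendsto_integral_mul {u k : ℝ × ℝ → ℂ} {f : ℕ → ℝ × ℝ → ℂ} (hu : MemLp u 2 vol)
    (hf : ∀ j, MemLp (f j) 2 vol) (hk : MemLp k 2 vol)
    (ht : Tendsto (fun j => eLpNorm (fun p => u p - f j p) 2 vol) atTop (𝓝 0)) :
    Tendsto (fun j => ∫ p, f j p * k p ∂vol) atTop (𝓝 (∫ p, u p * k p ∂vol)) := by
  have hi : ∀ {f : ℝ × ℝ → ℂ}, MemLp f 2 vol → Integrable (fun p => f p * k p) vol :=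
    fun hf => hf.integrable_mul hk
  refine tendsto_integral_of_L1' _ (hi hu).1 (Eventually.of_forall fun j => hi (hf j)) ?_
  have h2 : Tendsto (fun j => eLpNorm (fun p => u p - f j p) 2 vol * eLpNorm k 2 vol) atTop (𝓝 0) := by
    have := ENNReal.Tendsto.mul_const ht (Or.inr hk.2.ne)
    rwa [zero_mul] at this
  refine tendsto_of_tendsto_of_tendsto_of_le_of_le tendsto_const_nhds h2 (fun _ => zero_le) fun j => ?_
  have h3 := eLpNorm_smul_le_mul_eLpNorm (p := 2) (q := 2) (r := 1) hk.1 (hu.sub (hf j)).1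
  refine le_trans (le_of_eq ?_) h3
  rw [← eLpNorm_neg]
  congr 1
  ext p
  simp only [Pi.neg_apply, Pi.sub_apply, Pi.smul_apply', smul_eq_mul]
  ring

lemma memLp_of_continuous {k : ℝ × ℝ → ℂ} (hk : Continuous k) (hc : HasCompactSupport k) :
    MemLp k 2 vol :=
  (hk.memLp_of_hasCompactSupport hc).restrict _

/-- Integration by parts for functions with vanishing trace. -/
lemma byParts_of_approx {u w : ℝ × ℝ → ℂ} {φ : ℕ → ℝ × ℝ → ℂ} (hu : MemLp u 2 vol)
    (hw : MemLp w 2 vol) (hφ : ∀ j, IsTest (φ j))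
    (h1 : Tendsto (fun j => eLpNorm (fun p => u p - φ j p) 2 vol) atTop (𝓝 0))
    (h2 : Tendsto (fun j => eLpNorm (fun p => w p - fderiv ℝ (φ j) p (0, 1)) 2 vol) atTop (𝓝 0))
    {χ : ℝ × ℝ → ℂ} (sχ : ContDiff ℝ ∞ χ) (cχ : HasCompactSupport χ) :
    ∫ p, u p * fderiv ℝ χ p (0, 1) ∂vol = -∫ p, w p * χ p ∂vol := by
  have cf : Continuous fun p => fderiv ℝ χ p (0, 1) :=
    (sχ.continuous_fderiv (by simp)).clm_apply continuous_const
  have t1 := tendsto_integral_mul hu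
    (fun j => memLp_of_continuous (hφ j).smooth.continuous (hφ j).compact)
    (memLp_of_continuous cf (cχ.fderiv_apply (𝕜 := ℝ) _)) h1
  have t2 := tendsto_integral_mul hw
    (fun j => memLp_of_continuous ((hφ j).continuous_fderiv_apply (0, 1))
      ((hφ j).compact.fderiv_apply (𝕜 := ℝ) _))
    (memLp_of_continuous sχ.continuous cχ) h2
  refine tendsto_nhds_unique t1 (t2.neg.congr fun j => ?_)
  have sφ := (hφ j).smooth
  have i0 := integral_dMu (F := fun p => φ j p * χ p) (sφ.mul sχ) cχ.mul_left
  -- The approximants vanish on the boundary, so `χ` need not. This is the form in which the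
  -- vanishing trace of `u` will be used.
  have e0 : ∫ θ : ℝ, φ j (θ, 0) * χ (θ, 0) = 0 := by
    refine integral_eq_zero_of_ae (Eventually.of_forall fun θ => ?_)
    have hz : φ j (θ, 0) = 0 :=
      image_eq_zero_of_notMem_tsupport fun hmem => lt_irrefl (0 : ℝ) ((hφ j).supp hmem)
    simp [hz]
  have ed : ∀ p, dMu (fun p => φ j p * χ p) p
      = fderiv ℝ (φ j) p (0, 1) * χ p + φ j p * fderiv ℝ χ p (0, 1) := fun p => by
    have h : HasFDerivAt (fun p => φ j p * χ p) _ p := (sφ.differentiable (by simp) p).hasFDerivAt.mul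
      (sχ.differentiable (by simp) p).hasFDerivAt
    rw [dMu, h.fderiv]
    simp
    ring
  have i1 : Integrable (fun p => fderiv ℝ (φ j) p (0, 1) * χ p) vol :=
    integrable_vol (((hφ j).continuous_fderiv_apply _).mul sχ.continuous) cχ.mul_left
  have i2 : Integrable (fun p => φ j p * fderiv ℝ χ p (0, 1)) vol :=
    integrable_vol (sφ.continuous.mul cf) (hφ j).compact.mul_right
  simp only [ed] at i0
  rw [integral_add i1 i2, e0, neg_zero] at i0
  linear_combination -i0

/-- A function with vanishing trace together with its weak derivatives, all square integrable. -/
structure IsRegular (u uθ uθθ uμ uμμ : ℝ × ℝ → ℂ) : Prop where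
  memLp : MemLp u 2 vol
  memLp_theta : MemLp uθ 2 vol
  memLp_theta_theta : MemLp uθθ 2 vol
  memLp_mu : MemLp uμ 2 vol
  memLp_mu_mu : MemLp uμμ 2 vol
  theta : HasWeakDTheta u uθ
  theta_theta : HasWeakDTheta uθ uθθ
  mu : ∀ χ : ℝ × ℝ → ℂ, ContDiff ℝ ∞ χ → HasCompactSupport χ →
    ∫ p, u p * fderiv ℝ χ p (0, 1) ∂vol = -∫ p, uμ p * χ p ∂vol
  mu_mu : HasWeakDMu uμ uμμ

/-- Collects one consistent family of square integrable derivatives and expands `D² = ∂_θ² + 2iμ∂_θ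
- μ²`; the trace condition becomes integration by parts without boundary restriction on the test
function. -/
lemma exists_isRegular {lam : ℝ} {Ψ g : ℝ × ℝ → ℂ} (h2 : MemH2 Ψ) (h0 : MemH10 Ψ)
    (hs : SolvesH0 lam Ψ g) : ∃ Ψθ Ψθθ Ψμ Ψμμ, IsRegular Ψ Ψθ Ψθθ Ψμ Ψμμ ∧ ∀ᵐ p ∂vol,
      -Ψμμ p - (Ψθθ p + 2 * (Complex.I * (p.2 : ℂ)) * Ψθ p - (p.2 : ℂ) ^ 2 * Ψ p) - lam * Ψ p = g p := by
  obtain ⟨hΨ, Ψθ, Ψμ, wθ, wμ, ⟨lθ, Ψθθ, -, wθθ, -, lθθ, -⟩, ⟨lμ, -, Ψμμ, -, wμμ, -, lμμ⟩⟩ := h2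
  obtain ⟨-, -, uμ, -, vμ, -, kμ, φ, hφ, a1, -, a2⟩ := h0
  obtain ⟨Pμ, Pμμ, D, DD, sμ, sμμ, ⟨Q, sQ, eD⟩, ⟨T, sT, eDD⟩, heq⟩ := hs
  have r1 : uμ =ᵐ[vol] Ψμ := vμ.ae_eq wμ EventuallyEq.rfl
  have r2 : Pμ =ᵐ[vol] Ψμ := sμ.ae_eq wμ EventuallyEq.rfl
  have r3 : Pμμ =ᵐ[vol] Ψμμ := sμμ.ae_eq wμμ r2
  have r4 : Q =ᵐ[vol] Ψθ := sQ.ae_eq wθ EventuallyEq.rfl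
  have r5 : T =ᵐ[vol] fun p => Ψθθ p + Complex.I * (p.2 : ℂ) * Ψθ p :=
    sT.ae_eq (wθ.covariant wθθ) (by filter_upwards [r4] with p hp; rw [eD, hp])
  refine ⟨Ψθ, Ψθθ, Ψμ, Ψμμ, ⟨hΨ, lθ, lθθ, lμ, lμμ, wθ, wθθ, fun χ sχ cχ => ?_, wμμ⟩, ?_⟩
  · rw [byParts_of_approx hΨ kμ hφ a1 a2 sχ cχ]
    congr 1
    exact integral_congr_ae (by filter_upwards [r1] with p hp; rw [hp])
  · filter_upwards [heq, r3, r4, r5] with p hp q3 q4 q5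
    rw [eDD, eD, q3, q4, q5] at hp
    rw [← hp]
    linear_combination ((p.2 : ℂ) ^ 2 * Ψ p) * Complex.I_sq

/-! ### Derivatives of the mollified extension -/

lemma pairKernel_zero (k : ℝ × ℝ → ℂ) (x : ℝ × ℝ) (θ : ℝ) : pairKernel (-1) k x (θ, 0) = 0 := by
  simp [pairKernel, refl]

/-- Tangential derivatives preserve parity. The odd paired kernel vanishes on the boundary, so no
trace condition on `u` is needed. -/
lemma dTheta_conv_ext {u w k : ℝ × ℝ → ℂ} (h : HasWeakDTheta u w) (hu : MemLp u 2 vol)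
    (hw : MemLp w 2 vol) (hk : ContDiff ℝ ∞ k) (hc : HasCompactSupport k) :
    dTheta (conv (ext (-1) u) k) = conv (ext (-1) w) k := by
  ext x
  rw [dTheta, fderiv_conv ((memLp_ext _ hu).locallyIntegrable (by norm_num)) hk hc,
    conv_ext _ hu ((hk.continuous_fderiv (by simp)).clm_apply continuous_const)
      (hc.fderiv_apply (𝕜 := ℝ) _), conv_ext _ hw hk.continuous hc, ← neg_inj,
    ← h.byParts_of_zero hu hw (contDiff_pairKernel _ hk x) (hasCompactSupport_pairKernel _ hc x)
      (pairKernel_zero k x), ← integral_neg]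
  refine integral_congr_ae (Eventually.of_forall fun y => ?_)
  have e1 : refl (1, 0) = (1, 0) := by simp [refl]
  simp only [fderiv_pairKernel _ hk, e1, pairKernel]
  ring

lemma fderiv_refl_mu (k : ℝ × ℝ → ℂ) (x : ℝ × ℝ) :
    fderiv ℝ k x (refl (0, 1)) = -fderiv ℝ k x (0, 1) := by
  rw [← map_neg]; congr 1; simp [refl]

/-- The normal derivative turns odd into even. The test function is then the even paired kernel,
which does not vanish on the boundary; this is where the vanishing trace of `u` is indispensable. -/
lemma dMu_conv_ext_odd {u w k : ℝ × ℝ → ℂ} (h : ∀ χ : ℝ × ℝ → ℂ, ContDiff ℝ ∞ χ →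
      HasCompactSupport χ → ∫ p, u p * fderiv ℝ χ p (0, 1) ∂vol = -∫ p, w p * χ p ∂vol)
    (hu : MemLp u 2 vol) (hw : MemLp w 2 vol) (hk : ContDiff ℝ ∞ k) (hc : HasCompactSupport k) :
    dMu (conv (ext (-1) u) k) = conv (ext 1 w) k := by
  ext x
  rw [dMu, fderiv_conv ((memLp_ext _ hu).locallyIntegrable (by norm_num)) hk hc,
    conv_ext _ hu ((hk.continuous_fderiv (by simp)).clm_apply continuous_const)
      (hc.fderiv_apply (𝕜 := ℝ) _), conv_ext _ hw hk.continuous hc, ← neg_inj,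
    ← h _ (contDiff_pairKernel _ hk x) (hasCompactSupport_pairKernel _ hc x), ← integral_neg]
  refine integral_congr_ae (Eventually.of_forall fun y => ?_)
  simp only [fderiv_pairKernel _ hk, fderiv_refl_mu, pairKernel]
  ring

/-- For the second normal derivative the test function is the odd paired kernel again, so nothing is
required of the boundary values. -/
lemma dMu_conv_ext_even {u w k : ℝ × ℝ → ℂ} (h : HasWeakDMu u w) (hu : MemLp u 2 vol)
    (hw : MemLp w 2 vol) (hk : ContDiff ℝ ∞ k) (hc : HasCompactSupport k) :
    dMu (conv (ext 1 u) k) = conv (ext (-1) w) k := by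
  ext x
  rw [dMu, fderiv_conv ((memLp_ext _ hu).locallyIntegrable (by norm_num)) hk hc,
    conv_ext _ hu ((hk.continuous_fderiv (by simp)).clm_apply continuous_const)
      (hc.fderiv_apply (𝕜 := ℝ) _), conv_ext _ hw hk.continuous hc, ← neg_inj,
    ← h.byParts_of_zero hu hw (contDiff_pairKernel _ hk x) (hasCompactSupport_pairKernel _ hc x)
      (pairKernel_zero k x), ← integral_neg]
  refine integral_congr_ae (Eventually.of_forall fun y => ?_)
  simp only [fderiv_pairKernel _ hk, fderiv_refl_mu, pairKernel]
  ring

/-- The mollifier is even in `μ`, so mollifying the odd extension keeps it odd and the Dirichlet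
condition holds exactly. -/
lemma conv_ext_moll_zero {u : ℝ × ℝ → ℂ} (hu : MemLp u 2 vol) (j : ℕ) (θ : ℝ) :
    conv (ext (-1) u) (moll j) (θ, 0) = 0 := by
  rw [conv_ext _ hu (contDiff_moll j).continuous (hasCompactSupport_moll j)]
  refine integral_eq_zero_of_ae (Eventually.of_forall fun y => ?_)
  have e : moll j ((θ, 0) - y) = moll j ((θ, 0) - refl y) := by
    obtain ⟨a, b⟩ := y
    simp only [moll, refl, Prod.mk_sub_mk, zero_sub, neg_neg, planeBump_neg_snd]
  simp [pairKernel, e]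

section

variable {lam : ℝ} {Ψ Ψθ Ψθθ Ψμ Ψμμ g : ℝ × ℝ → ℂ}

/-! ### Approximation by smooth functions -/

lemma lintegral_sub_sq_le {a b c : ℝ × ℝ → ℂ} (ha : AEStronglyMeasurable a vol)
    (hb : AEStronglyMeasurable b vol) : ∫⁻ p, ‖a p - c p‖ₑ ^ 2 ∂vol
      ≤ 2 * (∫⁻ p, ‖a p - b p‖ₑ ^ 2 ∂vol + ∫⁻ p, ‖b p - c p‖ₑ ^ 2 ∂vol) := by
  have hm : AEMeasurable (fun p => ‖a p - b p‖ₑ ^ 2) vol := (ha.sub hb).enorm.pow_const 2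
  rw [← lintegral_add_left' hm, ← lintegral_const_mul' _ _ ENNReal.ofNat_ne_top]
  refine lintegral_mono fun p => ?_
  have h := enorm_sub_sq_le (a p - b p) (-(b p - c p))
  rwa [enorm_neg, sub_neg_eq_add, sub_add_sub_cancel] at h

lemma lintegral_add_four {f₁ f₂ f₃ f₄ : ℝ × ℝ → ℝ≥0∞} (h₁ : AEMeasurable f₁ vol)
    (h₂ : AEMeasurable f₂ vol) (h₃ : AEMeasurable f₃ vol) :
    ∫⁻ p, (f₁ p + f₂ p + f₃ p + f₄ p) ∂vol
      = ∫⁻ p, f₁ p ∂vol + ∫⁻ p, f₂ p ∂vol + ∫⁻ p, f₃ p ∂vol + ∫⁻ p, f₄ p ∂vol := by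
  have h₁₂ : AEMeasurable (fun p => f₁ p + f₂ p) vol := h₁.add h₂
  have h₁₂₃ : AEMeasurable (fun p => f₁ p + f₂ p + f₃ p) vol := h₁₂.add h₃
  rw [lintegral_add_left' h₁₂₃, lintegral_add_left' h₁₂, lintegral_add_left' h₁]

lemma resid_eq {v : ℝ × ℝ → ℂ} (hv : ContDiff ℝ ∞ v) (p : ℝ × ℝ) :
    resid lam v p = -dMu (dMu v) p - (dTheta (dTheta v) p
      + 2 * (Complex.I * (p.2 : ℂ)) * dTheta v p - (p.2 : ℂ) ^ 2 * v p) - lam * v p := by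
  have dμ : HasFDerivAt (fun q : ℝ × ℝ => Complex.I * (q.2 : ℂ)) _ p :=
    (Complex.ofRealCLM.hasFDerivAt.comp p (hasFDerivAt_snd (𝕜 := ℝ) (p := p))).const_mul Complex.I
  have dv := (differentiable_of_smooth hv p).hasFDerivAt
  have dθ := (differentiable_of_smooth (contDiff_dTheta hv) p).hasFDerivAt
  have h : HasFDerivAt (covD v) _ p := dθ.add (dμ.mul dv)
  have e : dTheta (covD v) p = dTheta (dTheta v) p + Complex.I * (p.2 : ℂ) * dTheta v p := by
    rw [dTheta, h.fderiv]
    simp [dTheta]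
  rw [resid, landau]
  conv_lhs => rw [covD, e, covD]
  linear_combination (-(p.2 : ℂ) ^ 2 * v p) * Complex.I_sq

/-- The source of the product of `Ψ` with the cutoff `z`. -/
def cutSource (z Ψ Ψθ Ψμ g : ℝ × ℝ → ℂ) (p : ℝ × ℝ) : ℂ :=
  z p * g p - 2 * (dTheta z p * (Ψθ p + Complex.I * (p.2 : ℂ) * Ψ p) + dMu z p * Ψμ p)
    - (dTheta (dTheta z) p + dMu (dMu z) p) * Ψ p

/-- Mollification commutes with every derivative involved. The error is thus a combination of five
mollification errors tending to zero in `L²`, and the cutoff `z` makes the coefficients, which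
contain `μ` and `μ²`, bounded. -/
lemma tendsto_resid_mul_conv (h : IsRegular Ψ Ψθ Ψθθ Ψμ Ψμμ) (hg : ∀ᵐ p ∂vol,
      -Ψμμ p - (Ψθθ p + 2 * (Complex.I * (p.2 : ℂ)) * Ψθ p - (p.2 : ℂ) ^ 2 * Ψ p) - lam * Ψ p = g p)
    {z : ℝ × ℝ → ℂ} (hz : ContDiff ℝ ∞ z) (hc : HasCompactSupport z) :
    Tendsto (fun j => ∫⁻ p, ‖resid lam (fun q => z q * conv (ext (-1) Ψ) (moll j) q) p
      - cutSource z Ψ Ψθ Ψμ g p‖ₑ ^ 2 ∂vol) atTop (𝓝 0) := by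
  have bdd : ∀ {F : ℝ × ℝ → ℂ}, Continuous F → (∀ p ∉ tsupport z, F p = 0) → ∃ A, ∀ p, ‖F p‖ ≤ A :=
    fun hF h0 => hF.bounded_above_of_compact_support (HasCompactSupport.intro hc.isCompact h0)
  have z0 : ∀ p ∉ tsupport z, z p = 0 := fun p => image_eq_zero_of_notMem_tsupport
  have zθ := contDiff_dTheta hz
  have zμ := contDiff_dMu hz
  have cz := hz.continuous
  have czθ := zθ.continuous
  have czμ := zμ.continuous
  have czθθ := (contDiff_dTheta zθ).continuous
  have czμμ := (contDiff_dMu zμ).continuous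
  obtain ⟨A, hA⟩ := bdd (F := fun p => -z p) (by fun_prop) fun p hp => by simp [z0 p hp]
  obtain ⟨A₁, hA₁⟩ := bdd (F := fun p => -(2 * (Complex.I * (p.2 : ℂ)) * z p + 2 * dTheta z p))
    (by fun_prop) fun p hp => by simp [z0 p hp, dTheta_eq_zero hp]
  obtain ⟨A₃, hA₃⟩ := bdd (F := fun p => -(2 * dMu z p)) (by fun_prop)
    fun p hp => by simp [dMu_eq_zero hp]
  obtain ⟨A₀, hA₀⟩ := bdd (F := fun p => (p.2 : ℂ) ^ 2 * z p - lam * z p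
      - 2 * (Complex.I * (p.2 : ℂ)) * dTheta z p - (dTheta (dTheta z) p + dMu (dMu z) p))
    (by fun_prop) fun p hp => by
      rw [z0 p hp, dTheta_eq_zero hp, dTheta_eq_zero fun h => hp (tsupport_dTheta z h),
        dMu_eq_zero fun h => hp (tsupport_dMu z h)]
      simp
  have pA : 0 ≤ A := (norm_nonneg _).trans (hA 0)
  have pA₁ : 0 ≤ A₁ := (norm_nonneg _).trans (hA₁ 0)
  have pA₃ : 0 ≤ A₃ := (norm_nonneg _).trans (hA₃ 0)
  have pA₀ : 0 ≤ A₀ := (norm_nonneg _).trans (hA₀ 0)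
  set S := A + A₁ + A₃ + A₀ with hS
  set V : ℕ → ℂ → (ℝ × ℝ → ℂ) → ℝ × ℝ → ℂ := fun j s f => conv (ext s f) (moll j) with hV
  have sV : ∀ j s {f : ℝ × ℝ → ℂ}, MemLp f 2 vol → ContDiff ℝ ∞ (V j s f) := fun j s f hf =>
    contDiff_conv ((memLp_ext s hf).locallyIntegrable (by norm_num)) (contDiff_moll j)
      (hasCompactSupport_moll j)
  have dm : ∀ j s {f : ℝ × ℝ → ℂ}, MemLp f 2 vol → AEMeasurable (fun p => ‖V j s f p - f p‖ₑ ^ 2) vol :=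
    fun j s f hf => (((sV j s hf).continuous.aestronglyMeasurable).sub hf.1).enorm.pow_const 2
  have lim := (((((tendsto_conv_ext (-1) h.memLp).add (tendsto_conv_ext (-1) h.memLp_theta)).add
    (tendsto_conv_ext (-1) h.memLp_theta_theta)).add (tendsto_conv_ext 1 h.memLp_mu)).add
    (tendsto_conv_ext (-1) h.memLp_mu_mu))
  have lim2 := ENNReal.Tendsto.const_mul (a := ENNReal.ofReal (5 * S ^ 2)) lim
    (Or.inr ENNReal.ofReal_ne_top)
  simp only [add_zero, mul_zero] at lim2
  refine tendsto_of_tendsto_of_tendsto_of_le_of_le tendsto_const_nhds lim2 (fun _ => zero_le) fun j => ?_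
  have d0 := dm j (-1) h.memLp
  have d1 := dm j (-1) h.memLp_theta
  have d2 := dm j (-1) h.memLp_theta_theta
  have d3 := dm j 1 h.memLp_mu
  have eθ : dTheta (V j (-1) Ψ) = V j (-1) Ψθ := dTheta_conv_ext h.theta h.memLp h.memLp_theta
    (contDiff_moll j) (hasCompactSupport_moll j)
  have eθθ : dTheta (V j (-1) Ψθ) = V j (-1) Ψθθ := dTheta_conv_ext h.theta_theta h.memLp_theta
    h.memLp_theta_theta (contDiff_moll j) (hasCompactSupport_moll j)
  have eμ : dMu (V j (-1) Ψ) = V j 1 Ψμ := dMu_conv_ext_odd h.mu h.memLp h.memLp_mu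
    (contDiff_moll j) (hasCompactSupport_moll j)
  have eμμ : dMu (V j 1 Ψμ) = V j (-1) Ψμμ := dMu_conv_ext_even h.mu_mu h.memLp_mu h.memLp_mu_mu
    (contDiff_moll j) (hasCompactSupport_moll j)
  have sv := sV j (-1) h.memLp
  calc _ ≤ ∫⁻ p, ENNReal.ofReal (5 * S ^ 2) * (‖V j (-1) Ψ p - Ψ p‖ₑ ^ 2 + ‖V j (-1) Ψθ p - Ψθ p‖ₑ ^ 2
        + ‖V j (-1) Ψθθ p - Ψθθ p‖ₑ ^ 2 + ‖V j 1 Ψμ p - Ψμ p‖ₑ ^ 2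
        + ‖V j (-1) Ψμμ p - Ψμμ p‖ₑ ^ 2) ∂vol := by
        refine lintegral_mono_ae ?_
        filter_upwards [hg] with p hp
        have e1 : resid lam (fun q => z q * V j (-1) Ψ q) p - cutSource z Ψ Ψθ Ψμ g p
            = ((p.2 : ℂ) ^ 2 * z p - lam * z p - 2 * (Complex.I * (p.2 : ℂ)) * dTheta z p
                - (dTheta (dTheta z) p + dMu (dMu z) p)) * (V j (-1) Ψ p - Ψ p)
              + -(2 * (Complex.I * (p.2 : ℂ)) * z p + 2 * dTheta z p) * (V j (-1) Ψθ p - Ψθ p)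
              + -z p * (V j (-1) Ψθθ p - Ψθθ p) + -(2 * dMu z p) * (V j 1 Ψμ p - Ψμ p)
              + -z p * (V j (-1) Ψμμ p - Ψμμ p) := by
          rw [resid_mul lam hz sv, resid_eq sv, cutSource, ← hp, eμ, eμμ, covD, eθ, eθθ]
          ring
        change ‖resid lam (fun q => z q * V j (-1) Ψ q) p - cutSource z Ψ Ψθ Ψμ g p‖ₑ ^ 2 ≤ _
        rw [e1]
        set x₀ := V j (-1) Ψ p - Ψ p
        set x₁ := V j (-1) Ψθ p - Ψθ p
        set x₂ := V j (-1) Ψθθ p - Ψθθ p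
        set x₃ := V j 1 Ψμ p - Ψμ p
        set x₄ := V j (-1) Ψμμ p - Ψμμ p
        simp only [← ofReal_norm, ← ENNReal.ofReal_pow (norm_nonneg _)]
        rw [← ENNReal.ofReal_add (by positivity) (by positivity),
          ← ENNReal.ofReal_add (by positivity) (by positivity),
          ← ENNReal.ofReal_add (by positivity) (by positivity),
          ← ENNReal.ofReal_add (by positivity) (by positivity), ← ENNReal.ofReal_mul (by positivity)]
        refine ENNReal.ofReal_le_ofReal ?_
        have m : ∀ {c x : ℂ} {a : ℝ}, ‖c‖ ≤ a → a ≤ S → ‖c * x‖ ≤ S * ‖x‖ := fun hc ha => by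
          rw [norm_mul]
          exact mul_le_mul_of_nonneg_right (hc.trans ha) (norm_nonneg _)
        have hn := norm_add_le_of_le (norm_add_le_of_le (norm_add_le_of_le (norm_add_le_of_le
          (m (x := x₀) (hA₀ p) (by linarith)) (m (x := x₁) (hA₁ p) (by linarith)))
          (m (x := x₂) (hA p) (by linarith))) (m (x := x₃) (hA₃ p) (by linarith)))
          (m (x := x₄) (hA p) (by linarith))
        refine (pow_le_pow_left₀ (norm_nonneg _) hn 2).trans ?_
        have hsq : (‖x₀‖ + ‖x₁‖ + ‖x₂‖ + ‖x₃‖ + ‖x₄‖) ^ 2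
            ≤ 5 * (‖x₀‖ ^ 2 + ‖x₁‖ ^ 2 + ‖x₂‖ ^ 2 + ‖x₃‖ ^ 2 + ‖x₄‖ ^ 2) := by
          have := sq_sum_le_card_mul_sum_sq (s := Finset.univ)
            (f := ![‖x₀‖, ‖x₁‖, ‖x₂‖, ‖x₃‖, ‖x₄‖])
          simpa [Fin.sum_univ_five] using this
        calc _ = S ^ 2 * (‖x₀‖ + ‖x₁‖ + ‖x₂‖ + ‖x₃‖ + ‖x₄‖) ^ 2 := by ring
          _ ≤ S ^ 2 * (5 * (‖x₀‖ ^ 2 + ‖x₁‖ ^ 2 + ‖x₂‖ ^ 2 + ‖x₃‖ ^ 2 + ‖x₄‖ ^ 2)) :=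
              mul_le_mul_of_nonneg_left hsq (sq_nonneg _)
          _ = _ := by ring
    _ = _ := by
        have d4 := dm j (-1) h.memLp_mu_mu
        rw [lintegral_const_mul' _ _ ENNReal.ofReal_ne_top, lintegral_add_right' _ d4,
          lintegral_add_four d0 d1 d2]

/-- The bound with the factor `|μ|` is needed for the magnetic potential: the derivative of the
cutoff is of order `1/R`, and the cutoff vanishes once `|μ| ≥ 2R`. -/
lemma norm_boxCut_derivs_le {R : ℝ} (hR : 1 ≤ R) (p : ℝ × ℝ) :
    ‖dTheta (fun q => (boxCut R q : ℂ)) p‖ ≤ cutoffBound ∧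
    ‖dTheta (fun q => (boxCut R q : ℂ)) p‖ * |p.2| ≤ 2 * cutoffBound ∧
    ‖dMu (fun q => (boxCut R q : ℂ)) p‖ ≤ cutoffBound ∧
    ‖dTheta (dTheta fun q => (boxCut R q : ℂ)) p + dMu (dMu fun q => (boxCut R q : ℂ)) p‖
      ≤ 2 * cutoffBound := by
  have hR0 : 0 < R := by linarith
  have hc0 := cutoffBound_nonneg
  have sc := contDiff_scaledCut R
  have sc' := contDiff_deriv sc
  unfold boxCut
  rw [dTheta_mul_split sc sc, dMu_mul_split sc sc, dTheta_mul_split sc' sc, dMu_mul_split sc sc']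
  have b0 := abs_scaledCut_le_one R
  have b1 := abs_deriv_scaledCut_le hR0
  have c1 : cutoffBound / R ≤ cutoffBound := div_le_self hc0 hR
  have c2 : cutoffBound / R ^ 2 ≤ cutoffBound := div_le_self hc0 (one_le_pow₀ hR)
  have b2 := fun x => (abs_deriv_deriv_scaledCut_le hR0 x).trans c2
  refine ⟨(norm_ofReal_mul_le (b1 p.1) (b0 p.2)).trans (by rwa [mul_one]), ?_, (norm_ofReal_mul_le (b0 p.1) (b1 p.2)).trans
    (by rwa [one_mul]), ?_⟩
  · by_cases hp : 2 * R ≤ |p.2|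
    · simp only
      rw [scaledCut_eq_zero hR0 hp, mul_zero, Complex.ofReal_zero, norm_zero, zero_mul]
      positivity
    · calc _ ≤ (cutoffBound / R * 1) * (2 * R) :=
            mul_le_mul (norm_ofReal_mul_le (b1 p.1) (b0 p.2)) (not_le.1 hp).le (abs_nonneg _) (by positivity)
        _ = _ := by field_simp
  · exact (norm_add_le_of_le (norm_ofReal_mul_le (b2 p.1) (b0 p.2)) (norm_ofReal_mul_le (b0 p.1) (b2 p.2))).trans_eq (by ring)

lemma boxCut_derivs_eq_zero {R : ℝ} (hR : 0 < R) {p : ℝ × ℝ} (h1 : |p.1| < R) (h2 : |p.2| < R) :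
    dTheta (fun q => (boxCut R q : ℂ)) p = 0 ∧ dMu (fun q => (boxCut R q : ℂ)) p = 0 ∧
    dTheta (dTheta fun q => (boxCut R q : ℂ)) p + dMu (dMu fun q => (boxCut R q : ℂ)) p = 0 := by
  have sc := contDiff_scaledCut R
  have sc' := contDiff_deriv sc
  unfold boxCut
  rw [dTheta_mul_split sc sc, dMu_mul_split sc sc, dTheta_mul_split sc' sc, dMu_mul_split sc sc']
  have a : ∀ x, |x| < R → |x / R| < 1 := fun x hx => by
    rwa [abs_div, abs_of_pos hR, div_lt_one hR]
  have d1 : ∀ x, |x| < R → deriv (scaledCut R) x = 0 := fun x hx => by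
    rw [deriv_scaledCut]; simp [deriv_cutoff_eq_zero' (a x hx).le]
  have d2 : ∀ x, |x| < R → deriv (deriv (scaledCut R)) x = 0 := fun x hx => by
    rw [deriv_deriv_scaledCut]; simp [deriv_deriv_cutoff_eq_zero (Or.inl (a x hx))]
  simp [d1 _ h1, d1 _ h2, d2 _ h1, d2 _ h2]

lemma tendsto_of_eventually_eq_of_le {f : ℕ → ℝ × ℝ → ℂ} {F : ℝ × ℝ → ℂ} {b : ℝ × ℝ → ℝ≥0∞}
    (hf : ∀ k, AEStronglyMeasurable (f k) vol) (hF : AEStronglyMeasurable F vol)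
    (hb : ∫⁻ p, b p ∂vol ≠ ⊤) (hle : ∀ k p, ‖f k p - F p‖ₑ ^ 2 ≤ b p)
    (heq : ∀ p, ∀ᶠ k in atTop, f k p = F p) :
    Tendsto (fun k => ∫⁻ p, ‖f k p - F p‖ₑ ^ 2 ∂vol) atTop (𝓝 0) := by
  have := tendsto_lintegral_of_dominated_convergence' (f := fun _ => 0) b
    (fun k => ((hf k).sub hF).enorm.pow_const 2)
    (fun k => Eventually.of_forall (hle k)) hb (Eventually.of_forall fun p => by
      refine tendsto_const_nhds.congr' ?_
      filter_upwards [heq p] with k hk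
      simp [hk])
  simpa using this

lemma lintegral_ne_top_of_memLp {f : ℝ × ℝ → ℂ} (hf : MemLp f 2 vol) :
    ∫⁻ p, ‖f p‖ₑ ^ 2 ∂vol ≠ ⊤ := by
  rw [lintegral_enorm_sq_eq]
  exact ENNReal.pow_ne_top hf.2.ne

lemma tendsto_boxCut_mul (hΨ : MemLp Ψ 2 vol) :
    Tendsto (fun k : ℕ => ∫⁻ p, ‖(boxCut (k + 1) p : ℂ) * Ψ p - Ψ p‖ₑ ^ 2 ∂vol) atTop (𝓝 0) := by
  have cz : ∀ k : ℕ, Continuous fun p => (boxCut (k + 1) p : ℂ) := fun k =>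
    (contDiff_ofReal_comp (contDiff_boxCut _)).continuous
  refine tendsto_of_eventually_eq_of_le (b := fun p => ‖Ψ p‖ₑ ^ 2)
    (fun k => (cz k).aestronglyMeasurable.mul hΨ.1) hΨ.1 (lintegral_ne_top_of_memLp hΨ)
    (fun k p => ?_) fun p => ?_
  · rw [← sub_one_mul, enorm_mul]
    refine pow_le_pow_left' (mul_le_of_le_one_left' ?_) 2
    rw [← Complex.ofReal_one, ← Complex.ofReal_sub, ← ofReal_norm, Complex.norm_real, Real.norm_eq_abs]
    refine ENNReal.ofReal_le_one.2 (abs_le.2 ⟨?_, ?_⟩)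
    · linarith [boxCut_nonneg (k + 1) p]
    · linarith [boxCut_le_one (k + 1) p]
  · filter_upwards [eventually_abs_lt p] with k hk
    rw [boxCut_eq_one (by positivity) hk.1.le hk.2.le, Complex.ofReal_one, one_mul]

lemma aestronglyMeasurable_cutSource {z : ℝ × ℝ → ℂ} (sz : ContDiff ℝ ∞ z) (hΨ : MemLp Ψ 2 vol)
    (hθ : MemLp Ψθ 2 vol) (hμ : MemLp Ψμ 2 vol) (hg : MemLp g 2 vol) :
    AEStronglyMeasurable (cutSource z Ψ Ψθ Ψμ g) vol := by
  have m : ∀ {f : ℝ × ℝ → ℂ}, ContDiff ℝ ∞ f → AEStronglyMeasurable f vol := fun hf =>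
    hf.continuous.aestronglyMeasurable
  have zθ := contDiff_dTheta sz
  have zμ := contDiff_dMu sz
  have ci : AEStronglyMeasurable (fun p : ℝ × ℝ => Complex.I * (p.2 : ℂ)) vol :=
    (by fun_prop : Continuous fun p : ℝ × ℝ => Complex.I * (p.2 : ℂ)).aestronglyMeasurable
  exact (((m sz).mul hg.1).sub ((((m zθ).mul (hθ.1.add (ci.mul hΨ.1))).add
    ((m zμ).mul hμ.1)).const_mul 2)).sub (((m (contDiff_dTheta zθ)).add (m (contDiff_dMu zμ))).mul hΨ.1)

/-- Dominated convergence: all derivatives of the cutoff, also that multiplied by `μ`, are bounded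
uniformly in `k`, and at a given point they eventually vanish. -/
lemma tendsto_cutSource (hΨ : MemLp Ψ 2 vol) (hθ : MemLp Ψθ 2 vol) (hμ : MemLp Ψμ 2 vol)
    (hg : MemLp g 2 vol) :
    Tendsto (fun k : ℕ => ∫⁻ p, ‖cutSource (fun q => (boxCut (k + 1) q : ℂ)) Ψ Ψθ Ψμ g p - g p‖ₑ ^ 2
      ∂vol) atTop (𝓝 0) := by
  have hc0 := cutoffBound_nonneg
  have sz : ∀ k : ℕ, ContDiff ℝ ∞ fun p => (boxCut (k + 1) p : ℂ) := fun k =>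
    contDiff_ofReal_comp (contDiff_boxCut _)
  set D := 1 + 6 * cutoffBound with hD
  refine tendsto_of_eventually_eq_of_le (b := fun p => ENNReal.ofReal (4 * D ^ 2)
    * (‖g p‖ₑ ^ 2 + ‖Ψθ p‖ₑ ^ 2 + ‖Ψ p‖ₑ ^ 2 + ‖Ψμ p‖ₑ ^ 2))
    (fun k => aestronglyMeasurable_cutSource (sz k) hΨ hθ hμ hg) hg.1 ?_ (fun k p => ?_) fun p => ?_
  · have m1 := hg.1.enorm.pow_const 2
    have m2 := hθ.1.enorm.pow_const 2
    have m3 := hΨ.1.enorm.pow_const 2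
    rw [lintegral_const_mul' _ _ ENNReal.ofReal_ne_top, lintegral_add_four m1 m2 m3]
    refine ENNReal.mul_ne_top ENNReal.ofReal_ne_top (ENNReal.add_ne_top.2 ⟨ENNReal.add_ne_top.2
      ⟨ENNReal.add_ne_top.2 ⟨?_, ?_⟩, ?_⟩, ?_⟩) <;> exact lintegral_ne_top_of_memLp ‹_›
  · have hR : (1 : ℝ) ≤ k + 1 := by linarith [k.cast_nonneg (α := ℝ)]
    obtain ⟨q1, q2, q3, q4⟩ := norm_boxCut_derivs_le hR p
    simp only [← ofReal_norm, ← ENNReal.ofReal_pow (norm_nonneg _)]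
    rw [← ENNReal.ofReal_add (by positivity) (by positivity),
      ← ENNReal.ofReal_add (by positivity) (by positivity),
      ← ENNReal.ofReal_add (by positivity) (by positivity), ← ENNReal.ofReal_mul (by positivity)]
    refine ENNReal.ofReal_le_ofReal ?_
    have e : cutSource (fun q => (boxCut (k + 1) q : ℂ)) Ψ Ψθ Ψμ g p - g p
        = ((boxCut (k + 1) p - 1 : ℝ) : ℂ) * g p
          + -(2 * dTheta (fun q => (boxCut (k + 1) q : ℂ)) p) * Ψθ p
          + -(2 * (dTheta (fun q => (boxCut (k + 1) q : ℂ)) p * (Complex.I * (p.2 : ℂ)))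
            + (dTheta (dTheta fun q => (boxCut (k + 1) q : ℂ)) p
              + dMu (dMu fun q => (boxCut (k + 1) q : ℂ)) p)) * Ψ p
          + -(2 * dMu (fun q => (boxCut (k + 1) q : ℂ)) p) * Ψμ p := by
      rw [cutSource]; push_cast; ring
    rw [e]
    have m : ∀ {c x : ℂ}, ‖c‖ ≤ D → ‖c * x‖ ≤ D * ‖x‖ := fun hc => by
      rw [norm_mul]
      exact mul_le_mul_of_nonneg_right hc (norm_nonneg _)
    have k1 : ‖((boxCut (k + 1) p - 1 : ℝ) : ℂ)‖ ≤ D := by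
      rw [Complex.norm_real, Real.norm_eq_abs, abs_le]
      constructor
      · linarith [boxCut_nonneg (k + 1) p]
      · linarith [boxCut_le_one (k + 1) p]
    have k2 : ‖-(2 * dTheta (fun q => (boxCut (k + 1) q : ℂ)) p)‖ ≤ D := by
      rw [norm_neg, norm_mul, Complex.norm_ofNat]; linarith
    have k4 : ‖-(2 * dMu (fun q => (boxCut (k + 1) q : ℂ)) p)‖ ≤ D := by
      rw [norm_neg, norm_mul, Complex.norm_ofNat]; linarith
    have k3 : ‖-(2 * (dTheta (fun q => (boxCut (k + 1) q : ℂ)) p * (Complex.I * (p.2 : ℂ)))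
            + (dTheta (dTheta fun q => (boxCut (k + 1) q : ℂ)) p
              + dMu (dMu fun q => (boxCut (k + 1) q : ℂ)) p))‖ ≤ D := by
      rw [norm_neg]
      refine (norm_add_le _ _).trans ?_
      rw [norm_mul, norm_mul, norm_mul, Complex.norm_I, one_mul, Complex.norm_real, Complex.norm_ofNat,
        Real.norm_eq_abs]
      linarith
    have hn := norm_add_le_of_le (norm_add_le_of_le (norm_add_le_of_le
      (m (x := g p) k1) (m (x := Ψθ p) k2)) (m (x := Ψ p) k3)) (m (x := Ψμ p) k4)
    refine (pow_le_pow_left₀ (norm_nonneg _) hn 2).trans ?_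
    have hsq : (‖g p‖ + ‖Ψθ p‖ + ‖Ψ p‖ + ‖Ψμ p‖) ^ 2
        ≤ 4 * (‖g p‖ ^ 2 + ‖Ψθ p‖ ^ 2 + ‖Ψ p‖ ^ 2 + ‖Ψμ p‖ ^ 2) := by
      have := sq_sum_le_card_mul_sum_sq (s := Finset.univ) (f := ![‖g p‖, ‖Ψθ p‖, ‖Ψ p‖, ‖Ψμ p‖])
      simpa [Fin.sum_univ_four] using this
    calc _ = D ^ 2 * (‖g p‖ + ‖Ψθ p‖ + ‖Ψ p‖ + ‖Ψμ p‖) ^ 2 := by ring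
      _ ≤ D ^ 2 * (4 * (‖g p‖ ^ 2 + ‖Ψθ p‖ ^ 2 + ‖Ψ p‖ ^ 2 + ‖Ψμ p‖ ^ 2)) :=
          mul_le_mul_of_nonneg_left hsq (sq_nonneg _)
      _ = _ := by ring
  · filter_upwards [eventually_abs_lt p] with k hk
    have hR : (0 : ℝ) < k + 1 := by positivity
    obtain ⟨q1, q2, q3⟩ := boxCut_derivs_eq_zero hR hk.1 hk.2
    rw [cutSource, q1, q2, q3, boxCut_eq_one hR hk.1.le hk.2.le]
    simp

/-- Solutions in `H² ∩ H¹₀` are limits, together with their sources, of smooth compactly supported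
functions vanishing on the boundary. -/
theorem exists_isDirichlet_approx (h2 : MemH2 Ψ) (h0 : MemH10 Ψ) (hs : SolvesH0 lam Ψ g)
    (hg : MemLp g 2 vol) {ε : ℝ≥0∞} (hε : 0 < ε) : ∃ Φ, IsDirichlet Φ ∧
      ∫⁻ p, ‖Φ p - Ψ p‖ₑ ^ 2 ∂vol ≤ ε ∧ ∫⁻ p, ‖resid lam Φ p - g p‖ₑ ^ 2 ∂vol ≤ ε := by
  obtain ⟨Ψθ, Ψθθ, Ψμ, Ψμμ, h, heq⟩ := exists_isRegular h2 h0 hs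
  have hε4 : 0 < ε / 4 := ENNReal.div_pos hε.ne' ENNReal.ofNat_ne_top
  have hsum : 2 * (ε / 4 + ε / 4) = ε := by
    rw [← two_mul, ← mul_assoc, show (2 * 2 : ℝ≥0∞) = 4 by norm_num,
      ENNReal.mul_div_cancel (by norm_num) (by norm_num)]
  -- The cutoff is fixed before the mollifier, since the coefficients in the mollification error
  -- depend on it. Each step costs `ε/4`, and the squared triangle inequality doubles the sum.
  obtain ⟨k, hk1, hk2⟩ := ((((tendsto_boxCut_mul h.memLp).eventually (Iic_mem_nhds hε4))).and
    ((tendsto_cutSource h.memLp h.memLp_theta h.memLp_mu hg).eventually (Iic_mem_nhds hε4))).exists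
  have hR : (0 : ℝ) < k + 1 := by positivity
  set z : ℝ × ℝ → ℂ := fun q => (boxCut (k + 1) q : ℂ) with hz
  have sz : ContDiff ℝ ∞ z := contDiff_ofReal_comp (contDiff_boxCut _)
  have cz : HasCompactSupport z :=
    (hasCompactSupport_boxCut hR).comp_left (g := fun x : ℝ => (x : ℂ)) (by simp)
  obtain ⟨j, hj1, hj2⟩ := (((tendsto_conv_ext (-1) h.memLp).eventually (Iic_mem_nhds hε4)).and
    ((tendsto_resid_mul_conv h heq sz cz).eventually (Iic_mem_nhds hε4))).exists
  set v := conv (ext (-1) Ψ) (moll j) with hv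
  have sv : ContDiff ℝ ∞ v := contDiff_conv ((memLp_ext _ h.memLp).locallyIntegrable (by norm_num))
    (contDiff_moll j) (hasCompactSupport_moll j)
  have dΦ : IsDirichlet fun q => z q * v q :=
    isDirichlet_boxCut_mul hR sv (conv_ext_moll_zero h.memLp j)
  refine ⟨fun q => z q * v q, dΦ, ?_, ?_⟩
  · refine (lintegral_sub_sq_le (b := fun p => z p * Ψ p) dΦ.smooth.continuous.aestronglyMeasurable
      (sz.continuous.aestronglyMeasurable.mul h.memLp.1)).trans (le_of_le_of_eq ?_ hsum)
    refine mul_le_mul_right (add_le_add (le_trans (lintegral_mono fun p => ?_) hj1) hk1) _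
    rw [← mul_sub]
    exact pow_le_pow_left' (enorm_boxCut_mul_le _ _ _) 2
  · refine (lintegral_sub_sq_le (b := cutSource z Ψ Ψθ Ψμ g)
      (contDiff_resid lam dΦ.smooth).continuous.aestronglyMeasurable
      (aestronglyMeasurable_cutSource sz h.memLp h.memLp_theta h.memLp_mu hg)).trans
      (le_of_le_of_eq ?_ hsum)
    exact mul_le_mul_right (add_le_add hj2 hk2) _

end

section

variable {lam Λ B : ℝ} {Ψ g : ℝ × ℝ → ℂ}

/-! ### Averages and weighted masses -/

/-- The mass of `(1 + μ)^{-n} f` on the half-line over `θ`. -/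
def slice (n : ℕ) (f : ℝ × ℝ → ℂ) (θ : ℝ) : ℝ≥0∞ :=
  ∫⁻ μ in Ioi (0 : ℝ), ‖weighted n f (θ, μ)‖ₑ ^ 2

lemma slice_congr (n : ℕ) {f f' : ℝ × ℝ → ℂ} (h : f =ᵐ[vol] f') : slice n f =ᵐ[volume] slice n f' := by
  rw [EventuallyEq, vol_eq_prod] at h
  filter_upwards [Measure.ae_ae_of_ae_prod h] with θ hθ
  refine lintegral_congr_ae ?_
  filter_upwards [hθ] with μ hμ
  rw [weighted, weighted, hμ]

lemma enorm_weighted_sq (n : ℕ) (f : ℝ × ℝ → ℂ) {p : ℝ × ℝ} (hp : 0 < p.2) :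
    ‖weighted n f p‖ₑ ^ 2 = ENNReal.ofReal (((1 + p.2) ^ (2 * n))⁻¹) * ‖f p‖ₑ ^ 2 := by
  have h : 0 ≤ ((1 + p.2) ^ n)⁻¹ := by positivity
  rw [weighted, enorm_smul, mul_pow, ← ofReal_norm (((1 + p.2) ^ n)⁻¹), Real.norm_of_nonneg h,
    ← ENNReal.ofReal_pow h, inv_pow, ← pow_mul, mul_comm n 2]

lemma measurable_weighted (n : ℕ) {f : ℝ × ℝ → ℂ} (hf : Measurable f) : Measurable (weighted n f) := by
  unfold weighted; fun_prop

lemma measurable_slice (n : ℕ) {f : ℝ × ℝ → ℂ} (hf : Measurable f) : Measurable (slice n f) :=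
  ((measurable_weighted n hf).enorm.pow_const 2).lintegral_prod_right'

/-- Links the weighted masses of the estimates to the slice integrals in `avgSq`; measurable
representatives are needed because the latter are iterated integrals. -/
lemma wmass_eq_slice (n : ℕ) {f : ℝ × ℝ → ℂ} (hf : AEStronglyMeasurable f vol) {a : ℝ → ℝ}
    (ha : Measurable a) : wmass n a f = ∫⁻ θ, ENNReal.ofReal (a θ ^ 2) * slice n f θ := by
  have hae := hf.ae_eq_mk
  have e1 : wmass n a f = ∫⁻ p, ENNReal.ofReal (a p.1 ^ 2) * ‖weighted n (hf.mk f) p‖ₑ ^ 2 ∂vol := by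
    refine lintegral_congr_ae ?_
    filter_upwards [hae, ae_vol_pos] with p hp h0
    rw [enorm_weighted_sq n _ h0, ← hp, ← mul_assoc, ← ENNReal.ofReal_mul (sq_nonneg _)]
  rw [e1, lintegral_vol_weight (w := fun θ => ENNReal.ofReal (a θ ^ 2))
    (measurable_weighted n hf.stronglyMeasurable_mk.measurable) (by fun_prop)]
  refine lintegral_congr_ae ?_
  filter_upwards [slice_congr n hae] with θ hθ
  rw [hθ, slice]

lemma setLIntegral_strip_eq_slice (n : ℕ) {f : ℝ × ℝ → ℂ} (hf : AEStronglyMeasurable f vol) (r : ℝ) :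
    ∫⁻ p in strip r, ENNReal.ofReal (((1 + p.2) ^ (2 * n))⁻¹) * ‖f p‖ₑ ^ 2 ∂vol
      = ∫⁻ θ in {θ | |θ - 0| < r}, slice n f θ := by
  have hae := hf.ae_eq_mk
  have e1 : ∫⁻ p in strip r, ENNReal.ofReal (((1 + p.2) ^ (2 * n))⁻¹) * ‖f p‖ₑ ^ 2 ∂vol
      = ∫⁻ p in strip r, ‖weighted n (hf.mk f) p‖ₑ ^ 2 ∂vol := by
    refine lintegral_congr_ae (ae_restrict_of_ae ?_)
    filter_upwards [hae, ae_vol_pos] with p hp h0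
    rw [enorm_weighted_sq n _ h0, ← hp]
  simp only [sub_zero]
  rw [e1, setLIntegral_strip (measurable_weighted n hf.stronglyMeasurable_mk.measurable)]
  refine lintegral_congr_ae (ae_restrict_of_ae ?_)
  filter_upwards [slice_congr n hae] with θ hθ
  rw [hθ, slice]

lemma setLIntegral_slice (n : ℕ) (f : ℝ × ℝ → ℂ) (Θ : ℝ) {r : ℝ} (hr : 0 < r) :
    ∫⁻ θ in {θ | |θ - Θ| < r}, slice n f θ = ENNReal.ofReal (2 * r) * avgSq Θ r (weighted n f) := by
  have hset : {θ : ℝ | |θ - Θ| < r} = Metric.ball Θ r := by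
    ext θ; simp [Real.dist_eq]
  rw [avgSq, setLAverage_eq, hset, Real.volume_ball, ENNReal.mul_div_cancel]
  · rfl
  · simpa using hr
  · exact ENNReal.ofReal_ne_top

lemma avgSq_le_of_tripleNorm_le {m : ℕ} {M : ℝ} {u : ℝ × ℝ → ℂ} {k : ℝ} (hk : 0 ≤ k)
    (h : tripleNorm m M u ≤ ENNReal.ofReal k) (Θ : ℝ) :
    avgSq Θ M u ≤ ENNReal.ofReal (k ^ 2 * growth M Θ ^ (2 * m)) := by
  have hg : 0 < growth M Θ ^ m := pow_pos (zero_lt_one.trans_le (one_le_growth M Θ)) m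
  have h1 : ENNReal.ofReal ((growth M Θ ^ m)⁻¹) * avgSq Θ M u ^ (1 / 2 : ℝ) ≤ ENNReal.ofReal k :=
    (le_iSup (fun Θ : ℝ => ENNReal.ofReal (((1 + |Θ / M|) ^ m)⁻¹) * avgSq Θ M u ^ (1 / 2 : ℝ)) Θ).trans h
  have h2 : avgSq Θ M u ^ (1 / 2 : ℝ) ≤ ENNReal.ofReal (growth M Θ ^ m * k) := by
    calc avgSq Θ M u ^ (1 / 2 : ℝ) = ENNReal.ofReal (growth M Θ ^ m)
          * (ENNReal.ofReal ((growth M Θ ^ m)⁻¹) * avgSq Θ M u ^ (1 / 2 : ℝ)) := by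
          rw [← mul_assoc, ← ENNReal.ofReal_mul hg.le, mul_inv_cancel₀ hg.ne', ENNReal.ofReal_one,
            one_mul]
      _ ≤ ENNReal.ofReal (growth M Θ ^ m) * ENNReal.ofReal k := mul_le_mul_right h1 _
      _ = _ := (ENNReal.ofReal_mul hg.le).symm
  calc avgSq Θ M u = (avgSq Θ M u ^ (1 / 2 : ℝ)) ^ 2 := by
        rw [← ENNReal.rpow_natCast, ← ENNReal.rpow_mul]; norm_num
    _ ≤ ENNReal.ofReal (growth M Θ ^ m * k) ^ 2 := pow_le_pow_left' h2 2
    _ = _ := by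
        rw [← ENNReal.ofReal_pow (by positivity)]
        congr 1
        ring

lemma tripleNorm_le_of_avgSq_le {m : ℕ} {M D : ℝ} {u : ℝ × ℝ → ℂ} (hD : 0 ≤ D)
    (h : ∀ Θ, avgSq Θ M u ≤ ENNReal.ofReal (D ^ 2 * growth M Θ ^ (2 * m))) :
    tripleNorm m M u ≤ ENNReal.ofReal D := by
  refine iSup_le fun Θ => ?_
  have hg : 0 < growth M Θ ^ m := pow_pos (zero_lt_one.trans_le (one_le_growth M Θ)) m
  have h1 : avgSq Θ M u ^ (1 / 2 : ℝ) ≤ ENNReal.ofReal (D * growth M Θ ^ m) := by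
    refine (ENNReal.rpow_le_rpow (h Θ) (by norm_num)).trans_eq ?_
    rw [show D ^ 2 * growth M Θ ^ (2 * m) = (D * growth M Θ ^ m) ^ 2 by ring,
      ENNReal.ofReal_rpow_of_nonneg (by positivity) (by norm_num), ← Real.sqrt_eq_rpow,
      Real.sqrt_sq (by positivity)]
  calc _ ≤ ENNReal.ofReal ((growth M Θ ^ m)⁻¹) * ENNReal.ofReal (D * growth M Θ ^ m) :=
        mul_le_mul_right h1 _
    _ = _ := by
        rw [← ENNReal.ofReal_mul (by positivity)]
        congr 1
        field_simp

lemma lintegral_weight_sq_le {w : ℝ × ℝ → ℝ≥0∞} (hw : AEMeasurable w vol) (hw1 : ∀ᵐ p ∂vol, w p ≤ 1)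
    {a b : ℝ × ℝ → ℂ} (hb : AEStronglyMeasurable b vol) :
    ∫⁻ p, w p * ‖a p‖ₑ ^ 2 ∂vol
      ≤ 2 * (∫⁻ p, w p * ‖b p‖ₑ ^ 2 ∂vol + ∫⁻ p, ‖a p - b p‖ₑ ^ 2 ∂vol) := by
  have hm : AEMeasurable (fun p => w p * ‖b p‖ₑ ^ 2) vol := hw.mul (hb.enorm.pow_const 2)
  rw [← lintegral_add_left' hm, ← lintegral_const_mul' _ _ ENNReal.ofNat_ne_top]
  refine lintegral_mono_ae ?_
  filter_upwards [hw1] with p hp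
  have h := enorm_sub_sq_le (b p) (-(a p - b p))
  rw [enorm_neg, sub_neg_eq_add, add_sub_cancel] at h
  calc w p * ‖a p‖ₑ ^ 2 ≤ w p * (2 * (‖b p‖ₑ ^ 2 + ‖a p - b p‖ₑ ^ 2)) := mul_le_mul_right h _
    _ = 2 * (w p * ‖b p‖ₑ ^ 2 + w p * ‖a p - b p‖ₑ ^ 2) := by ring
    _ ≤ _ := by
        gcongr
        exact mul_le_of_le_one_left' hp

lemma wmass_le_add (n : ℕ) (l Θ : ℝ) {a b : ℝ × ℝ → ℂ} (hb : AEStronglyMeasurable b vol) :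
    wmass n (sech l Θ) a ≤ 2 * (wmass n (sech l Θ) b + ∫⁻ p, ‖a p - b p‖ₑ ^ 2 ∂vol) := by
  have := (contDiff_sech l Θ).continuous.measurable
  refine lintegral_weight_sq_le (by fun_prop) ?_ hb
  filter_upwards [ae_vol_pos] with p hp
  exact ENNReal.ofReal_le_one.2 (mul_le_one₀ (sechSq_le_one l Θ p.1) (by positivity) (inv_pow_le_one hp))

lemma strip_le_add (n : ℕ) (r : ℝ) {a b : ℝ × ℝ → ℂ} (hb : AEStronglyMeasurable b vol) :
    ∫⁻ p in strip r, ENNReal.ofReal (((1 + p.2) ^ (2 * n))⁻¹) * ‖a p‖ₑ ^ 2 ∂vol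
      ≤ 2 * (∫⁻ p in strip r, ENNReal.ofReal (((1 + p.2) ^ (2 * n))⁻¹) * ‖b p‖ₑ ^ 2 ∂vol
        + ∫⁻ p, ‖a p - b p‖ₑ ^ 2 ∂vol) := by
  have hms := measurableSet_strip r
  have hm : Measurable fun p : ℝ × ℝ => ENNReal.ofReal (((1 + p.2) ^ (2 * n))⁻¹) := by fun_prop
  have := lintegral_weight_sq_le (a := a) (hm.indicator hms).aemeasurable (by
    filter_upwards [ae_vol_pos] with p hp
    exact indicator_apply_le' (fun _ => ENNReal.ofReal_le_one.2 (inv_pow_le_one hp))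
      fun _ => zero_le_one) hb
  have e : ∀ f : ℝ × ℝ → ℂ, (fun p => (strip r).indicator
      (fun p => ENNReal.ofReal (((1 + p.2) ^ (2 * n))⁻¹)) p * ‖f p‖ₑ ^ 2)
      = (strip r).indicator fun p => ENNReal.ofReal (((1 + p.2) ^ (2 * n))⁻¹) * ‖f p‖ₑ ^ 2 := fun f => by
    ext p
    by_cases hp : p ∈ strip r <;> simp [hp]
  rwa [e, e, lintegral_indicator hms, lintegral_indicator hms] at this

/-- The estimate for a single solution. -/
theorem tripleNorm_le (hΛ : 0 ≤ Λ) (B : ℝ) (m n : ℕ) :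
    ∃ C : ℝ, 0 < C ∧ ∀ {lam : ℝ}, Admissible Λ B lam → ∀ {M : ℝ}, 1 ≤ M → ∀ {Ψ g : ℝ × ℝ → ℂ},
      MemH2 Ψ → MemH2 g → SolvesH0 lam Ψ g → MemH10 Ψ → tripleNorm m M (weighted n g) ≤ 2 →
      tripleNorm (m + 1) M (weighted n Ψ)
        ≤ ENNReal.ofReal C * (ENNReal.ofReal M + avgSq 0 (2 * M) (weighted n Ψ)) := by
  obtain ⟨C, hC, hest⟩ := weighted_estimate hΛ B m n
  set s := scale Λ B with hs
  have h8 : 8 ≤ s := eight_le_scale hΛ B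
  set K₀ := Real.exp 2 * sechMoment s (2 * m) * 4 with hK₀
  have hK₀0 : 0 ≤ K₀ := mul_nonneg (mul_nonneg (Real.exp_nonneg _) (sechMoment_nonneg _ _)) (by norm_num)
  set D := 2 * (2 * C + 1) * (18 + 2 * K₀) + 1 with hD
  have hD1 : 1 ≤ D := by
    have : 0 ≤ 2 * (2 * C + 1) * (18 + 2 * K₀) := by positivity
    linarith
  refine ⟨D, by linarith, ?_⟩
  intro lam ha M hM Ψ g hΨ2 hg2 hsol hΨ0 hg
  have hM0 : 0 < M := by linarith
  have hl1 : M ≤ s * M := le_mul_of_one_le_left hM0.le (by linarith)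
  -- If the average on the right is infinite there is nothing to prove; otherwise it becomes a real
  -- number `x`.
  by_cases htop : avgSq 0 (2 * M) (weighted n Ψ) = ⊤
  · rw [htop, add_top, ENNReal.mul_top (by simpa using by linarith)]
    exact le_top
  obtain ⟨x, hx0, hx⟩ : ∃ x : ℝ, 0 ≤ x ∧ avgSq 0 (2 * M) (weighted n Ψ) = ENNReal.ofReal x :=
    ⟨_, ENNReal.toReal_nonneg, (ENNReal.ofReal_toReal htop).symm⟩
  have hgL : MemLp g 2 vol := hg2.1
  have hΨL : MemLp Ψ 2 vol := hΨ2.1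
  have hgr : ∀ Θ, 1 ≤ growth M Θ := one_le_growth M
  -- the source
  have hgm : ∀ Θ, wmass n (sech (s * M) Θ) g ≤ ENNReal.ofReal (M * K₀ * growth M Θ ^ (2 * m)) := by
    intro Θ
    have hae := slice_congr n hgL.1.ae_eq_mk
    have hF := measurable_slice n hgL.1.stronglyMeasurable_mk.measurable
    have hb := lintegral_sechSq_le (L := s) (M := M) (K := 4) (by linarith) hM0 (by norm_num) (2 * m) hF
      (fun Θ => by
        rw [← lintegral_congr_ae (ae_restrict_of_ae hae), setLIntegral_slice n g Θ hM0]
        have h4 := avgSq_le_of_tripleNorm_le zero_le_two (hg.trans_eq (ENNReal.ofReal_ofNat 2).symm) Θ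
        refine (mul_le_mul_right h4 _).trans_eq ?_
        rw [← ENNReal.ofReal_mul (by positivity)]
        congr 1
        ring) Θ
    rw [wmass_eq_slice n hgL.1 (contDiff_sech _ _).continuous.measurable]
    refine le_trans (le_of_eq (lintegral_congr_ae ?_)) (hb.trans_eq ?_)
    · filter_upwards [hae] with θ hθ
      rw [hθ, sechSq]
    · rw [hK₀]
      congr 1
      ring
  -- A fixed tolerance suffices: since `M` and all growth factors are at least `1`, an error `1/4`
  -- is absorbed into the constants and no limit of approximations is needed.
  obtain ⟨Φ, dΦ, hΦ1, hΦ2⟩ := exists_isDirichlet_approx hΨ2 hΨ0 hsol hgL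
    (ε := ENNReal.ofReal (1 / 4)) (by simp)
  have hΦ1' : ∫⁻ p, ‖Ψ p - Φ p‖ₑ ^ 2 ∂vol ≤ ENNReal.ofReal (1 / 4) := by
    refine le_trans (le_of_eq (lintegral_congr fun p => ?_)) hΦ1
    rw [← enorm_neg, neg_sub]
  have h2 : (2 : ℝ≥0∞) = ENNReal.ofReal 2 := (ENNReal.ofReal_ofNat 2).symm
  have hΦg : ∀ Θ, wmass n (sech (s * M) Θ) (resid lam Φ)
      ≤ ENNReal.ofReal (M * (2 * K₀ + 1) * growth M Θ ^ (2 * m)) := by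
    intro Θ
    have hgx : 1 ≤ growth M Θ ^ (2 * m) := one_le_pow₀ (hgr Θ)
    refine (wmass_le_add n (s * M) Θ hgL.1).trans ((mul_le_mul_right (add_le_add (hgm Θ) hΦ2) _).trans ?_)
    rw [h2, ← ENNReal.ofReal_add (by positivity) (by norm_num), ← ENNReal.ofReal_mul zero_le_two]
    refine ENNReal.ofReal_le_ofReal ?_
    nlinarith
  have hΦs : ∫⁻ p in strip (2 * M), ENNReal.ofReal (((1 + p.2) ^ (2 * n))⁻¹) * ‖Φ p‖ₑ ^ 2 ∂vol
      ≤ ENNReal.ofReal (M * (8 * x + 1)) := by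
    refine (strip_le_add n (2 * M) hΨL.1).trans ?_
    rw [setLIntegral_strip_eq_slice n hΨL.1, setLIntegral_slice n Ψ 0 (by positivity), hx,
      ← ENNReal.ofReal_mul (by positivity)]
    refine (mul_le_mul_right (add_le_add_right hΦ1 _) _).trans ?_
    rw [h2, ← ENNReal.ofReal_add (by positivity) (by norm_num), ← ENNReal.ofReal_mul zero_le_two]
    refine ENNReal.ofReal_le_ofReal ?_
    nlinarith
  have hres := hest ha hM dΦ (K := 2 * K₀ + 1) (by positivity) (by positivity) hΦs hΦg
  rw [hx, ← ENNReal.ofReal_add hM0.le hx0, ← ENNReal.ofReal_mul (by linarith)]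
  refine tripleNorm_le_of_avgSq_le (by positivity) fun Θ => ?_
  have hw := (wmass_le_add n (s * M) Θ dΦ.smooth.continuous.aestronglyMeasurable).trans
    (mul_le_mul_right (add_le_add (hres Θ) hΦ1') 2)
  rw [h2, ← ENNReal.ofReal_add (mul_nonneg (by positivity) (by positivity [hgr Θ])) (by norm_num),
    ← ENNReal.ofReal_mul zero_le_two] at hw
  have hball := lintegral_ball_le_sechSq (hM0.trans_le hl1) hl1 (slice n Ψ) Θ
  rw [setLIntegral_slice n Ψ Θ hM0] at hball
  have e1 : ∫⁻ θ, ENNReal.ofReal (sechSq (s * M) Θ θ) * slice n Ψ θ = wmass n (sech (s * M) Θ) Ψ :=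
    (wmass_eq_slice n hΨL.1 (contDiff_sech _ _).continuous.measurable).symm
  rw [e1] at hball
  have hG1 : 1 ≤ growth M Θ ^ (2 * m + 2) := one_le_pow₀ (hgr Θ)
  set G := growth M Θ ^ (2 * m + 2) with hG
  have hfin := hball.trans (mul_le_mul_right hw 4)
  have h2M : ENNReal.ofReal (2 * M) ≠ 0 := by simpa using hM0
  rw [← ENNReal.mul_le_mul_iff_right h2M ENNReal.ofReal_ne_top]
  refine hfin.trans ?_
  rw [← ENNReal.ofReal_ofNat 4, ← ENNReal.ofReal_mul (by norm_num), ← ENNReal.ofReal_mul (by positivity),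
    show 2 * (m + 1) = 2 * m + 2 by ring, ← hG]
  refine ENNReal.ofReal_le_ofReal ?_
  -- The estimate bounds the square of the norm by a multiple of `x + M²`. As `M ≥ 1`, this is at
  -- most a multiple of `(M + x)²`, whose root is the linear right side.
  have q0 : 1 ≤ (M + x) ^ 2 := one_le_pow₀ (by linarith)
  have q1 : 8 * x + 1 + M ^ 2 * (2 * K₀ + 1) ≤ (10 + 2 * K₀) * (M + x) ^ 2 := by
    have t1 : x ≤ (M + x) ^ 2 := by nlinarith
    have t2 : M ^ 2 ≤ (M + x) ^ 2 := by nlinarith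
    nlinarith
  have q2 : 1 / 4 ≤ M * ((M + x) ^ 2 * G) := by
    have : 1 ≤ (M + x) ^ 2 * G := by nlinarith
    nlinarith
  have hY : 0 ≤ M * ((M + x) ^ 2 * G) := by positivity
  calc 4 * (2 * (M * (C * (8 * x + 1 + M ^ 2 * (2 * K₀ + 1))) * G + 1 / 4))
      ≤ 4 * (2 * (M * (C * ((10 + 2 * K₀) * (M + x) ^ 2)) * G + M * ((M + x) ^ 2 * G))) := by gcongr
    _ = 2 * (4 * (C * (10 + 2 * K₀) + 1)) * (M * ((M + x) ^ 2 * G)) := by ring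
    _ ≤ 2 * D ^ 2 * (M * ((M + x) ^ 2 * G)) := by
        refine mul_le_mul_of_nonneg_right ?_ hY
        have t3 : D ≤ D ^ 2 := by nlinarith
        have t4 : 4 * (C * (10 + 2 * K₀) + 1) ≤ D := by
          rw [hD]
          nlinarith [mul_nonneg hC hK₀0]
        linarith
    _ = _ := by ring

/-! ### Uniformity in the gap and passage to the limit superior -/

lemma admissible_of_mem_gap {N : ℕ} (hN : 1 ≤ N) {δ : ℝ} (hδ : 0 < δ)
    (hl : lam ∈ Ioo (2 * (N : ℝ) - 1) (2 * (N : ℝ) + 1)) (hd : δ ≤ Metric.infDist lam landauLevels) :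
    Admissible (2 * N + 1) (greenBound N δ) lam where
  abs_le := by
    have : (1 : ℝ) ≤ N := by exact_mod_cast hN
    rw [abs_le]
    constructor <;> linarith [hl.1, hl.2]
  ne h := by
    have := norm_one_add_exp_ge hl hN hd
    rw [h, norm_zero] at this
    linarith
  le := greenConst_le hδ hl hN hd

end

end HalfPlane

end

theorem proposition4 (N : ℕ) (hN : 1 ≤ N) (δ : ℝ) (hδ : 0 < δ) (m n : ℕ) :
    ∃ C : ℝ≥0, ∀ lam : ℝ,
      lam ∈ Ioo (2 * (N : ℝ) - 1) (2 * (N : ℝ) + 1) →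
      δ ≤ Metric.infDist lam HalfPlane.landauLevels →
      ∀ M : ℝ, 1 ≤ M →
      ∀ Ψ g : ℝ → ℝ × ℝ → ℂ,
        (∀ ε : ℝ, 0 < ε →
          HalfPlane.MemH2 (Ψ ε) ∧ HalfPlane.MemH2 (g ε) ∧
          HalfPlane.CompactlySupportedInTheta (Ψ ε) ∧ HalfPlane.CompactlySupportedInTheta (g ε) ∧
          HalfPlane.SolvesH0 lam (Ψ ε) (g ε) ∧ HalfPlane.MemH10 (Ψ ε)) →
        limsup (fun ε => HalfPlane.tripleNorm m M (HalfPlane.weighted n (g ε))) (𝓝[>] (0 : ℝ)) ≤ 1 →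
        limsup (fun ε => HalfPlane.tripleNorm (m + 1) M (HalfPlane.weighted n (Ψ ε))) (𝓝[>] (0 : ℝ)) ≤
          (C : ℝ≥0∞) * (ENNReal.ofReal M +
            limsup (fun ε => HalfPlane.avgSq 0 (2 * M) (HalfPlane.weighted n (Ψ ε))) (𝓝[>] (0 : ℝ))) := by
  obtain ⟨C, -, hest⟩ := HalfPlane.tripleNorm_le (Λ := 2 * N + 1) (by positivity)
    (HalfPlane.greenBound N δ) m n
  refine ⟨C.toNNReal, fun lam hl hd M hM Ψ g hyp hg => ?_⟩
  have ha := HalfPlane.admissible_of_mem_gap hN hδ hl hd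
  -- A limit superior at most `1` gives norms below `2` for all small `ε`; this is why the estimate
  -- for one solution is stated with the bound `2`.
  have hlt := eventually_lt_of_limsup_lt (hg.trans_lt ENNReal.one_lt_two)
  have hmono : Monotone fun x : ℝ≥0∞ => ENNReal.ofReal C * (ENNReal.ofReal M + x) := fun x y hxy =>
    mul_le_mul_right (add_le_add_right hxy _) _
  have hcont : Continuous fun x : ℝ≥0∞ => ENNReal.ofReal C * (ENNReal.ofReal M + x) :=
    (ENNReal.continuous_const_mul ENNReal.ofReal_ne_top).comp (continuous_const_add _)
  -- The right side is a continuous monotone function of the average, so it commutes with the limit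
  -- superior.
  refine le_of_le_of_eq (limsup_le_limsup ?_) (hmono.map_limsup_of_continuousAt
    (fun ε => HalfPlane.avgSq 0 (2 * M) (HalfPlane.weighted n (Ψ ε))) hcont.continuousAt).symm
  filter_upwards [hlt, self_mem_nhdsWithin] with ε h2 hε
  obtain ⟨p1, p2, -, -, p3, p4⟩ := hyp ε hε
  exact hest ha hM p1 p2 p3 p4 h2.le
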